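/- Euclidean Capacitated Sum of Radii with uniform capacities: the input consists of a set $P$ of $n\ge 1$ points in $\mathbb{R}^d$ ($d\ge 1$), an integer $k\ge 1$ and a capacity $U\in\mathbb{Z}_{\ge 0}$. A solution with capacity $u$ consists of $k$ balls with distinct centers in $\mathbb{R}^d$ and real radii $r_1,\dots,r_k\ge 0$, together with an assignment of each point of $P$ to a ball that contains it, such that at most $u$ points are assigned to each ball; its cost is $\sum_{q=1}^k r_q$. Let $\mathrm{OPT}$ be the infimum of the costs of all solutions with capacity $U$. Theorem. There are a randomized real-RAM algorithm and absolute constants $C,p>0$ such that, for every such input and every $\varepsilon>0$ (given to the algorithm as part of the input), the algorithm always halts within $$2^{C\cdot\frac{k}{\min(\varepsilon,1)^2}\log\max(k,2)}\cdot d\,n^3$$ steps and, if the instance has a solution with capacity $U$, then with probability at least $p$ it returns a solution with capacity $(1+\varepsilon)U$, including the assignment, whose cost is at most $(1+\varepsilon)\cdot\mathrm{OPT}$. Here the real RAM performs $+,-,\times,/,\sqrt{\cdot}$ and comparisons on reals, addition, truncated subtraction, comparison and uniform random choice from $\{0,\dots,m\}$ on natural numbers, conversion of natural numbers to reals, and indirect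 addressing, each in one step; it has no rounding operation. -/

import Mathlib

noncomputable section

namespace SumOfRadii

/-! ### The Euclidean capacitated sum of radii problem with uniform capacities -/

/-- A candidate solution for `n` points in `ℝ^d`: `k` balls, each given by its center (any point
of `ℝ^d`) and its radius, and an assignment of the points to the balls. -/
structure Solution (n d k : ℕ) where
  center : Fin k → EuclideanSpace ℝ (Fin d)
  radius : Fin k → ℝ
  assign : Fin n → Fin k

/-- The cost of a solution: the sum of the radii. -/
def Solution.cost {n d k : ℕ} (S : Solution n d k) : ℝ := ∑ q, S.radius q

/-- `S` is a solution for the points `P` in which every ball uses capacity at most `cap`: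
the `k` centers are distinct (hard capacities), the radii are non-negative, every point lies in
the ball it is assigned to, and at most `cap` points are assigned to each ball. -/
structure Solution.IsValid {n d k : ℕ} (S : Solution n d k)
    (P : Fin n → EuclideanSpace ℝ (Fin d)) (cap : ℝ) : Prop where
  center_injective : Function.Injective S.center
  radius_nonneg : ∀ q, 0 ≤ S.radius q
  dist_le : ∀ i, dist (P i) (S.center (S.assign i)) ≤ S.radius (S.assign i)
  card_le : ∀ q, ((Finset.univ.filter fun i => S.assign i = q).card : ℝ) ≤ cap

/-- The optimal cost of a solution with `k` balls that use at most `cap` capacity each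
(meaningful if there is such a solution). -/
def OPT {n d : ℕ} (P : Fin n → EuclideanSpace ℝ (Fin d)) (k : ℕ) (cap : ℝ) : ℝ :=
  sInf {c : ℝ | ∃ S : Solution n d k, S.IsValid P cap ∧ S.cost = c}

/-! ### Randomized real RAM

There is a memory `nat` of natural numbers, a memory `real` of real numbers, both with indirect
addressing, and a read-only array of input reals. Natural numbers are only added, subtracted and
compared. Reals cannot be rounded, and a program has no real constants of its own. -/

/-- The instructions. Below `N` and `R` denote the two memories and `I` the input array. -/
inductive Instr where
  /-- `N[a] := m` -/
  | natConst (a m : ℕ)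
  /-- `N[a] := N[b] + N[c]` -/
  | natAdd (a b c : ℕ)
  /-- `N[a] := max (N[b] - N[c]) 0` -/
  | natSub (a b c : ℕ)
  /-- `N[a] := N[N[b]]` -/
  | natLoad (a b : ℕ)
  /-- `N[N[a]] := N[b]` -/
  | natStore (a b : ℕ)
  /-- `N[a] :=` a fresh uniformly random element of `{0, ..., N[b]}` -/
  | natRand (a b : ℕ)
  /-- `R[a] := I[N[b]]` -/
  | readInput (a b : ℕ)
  /-- `R[a] := N[b]` -/
  | realOfNat (a b : ℕ)
  /-- `R[a] := R[b] + R[c]` -/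
  | realAdd (a b c : ℕ)
  /-- `R[a] := R[b] - R[c]` -/
  | realSub (a b c : ℕ)
  /-- `R[a] := R[b] * R[c]` -/
  | realMul (a b c : ℕ)
  /-- `R[a] := R[b] / R[c]`, and `0` if `R[c] = 0` -/
  | realDiv (a b c : ℕ)
  /-- `R[a] := √R[b]`, and `0` if `R[b] < 0` -/
  | realSqrt (a b : ℕ)
  /-- `R[a] := R[N[b]]` -/
  | realLoad (a b : ℕ)
  /-- `R[N[a]] := R[b]` -/
  | realStore (a b : ℕ)
  /-- if `N[b] ≤ N[c]` go to line `l` -/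
  | natJump (b c l : ℕ)
  /-- if `R[b] ≤ R[c]` go to line `l` -/
  | realJump (b c l : ℕ)

/-- A program is a finite list of instructions. -/
abbrev Program := List Instr

/-- A configuration: the current line and the contents of the two memories. -/
@[ext] structure Config where
  pc : ℕ
  nat : ℕ → ℕ
  real : ℕ → ℝ

/-- Write the natural number `m` to `N[a]` and go to the next line. -/
def Config.setNat (c : Config) (a m : ℕ) : Config :=
  ⟨c.pc + 1, Function.update c.nat a m, c.real⟩

/-- Write the real number `x` to `R[a]` and go to the next line. -/
def Config.setReal (c : Config) (a : ℕ) (x : ℝ) : Config :=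
  ⟨c.pc + 1, c.nat, Function.update c.real a x⟩

/-- Go to line `l` if `p` holds and to the next line otherwise. -/
def Config.jump (c : Config) (p : Prop) [Decidable p] (l : ℕ) : Config :=
  ⟨if p then l else c.pc + 1, c.nat, c.real⟩

open Classical in
/-- The effect of one instruction, as a distribution over configurations. -/
def Instr.exec (I : ℕ → ℝ) (c : Config) : Instr → PMF Config
  | natConst a m => PMF.pure (c.setNat a m)
  | natAdd a b b' => PMF.pure (c.setNat a (c.nat b + c.nat b'))
  | natSub a b b' => PMF.pure (c.setNat a (c.nat b - c.nat b'))
  | natLoad a b => PMF.pure (c.setNat a (c.nat (c.nat b)))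
  | natStore a b => PMF.pure (c.setNat (c.nat a) (c.nat b))
  | natRand a b =>
      (PMF.uniformOfFintype (Fin (c.nat b + 1))).map fun m : Fin (c.nat b + 1) => c.setNat a (m : ℕ)
  | readInput a b => PMF.pure (c.setReal a (I (c.nat b)))
  | realOfNat a b => PMF.pure (c.setReal a (c.nat b : ℝ))
  | realAdd a b b' => PMF.pure (c.setReal a (c.real b + c.real b'))
  | realSub a b b' => PMF.pure (c.setReal a (c.real b - c.real b'))
  | realMul a b b' => PMF.pure (c.setReal a (c.real b * c.real b'))
  | realDiv a b b' => PMF.pure (c.setReal a (c.real b / c.real b'))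
  | realSqrt a b => PMF.pure (c.setReal a (Real.sqrt (c.real b)))
  | realLoad a b => PMF.pure (c.setReal a (c.real (c.nat b)))
  | realStore a b => PMF.pure (c.setReal (c.nat a) (c.real b))
  | natJump b b' l => PMF.pure (c.jump (c.nat b ≤ c.nat b') l)
  | realJump b b' l => PMF.pure (c.jump (c.real b ≤ c.real b') l)

/-- A program has halted when the current line is past its end. -/
def Halted (A : Program) (c : Config) : Prop := A.length ≤ c.pc

/-- One step of a program. A halted configuration does not change any more. -/
def step (A : Program) (I : ℕ → ℝ) (c : Config) : PMF Config :=
  match A[c.pc]? with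
  | some instr => instr.exec I c
  | none => PMF.pure c

/-- The distribution of the configuration after `t` steps (every instruction is one step). -/
def run (A : Program) (I : ℕ → ℝ) (c : Config) : ℕ → PMF Config
  | 0 => PMF.pure c
  | t + 1 => (run A I c t).bind (step A I)

/-- With initial configuration `c` and input array `I`, every run of `A` has halted after at most
`t` steps, whatever the random choices are. -/
def HaltsWithin (A : Program) (I : ℕ → ℝ) (c : Config) (t : ℕ) : Prop :=
  ∀ c' ∈ (run A I c t).support, Halted A c'

/-! ### Input and output format -/

/-- The input array holds the coordinates of the points, point after point:
entry `i * d + j` is coordinate `j` of point `i`. -/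
def inputArray {n d : ℕ} (P : Fin n → EuclideanSpace ℝ (Fin d)) (m : ℕ) : ℝ :=
  if h : m < n * d then P (Fin.divNat ⟨m, h⟩) (Fin.modNat ⟨m, h⟩) else 0

/-- The initial configuration: `N[0], N[1], N[2], N[3]` are `n, d, k, U`, and `R[0]` is `ε`;
all other cells are zero. -/
def initial (n d k U : ℕ) (ε : ℝ) : Config where
  pc := 0
  nat := fun a => if a = 0 then n else if a = 1 then d else if a = 2 then k
    else if a = 3 then U else 0
  real := fun a => if a = 0 then ε else 0

/-- The solution that a configuration displays: the centers (coordinate by coordinate), the radii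
and the assignment are stored as arrays that start at the addresses `N[0]`, `N[1]`, `N[2]`. -/
def Outputs {n d k : ℕ} (c : Config) (S : Solution n d k) : Prop :=
  (∀ (q : Fin k) (j : Fin d), S.center q j = c.real (c.nat 0 + (q : ℕ) * d + j)) ∧
  (∀ q : Fin k, S.radius q = c.real (c.nat 1 + q)) ∧
  (∀ i : Fin n, (S.assign i : ℕ) = c.nat (c.nat 2 + i))

end SumOfRadii

end

noncomputable section

namespace SumOfRadii

section

open scoped ENNReal

/-! ### Expectations under `PMF`s -/

/-! The algorithm guesses a near-optimal clustering. Put `K = 16 * ⌈1 / ε⌉`. If `n ≤ k`, every point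
gets its own ball and the cost is zero (`exec_singletons`). Otherwise `OPT > 0`. Take an almost
optimal solution and let `D` be the largest diameter of one of its clusters. Radii above `D` can be
cut down to `D` by recentring at a point of the cluster, `D` is at most twice the cost, and rounding
the radii up to multiples of `D / (k * K)` is cheap; this gives the target of `exists_target`.
Trying all pairs of points finds `D`, and the rounded radii `ρ` are guessed with probability at
least `(1 / (k * K + 1)) ^ k`.

The centers are found by a walk. A ball starts at the first point chosen for it and later moves by
the fraction `1 / (2 * K)` towards further chosen points; its working radius is `(1 + 1 / K) * ρ`.
If the chosen point belongs to the target cluster of the ball but lies outside the ball, then the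
potential `dist c z ^ 2 + ρ ^ 2 / (2 * K)`, with `z` the target center, shrinks by the factor `1 - 1
/ (2 * K)` (`potential_move`). Since it never drops below `ρ ^ 2 / (2 * K)`, a ball makes only `O(K
log K)` such moves (`potential_steps`).

Every step has probability at least `1 / (K * k ^ 3)` of a good move or of success
(`Setup.trialStep_le`). If some point is uncovered, it suffices to guess its cluster. If all points
are covered but some cluster has more than `U / (k * K)` points outside of its ball, a uniformly
random point is one of them with probability at least `1 / (k ^ 2 * K)`, because `n ≤ k * U`.
Otherwise all points outside of their own ball can be sent to arbitrary covering balls, and no load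
exceeds `(1 + 1 / K) * U` (`Target.feasible`). Then push-relabel finds an assignment within the
capacity (`exec_flow`); the key fact is that an overloaded ball has a label below `k`
(`FlowInv.label_lt`). A random tiny shift of the centers makes them distinct with probability at
least `1 / 2` (`card_good_shift`).

Altogether a trial at the right scale succeeds with probability at least `1 / f` for `f = max k 2 ^
(64 * k * K ^ 2)`: the logarithms of `K` in the exponent are absorbed, as `(log K) ^ 2 = O(K)`
(`exists_bits`, `inv_reps_le_trialProb`). Hence `f` trials fail with probability at most `1 / 2`.
The same `f` bounds the numbers of sweeps and of steps, so the running time is at most `n ^ 3 * d *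
f ^ 5`; the cubic factor comes from the pairs of points and from the scans over all points.

For the machine, the algorithm is written in a small structured language with a
weakest-preexpectation semantics `Cmd.wp`, and a compiler is verified once (`Cmd.code_reach`): the
compiled code reaches its end within `Cmd.cost` steps, and the expectation of `F` there is at most
`wp F`. Expectations take values in `[0, ∞]` and `⊤` is given to configurations in which the program
has not ended or an invariant fails. A finite bound therefore excludes these altogether, while the
value `1` marks an ordinary failure, so that one inequality yields both halting and the success
probability. -/

/-- The expectation of a `[0, ∞]`-valued function. -/
def expect {α : Type*} (μ : PMF α) (F : α → ℝ≥0∞) : ℝ≥0∞ := ∑' a, μ a * F a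

theorem expect_pure {α : Type*} (a : α) (F : α → ℝ≥0∞) : expect (PMF.pure a) F = F a := by
  unfold expect
  rw [tsum_eq_single a]
  · simp
  · intro b hb
    simp [hb]

theorem expect_bind {α β : Type*} (μ : PMF α) (κ : α → PMF β) (F : β → ℝ≥0∞) :
    expect (μ.bind κ) F = expect μ fun a => expect (κ a) F := by
  unfold expect
  simp only [PMF.bind_apply, ← ENNReal.tsum_mul_right, ← ENNReal.tsum_mul_left]
  rw [ENNReal.tsum_comm]
  simp only [mul_assoc]

theorem expect_map {α β : Type*} (μ : PMF α) (g : α → β) (F : β → ℝ≥0∞) :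
    expect (μ.map g) F = expect μ fun a => F (g a) := by
  rw [← PMF.bind_pure_comp, expect_bind]
  simp [expect_pure, Function.comp]

theorem expect_mono {α : Type*} (μ : PMF α) {F G : α → ℝ≥0∞} (h : ∀ a, F a ≤ G a) :
    expect μ F ≤ expect μ G :=
  ENNReal.tsum_le_tsum fun a => mul_le_mul_right (h a) _

theorem expect_uniform_fin (M : ℕ) (F : Fin (M + 1) → ℝ≥0∞) :
    expect (PMF.uniformOfFintype (Fin (M + 1))) F = (∑ m, F m) / ((M : ℝ≥0∞) + 1) := by
  unfold expect
  rw [tsum_fintype]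
  simp only [PMF.uniformOfFintype_apply, Fintype.card_fin]
  rw [← Finset.mul_sum, ENNReal.div_eq_inv_mul]
  push_cast
  rfl

/-! ### Expected values when a run is stopped -/

/-- A run that starts in `c` can be stopped after at most `t` steps, depending on its course, such
that the expectation of `F` in the configuration in which it is stopped is at most `x`. -/
inductive Reach (A : Program) (I : ℕ → ℝ) (F : Config → ℝ≥0∞) : ℕ → Config → ℝ≥0∞ → Prop
  | finish {t : ℕ} {c : Config} {x : ℝ≥0∞} : F c ≤ x → Reach A I F t c x
  | step {t : ℕ} {c : Config} {x : ℝ≥0∞} (g : Config → ℝ≥0∞) :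
      (∀ c', Reach A I F t c' (g c')) → expect (step A I c) g ≤ x → Reach A I F (t + 1) c x

variable {A : Program} {I : ℕ → ℝ}

/-- Each stopping configuration `c'` is continued with the value `F c'` as its own bound. The inner
`mono` is needed because a run may stop before its `s` steps are used up. -/
theorem Reach.comp {F G : Config → ℝ≥0∞} {s t : ℕ} {c : Config} {x : ℝ≥0∞}
    (h : Reach A I F s c x) (hG : ∀ c', Reach A I G t c' (F c')) : Reach A I G (s + t) c x := by
  have mono : ∀ {t t' : ℕ} {c : Config} {x x' : ℝ≥0∞}, Reach A I G t c x → t ≤ t' → x ≤ x' →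
      Reach A I G t' c x' := by
    intro t t' c x x' h
    induction h generalizing t' x' with
    | finish h => exact fun _ hx => .finish (h.trans hx)
    | step g _ hx ih =>
      intro ht hx'
      obtain ⟨t', rfl⟩ : ∃ m, t' = m + 1 := ⟨t' - 1, by omega⟩
      exact .step g (fun c' => ih c' (by omega) le_rfl) (hx.trans hx')
  induction h with
  | finish h => exact mono (hG _) (by omega) h
  | step g _ hx ih =>
    rw [Nat.add_right_comm]
    exact .step g ih hx

theorem Reach.mono {F : Config → ℝ≥0∞} {t t' : ℕ} {c : Config} {x x' : ℝ≥0∞}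
    (h : Reach A I F t c x) (ht : t ≤ t') (hx : x ≤ x') : Reach A I F t' c x' := by
  induction h generalizing t' x' with
  | finish h => exact .finish (h.trans hx)
  | step g _ hx' ih =>
    obtain ⟨t', rfl⟩ : ∃ m, t' = m + 1 := ⟨t' - 1, by omega⟩
    exact .step g (fun c' => ih c' (by omega) le_rfl) (hx'.trans hx)

/-- `run` appends steps at the end, whereas `Reach` peels them off at the front. -/
theorem run_succ' (c : Config) (t : ℕ) :
    run A I c (t + 1) = (step A I c).bind fun c' => run A I c' t := by
  induction t with
  | zero => simp [run]
  | succ t ih =>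
    rw [run, ih, PMF.bind_bind]
    rfl

theorem run_of_halted {c : Config} (h : Halted A c) (t : ℕ) : run A I c t = PMF.pure c := by
  induction t with
  | zero => rfl
  | succ t ih =>
    rw [run, ih, PMF.pure_bind, step, List.getElem?_eq_none h]

/-- Stopping early does no harm: where `F` is finite the program has halted, and the remaining steps
of `run` change nothing. -/
theorem Reach.expect_run_le {F : Config → ℝ≥0∞} (hF : ∀ c, F c ≠ ⊤ → Halted A c) {t : ℕ}
    {c : Config} {x : ℝ≥0∞} (h : Reach A I F t c x) : expect (run A I c t) F ≤ x := by
  induction h with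
  | @finish t c x h =>
    by_cases hc : F c = ⊤
    · rw [hc, top_le_iff] at h
      simp [h]
    · rwa [run_of_halted (hF c hc), expect_pure]
  | step g _ hx ih =>
    rw [run_succ', expect_bind]
    exact (expect_mono _ ih).trans hx

/-- A run that starts in `c` is in `c'` after exactly `m` steps. -/
def Leads (A : Program) (I : ℕ → ℝ) (c : Config) (m : ℕ) (c' : Config) : Prop :=
  ∀ F t x, Reach A I F t c' x → Reach A I F (m + t) c x

theorem Leads.trans {c c' c'' : Config} {m m' : ℕ} (h : Leads A I c m c')
    (h' : Leads A I c' m' c'') : Leads A I c (m + m') c'' := fun F t x hr => by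
  rw [Nat.add_assoc]
  exact h _ _ _ (h' _ _ _ hr)

theorem Leads.of_exec {c c' : Config} {instr : Instr} (hi : A[c.pc]? = some instr)
    (he : instr.exec I c = PMF.pure c') : Leads A I c 1 c' := fun F t x hr => by
  classical
  rw [Nat.add_comm]
  -- All configurations other than the successor get `⊤`, which is trivially reachable and has
  -- probability zero.
  refine .step (fun d => if d = c' then x else ⊤) (fun d => ?_) ?_
  · by_cases hd : d = c'
    · simpa [hd] using hr
    · simpa [hd] using Reach.finish le_top
  · simp [step, hi, he, expect_pure]

theorem reach_of_rand {F : Config → ℝ≥0∞} {t : ℕ} {c : Config} {a b : ℕ} {g : ℕ → ℝ≥0∞}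
    (hi : A[c.pc]? = some (.natRand a b))
    (h : ∀ m ≤ c.nat b, Reach A I F t (c.setNat a m) (g m)) :
    Reach A I F (1 + t) c ((∑ m ∈ Finset.range (c.nat b + 1), g m) / ((c.nat b : ℝ≥0∞) + 1)) := by
  classical
  rw [Nat.add_comm]
  -- The random outcome is read back from cell `a` of the successor.
  refine .step (fun d => if ∃ m ≤ c.nat b, d = c.setNat a m then g (d.nat a) else ⊤)
    (fun d => ?_) ?_
  · by_cases hd : ∃ m ≤ c.nat b, d = c.setNat a m
    · obtain ⟨m, hm, rfl⟩ := hd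
      rw [if_pos ⟨m, hm, rfl⟩]
      simpa [Config.setNat] using h m hm
    · simpa only [if_neg hd] using Reach.finish le_top
  · simp only [step, hi, Instr.exec, expect_map, expect_uniform_fin, Finset.sum_range]
    gcongr with m
    rw [if_pos ⟨m, by omega, rfl⟩]
    simp [Config.setNat]

/-! ### A structured language -/

/-- The memory of structured programs: arrays of natural numbers and of reals, given by name and
index. Scalars are stored at index `0`. -/
@[ext] structure Mem where
  N : ℕ → ℕ → ℕ
  R : ℕ → ℕ → ℝ

def Mem.setN (σ : Mem) (x i v : ℕ) : Mem :=
  ⟨fun y j => if y = x ∧ j = i then v else σ.N y j, σ.R⟩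

def Mem.setR (σ : Mem) (x i : ℕ) (v : ℝ) : Mem :=
  ⟨σ.N, fun y j => if y = x ∧ j = i then v else σ.R y j⟩

/-- Expressions for natural numbers. -/
inductive NExpr where
  | const (m : ℕ)
  | get (x : ℕ) (i : NExpr)
  | add (a b : NExpr)
  | sub (a b : NExpr)

/-- Expressions for reals. -/
inductive RExpr where
  | get (x : ℕ) (i : NExpr)
  | inp (i : NExpr)
  | nat (e : NExpr)
  | add (a b : RExpr)
  | sub (a b : RExpr)
  | mul (a b : RExpr)
  | div (a b : RExpr)
  | sqrt (a : RExpr)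

def NExpr.eval (σ : Mem) : NExpr → ℕ
  | const m => m
  | get x i => σ.N x (i.eval σ)
  | add a b => a.eval σ + b.eval σ
  | sub a b => a.eval σ - b.eval σ

def RExpr.eval (I : ℕ → ℝ) (σ : Mem) : RExpr → ℝ
  | get x i => σ.R x (i.eval σ)
  | inp i => I (i.eval σ)
  | nat e => (e.eval σ : ℝ)
  | add a b => a.eval I σ + b.eval I σ
  | sub a b => a.eval I σ - b.eval I σ
  | mul a b => a.eval I σ * b.eval I σ
  | div a b => a.eval I σ / b.eval I σ
  | sqrt a => √(a.eval I σ)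

/-- Commands. The two conditionals test whether a natural number is zero, and whether a real number
is at most another one. `loop v b c` runs `c` for the values `0, 1, ..., b - 1` of the scalar `v`,
where the scalar `b` is read. `rawN` and `rawR` write to an absolute address. -/
inductive Cmd where
  | skip
  | setN (x : ℕ) (i e : NExpr)
  | setR (x : ℕ) (i : NExpr) (e : RExpr)
  | rand (x : ℕ) (e : NExpr)
  | rawN (a e : NExpr)
  | rawR (a : NExpr) (e : RExpr)
  | seq (c₁ c₂ : Cmd)
  | ifz (e : NExpr) (c₁ c₂ : Cmd)
  | ifle (a b : RExpr) (c₁ c₂ : Cmd)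
  | loop (v b : ℕ) (c : Cmd)

/-- The memory after `m` rounds of a loop with loop variable `v` and body `f`. -/
def rounds (f : Mem → Mem) (v : ℕ) (σ : Mem) : ℕ → Mem
  | 0 => σ.setN v 0 0
  | m + 1 => (f (rounds f v σ m)).setN v 0 (m + 1)

/-- The weakest preexpectation of `m` rounds of a loop with loop variable `v`. -/
def wpRounds (W : (Mem → ℝ≥0∞) → Mem → ℝ≥0∞) (v : ℕ) : ℕ → (Mem → ℝ≥0∞) → Mem → ℝ≥0∞
  | 0, F, σ => F (σ.setN v 0 0)
  | m + 1, F, σ => wpRounds W v m (W fun ρ => F (ρ.setN v 0 (m + 1))) σ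

/-- The weakest preexpectation of a command. -/
def Cmd.wp (I : ℕ → ℝ) : Cmd → (Mem → ℝ≥0∞) → Mem → ℝ≥0∞
  | skip, F, σ => F σ
  | setN x i e, F, σ => F (σ.setN x (i.eval σ) (e.eval σ))
  | setR x i e, F, σ => F (σ.setR x (i.eval σ) (e.eval I σ))
  | rand x e, F, σ =>
      (∑ m ∈ Finset.range (e.eval σ + 1), F (σ.setN x 0 m)) / ((e.eval σ : ℝ≥0∞) + 1)
  | rawN a e, F, σ => F (σ.setN (a.eval σ % 64) (a.eval σ / 64 + 1) (e.eval σ))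
  | rawR a e, F, σ => F (σ.setR (a.eval σ % 64) (a.eval σ / 64 + 1) (e.eval I σ))
  | seq c₁ c₂, F, σ => c₁.wp I (c₂.wp I F) σ
  | ifz e c₁ c₂, F, σ => if e.eval σ = 0 then c₁.wp I F σ else c₂.wp I F σ
  | ifle a b c₁ c₂, F, σ => if a.eval I σ ≤ b.eval I σ then c₁.wp I F σ else c₂.wp I F σ
  | loop v b c, F, σ => wpRounds (c.wp I) v (σ.N b 0) F σ

/-- The scalars that bound loops of a command. -/
def Cmd.bounds : Cmd → List ℕ
  | seq c₁ c₂ => c₁.bounds ++ c₂.bounds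
  | ifz _ c₁ c₂ => c₁.bounds ++ c₂.bounds
  | ifle _ _ c₁ c₂ => c₁.bounds ++ c₂.bounds
  | loop _ b c => b :: c.bounds
  | _ => []

/-- The names of natural numbers to which a command writes. -/
def Cmd.writesN : Cmd → List ℕ
  | setN x _ _ => [x]
  | rand x _ => [x]
  | seq c₁ c₂ => c₁.writesN ++ c₂.writesN
  | ifz _ c₁ c₂ => c₁.writesN ++ c₂.writesN
  | ifle _ _ c₁ c₂ => c₁.writesN ++ c₂.writesN
  | loop v _ c => v :: c.writesN
  | _ => []

theorem wpRounds_congr {W : (Mem → ℝ≥0∞) → Mem → ℝ≥0∞} {v : ℕ} {Q : Mem → Mem → Prop}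
    (htrans : ∀ σ τ ρ, Q σ τ → Q τ ρ → Q σ ρ) (hset : ∀ σ m, Q σ (σ.setN v 0 m))
    (hW : ∀ F G σ, (∀ τ, Q σ τ → F τ = G τ) → W F σ = W G σ) (m : ℕ) {F G : Mem → ℝ≥0∞} {σ : Mem}
    (h : ∀ τ, Q σ τ → F τ = G τ) : wpRounds W v m F σ = wpRounds W v m G σ := by
  induction m generalizing F G with
  | zero => exact h _ (hset _ _)
  | succ m ih =>
    exact ih fun τ hτ => hW _ _ _ fun ρ hρ =>
      h _ (htrans _ _ _ hτ (htrans _ _ _ hρ (hset _ _)))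

/-- Raw writes do not count in `writesN`: they go to indices from one on, and only the scalars, at
index zero, are claimed to be preserved. -/
theorem Cmd.wp_congr {s : Cmd} {F G : Mem → ℝ≥0∞} {σ : Mem}
    (h : ∀ τ, (∀ x ∉ s.writesN, τ.N x 0 = σ.N x 0) → F τ = G τ) : s.wp I F σ = s.wp I G σ := by
  induction s generalizing F G σ with
  | skip => exact h σ fun _ _ => rfl
  | setN x i e =>
    refine h _ fun y hy => ?_
    simp only [writesN, List.mem_singleton] at hy
    simp [Mem.setN, hy]
  | setR x i e => exact h _ fun y _ => rfl
  | rand x e =>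
    simp only [wp]
    congr 1
    refine Finset.sum_congr rfl fun m _ => h _ fun y hy => ?_
    simp only [writesN, List.mem_singleton] at hy
    simp [Mem.setN, hy]
  | rawN a e => exact h _ fun y _ => by simp [Mem.setN]
  | rawR a e => exact h _ fun y _ => rfl
  | seq c₁ c₂ ih₁ ih₂ =>
    refine ih₁ fun τ hτ => ih₂ fun ρ hρ => h ρ fun x hx => ?_
    simp only [writesN, List.mem_append, not_or] at hx
    rw [hρ x hx.2, hτ x hx.1]
  | ifz e c₁ c₂ ih₁ ih₂ =>
    simp only [wp]
    split_ifs
    · exact ih₁ fun τ hτ => h τ fun x hx => hτ x fun h' => hx (by simp [writesN, h'])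
    · exact ih₂ fun τ hτ => h τ fun x hx => hτ x fun h' => hx (by simp [writesN, h'])
  | ifle a b c₁ c₂ ih₁ ih₂ =>
    simp only [wp]
    split_ifs
    · exact ih₁ fun τ hτ => h τ fun x hx => hτ x fun h' => hx (by simp [writesN, h'])
    · exact ih₂ fun τ hτ => h τ fun x hx => hτ x fun h' => hx (by simp [writesN, h'])
  | loop v b c ih =>
    refine wpRounds_congr (Q := fun σ τ => ∀ x ∉ (loop v b c).writesN, τ.N x 0 = σ.N x 0)
      (fun σ τ ρ h₁ h₂ x hx => (h₂ x hx).trans (h₁ x hx)) ?_ ?_ _ h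
    · intro σ m x hx
      simp only [writesN, List.mem_cons, not_or] at hx
      simp [Mem.setN, hx.1]
    · intro F G σ hFG
      exact ih fun τ hτ => hFG τ fun x hx => hτ x fun h' => hx (by simp [writesN, h'])

/-! ### Compilation -/

/-- Entry `i` of the array with name `x < 64` is stored at the address `64 * i + x`. The cells
`40, ..., 63` are used for intermediate results and hidden here. -/
def Config.view (c : Config) : Mem where
  N x i := if x < 64 ∧ (x < 40 ∨ 0 < i) then c.nat (64 * i + x) else 0
  R x i := if x < 64 ∧ (x < 40 ∨ 0 < i) then c.real (64 * i + x) else 0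

/-- Replace the index in cell `40 + p` by the address of the array entry. -/
def addrCode (x p : ℕ) : List Instr :=
  -- Six doublings multiply the index by 64; then the name is added.
  [.natAdd (40 + p) (40 + p) (40 + p), .natAdd (40 + p) (40 + p) (40 + p),
   .natAdd (40 + p) (40 + p) (40 + p), .natAdd (40 + p) (40 + p) (40 + p),
   .natAdd (40 + p) (40 + p) (40 + p), .natAdd (40 + p) (40 + p) (40 + p),
   .natConst (41 + p) x, .natAdd (40 + p) (40 + p) (41 + p)]

/-- Code that computes an expression into cell `40 + p`. -/
def NExpr.code : NExpr → ℕ → List Instr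
  | const m, p => [.natConst (40 + p) m]
  | get x i, p => i.code p ++ (addrCode x p ++ [.natLoad (40 + p) (40 + p)])
  | add a b, p => a.code p ++ (b.code (p + 1) ++ [.natAdd (40 + p) (40 + p) (41 + p)])
  | sub a b, p => a.code p ++ (b.code (p + 1) ++ [.natSub (40 + p) (40 + p) (41 + p)])

/-- The code of `e` uses the cells from `40 + p` on only, and none from `64` on. -/
def NExpr.Fits : NExpr → ℕ → Bool
  | const _, p => p < 24
  -- One cell less is available, since `addrCode` also uses cell `41 + p`.
  | get x i, p => x < 40 && i.Fits p && p < 23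
  | add a b, p => a.Fits p && b.Fits (p + 1)
  | sub a b, p => a.Fits p && b.Fits (p + 1)

def RExpr.code : RExpr → ℕ → List Instr
  | get x i, p => i.code p ++ (addrCode x p ++ [.realLoad (40 + p) (40 + p)])
  | inp i, p => i.code p ++ [.readInput (40 + p) (40 + p)]
  | nat e, p => e.code p ++ [.realOfNat (40 + p) (40 + p)]
  | add a b, p => a.code p ++ (b.code (p + 1) ++ [.realAdd (40 + p) (40 + p) (41 + p)])
  | sub a b, p => a.code p ++ (b.code (p + 1) ++ [.realSub (40 + p) (40 + p) (41 + p)])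
  | mul a b, p => a.code p ++ (b.code (p + 1) ++ [.realMul (40 + p) (40 + p) (41 + p)])
  | div a b, p => a.code p ++ (b.code (p + 1) ++ [.realDiv (40 + p) (40 + p) (41 + p)])
  | sqrt a, p => a.code p ++ [.realSqrt (40 + p) (40 + p)]

def RExpr.Fits : RExpr → ℕ → Bool
  | get x i, p => x < 40 && i.Fits p && p < 23
  | inp i, p => i.Fits p && p < 24
  | nat e, p => e.Fits p && p < 24
  | add a b, p => a.Fits p && b.Fits (p + 1)
  | sub a b, p => a.Fits p && b.Fits (p + 1)
  | mul a b, p => a.Fits p && b.Fits (p + 1)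
  | div a b, p => a.Fits p && b.Fits (p + 1)
  | sqrt a, p => a.Fits p && p < 24

/-- The program `A` contains the code `l` from line `b` on. -/
def CodeAt (A : Program) (b : ℕ) (l : List Instr) : Prop :=
  ∀ i, i < l.length → A[b + i]? = l[i]?

theorem CodeAt.left {b : ℕ} {l l' : List Instr} (h : CodeAt A b (l ++ l')) : CodeAt A b l :=
  fun i hi => by rw [h i (by simp; omega), List.getElem?_append_left hi]

theorem CodeAt.right {b : ℕ} {l l' : List Instr} (h : CodeAt A b (l ++ l')) :
    CodeAt A (b + l.length) l' := fun i hi => by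
  rw [Nat.add_assoc, h (l.length + i) (by simp; omega), List.getElem?_append_right (by omega)]
  simp

theorem CodeAt.get {b : ℕ} {l : List Instr} (h : CodeAt A b l) (i : ℕ) {instr : Instr}
    (hi : l[i]? = some instr) : A[b + i]? = some instr := by
  rw [h i (List.getElem?_eq_some_iff.1 hi).1, hi]

/-- `c'` is `c` up to the line and the intermediate results from number `p` on. -/
structure SameFrom (p : ℕ) (c c' : Config) : Prop where
  nat : ∀ a, a < 40 + p ∨ 64 ≤ a → c'.nat a = c.nat a
  real : ∀ a, a < 40 + p ∨ 64 ≤ a → c'.real a = c.real a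

theorem SameFrom.trans {p q : ℕ} {c c' c'' : Config} (h : SameFrom p c c')
    (h' : SameFrom q c' c'') (hpq : p ≤ q) : SameFrom p c c'' :=
  ⟨fun a ha => (h'.nat a (by omega)).trans (h.nat a ha),
    fun a ha => (h'.real a (by omega)).trans (h.real a ha)⟩

theorem SameFrom.view {p : ℕ} {c c' : Config} (h : SameFrom p c c') : c'.view = c.view := by
  ext x i
  · simp only [Config.view]
    split_ifs with hx
    · exact h.nat _ (by omega)
    · rfl
  · simp only [Config.view]
    split_ifs with hx
    · exact h.real _ (by omega)
    · rfl

/-- The code `l` leads from `c` to its end and to a configuration that satisfies `P`, and uses only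
the cells for intermediate results from number `p` on. -/
def Runs (A : Program) (I : ℕ → ℝ) (c : Config) (l : List Instr) (p : ℕ) (P : Config → Prop) :
    Prop :=
  CodeAt A c.pc l →
    ∃ c', Leads A I c l.length c' ∧ c'.pc = c.pc + l.length ∧ SameFrom p c c' ∧ P c'

theorem Runs.append {c : Config} {l l' : List Instr} {p q : ℕ} {P Q : Config → Prop}
    (h : Runs A I c l p P) (hpq : p ≤ q)
    (h' : ∀ c', SameFrom p c c' → P c' → Runs A I c' l' q Q) : Runs A I c (l ++ l') p Q := by
  intro hc
  obtain ⟨c₁, l₁, e₁, s₁, v₁⟩ := h hc.left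
  have h₂ := hc.right
  rw [← e₁] at h₂
  obtain ⟨c₂, l₂, e₂, s₂, v₂⟩ := h' c₁ s₁ v₁ h₂
  exact ⟨c₂, by simpa using l₁.trans l₂, by simp [e₂, e₁]; omega, s₁.trans s₂ hpq, v₂⟩

theorem runs_setNat {c : Config} {instr : Instr} {p v : ℕ} {P : Config → Prop} (hp : p < 24)
    (he : instr.exec I c = PMF.pure (c.setNat (40 + p) v)) (hP : P (c.setNat (40 + p) v)) :
    Runs A I c [instr] p P := fun h =>
  ⟨_, Leads.of_exec (h.get 0 rfl) he, rfl, ⟨fun a ha => by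
    have h1 : a ≠ 40 + p := by omega
    simp [Config.setNat, h1], fun _ _ => rfl⟩, hP⟩

theorem runs_setReal {c : Config} {instr : Instr} {p : ℕ} {v : ℝ} {P : Config → Prop} (hp : p < 24)
    (he : instr.exec I c = PMF.pure (c.setReal (40 + p) v)) (hP : P (c.setReal (40 + p) v)) :
    Runs A I c [instr] p P := fun h =>
  ⟨_, Leads.of_exec (h.get 0 rfl) he, rfl, ⟨fun _ _ => rfl, fun a ha => by
    have h1 : a ≠ 40 + p := by omega
    simp [Config.setReal, h1]⟩, hP⟩

theorem addrCode_runs {x p : ℕ} {c : Config} (hp : p < 23) :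
    Runs A I c (addrCode x p) p fun c' => c'.nat (40 + p) = 64 * c.nat (40 + p) + x := by
  intro h
  refine ⟨_, (Leads.of_exec (h.get 0 rfl) rfl).trans <| (Leads.of_exec (h.get 1 rfl) rfl).trans <|
    (Leads.of_exec (h.get 2 rfl) rfl).trans <| (Leads.of_exec (h.get 3 rfl) rfl).trans <|
    (Leads.of_exec (h.get 4 rfl) rfl).trans <| (Leads.of_exec (h.get 5 rfl) rfl).trans <|
    (Leads.of_exec (h.get 6 rfl) rfl).trans <| (Leads.of_exec (h.get 7 rfl) rfl), rfl, ⟨?_, ?_⟩, ?_⟩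
  · intro a ha
    have h1 : a ≠ 40 + p := by omega
    have h2 : a ≠ 41 + p := by omega
    simp [Config.setNat, h1, h2]
  · intro a _
    simp [Config.setNat]
  · simp [Config.setNat]
    omega

theorem NExpr.lt_of_fits {e : NExpr} {p : ℕ} (h : e.Fits p = true) : p < 24 := by
  induction e with
  | const m => simpa [Fits] using h
  | get x i ih => exact ih (by simp only [Fits, Bool.and_eq_true] at h; exact h.1.2)
  | add a b ih _ => exact ih (by simp only [Fits, Bool.and_eq_true] at h; exact h.1)
  | sub a b ih _ => exact ih (by simp only [Fits, Bool.and_eq_true] at h; exact h.1)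

theorem RExpr.lt_of_fits {e : RExpr} {p : ℕ} (h : e.Fits p = true) : p < 24 := by
  induction e with
  | get x i => simp only [Fits, Bool.and_eq_true, decide_eq_true_eq] at h; omega
  | inp i => simp only [Fits, Bool.and_eq_true, decide_eq_true_eq] at h; omega
  | nat e => simp only [Fits, Bool.and_eq_true, decide_eq_true_eq] at h; omega
  | add a b ih _ => exact ih (by simp only [Fits, Bool.and_eq_true] at h; exact h.1)
  | sub a b ih _ => exact ih (by simp only [Fits, Bool.and_eq_true] at h; exact h.1)
  | mul a b ih _ => exact ih (by simp only [Fits, Bool.and_eq_true] at h; exact h.1)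
  | div a b ih _ => exact ih (by simp only [Fits, Bool.and_eq_true] at h; exact h.1)
  | sqrt a ih => exact ih (by simp only [Fits, Bool.and_eq_true] at h; exact h.1)

theorem NExpr.code_runs (e : NExpr) {p : ℕ} {c : Config} (hp : e.Fits p = true) :
    Runs A I c (e.code p) p fun c' => c'.nat (40 + p) = e.eval c.view := by
  induction e generalizing p c with
  | const m =>
    exact runs_setNat (NExpr.lt_of_fits hp) rfl (by simp [Config.setNat, eval])
  | get x i ih =>
    simp only [Fits, Bool.and_eq_true, decide_eq_true_eq] at hp
    obtain ⟨⟨hx, hi⟩, hp⟩ := hp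
    refine (ih hi).append le_rfl fun c₁ s₁ v₁ => (addrCode_runs hp).append le_rfl fun c₂ s₂ v₂ =>
      runs_setNat (by omega) rfl ?_
    simp only [Config.setNat, Function.update_self, v₂, v₁, eval]
    rw [s₂.nat _ (by omega), s₁.nat _ (by omega)]
    simp [Config.view, hx, show x < 64 by omega]
  | add a b iha ihb =>
    simp only [Fits, Bool.and_eq_true] at hp
    have := NExpr.lt_of_fits hp.2
    refine (iha hp.1).append le_rfl fun c₁ s₁ v₁ => Runs.append (p := p) (q := p) (P := fun c' =>
      c'.nat (40 + p) = a.eval c.view ∧ c'.nat (40 + (p + 1)) = b.eval c.view) ?_ le_rfl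
      fun c₂ s₂ v₂ => runs_setNat (by omega) rfl ?_
    · intro hc
      obtain ⟨c₂, l₂, e₂, s₂, v₂⟩ := ihb hp.2 hc
      exact ⟨c₂, l₂, e₂, SameFrom.trans ⟨fun _ _ => rfl, fun _ _ => rfl⟩ s₂ (by omega),
        by rw [s₂.nat _ (by omega), v₁], by rw [v₂, s₁.view]⟩
    · rw [show 40 + (p + 1) = 41 + p by omega] at v₂
      simp [Config.setNat, eval, v₂.1, v₂.2]
  | sub a b iha ihb =>
    simp only [Fits, Bool.and_eq_true] at hp
    have := NExpr.lt_of_fits hp.2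
    refine (iha hp.1).append le_rfl fun c₁ s₁ v₁ => Runs.append (p := p) (q := p) (P := fun c' =>
      c'.nat (40 + p) = a.eval c.view ∧ c'.nat (40 + (p + 1)) = b.eval c.view) ?_ le_rfl
      fun c₂ s₂ v₂ => runs_setNat (by omega) rfl ?_
    · intro hc
      obtain ⟨c₂, l₂, e₂, s₂, v₂⟩ := ihb hp.2 hc
      exact ⟨c₂, l₂, e₂, SameFrom.trans ⟨fun _ _ => rfl, fun _ _ => rfl⟩ s₂ (by omega),
        by rw [s₂.nat _ (by omega), v₁], by rw [v₂, s₁.view]⟩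
    · rw [show 40 + (p + 1) = 41 + p by omega] at v₂
      simp [Config.setNat, eval, v₂.1, v₂.2]

theorem runs_realOp {a b : RExpr} {p : ℕ} {c : Config} {instr : Instr} {op : ℝ → ℝ → ℝ}
    (hb : b.Fits (p + 1) = true)
    (iha : Runs A I c (a.code p) p fun c' => c'.real (40 + p) = a.eval I c.view)
    (ihb : ∀ c, Runs A I c (b.code (p + 1)) (p + 1) fun c' =>
      c'.real (40 + (p + 1)) = b.eval I c.view)
    (he : ∀ c : Config, instr.exec I c =
      PMF.pure (c.setReal (40 + p) (op (c.real (40 + p)) (c.real (41 + p))))) :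
    Runs A I c (a.code p ++ (b.code (p + 1) ++ [instr])) p fun c' =>
      c'.real (40 + p) = op (a.eval I c.view) (b.eval I c.view) := by
  have := RExpr.lt_of_fits hb
  refine iha.append le_rfl fun c₁ s₁ v₁ => Runs.append (p := p) (q := p) (P := fun c' =>
    c'.real (40 + p) = a.eval I c.view ∧ c'.real (40 + (p + 1)) = b.eval I c.view) ?_ le_rfl
    fun c₂ s₂ v₂ => runs_setReal (by omega) (he c₂) ?_
  · intro hc
    obtain ⟨c₂, l₂, e₂, s₂, v₂⟩ := ihb c₁ hc
    exact ⟨c₂, l₂, e₂, SameFrom.trans ⟨fun _ _ => rfl, fun _ _ => rfl⟩ s₂ (by omega),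
      by rw [s₂.real _ (by omega), v₁], by rw [v₂, s₁.view]⟩
  · rw [show 40 + (p + 1) = 41 + p by omega] at v₂
    simp [Config.setReal, v₂.1, v₂.2]

theorem RExpr.code_runs (e : RExpr) {p : ℕ} {c : Config} (hp : e.Fits p = true) :
    Runs A I c (e.code p) p fun c' => c'.real (40 + p) = e.eval I c.view := by
  induction e generalizing p c with
  | get x i =>
    simp only [Fits, Bool.and_eq_true, decide_eq_true_eq] at hp
    obtain ⟨⟨hx, hi⟩, hp⟩ := hp
    refine (i.code_runs hi).append le_rfl fun c₁ s₁ v₁ => (addrCode_runs hp).append le_rfl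
      fun c₂ s₂ v₂ => runs_setReal (by omega) rfl ?_
    simp only [Config.setReal, Function.update_self, v₂, v₁, eval]
    rw [s₂.real _ (by omega), s₁.real _ (by omega)]
    simp [Config.view, hx, show x < 64 by omega]
  | inp i =>
    simp only [Fits, Bool.and_eq_true, decide_eq_true_eq] at hp
    exact (i.code_runs hp.1).append le_rfl fun c₁ s₁ v₁ => runs_setReal hp.2 rfl
      (by simp [Config.setReal, v₁, eval])
  | nat e =>
    simp only [Fits, Bool.and_eq_true, decide_eq_true_eq] at hp
    exact (e.code_runs hp.1).append le_rfl fun c₁ s₁ v₁ => runs_setReal hp.2 rfl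
      (by simp [Config.setReal, v₁, eval])
  | add a b iha ihb =>
    simp only [Fits, Bool.and_eq_true] at hp
    exact runs_realOp hp.2 (iha hp.1) (fun c => ihb hp.2) fun _ => rfl
  | sub a b iha ihb =>
    simp only [Fits, Bool.and_eq_true] at hp
    exact runs_realOp hp.2 (iha hp.1) (fun c => ihb hp.2) fun _ => rfl
  | mul a b iha ihb =>
    simp only [Fits, Bool.and_eq_true] at hp
    exact runs_realOp hp.2 (iha hp.1) (fun c => ihb hp.2) fun _ => rfl
  | div a b iha ihb =>
    simp only [Fits, Bool.and_eq_true] at hp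
    exact runs_realOp hp.2 (iha hp.1) (fun c => ihb hp.2) fun _ => rfl
  | sqrt a iha =>
    simp only [Fits, Bool.and_eq_true, decide_eq_true_eq] at hp
    exact (iha hp.1).append le_rfl fun c₁ s₁ v₁ => runs_setReal hp.2 rfl
      (by simp [Config.setReal, v₁, eval])

end

/-! ### Code of commands and correctness of the compiler -/

section

open scoped ENNReal

variable {A : Program} {I : ℕ → ℝ}

/-- Code of a command, placed at line `b`. -/
def Cmd.code : Cmd → ℕ → List Instr
  | skip, _ => []
  | setN x i e, _ => i.code 0 ++ (addrCode x 0 ++ (e.code 1 ++ [.natStore 40 41]))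
  | setR x i e, _ => i.code 0 ++ (addrCode x 0 ++ (e.code 1 ++ [.realStore 40 41]))
  | rand x e, _ => e.code 0 ++ [.natRand x 40]
  | rawN a e, _ => a.code 0 ++ ([.natConst 41 64] ++ ([.natAdd 40 40 41] ++
      (e.code 1 ++ [.natStore 40 41])))
  | rawR a e, _ => a.code 0 ++ ([.natConst 41 64] ++ ([.natAdd 40 40 41] ++
      (e.code 1 ++ [.realStore 40 41])))
  | seq c₁ c₂, b => c₁.code b ++ c₂.code (b + (c₁.code b).length)
  | ifz e c₁ c₂, b =>
      -- The second branch is laid out first. The test is for being at most zero, and `natJump 40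
      -- 40` always jumps.
      let t := e.code 0 ++ [.natConst 41 0]
      let l₂ := c₂.code (b + t.length + 1)
      let l₁ := c₁.code (b + t.length + 1 + l₂.length + 1)
      t ++ ([.natJump 40 41 (b + t.length + 1 + l₂.length + 1)] ++ (l₂ ++
        ([.natJump 40 40 (b + t.length + 1 + l₂.length + 1 + l₁.length)] ++ l₁)))
  | ifle x y c₁ c₂, b =>
      let t := x.code 0 ++ y.code 1
      let l₂ := c₂.code (b + t.length + 1)
      let l₁ := c₁.code (b + t.length + 1 + l₂.length + 1)
      t ++ ([.realJump 40 41 (b + t.length + 1 + l₂.length + 1)] ++ (l₂ ++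
        ([.natJump 40 40 (b + t.length + 1 + l₂.length + 1 + l₁.length)] ++ l₁)))
  | loop v w c, b =>
      -- The test is at line `b + 1`: the loop is left as soon as the bound is at most the loop
      -- variable.
      let l := c.code (b + 2)
      [.natConst v 0, .natJump w v (b + 2 + l.length + 3)] ++ (l ++
        [.natConst 40 1, .natAdd v v 40, .natJump 40 40 (b + 1)])

/-- The names are in range, and loop variables and bounds are not written by the loop bodies. -/
def Cmd.Ok : Cmd → Bool
  | skip => true
  | setN x i e => x < 40 && i.Fits 0 && e.Fits 1
  | setR x i e => x < 40 && i.Fits 0 && e.Fits 1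
  | rand x e => x < 40 && e.Fits 0
  | rawN a e => a.Fits 0 && e.Fits 1
  | rawR a e => a.Fits 0 && e.Fits 1
  | seq c₁ c₂ => c₁.Ok && c₂.Ok
  | ifz e c₁ c₂ => e.Fits 0 && c₁.Ok && c₂.Ok
  | ifle x y c₁ c₂ => x.Fits 0 && y.Fits 1 && c₁.Ok && c₂.Ok
  | loop v b c => v < 40 && b < 40 && !(c.writesN.contains v) && c.Ok

/-- The running time, as a function of the scalars that bound loops. -/
def Cmd.cost (ρ : ℕ → ℕ) : Cmd → ℕ
  | skip => 0
  | setN x i e => ((setN x i e).code 0).length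
  | setR x i e => ((setR x i e).code 0).length
  | rand x e => ((rand x e).code 0).length
  | rawN a e => ((rawN a e).code 0).length
  | rawR a e => ((rawR a e).code 0).length
  | seq c₁ c₂ => c₁.cost ρ + c₂.cost ρ
  -- Both branches are counted, so that the cost depends on the loop bounds only.
  | ifz e c₁ c₂ => (e.code 0).length + (c₁.cost ρ + c₂.cost ρ + 3)
  | ifle x y c₁ c₂ => (x.code 0).length + (y.code 1).length + (c₁.cost ρ + c₂.cost ρ + 3)
  | loop _ b c => 2 + ρ b * (c.cost ρ + 4)

theorem view_setNat (c : Config) {x i : ℕ} (v : ℕ) (hx : x < 64) (h : x < 40 ∨ 0 < i) :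
    (c.setNat (64 * i + x) v).view = c.view.setN x i v := by
  ext y j
  · simp only [Config.view, Config.setNat, Mem.setN, Function.update_apply]
    by_cases hy : y < 64 ∧ (y < 40 ∨ 0 < j)
    · have : 64 * j + y = 64 * i + x ↔ y = x ∧ j = i := by omega
      simp only [hy, this, and_self, if_true]
    · rw [if_neg hy, if_neg, if_neg hy]
      rintro ⟨rfl, rfl⟩
      exact hy ⟨hx, h⟩
  · rfl

theorem view_setReal (c : Config) {x i : ℕ} (v : ℝ) (hx : x < 64) (h : x < 40 ∨ 0 < i) :
    (c.setReal (64 * i + x) v).view = c.view.setR x i v := by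
  ext y j
  · rfl
  · simp only [Config.view, Config.setReal, Mem.setR, Function.update_apply]
    by_cases hy : y < 64 ∧ (y < 40 ∨ 0 < j)
    · have : 64 * j + y = 64 * i + x ↔ y = x ∧ j = i := by omega
      simp only [hy, this, and_self, if_true]
    · rw [if_neg hy, if_neg, if_neg hy]
      rintro ⟨rfl, rfl⟩
      exact hy ⟨hx, h⟩

/-- The value of `F` at the memory if the line `e` is reached, and `∞` otherwise. -/
def exitAt (e : ℕ) (F : Mem → ℝ≥0∞) (c : Config) : ℝ≥0∞ := if c.pc = e then F c.view else ⊤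

theorem reach_exitAt {e t : ℕ} {F : Mem → ℝ≥0∞} {c : Config} {x : ℝ≥0∞} (h : c.pc = e)
    (hx : F c.view ≤ x) : Reach A I (exitAt e F) t c x :=
  .finish (by simpa [exitAt, h] using hx)

theorem Runs.reach {c : Config} {l : List Instr} {p : ℕ} {P : Config → Prop}
    (h : Runs A I c l p P) (hc : CodeAt A c.pc l) {G : Config → ℝ≥0∞} {t : ℕ} {x : ℝ≥0∞}
    (h' : ∀ c', c'.pc = c.pc + l.length → SameFrom p c c' → P c' → Reach A I G t c' x) :
    Reach A I G (l.length + t) c x := by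
  obtain ⟨c', l', e', s', v'⟩ := h hc
  exact l' _ _ _ (h' c' e' s' v')

theorem Leads.reach {c c' : Config} {m : ℕ} (h : Leads A I c m c') {G : Config → ℝ≥0∞} {t : ℕ}
    {x : ℝ≥0∞} (h' : Reach A I G t c' x) : Reach A I G (m + t) c x := h _ _ _ h'

theorem reach_exitAt_apply {e t : ℕ} {F : Mem → ℝ≥0∞} {G : Config → ℝ≥0∞} {c : Config}
    (h : c.pc = e → Reach A I G t c (F c.view)) : Reach A I G t c (exitAt e F c) := by
  unfold exitAt
  split_ifs with hc
  · exact h hc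
  · exact .finish le_top

theorem reach_ite {t : ℕ} {G : Config → ℝ≥0∞} {c : Config} {x : ℝ≥0∞} {P : Prop} [Decidable P]
    (h : P → Reach A I G t c x) : Reach A I G t c (if P then x else ⊤) := by
  split_ifs with hc
  · exact h hc
  · exact .finish le_top

/-- The common part of both conditionals, once the operands of the test have been computed. -/
theorem reach_branch {c : Config} {b t t₁ t₂ L₁ L₂ : ℕ} {jump : Instr} {l₁ l₂ : List Instr}
    {P : Prop} [Decidable P] {x₁ x₂ : ℝ≥0∞} {F : Mem → ℝ≥0∞}
    (hc : CodeAt A b ([jump] ++ (l₂ ++ ([.natJump 40 40 L₂] ++ l₁))))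
    (hb : c.pc = b) (hL₁ : L₁ = b + 1 + l₂.length + 1)
    (hj : jump.exec I c = PMF.pure (c.jump P L₁))
    (h₁ : ∀ c', CodeAt A (b + 1 + l₂.length + 1) l₁ → c'.pc = b + 1 + l₂.length + 1 →
      c'.view = c.view → Reach A I (exitAt L₂ F) t₁ c' x₁)
    (h₂ : ∀ c', CodeAt A (b + 1) l₂ → c'.pc = b + 1 →
      c'.view = c.view → Reach A I (exitAt (b + 1 + l₂.length) F) t₂ c' x₂)
    (ht : t₁ + t₂ + 2 ≤ t) :
    Reach A I (exitAt L₂ F) t c (if P then x₁ else x₂) := by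
  subst hb
  have e := Leads.of_exec (I := I) (hc.get 0 rfl) hj
  have d₁ := hc.right.left
  have d₂ := hc.right.right.left
  have d₃ := hc.right.right.right
  simp only [List.length_singleton] at d₁ d₂ d₃
  by_cases hP : P
  · rw [if_pos hP]
    refine (e.reach (h₁ _ d₃ ?_ rfl)).mono (by omega) le_rfl
    simp [Config.jump, hP, hL₁]
  · rw [if_neg hP]
    refine (e.reach (t := t₂ + 1) (x := x₂) ((h₂ (c.jump P L₁) d₁ ?_ rfl).comp (t := 1) (G := exitAt L₂ F)
      fun c' => ?_)).mono (by omega) le_rfl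
    · simp [Config.jump, hP]
    · refine reach_exitAt_apply fun hpc => ?_
      rw [← hpc] at d₂
      exact (Leads.of_exec (d₂.get 0 rfl) rfl).reach (t := 0)
        (reach_exitAt (by simp [Config.jump]) le_rfl)

/-- By induction on `m`, the test is reached for the next time after `m` rounds with loop variable
`m`. The predicate `J` carries the fact that the bounds have not changed; memories that violate it
get `⊤`, which imposes no obligation on the rest of the run. -/
theorem wpRounds_reach {W : (Mem → ℝ≥0∞) → Mem → ℝ≥0∞} {v w b e t M : ℕ} (hv : v < 40)
    (hw : w < 40) {c : Config} {J : Mem → Prop}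
    [DecidablePred J] (hJ : J c.view)
    (hJv : ∀ σ m, J σ → J (σ.setN v 0 m)) (hM : ∀ σ, J σ → σ.N w 0 = M)
    (h₀ : A[b]? = some (.natConst v 0)) (h₁ : A[b + 1]? = some (.natJump w v (e + 3)))
    (h₂ : A[e]? = some (.natConst 40 1)) (h₃ : A[e + 1]? = some (.natAdd v v 40))
    (h₄ : A[e + 2]? = some (.natJump 40 40 (b + 1)))
    (hbody : ∀ (F : Mem → ℝ≥0∞) (c' : Config), c'.pc = b + 2 → J c'.view →
      Reach A I (exitAt e fun τ => if J τ ∧ τ.N v 0 = c'.view.N v 0 then F τ else ⊤) t c'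
        (W F c'.view))
    (hpc : c.pc = b) (F : Mem → ℝ≥0∞) :
    Reach A I (exitAt (e + 3) F) (2 + M * (t + 4)) c (wpRounds W v M F c.view) := by
  have key : ∀ m ≤ M, ∀ F : Mem → ℝ≥0∞,
      Reach A I (exitAt (b + 1) fun τ => if J τ ∧ τ.N v 0 = m then F τ else ⊤) (1 + m * (t + 4)) c
        (wpRounds W v m F c.view) := by
    intro m
    induction m with
    | zero =>
      intro _ F
      refine (Leads.of_exec (hpc ▸ h₀) rfl).reach (reach_exitAt (by simp [Config.setNat, hpc]) ?_)
      have := view_setNat c (i := 0) 0 (show v < 64 by omega) (.inl hv)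
      rw [Nat.mul_zero, Nat.zero_add] at this
      rw [this, if_pos ⟨hJv _ _ hJ, by simp [Mem.setN]⟩]
      rfl
    | succ m ih =>
      intro hm F
      have := (ih (by omega) (W fun ρ => F (ρ.setN v 0 (m + 1)))).comp (t := t + 4)
        (G := exitAt (b + 1) fun τ => if J τ ∧ τ.N v 0 = m + 1 then F τ else ⊤) fun c' => ?_
      · exact this.mono (by ring_nf; rfl) le_rfl
      refine reach_exitAt_apply fun hpc' => reach_ite fun hJ' => ?_
      · rw [← hpc'] at h₁
        have hjump : ¬ c'.nat w ≤ c'.nat v := by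
          have e1 := hM _ hJ'.1
          have e2 := hJ'.2
          simp [Config.view, hv, hw, show v < 64 by omega, show w < 64 by omega] at e1 e2
          omega
        refine ((Leads.of_exec h₁ rfl).reach (t := t + 3) ((hbody _ (c'.jump (c'.nat w ≤ c'.nat v) (e + 3)) ?_ hJ'.1).comp (t := 3) (G := exitAt (b + 1)
          fun τ => if J τ ∧ τ.N v 0 = m + 1 then F τ else ⊤) fun d => ?_)).mono (by omega) le_rfl
        · simp [Config.jump, hjump, hpc']
        · refine reach_exitAt_apply fun hd => reach_ite fun hJd => ?_
          · rw [← hd] at h₂ h₃ h₄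
            refine (Leads.of_exec h₂ rfl).reach <| (Leads.of_exec h₃ rfl).reach <|
              (Leads.of_exec h₄ rfl).reach (t := 0) (reach_exitAt (by simp [Config.jump]) ?_)
            have hvd : d.nat v = m := by
              have e1 := hJd.2.trans hJ'.2
              simpa [Config.view, hv, show v < 64 by omega] using e1
            have e3 : (((d.setNat 40 1).setNat v (d.nat v + 1)).jump (40 ≤ 40) (b + 1)).view
                = d.view.setN v 0 (m + 1) := by
              have h40 : SameFrom 0 d (d.setNat 40 1) := ⟨fun a ha => by
                have : a ≠ 40 := by omega
                simp [Config.setNat, this], fun _ _ => rfl⟩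
              have := view_setNat (d.setNat 40 1) (i := 0) (m + 1) (show v < 64 by omega) (.inl hv)
              rw [Nat.mul_zero, Nat.zero_add, h40.view] at this
              rw [hvd, ← this]
              rfl
            have e4 : (Config.jump (Config.setNat (d.setNat 40 1) v
                ((d.setNat 40 1).nat v + (d.setNat 40 1).nat 40))
                (((d.setNat 40 1).setNat v ((d.setNat 40 1).nat v + (d.setNat 40 1).nat 40)).nat 40
                  ≤ ((d.setNat 40 1).setNat v
                    ((d.setNat 40 1).nat v + (d.setNat 40 1).nat 40)).nat 40) (b + 1)).view
                = d.view.setN v 0 (m + 1) := by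
              rw [← e3]
              have hv40 : v ≠ 40 := by omega
              simp [Config.view, Config.setNat, Config.jump, hv40]
            rw [e4, if_pos ⟨hJv _ _ hJd.1, by simp [Mem.setN]⟩]
  refine ((key M le_rfl F).comp (t := 1) (G := exitAt (e + 3) F) fun c' => ?_).mono
    (by omega) le_rfl
  refine reach_exitAt_apply fun hpc' => reach_ite fun hJ' => ?_
  · rw [← hpc'] at h₁
    have hjump : c'.nat w ≤ c'.nat v := by
      have e1 := hM _ hJ'.1
      have e2 := hJ'.2
      simp [Config.view, hv, hw, show v < 64 by omega, show w < 64 by omega] at e1 e2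
      omega
    refine (Leads.of_exec h₁ rfl).reach (t := 0) (reach_exitAt (by simp [Config.jump, hjump]) ?_)
    exact le_rfl

/-- A property that only depends on scalars that are not written may be assumed after the command at
no cost. -/
theorem Cmd.wp_ite_top {s : Cmd} {F : Mem → ℝ≥0∞} {σ : Mem} {Q : Mem → Prop}
    [DecidablePred Q] (hQ : ∀ τ, (∀ x ∉ s.writesN, τ.N x 0 = σ.N x 0) → Q τ) :
    s.wp I (fun τ => if Q τ then F τ else ⊤) σ = s.wp I F σ :=
  s.wp_congr fun τ hτ => if_pos (hQ τ hτ)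

theorem code_ifz_end (e : NExpr) (c₁ c₂ : Cmd) (b : ℕ) :
    b + ((Cmd.ifz e c₁ c₂).code b).length =
      let t := e.code 0 ++ [.natConst 41 0]
      let l₂ := c₂.code (b + t.length + 1)
      let l₁ := c₁.code (b + t.length + 1 + l₂.length + 1)
      b + t.length + 1 + l₂.length + 1 + l₁.length := by
  simp [Cmd.code]
  omega

theorem code_ifle_end (x y : RExpr) (c₁ c₂ : Cmd) (b : ℕ) :
    b + ((Cmd.ifle x y c₁ c₂).code b).length =
      let t := x.code 0 ++ y.code 1
      let l₂ := c₂.code (b + t.length + 1)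
      let l₁ := c₁.code (b + t.length + 1 + l₂.length + 1)
      b + t.length + 1 + l₂.length + 1 + l₁.length := by
  simp [Cmd.code]
  omega

/-- Compiled code stays within the cost, and realizes the weakest preexpectation. -/
theorem Cmd.code_reach (s : Cmd) (hs : s.Ok = true) {b : ℕ} {c : Config} {ρ : ℕ → ℕ}
    (hc : CodeAt A b (s.code b)) (hpc : c.pc = b) (hρ : ∀ x ∈ s.bounds, c.view.N x 0 = ρ x)
    {D : List ℕ} (hD : ∀ x ∈ s.writesN, x ∈ D) (hb : ∀ x ∈ s.bounds, x ∉ D) (F : Mem → ℝ≥0∞) :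
    Reach A I (exitAt (b + (s.code b).length) F) (s.cost ρ) c (s.wp I F c.view) := by
  induction s generalizing b c F with
  | skip => exact reach_exitAt (by simp [code, hpc]) le_rfl
  | setN x i e =>
    simp only [Ok, Bool.and_eq_true, decide_eq_true_eq] at hs
    subst hpc
    simp only [code] at hc
    simp only [cost, code, List.length_append]
    refine Runs.reach (i.code_runs hs.1.2) hc.left fun c₁ e₁ s₁ v₁ => ?_
    have h₁ := hc.right; rw [← e₁] at h₁
    refine Runs.reach (addrCode_runs (by omega)) h₁.left fun c₂ e₂ s₂ v₂ => ?_
    have h₂ := h₁.right; rw [← e₂] at h₂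
    refine Runs.reach (e.code_runs hs.2) h₂.left fun c₃ e₃ s₃ v₃ => ?_
    have h₃ := h₂.right; rw [← e₃] at h₃
    refine (Leads.of_exec (h₃.get 0 rfl) rfl).reach (t := 0) (reach_exitAt ?_ ?_)
    · simp [Config.setNat, e₁, e₂, e₃]; omega
    · rw [show c₃.nat 41 = e.eval c.view by rw [v₃, s₂.view, s₁.view],
        show c₃.nat 40 = 64 * i.eval c.view + x by
          rw [s₃.nat 40 (by omega), v₂, v₁], view_setNat _ _ (by omega) (.inl hs.1.1),
        s₃.view, s₂.view, s₁.view]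
      rfl
  | setR x i e =>
    simp only [Ok, Bool.and_eq_true, decide_eq_true_eq] at hs
    subst hpc
    simp only [code] at hc
    simp only [cost, code, List.length_append]
    refine Runs.reach (i.code_runs hs.1.2) hc.left fun c₁ e₁ s₁ v₁ => ?_
    have h₁ := hc.right; rw [← e₁] at h₁
    refine Runs.reach (addrCode_runs (by omega)) h₁.left fun c₂ e₂ s₂ v₂ => ?_
    have h₂ := h₁.right; rw [← e₂] at h₂
    refine Runs.reach (e.code_runs hs.2) h₂.left fun c₃ e₃ s₃ v₃ => ?_
    have h₃ := h₂.right; rw [← e₃] at h₃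
    refine (Leads.of_exec (h₃.get 0 rfl) rfl).reach (t := 0) (reach_exitAt ?_ ?_)
    · simp [Config.setReal, e₁, e₂, e₃]; omega
    · rw [show c₃.real 41 = e.eval I c.view by rw [v₃, s₂.view, s₁.view],
        show c₃.nat 40 = 64 * i.eval c.view + x by
          rw [s₃.nat 40 (by omega), v₂, v₁], view_setReal _ _ (by omega) (.inl hs.1.1),
        s₃.view, s₂.view, s₁.view]
      rfl
  | rand x e =>
    simp only [Ok, Bool.and_eq_true, decide_eq_true_eq] at hs
    subst hpc
    simp only [code] at hc
    simp only [cost, code, List.length_append]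
    refine Runs.reach (e.code_runs hs.2) hc.left fun c₁ e₁ s₁ v₁ => ?_
    have h₁ := hc.right; rw [← e₁] at h₁
    have := reach_of_rand (I := I) (F := exitAt (c.pc + ((e.code 0).length + 1)) F) (t := 0)
      (g := fun m => F (c.view.setN x 0 m)) (h₁.get 0 rfl) fun m _ => reach_exitAt ?_ ?_
    · rw [show c₁.nat 40 = e.eval c.view from v₁] at this
      exact this
    · simp [Config.setNat, e₁]; omega
    · have := view_setNat c₁ (i := 0) m (show x < 64 by omega) (.inl hs.1)
      rw [Nat.mul_zero, Nat.zero_add] at this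
      rw [this, s₁.view]
  | rawN a e =>
    simp only [Ok, Bool.and_eq_true] at hs
    subst hpc
    simp only [code] at hc
    simp only [cost, code, List.length_append]
    refine Runs.reach (a.code_runs hs.1) hc.left fun c₁ e₁ s₁ v₁ => ?_
    have h₁ := hc.right; rw [← e₁] at h₁
    refine Runs.reach (runs_setNat (p := 1) (v := 64) (P := fun c' => c'.nat 41 = 64) (by omega)
      rfl (by simp [Config.setNat])) h₁.left fun c₂ e₂ s₂ v₂ => ?_
    have h₂ := h₁.right; rw [← e₂] at h₂
    refine Runs.reach (runs_setNat (p := 0) (v := c₂.nat 40 + c₂.nat 41)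
      (P := fun c' => c'.nat 40 = c₂.nat 40 + c₂.nat 41) (by omega)
      rfl (by simp [Config.setNat])) h₂.left fun c₃ e₃ s₃ v₃ => ?_
    have h₃ := h₂.right; rw [← e₃] at h₃
    refine Runs.reach (e.code_runs hs.2) h₃.left fun c₄ e₄ s₄ v₄ => ?_
    have h₄ := h₃.right; rw [← e₄] at h₄
    refine (Leads.of_exec (h₄.get 0 rfl) rfl).reach (t := 0) (reach_exitAt ?_ ?_)
    · simp [Config.setNat, e₁, e₂, e₃, e₄]; omega
    · rw [show c₄.nat 41 = e.eval c.view by rw [v₄, s₃.view, s₂.view, s₁.view],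
        show c₄.nat 40 = 64 * (a.eval c.view / 64 + 1) + a.eval c.view % 64 by
          rw [s₄.nat 40 (by omega), v₃, v₂, s₂.nat 40 (by omega), v₁]; omega,
        view_setNat _ _ (by omega) (.inr (by omega)), s₄.view, s₃.view, s₂.view, s₁.view]
      rfl
  | rawR a e =>
    simp only [Ok, Bool.and_eq_true] at hs
    subst hpc
    simp only [code] at hc
    simp only [cost, code, List.length_append]
    refine Runs.reach (a.code_runs hs.1) hc.left fun c₁ e₁ s₁ v₁ => ?_
    have h₁ := hc.right; rw [← e₁] at h₁
    refine Runs.reach (runs_setNat (p := 1) (v := 64) (P := fun c' => c'.nat 41 = 64) (by omega)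
      rfl (by simp [Config.setNat])) h₁.left fun c₂ e₂ s₂ v₂ => ?_
    have h₂ := h₁.right; rw [← e₂] at h₂
    refine Runs.reach (runs_setNat (p := 0) (v := c₂.nat 40 + c₂.nat 41)
      (P := fun c' => c'.nat 40 = c₂.nat 40 + c₂.nat 41) (by omega)
      rfl (by simp [Config.setNat])) h₂.left fun c₃ e₃ s₃ v₃ => ?_
    have h₃ := h₂.right; rw [← e₃] at h₃
    refine Runs.reach (e.code_runs hs.2) h₃.left fun c₄ e₄ s₄ v₄ => ?_
    have h₄ := h₃.right; rw [← e₄] at h₄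
    refine (Leads.of_exec (h₄.get 0 rfl) rfl).reach (t := 0) (reach_exitAt ?_ ?_)
    · simp [Config.setReal, e₁, e₂, e₃, e₄]; omega
    · rw [show c₄.real 41 = e.eval I c.view by rw [v₄, s₃.view, s₂.view, s₁.view],
        show c₄.nat 40 = 64 * (a.eval c.view / 64 + 1) + a.eval c.view % 64 by
          rw [s₄.nat 40 (by omega), v₃, v₂, s₂.nat 40 (by omega), v₁]; omega,
        view_setReal _ _ (by omega) (.inr (by omega)), s₄.view, s₃.view, s₂.view, s₁.view]
      rfl
  | seq c₁ c₂ ih₁ ih₂ =>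
    simp only [Ok, Bool.and_eq_true] at hs
    simp only [bounds, writesN, List.mem_append] at hρ hD hb
    simp only [code] at hc
    simp only [code, List.length_append, wp, cost]
    -- The second command needs its loop bounds to have their initial values; the first one does not
    -- write to them.
    rw [← Cmd.wp_ite_top (s := c₁) (Q := fun τ => ∀ x ∈ c₂.bounds, τ.N x 0 = ρ x)
      fun τ hτ x hx => by
        rw [hτ x fun h => hb x (.inr hx) (hD x (.inl h)), hρ x (.inr hx)]]
    refine (ih₁ hs.1 hc.left hpc (fun x hx => hρ x (.inl hx)) (fun x hx => hD x (.inl hx))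
      (fun x hx => hb x (.inl hx)) _).comp fun c' => ?_
    refine reach_exitAt_apply fun h₁ => reach_ite fun h₂ => ?_
    have := ih₂ hs.2 hc.right h₁ h₂ (fun x hx => hD x (.inr hx)) (fun x hx => hb x (.inr hx)) F
    rwa [Nat.add_assoc] at this
  | ifz e c₁ c₂ ih₁ ih₂ =>
    simp only [Ok, Bool.and_eq_true] at hs
    simp only [bounds, writesN, List.mem_append] at hρ hD hb
    simp only [code] at hc
    subst hpc
    simp only [wp, cost]
    have he : Runs A I c (e.code 0 ++ [.natConst 41 0]) 0 fun c' =>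
        c'.nat 40 = e.eval c.view ∧ c'.nat 41 = 0 :=
      (e.code_runs hs.1.1).append le_rfl fun c' s' v' => by
        intro h
        obtain ⟨d, l, p, s, v⟩ := runs_setNat (I := I) (p := 1) (v := 0)
          (P := fun d => d.nat 41 = 0 ∧ d.nat 40 = c'.nat 40) (by omega) rfl
          (by simp [Config.setNat]) h
        exact ⟨d, l, p, SameFrom.trans ⟨fun _ _ => rfl, fun _ _ => rfl⟩ s (by omega),
          v.2.trans v', v.1⟩
    refine (Runs.reach he hc.left fun c' e' s' v' => ?_).mono (t := _ + (c₁.cost ρ + c₂.cost ρ + 2))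
      (by simp only [List.length_append, List.length_singleton]; omega) le_rfl
    have h₁ := hc.right
    have hP : e.eval c.view = 0 ↔ c'.nat 40 ≤ c'.nat 41 := by rw [v'.1, v'.2]; omega
    simp only [hP]
    rw [show c.pc + (code (ifz e c₁ c₂) c.pc).length = _ from code_ifz_end ..]
    exact reach_branch h₁ e' rfl rfl
      (fun d hd hpd hvd => (hvd.trans s'.view) ▸ ih₁ hs.1.2 hd hpd (fun x hx => by
          rw [hvd, s'.view]; exact hρ x (.inl hx)) (fun x hx => hD x (.inl hx))
          (fun x hx => hb x (.inl hx)) F)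
      (fun d hd hpd hvd => (hvd.trans s'.view) ▸ ih₂ hs.2 hd hpd (fun x hx => by
          rw [hvd, s'.view]; exact hρ x (.inr hx)) (fun x hx => hD x (.inr hx))
          (fun x hx => hb x (.inr hx)) F) le_rfl
  | ifle x y c₁ c₂ ih₁ ih₂ =>
    simp only [Ok, Bool.and_eq_true] at hs
    simp only [bounds, writesN, List.mem_append] at hρ hD hb
    simp only [code] at hc
    subst hpc
    simp only [wp, cost]
    have he : Runs A I c (x.code 0 ++ y.code 1) 0 fun c' =>
        c'.real 40 = x.eval I c.view ∧ c'.real 41 = y.eval I c.view :=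
      (x.code_runs hs.1.1.1).append le_rfl fun c' s' v' => by
        intro h
        obtain ⟨d, l, p, s, v⟩ := y.code_runs (I := I) hs.1.1.2 h
        exact ⟨d, l, p, SameFrom.trans ⟨fun _ _ => rfl, fun _ _ => rfl⟩ s (by omega),
          (s.real 40 (by omega)).trans v', by rw [← s'.view]; exact v⟩
    refine (Runs.reach he hc.left fun c' e' s' v' => ?_).mono (t := _ + (c₁.cost ρ + c₂.cost ρ + 2))
      (by simp only [List.length_append]; omega) le_rfl
    have h₁ := hc.right
    rw [← v'.1, ← v'.2]
    rw [show c.pc + (code (ifle x y c₁ c₂) c.pc).length = _ from code_ifle_end ..]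
    exact reach_branch h₁ e' rfl (by simp only [Instr.exec])
      (fun d hd hpd hvd => (hvd.trans s'.view) ▸ ih₁ hs.1.2 hd hpd (fun x hx => by
          rw [hvd, s'.view]; exact hρ x (.inl hx)) (fun x hx => hD x (.inl hx))
          (fun x hx => hb x (.inl hx)) F)
      (fun d hd hpd hvd => (hvd.trans s'.view) ▸ ih₂ hs.2 hd hpd (fun x hx => by
          rw [hvd, s'.view]; exact hρ x (.inr hx)) (fun x hx => hD x (.inr hx))
          (fun x hx => hb x (.inr hx)) F) le_rfl
  | loop v w s ih =>
    simp only [Ok, Bool.and_eq_true, decide_eq_true_eq, Bool.not_eq_true',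
      List.contains_eq_mem, decide_eq_false_iff_not] at hs
    simp only [bounds, writesN, List.mem_cons] at hρ hD hb
    simp only [code] at hc
    simp only [wp, cost]
    rw [hρ w (.inl rfl)]
    have hl : (code (loop v w s) b).length = 2 + (s.code (b + 2)).length + 3 := by
      simp [code]; omega
    rw [hl, ← Nat.add_assoc, ← Nat.add_assoc]
    have h₁ := hc.right.left
    have h₂ := hc.right.right
    simp only [List.length_cons, List.length_nil, Nat.zero_add, Nat.reduceAdd] at h₁ h₂
    refine wpRounds_reach (e := b + 2 + (s.code (b + 2)).length) (J := fun τ =>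
      ∀ x ∈ (loop v w s).bounds, τ.N x 0 = ρ x) hs.1.1.1 hs.1.1.2 (by simpa [bounds] using hρ)
      (fun σ m hσ x hx => ?_) (fun σ hσ => hσ w (by simp [bounds])) (hc.left.get 0 rfl)
      (hc.left.get 1 rfl) (h₂.get 0 rfl) (h₂.get 1 rfl) (h₂.get 2 rfl) (fun G c' hpc' hJ => ?_)
      hpc F
    · rw [← hσ x hx]
      have : x ≠ v := by
        rintro rfl
        exact hb x (by simpa [bounds] using hx) (hD x (.inl rfl))
      simp [Mem.setN, this]
    · rw [← Cmd.wp_ite_top (s := s) (Q := fun τ =>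
        (∀ x ∈ (loop v w s).bounds, τ.N x 0 = ρ x) ∧ τ.N v 0 = c'.view.N v 0)
        fun τ hτ => ⟨fun x hx => by
          rw [hτ x fun h => hb x (by simpa [bounds] using hx) (hD x (.inr h)), hJ x hx],
          hτ v hs.1.2⟩]
      exact ih hs.2 h₁ hpc' (fun x hx => hJ x (by simp [bounds, hx])) (fun x hx => hD x (.inr hx))
        (fun x hx => hb x (.inr hx)) _

end

section

open scoped ENNReal

variable {A : Program} {I : ℕ → ℝ}

/-! ### Reasoning about commands -/

/-- The effect of a command without random choices. -/
def Cmd.exec (I : ℕ → ℝ) : Cmd → Mem → Mem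
  | skip, σ => σ
  | setN x i e, σ => σ.setN x (i.eval σ) (e.eval σ)
  | setR x i e, σ => σ.setR x (i.eval σ) (e.eval I σ)
  | rand _ _, σ => σ
  | rawN a e, σ => σ.setN (a.eval σ % 64) (a.eval σ / 64 + 1) (e.eval σ)
  | rawR a e, σ => σ.setR (a.eval σ % 64) (a.eval σ / 64 + 1) (e.eval I σ)
  | seq c₁ c₂, σ => c₂.exec I (c₁.exec I σ)
  | ifz e c₁ c₂, σ => if e.eval σ = 0 then c₁.exec I σ else c₂.exec I σ
  | ifle a b c₁ c₂, σ => if a.eval I σ ≤ b.eval I σ then c₁.exec I σ else c₂.exec I σ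
  | loop v b c, σ => rounds (c.exec I) v σ (σ.N b 0)

/-- There are no random choices. -/
def Cmd.Det : Cmd → Bool
  | rand _ _ => false
  | seq c₁ c₂ => c₁.Det && c₂.Det
  | ifz _ c₁ c₂ => c₁.Det && c₂.Det
  | ifle _ _ c₁ c₂ => c₁.Det && c₂.Det
  | loop _ _ c => c.Det
  | _ => true

/-- There are no writes to absolute addresses. -/
def Cmd.NoRaw : Cmd → Bool
  | rawN _ _ => false
  | rawR _ _ => false
  | seq c₁ c₂ => c₁.NoRaw && c₂.NoRaw
  | ifz _ c₁ c₂ => c₁.NoRaw && c₂.NoRaw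
  | ifle _ _ c₁ c₂ => c₁.NoRaw && c₂.NoRaw
  | loop _ _ c => c.NoRaw
  | _ => true

/-- The names of reals to which a command writes. -/
def Cmd.writesR : Cmd → List ℕ
  | setR x _ _ => [x]
  | seq c₁ c₂ => c₁.writesR ++ c₂.writesR
  | ifz _ c₁ c₂ => c₁.writesR ++ c₂.writesR
  | ifle _ _ c₁ c₂ => c₁.writesR ++ c₂.writesR
  | loop _ _ c => c.writesR
  | _ => []

theorem Cmd.wp_eq_exec {s : Cmd} (hs : s.Det = true) (F : Mem → ℝ≥0∞) (σ : Mem) :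
    s.wp I F σ = F (s.exec I σ) := by
  induction s generalizing F σ with
  | rand x e => simp [Det] at hs
  | seq c₁ c₂ ih₁ ih₂ =>
    simp only [Det, Bool.and_eq_true] at hs
    simp only [wp, exec, ih₁ hs.1, ih₂ hs.2]
  | ifz e c₁ c₂ ih₁ ih₂ =>
    simp only [Det, Bool.and_eq_true] at hs
    simp only [wp, exec, ih₁ hs.1, ih₂ hs.2]
    split_ifs <;> rfl
  | ifle a b c₁ c₂ ih₁ ih₂ =>
    simp only [Det, Bool.and_eq_true] at hs
    simp only [wp, exec, ih₁ hs.1, ih₂ hs.2]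
    split_ifs <;> rfl
  | loop v b c ih =>
    simp only [Det] at hs
    have : ∀ m F, wpRounds (c.wp I) v m F σ = F (rounds (c.exec I) v σ m) := by
      intro m
      induction m with
      | zero => exact fun F => rfl
      | succ m ihm =>
        intro F
        simp only [wpRounds, ihm, ih hs, rounds]
    exact this _ _
  | _ => rfl

theorem wpRounds_mono {W : (Mem → ℝ≥0∞) → Mem → ℝ≥0∞} {v : ℕ}
    (hW : ∀ F G, (∀ τ, F τ ≤ G τ) → ∀ σ, W F σ ≤ W G σ) (m : ℕ) {F G : Mem → ℝ≥0∞}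
    (h : ∀ τ, F τ ≤ G τ) (σ : Mem) : wpRounds W v m F σ ≤ wpRounds W v m G σ := by
  induction m generalizing F G with
  | zero => exact h _
  | succ m ih => exact ih (hW _ _ fun τ => h _)

theorem Cmd.wp_mono (s : Cmd) {F G : Mem → ℝ≥0∞} (h : ∀ τ, F τ ≤ G τ) (σ : Mem) :
    s.wp I F σ ≤ s.wp I G σ := by
  induction s generalizing F G σ with
  | rand x e =>
    simp only [wp]
    gcongr with m
    exact h _
  | seq c₁ c₂ ih₁ ih₂ => exact ih₁ (fun τ => ih₂ h τ) σ
  | ifz e c₁ c₂ ih₁ ih₂ =>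
    simp only [wp]
    split_ifs
    · exact ih₁ h σ
    · exact ih₂ h σ
  | ifle a b c₁ c₂ ih₁ ih₂ =>
    simp only [wp]
    split_ifs
    · exact ih₁ h σ
    · exact ih₂ h σ
  | loop v b c ih => exact wpRounds_mono (fun F G hFG τ => ih hFG τ) _ h σ
  | _ => exact h _

/-- A loop invariant for expectations: `G i` bounds the expected final value before round `i`. The
loop variable may be assumed to equal `i`, because the reset before the loop and the end of each
round set it. -/
theorem Cmd.wp_loop_le {v b m : ℕ} {s : Cmd} {σ : Mem} (hm : σ.N b 0 = m) {F : Mem → ℝ≥0∞}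
    (G : ℕ → Mem → ℝ≥0∞)
    (hstep : ∀ i < m, ∀ τ, τ.N v 0 = i →
      s.wp I (fun ρ => G (i + 1) (ρ.setN v 0 (i + 1))) τ ≤ G i τ)
    (hend : ∀ τ, F τ ≤ G m τ) : (loop v b s).wp I F σ ≤ G 0 (σ.setN v 0 0) := by
  classical
  simp only [wp, hm]
  have key : ∀ i ≤ m, wpRounds (s.wp I) v i (fun τ => if τ.N v 0 = i then G i τ else 0) σ ≤
      G 0 (σ.setN v 0 0) := by
    intro i
    induction i with
    | zero =>
      intro _
      simp [wpRounds, Mem.setN]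
    | succ i ih =>
      intro hi
      refine le_trans ?_ (ih (by omega))
      have hset : ∀ ρ : Mem, (ρ.setN v 0 (i + 1)).N v 0 = i + 1 := by simp [Mem.setN]
      simp only [wpRounds, hset, if_true]
      -- the rounds end with the loop variable equal to `i`
      have hfin : ∀ H : Mem → ℝ≥0∞, wpRounds (s.wp I) v i H σ =
          wpRounds (s.wp I) v i (fun τ => if τ.N v 0 = i then H τ else 0) σ := by
        intro H
        cases i with
        | zero => simp [wpRounds, Mem.setN]
        | succ i => simp [wpRounds, Mem.setN]
      rw [hfin]
      refine wpRounds_mono (fun F G h τ => s.wp_mono h τ) i (fun τ => ?_) σ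
      split_ifs with h
      · exact hstep i (by omega) τ h
      · exact le_rfl
  refine le_trans ?_ (key m le_rfl)
  have hfin : ∀ H : Mem → ℝ≥0∞, wpRounds (s.wp I) v m H σ =
      wpRounds (s.wp I) v m (fun τ => if τ.N v 0 = m then H τ else 0) σ := by
    intro H
    cases m with
    | zero => simp [wpRounds, Mem.setN]
    | succ i => simp [wpRounds, Mem.setN]
  rw [hfin]
  refine wpRounds_mono (fun F G h τ => s.wp_mono h τ) m (fun τ => ?_) σ
  split_ifs with h
  · exact hend τ
  · exact le_rfl

theorem Cmd.exec_loop {v b m : ℕ} {s : Cmd} {σ : Mem} (hm : σ.N b 0 = m) (P : ℕ → Mem → Prop)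
    (h0 : P 0 (σ.setN v 0 0))
    (hstep : ∀ i < m, ∀ τ, P i τ → τ.N v 0 = i → P (i + 1) ((s.exec I τ).setN v 0 (i + 1))) :
    P m ((loop v b s).exec I σ) := by
  simp only [exec, hm]
  have key : ∀ i ≤ m, P i (rounds (s.exec I) v σ i) ∧ (rounds (s.exec I) v σ i).N v 0 = i := by
    intro i
    induction i with
    | zero => exact fun _ => ⟨h0, by simp [rounds, Mem.setN]⟩
    | succ i ih =>
      intro hi
      obtain ⟨h1, h2⟩ := ih (by omega)
      exact ⟨hstep i (by omega) _ h1 h2, by simp [rounds, Mem.setN]⟩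
  exact (key m le_rfl).1

theorem rounds_induct {f : Mem → Mem} {v : ℕ} {Q : Mem → Prop} {σ : Mem} (h0 : Q σ)
    (hset : ∀ τ m, Q τ → Q (τ.setN v 0 m)) (hf : ∀ τ, Q τ → Q (f τ)) (m : ℕ) :
    Q (rounds f v σ m) := by
  induction m with
  | zero => exact hset _ _ h0
  | succ m ih => exact hset _ _ (hf _ ih)

theorem Cmd.exec_N_of_notMem {s : Cmd} (hraw : s.NoRaw = true) {x : ℕ} (hx : x ∉ s.writesN)
    (σ : Mem) : (s.exec I σ).N x = σ.N x := by
  induction s generalizing σ with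
  | setN y i e =>
    simp only [writesN, List.mem_singleton] at hx
    simp [exec, Mem.setN, hx]
  | rawN a e => simp [NoRaw] at hraw
  | rawR a e => simp [NoRaw] at hraw
  | seq c₁ c₂ ih₁ ih₂ =>
    simp only [NoRaw, Bool.and_eq_true] at hraw
    simp only [writesN, List.mem_append, not_or] at hx
    simp only [exec]
    rw [ih₂ hraw.2 hx.2, ih₁ hraw.1 hx.1]
  | ifz e c₁ c₂ ih₁ ih₂ =>
    simp only [NoRaw, Bool.and_eq_true] at hraw
    simp only [writesN, List.mem_append, not_or] at hx
    simp only [exec]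
    split_ifs
    · exact ih₁ hraw.1 hx.1 σ
    · exact ih₂ hraw.2 hx.2 σ
  | ifle a b c₁ c₂ ih₁ ih₂ =>
    simp only [NoRaw, Bool.and_eq_true] at hraw
    simp only [writesN, List.mem_append, not_or] at hx
    simp only [exec]
    split_ifs
    · exact ih₁ hraw.1 hx.1 σ
    · exact ih₂ hraw.2 hx.2 σ
  | loop v b c ih =>
    simp only [NoRaw] at hraw
    simp only [writesN, List.mem_cons, not_or] at hx
    exact rounds_induct (Q := fun τ => τ.N x = σ.N x) rfl
      (fun τ m h => by rw [← h]; simp [Mem.setN, hx.1]) (fun τ h => by rw [ih hraw hx.2, h]) _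
  | _ => rfl

theorem Cmd.exec_R_of_notMem {s : Cmd} (hraw : s.NoRaw = true) {x : ℕ} (hx : x ∉ s.writesR)
    (σ : Mem) : (s.exec I σ).R x = σ.R x := by
  induction s generalizing σ with
  | setR y i e =>
    simp only [writesR, List.mem_singleton] at hx
    simp [exec, Mem.setR, hx]
  | rawN a e => simp [NoRaw] at hraw
  | rawR a e => simp [NoRaw] at hraw
  | seq c₁ c₂ ih₁ ih₂ =>
    simp only [NoRaw, Bool.and_eq_true] at hraw
    simp only [writesR, List.mem_append, not_or] at hx
    simp only [exec]
    rw [ih₂ hraw.2 hx.2, ih₁ hraw.1 hx.1]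
  | ifz e c₁ c₂ ih₁ ih₂ =>
    simp only [NoRaw, Bool.and_eq_true] at hraw
    simp only [writesR, List.mem_append, not_or] at hx
    simp only [exec]
    split_ifs
    · exact ih₁ hraw.1 hx.1 σ
    · exact ih₂ hraw.2 hx.2 σ
  | ifle a b c₁ c₂ ih₁ ih₂ =>
    simp only [NoRaw, Bool.and_eq_true] at hraw
    simp only [writesR, List.mem_append, not_or] at hx
    simp only [exec]
    split_ifs
    · exact ih₁ hraw.1 hx.1 σ
    · exact ih₂ hraw.2 hx.2 σ
  | loop v b c ih =>
    simp only [NoRaw] at hraw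
    simp only [writesR] at hx
    exact rounds_induct (Q := fun τ => τ.R x = σ.R x) rfl
      (fun τ m h => h) (fun τ h => by rw [ih hraw hx, h]) _
  | _ => rfl

/-! ### Random choices -/

theorem average_le {M : ℕ} {F : ℕ → ℝ≥0∞} {y : ℝ≥0∞} (h : ∀ m ≤ M, F m ≤ y) :
    (∑ m ∈ Finset.range (M + 1), F m) / ((M : ℝ≥0∞) + 1) ≤ y := by
  refine ENNReal.div_le_of_le_mul ?_
  calc ∑ m ∈ Finset.range (M + 1), F m ≤ ∑ m ∈ Finset.range (M + 1), y :=
        Finset.sum_le_sum fun m hm => h m (by simpa [Nat.lt_succ_iff] using hm)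
    _ = y * ((M : ℝ≥0∞) + 1) := by simp [mul_comm]

/-- An upper bound for the failure probability if the success probability is at least `θ`. -/
def fail (θ : ℝ) : ℝ≥0∞ := ENNReal.ofReal (1 - θ)

theorem fail_anti {θ θ' : ℝ} (h : θ ≤ θ') : fail θ' ≤ fail θ :=
  ENNReal.ofReal_le_ofReal (by linarith)

theorem fail_le_one {θ : ℝ} (h : 0 ≤ θ) : fail θ ≤ 1 := by
  rw [← ENNReal.ofReal_one]
  exact ENNReal.ofReal_le_ofReal (by linarith)

/-- A choice from `S` has probability at least `β`, and leaves a success probability of at least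
`θ`; any other choice is charged with certain failure. All success bounds below arise from this by
multiplication. -/
theorem average_le_fail {M : ℕ} {F : ℕ → ℝ≥0∞} {β θ : ℝ} (S : Finset ℕ) (hS : ∀ m ∈ S, m ≤ M)
    (hθ : 0 ≤ θ) (hθ1 : θ ≤ 1)
    (hcard : β * ((M : ℝ) + 1) ≤ S.card) (h1 : ∀ m ≤ M, F m ≤ 1) (hF : ∀ m ∈ S, F m ≤ fail θ) :
    (∑ m ∈ Finset.range (M + 1), F m) / ((M : ℝ≥0∞) + 1) ≤ fail (β * θ) := by
  classical
  refine ENNReal.div_le_of_le_mul ?_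
  have hsub : S ⊆ Finset.range (M + 1) := fun m hm => by
    have := hS m hm
    simp; omega
  have h2 : ∑ m ∈ Finset.range (M + 1), F m ≤
      ENNReal.ofReal (∑ m ∈ Finset.range (M + 1), if m ∈ S then 1 - θ else 1) := by
    rw [ENNReal.ofReal_sum_of_nonneg (fun m _ => by split_ifs <;> linarith)]
    refine Finset.sum_le_sum fun m hm => ?_
    split_ifs with hmS
    · exact hF m hmS
    · simpa using h1 m (by simpa [Nat.lt_succ_iff] using hm)
  refine h2.trans ?_
  have h3 : ((M : ℝ≥0∞) + 1) = ENNReal.ofReal ((M : ℝ) + 1) := by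
    rw [ENNReal.ofReal_add (by positivity) zero_le_one]
    simp
  rw [h3, fail, ← ENNReal.ofReal_mul' (by positivity)]
  refine ENNReal.ofReal_le_ofReal ?_
  have h4 : ∀ m, (if m ∈ S then 1 - θ else 1) = 1 - θ * (if m ∈ S then 1 else 0) := by
    intro m
    split_ifs <;> ring
  simp only [h4, Finset.sum_sub_distrib, ← Finset.mul_sum, Finset.sum_ite_mem,
    Finset.inter_eq_right.2 hsub]
  simp
  nlinarith

end

section

/-! ### Capacitated assignment by pushing and relabelling -/

/-- The number of points that are assigned to `q`. -/
def load (n : ℕ) (a : ℕ → ℕ) (q : ℕ) : ℕ := ((Finset.range n).filter fun i => a i = q).card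

theorem load_le (n : ℕ) (a : ℕ → ℕ) (q : ℕ) : load n a q ≤ n :=
  (Finset.card_filter_le _ _).trans (by simp)

theorem sum_load (n : ℕ) (a : ℕ → ℕ) (X : Finset ℕ) :
    ∑ q ∈ X, load n a q = ((Finset.range n).filter fun i => a i ∈ X).card := by
  classical
  rw [Finset.card_eq_sum_card_fiberwise (f := a) (t := X) (fun i hi => by
    simp only [Finset.coe_filter, Set.mem_ofPred_eq] at hi
    exact hi.2)]
  refine Finset.sum_congr rfl fun q hq => ?_
  rw [load, Finset.filter_filter]
  congr 1
  ext i
  simp only [Finset.mem_filter, and_congr_right_iff]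
  rintro _
  constructor
  · rintro rfl
    exact ⟨hq, rfl⟩
  · exact fun h => h.2

theorem load_update {n : ℕ} {a : ℕ → ℕ} {i q : ℕ} (hi : i < n) (h : a i ≠ q) :
    load n (Function.update a i q) q = load n a q + 1 ∧
      load n (Function.update a i q) (a i) + 1 = load n a (a i) ∧
      ∀ r, r ≠ q → r ≠ a i → load n (Function.update a i q) r = load n a r := by
  classical
  -- Away from `i` nothing changes, so loads are compared after erasing `i`.
  have key : ∀ r, ((Finset.range n).filter fun j => Function.update a i q j = r).erase i =
      ((Finset.range n).filter fun j => a j = r).erase i := by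
    intro r
    ext j
    simp only [Finset.mem_erase, Finset.mem_filter, and_congr_right_iff]
    intro hj _
    rw [Function.update_of_ne hj]
  refine ⟨?_, ?_, fun r hq ha => ?_⟩
  · unfold load
    rw [← Finset.card_erase_add_one (a := i) (by simp [hi]), key, Finset.erase_eq_of_notMem]
    simp [h]
  · unfold load
    rw [← Finset.card_erase_add_one (s := (Finset.range n).filter fun j => a j = a i) (a := i)
      (by simp [hi]), ← key, Finset.erase_eq_of_notMem]
    simp [h.symm]
  · unfold load
    rw [← Finset.erase_eq_of_notMem (s := (Finset.range n).filter fun j => a j = r) (a := i),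
      ← key, Finset.erase_eq_of_notMem]
    · simp [hq.symm]
    · simp [ha.symm]

/-- The points are assigned to balls that cover them, labels decrease by at most one from the ball
of a point to another ball that covers it, and a ball with a positive label is full. -/
structure FlowInv (n k cap : ℕ) (Cov : ℕ → ℕ → Prop) (a l : ℕ → ℕ) : Prop where
  lt : ∀ i < n, a i < k
  cov : ∀ i < n, Cov i (a i)
  label : ∀ i < n, ∀ q < k, Cov i q → l (a i) ≤ l q + 1
  full : ∀ q < k, 0 < l q → cap ≤ load n a q

/-- Point `i` can be pushed from its overloaded ball to `q`, whose label is one less. -/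
def Adm (n cap : ℕ) (Cov : ℕ → ℕ → Prop) (a l : ℕ → ℕ) (i q : ℕ) : Prop :=
  Cov i q ∧ l q + 1 = l (a i) ∧ cap < load n a (a i)

variable {n k cap : ℕ} {Cov : ℕ → ℕ → Prop} {a l : ℕ → ℕ}

/-- The point moves to a label that is lower by one, so its label condition only gets easier; its
old ball was above the capacity and hence stays full. -/
theorem FlowInv.push (h : FlowInv n k cap Cov a l) {i q : ℕ} (hi : i < n) (hq : q < k)
    (hA : Adm n cap Cov a l i q) : FlowInv n k cap Cov (Function.update a i q) l := by
  have hne : a i ≠ q := by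
    rintro rfl
    have := hA.2.1
    omega
  obtain ⟨e1, e2, e3⟩ := load_update hi hne
  refine ⟨fun j hj => ?_, fun j hj => ?_, fun j hj r hr hc => ?_, fun r hr hl => ?_⟩
  · by_cases hij : j = i
    · simpa [hij] using hq
    · simpa [hij] using h.lt j hj
  · by_cases hij : j = i
    · simpa [hij] using hA.1
    · simpa [hij] using h.cov j hj
  · by_cases hij : j = i
    · subst hij
      have := h.label j hj r hr hc
      have := hA.2.1
      simp
      omega
    · simpa [hij] using h.label j hj r hr hc
  · have := h.full r hr hl
    by_cases h1 : r = q
    · subst h1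
      omega
    · by_cases h2 : r = a i
      · subst h2
        have := hA.2.2
        omega
      · rwa [e3 r h1 h2]

/-- The state of a sweep over all points and balls, before `i` and `q` are visited: no push is
possible from a label above `M`, and none from the label `M` among the pairs visited so far; if
there was no push so far, then no push is possible among these pairs. -/
structure SweepInv (n k cap : ℕ) (Cov : ℕ → ℕ → Prop) (a₀ l : ℕ → ℕ) (M i q : ℕ) (a : ℕ → ℕ)
    (moved : ℕ) : Prop where
  flow : FlowInv n k cap Cov a l
  le : ∀ i' < n, ∀ q' < k, Adm n cap Cov a l i' q' → l (a i') ≤ M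
  lt : ∀ i' < n, ∀ q' < k, i' < i ∨ i' = i ∧ q' < q → Adm n cap Cov a l i' q' → l (a i') < M
  still : moved = 0 → ∀ i' < n, ∀ q' < k, i' < i ∨ i' = i ∧ q' < q → ¬ Adm n cap Cov a l i' q'
  pos : moved ≠ 0 → 1 ≤ M
  done : (∀ r < k, load n a₀ r ≤ cap) → ∀ r < k, load n a r ≤ cap

/-- A push leads down by one label from a label at most `M`, so the only points that newly become
pushable are in the receiving ball, whose label is below `M`. The pair just visited cannot be
admissible at the label `M` any more. -/
theorem SweepInv.push {a₀ : ℕ → ℕ} {M i q moved : ℕ} (h : SweepInv n k cap Cov a₀ l M i q a moved)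
    (hi : i < n) (hq : q < k) (hA : Adm n cap Cov a l i q) :
    SweepInv n k cap Cov a₀ l M i (q + 1) (Function.update a i q) 1 := by
  have hne : a i ≠ q := by
    rintro rfl
    have := hA.2.1
    omega
  obtain ⟨e1, e2, e3⟩ := load_update hi hne
  have hM := h.le i hi q hq hA
  have hl := hA.2.1
  have back : ∀ i' < n, ∀ q' < k, Adm n cap Cov (Function.update a i q) l i' q' →
      l (Function.update a i q i') < M ∨
        i' ≠ i ∧ Function.update a i q i' = a i' ∧ Adm n cap Cov a l i' q' := by
    rintro i' hi' q' hq' ⟨h1, h2, h3⟩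
    by_cases hii : i' = i
    · left
      subst hii
      simp only [Function.update_self]
      omega
    · rw [Function.update_of_ne hii] at h2 h3 ⊢
      by_cases haq : a i' = q
      · left
        rw [haq]
        omega
      · refine .inr ⟨hii, rfl, h1, h2, ?_⟩
        by_cases haa : a i' = a i
        · rw [haa] at h3 ⊢
          omega
        · rwa [e3 _ haq haa] at h3
  refine ⟨h.flow.push hi hq hA, fun i' hi' q' hq' hA' => ?_, fun i' hi' q' hq' hb hA' => ?_,
    fun h0 => absurd h0 one_ne_zero, fun _ => by omega, fun hd => ?_⟩
  · obtain h1 | ⟨h1, h2, h3⟩ := back i' hi' q' hq' hA'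
    · exact h1.le
    · rw [h2]
      exact h.le i' hi' q' hq' h3
  · obtain h1 | ⟨h1, h2, h3⟩ := back i' hi' q' hq' hA'
    · exact h1
    · rw [h2]
      exact h.lt i' hi' q' hq' (.inl (by omega)) h3
  · exact absurd hA.2.2 (not_lt.2 (h.done hd _ (h.flow.lt i hi)))

theorem SweepInv.skip {a₀ : ℕ → ℕ} {M i q moved : ℕ} (h : SweepInv n k cap Cov a₀ l M i q a moved)
    (hA : ¬ Adm n cap Cov a l i q) : SweepInv n k cap Cov a₀ l M i (q + 1) a moved := by
  refine ⟨h.flow, h.le, fun i' hi' q' hq' hb hA' => ?_, fun h0 i' hi' q' hq' hb hA' => ?_, h.pos,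
    h.done⟩
  · by_cases heq : i' = i ∧ q' = q
    · rw [heq.1, heq.2] at hA'
      exact absurd hA' hA
    · exact h.lt i' hi' q' hq' (by omega) hA'
  · by_cases heq : i' = i ∧ q' = q
    · rw [heq.1, heq.2] at hA'
      exact absurd hA' hA
    · exact h.still h0 i' hi' q' hq' (by omega) hA'

theorem SweepInv.next {a₀ : ℕ → ℕ} {M i moved : ℕ} (h : SweepInv n k cap Cov a₀ l M i k a moved) :
    SweepInv n k cap Cov a₀ l M (i + 1) 0 a moved :=
  ⟨h.flow, h.le, fun i' hi' q' hq' hb => h.lt i' hi' q' hq' (by omega),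
    fun h0 i' hi' q' hq' hb => h.still h0 i' hi' q' hq' (by omega), h.pos, h.done⟩

/-- If no push is possible then the label never drops from an overloaded ball to another ball that
covers one of its points, so raising it by one keeps the drop within one. -/
theorem FlowInv.relabel (h : FlowInv n k cap Cov a l)
    (hA : ∀ i < n, ∀ q < k, ¬ Adm n cap Cov a l i q) {l' : ℕ → ℕ}
    (hl' : ∀ q < k, l' q = if cap < load n a q then l q + 1 else l q) :
    FlowInv n k cap Cov a l' := by
  refine ⟨h.lt, h.cov, fun i hi q hq hc => ?_, fun q hq h0 => ?_⟩
  · have h1 := h.label i hi q hq hc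
    have h2 := hA i hi q hq
    rw [hl' _ (h.lt i hi), hl' q hq]
    have h3 : cap < load n a (a i) → l (a i) ≤ l q := fun h3 => by
      by_contra h4
      exact h2 ⟨hc, by omega, h3⟩
    split_ifs with h4 h5 h5
    · have := h3 h4; omega
    · have := h3 h4; omega
    · omega
    · omega
  · rw [hl' q hq] at h0
    split_ifs at h0 with h1
    · omega
    · exact h.full q hq h0

/-- There is an assignment that respects the capacities. -/
def Feasible (n k cap : ℕ) (Cov : ℕ → ℕ → Prop) : Prop :=
  ∃ b : ℕ → ℕ, (∀ i < n, b i < k ∧ Cov i (b i)) ∧ ∀ q < k, load n b q ≤ cap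

/-- A gap argument. If an overloaded ball has a label of at least `k`, then some value `m < k` is
not a label. A point in a ball with label above `m` can only be covered by balls with labels at
least `m`, hence above `m`. So a feasible assignment puts at least as many points into these balls;
but they are all full, and one of them is overloaded. -/
theorem FlowInv.label_lt (h : FlowInv n k cap Cov a l) (hf : Feasible n k cap Cov) {q₀ : ℕ}
    (hq₀ : q₀ < k) (hover : cap < load n a q₀) : l q₀ < k := by
  classical
  obtain ⟨b, hb, hbcap⟩ := hf
  by_contra hk
  obtain ⟨m, hm, hmiss⟩ : ∃ m < k, ∀ q < k, l q ≠ m := by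
    by_contra hcon
    push Not at hcon
    have : Finset.range k ⊆ ((Finset.range k).erase q₀).image l := by
      intro m hm
      obtain ⟨q, hq, rfl⟩ := hcon m (by simpa using hm)
      refine Finset.mem_image_of_mem _ (Finset.mem_erase.2 ⟨?_, by simpa using hq⟩)
      rintro rfl
      simp at hm
      omega
    have h1 := (Finset.card_le_card this).trans Finset.card_image_le
    rw [Finset.card_erase_of_mem (by simpa using hq₀)] at h1
    simp at h1
    omega
  set X := (Finset.range k).filter fun q => m < l q with hX
  have hle : ∑ q ∈ X, load n a q ≤ ∑ q ∈ X, load n b q := by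
    rw [sum_load, sum_load]
    refine Finset.card_le_card fun i hi => ?_
    simp only [hX, Finset.mem_filter, Finset.mem_range] at hi ⊢
    have h1 := h.label i hi.1 (b i) (hb i hi.1).1 (hb i hi.1).2
    have h2 := hmiss (b i) (hb i hi.1).1
    exact ⟨hi.1, (hb i hi.1).1, by omega⟩
  have hlt : ∑ q ∈ X, load n b q < ∑ q ∈ X, load n a q := by
    refine Finset.sum_lt_sum (fun q hq => ?_) ⟨q₀, ?_, ?_⟩
    · simp only [hX, Finset.mem_filter, Finset.mem_range] at hq
      exact (hbcap q hq.1).trans (h.full q hq.1 (by omega))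
    · simp only [hX, Finset.mem_filter, Finset.mem_range]
      exact ⟨hq₀, by omega⟩
    · exact (hbcap q₀ hq₀).trans_lt hover
  omega

/-- The progress after `t` sweeps. -/
def Progress (n k cap : ℕ) (Cov : ℕ → ℕ → Prop) (a l : ℕ → ℕ) (t : ℕ) : Prop :=
  (∀ q < k, load n a q ≤ cap) ∨ ∃ M ≤ k, (∀ q < k, l q ≤ k) ∧
    (∀ i < n, ∀ q < k, Adm n cap Cov a l i q → l (a i) ≤ M) ∧
    -- A sweep with a push lowers `M`. A relabelling may reset `M` to `k`, a loss of at most `k`,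
    -- but raises the sum of the labels; hence the weight `k + 1`.
    t ≤ (k + 1) * (∑ q ∈ Finset.range k, l q) + (k - M)

theorem Progress.le_of_lt {t : ℕ} (h : Progress n k cap Cov a l t) (ht : (k + 1) * (k * k) + k < t) :
    ∀ q < k, load n a q ≤ cap := by
  obtain h | ⟨M, _, hl, _, h2⟩ := h
  · exact h
  · exfalso
    have : ∑ q ∈ Finset.range k, l q ≤ k * k := by
      calc ∑ q ∈ Finset.range k, l q ≤ ∑ q ∈ Finset.range k, k :=
            Finset.sum_le_sum fun q hq => hl q (by simpa using hq)
        _ = k * k := by simp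
    have := Nat.mul_le_mul_left (k + 1) this
    omega

/-- After a complete sweep all pairs have been visited, so no push from the label `M` is left. -/
theorem Progress.of_moved {a₀ : ℕ → ℕ} {t moved : ℕ} (hmoved : moved ≠ 0) (h : Progress n k cap Cov a₀ l t)
    (hs : ∀ M, (∀ i < n, ∀ q < k, Adm n cap Cov a₀ l i q → l (a₀ i) ≤ M) →
      SweepInv n k cap Cov a₀ l M n 0 a moved) : Progress n k cap Cov a l (t + 1) := by
  obtain h | ⟨M, hMk, hl, hM, ht⟩ := h
  · left
    have h0 : ∀ i < n, a₀ i < k → ∀ q, ¬ Adm n cap Cov a₀ l i q := fun i hi hik q hA =>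
      absurd hA.2.2 (not_lt.2 (h _ hik))
    by_cases hex : ∃ M, ∀ i < n, ∀ q < k, Adm n cap Cov a₀ l i q → l (a₀ i) ≤ M
    · obtain ⟨M, hM⟩ := hex
      exact (hs M hM).done h
    · exact absurd ⟨∑ i ∈ Finset.range n, l (a₀ i), fun i hi q _ _ =>
        Finset.single_le_sum (f := fun i => l (a₀ i)) (fun _ _ => Nat.zero_le _)
          (by simpa using hi)⟩ hex
  · right
    have h := hs M hM
    have h1 := h.pos hmoved
    refine ⟨M - 1, by omega, hl, fun i hi q hq hA => ?_, by omega⟩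
    have := h.lt i hi q hq (.inl hi) hA
    omega

/-- A sweep without a push leaves no admissible pair. Either all loads are within the capacity, or
some overloaded ball is raised; `FlowInv.label_lt` keeps the labels at most `k`. -/
theorem Progress.of_relabel {a₀ : ℕ → ℕ} {t : ℕ} (h : Progress n k cap Cov a₀ l t)
    (hf : Feasible n k cap Cov) (hs : ∃ M, SweepInv n k cap Cov a₀ l M n 0 a 0) {l' : ℕ → ℕ}
    (hl' : ∀ q < k, l' q = if cap < load n a q then l q + 1 else l q) :
    Progress n k cap Cov a l' (t + 1) := by
  obtain ⟨M', hs⟩ := hs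
  by_cases hd : ∀ q < k, load n a q ≤ cap
  · exact .inl hd
  obtain h | ⟨M, hMk, hl, hM, ht⟩ := h
  · exact absurd (hs.done h) hd
  · right
    push Not at hd
    obtain ⟨q₀, hq₀, hover⟩ := hd
    have hk : ∀ q < k, l' q ≤ k := by
      intro q hq
      rw [hl' q hq]
      split_ifs with h1
      · exact hs.flow.label_lt hf hq h1
      · exact hl q hq
    have hsum : ∑ q ∈ Finset.range k, l q < ∑ q ∈ Finset.range k, l' q := by
      refine Finset.sum_lt_sum (fun q hq => ?_) ⟨q₀, by simpa using hq₀, ?_⟩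
      · rw [hl' q (by simpa using hq)]
        split_ifs <;> omega
      · rw [hl' q₀ hq₀, if_pos hover]
        omega
    refine ⟨k, le_rfl, hk, fun i hi q _ _ => hk _ (hs.flow.lt i hi), ?_⟩
    have := Nat.mul_le_mul_left (k + 1) hsum
    simp only [Nat.mul_add, Nat.succ_eq_add_one] at this
    omega

end

section

open scoped ENNReal

variable {I : ℕ → ℝ}

/-! ### The program -/

/-! Names of natural numbers: the parameters, loop variables, random choices, and the rest. -/
notation "Nn" => (0 : ℕ)
notation "Nd" => (1 : ℕ)
notation "Nk" => (2 : ℕ)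
notation "NU" => (3 : ℕ)
notation "NK" => (4 : ℕ)
notation "NL" => (5 : ℕ)
notation "Nk2" => (6 : ℕ)
notation "Nf" => (7 : ℕ)
notation "NkK" => (8 : ℕ)
notation "Nrow" => (9 : ℕ)
notation "Ncap" => (10 : ℕ)
notation "Nacc" => (11 : ℕ)
notation "Va" => (12 : ℕ)
notation "Vb" => (13 : ℕ)
notation "Vtr" => (14 : ℕ)
notation "Vt" => (15 : ℕ)
notation "Vi" => (16 : ℕ)
notation "Vq" => (17 : ℕ)
notation "Vj" => (18 : ℕ)
notation "Vit" => (19 : ℕ)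
notation "Vr" => (20 : ℕ)
notation "Nx" => (21 : ℕ)
notation "Ns" => (22 : ℕ)
notation "Np" => (23 : ℕ)
notation "Nq" => (24 : ℕ)
notation "Nu" => (25 : ℕ)
notation "Nany" => (26 : ℕ)
notation "Nasg" => (27 : ℕ)
notation "Nload" => (28 : ℕ)
notation "Nlab" => (29 : ℕ)
notation "Nmoved" => (30 : ℕ)
notation "Nok" => (31 : ℕ)
notation "Nhave" => (32 : ℕ)
notation "Nbest" => (33 : ℕ)

/-! Names of reals. -/
notation "Reps" => (0 : ℕ)
notation "Rg" => (1 : ℕ)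
notation "Rrad" => (2 : ℕ)
notation "Rsq" => (3 : ℕ)
notation "RT" => (4 : ℕ)
notation "RC" => (5 : ℕ)
notation "Rz" => (6 : ℕ)
notation "RoC" => (7 : ℕ)
notation "RoR" => (8 : ℕ)
notation "Rcost" => (9 : ℕ)
notation "Rbcost" => (10 : ℕ)
notation "RbC" => (11 : ℕ)
notation "RbR" => (12 : ℕ)
notation "Rmx" => (13 : ℕ)

infixr:50 " ;; " => Cmd.seq

/-- The scalar `x`. -/
abbrev nv (x : ℕ) : NExpr := .get x (.const 0)

/-- The real scalar `x`. -/
abbrev rv (x : ℕ) : RExpr := .get x (.const 0)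

/-- Entry `q * d + j` of a matrix of reals, for the values of two scalars. -/
abbrev entry (x vq : ℕ) : RExpr := .get x (.add (.get Nrow (nv vq)) (nv Vj))

/-- Coordinate `j` of input point `i`, for the value of a scalar `i`. -/
abbrev coord (vi : ℕ) : RExpr := .inp (.add (.get Nrow (nv vi)) (nv Vj))

/-- The squared distance of two points whose coordinates are given for the scalar `Vj`. -/
def sqDist (x y : RExpr) : Cmd :=
  .setR Rz (.const 0) (.nat (.const 0)) ;;
  .loop Vj Nd (.setR Rz (.const 0) (.add (rv Rz) (.mul (.sub x y) (.sub x y))))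

/-- Assign every point to a ball that contains it, and find the first uncovered point. -/
def coverage : Cmd :=
  .setN Nu (.const 0) (nv Nn) ;;
  .loop Vi Nn (
    .setN Nany (.const 0) (.const 0) ;;
    .loop Vq Nk (
      sqDist (coord Vi) (entry RC Vq) ;;
      .ifle (rv Rz) (.get Rsq (nv Vq))
        (.setN Nany (.const 0) (.const 1) ;; .setN Nasg (nv Vi) (nv Vq)) .skip) ;;
    -- The sum vanishes iff no ball covers the point and `Nu` still has its initial value `n`.
    .ifz (.add (nv Nany) (.sub (nv Nn) (nv Nu))) (.setN Nu (.const 0) (nv Vi)) .skip)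

/-- Initialize the loads and the labels. -/
def flowInit : Cmd :=
  .loop Vq Nk (.setN Nload (nv Vq) (.const 0) ;; .setN Nlab (nv Vq) (.const 0)) ;;
  .loop Vi Nn (.setN Nload (.get Nasg (nv Vi)) (.add (.get Nload (.get Nasg (nv Vi))) (.const 1)))

/-- Push point `i` to ball `q` if this is admissible. -/
def visit : Cmd :=
  sqDist (coord Vi) (entry RC Vq) ;;
  .ifle (rv Rz) (.get Rsq (nv Vq))
    -- A sum of truncated differences vanishes iff all of them do: the first two say that the labels
    -- differ by exactly one, the third that the ball of the point is overloaded.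
    (.ifz (.add (.add (.sub (.add (.get Nlab (nv Vq)) (.const 1)) (.get Nlab (.get Nasg (nv Vi))))
          (.sub (.get Nlab (.get Nasg (nv Vi))) (.add (.get Nlab (nv Vq)) (.const 1))))
        (.sub (.add (nv Ncap) (.const 1)) (.get Nload (.get Nasg (nv Vi)))))
      (.setN Nload (.get Nasg (nv Vi)) (.sub (.get Nload (.get Nasg (nv Vi))) (.const 1)) ;;
        .setN Nasg (nv Vi) (nv Vq) ;;
        .setN Nload (nv Vq) (.add (.get Nload (nv Vq)) (.const 1)) ;;
        .setN Nmoved (.const 0) (.const 1)) .skip) .skip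

/-- Increase the labels of all overloaded balls. -/
def relabel : Cmd :=
  .loop Vq Nk (.ifz (.sub (.add (nv Ncap) (.const 1)) (.get Nload (nv Vq)))
    (.setN Nlab (nv Vq) (.add (.get Nlab (nv Vq)) (.const 1))) .skip)

/-- Push points from overloaded balls to other balls. -/
def flow : Cmd :=
  flowInit ;;
  .loop Vit Nf (
    .setN Nmoved (.const 0) (.const 0) ;;
    .loop Vi Nn (.loop Vq Nk visit) ;;
    .ifz (nv Nmoved) relabel .skip)

/-- The factor `1 + 1 / K`. -/
abbrev growth : RExpr := .add (.nat (.const 1)) (.div (.nat (.const 1)) (.nat (nv NK)))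

/-- The displacement `s * q * (g / (K * f * k * k))` of the center of ball `q`. -/
abbrev shift : RExpr :=
  .mul (.mul (.nat (nv Ns)) (.nat (nv Vq)))
    (.div (rv Rg) (.mul (.mul (.nat (nv NK)) (.nat (nv Nf))) (.mul (.nat (nv Nk)) (.nat (nv Nk)))))

/-- Compute the displaced first coordinates, the radii and the cost. -/
def displace : Cmd :=
  .setR Rcost (.const 0) (.nat (.const 0)) ;;
  .loop Vq Nk (
    .setR RoC (nv Vq) (.add (.get RC (.get Nrow (nv Vq))) shift) ;;
    .setR RoR (nv Vq) (.add (.mul growth (.get Rrad (nv Vq))) shift) ;;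
    .setR Rcost (.const 0) (.add (rv Rcost) (.get RoR (nv Vq))))

/-- Check the loads, and that the displaced first coordinates are distinct. -/
def verify : Cmd :=
  .setN Nok (.const 0) (.const 1) ;;
  .loop Vq Nk (
    .ifz (.sub (.get Nload (nv Vq)) (nv Ncap)) .skip (.setN Nok (.const 0) (.const 0)) ;;
    -- Only pairs with `q < r` are compared, and equality is tested by two comparisons.
    .loop Vr Nk (.ifz (.sub (.add (nv Vq) (.const 1)) (nv Vr))
      (.ifle (.get RoC (nv Vq)) (.get RoC (nv Vr))
        (.ifle (.get RoC (nv Vr)) (.get RoC (nv Vq)) (.setN Nok (.const 0) (.const 0)) .skip) .skip)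
      .skip))

/-- Store the current solution. -/
def record : Cmd :=
  .setN Nhave (.const 0) (.const 1) ;;
  .setR Rbcost (.const 0) (rv Rcost) ;;
  .loop Vq Nk (
    .loop Vj Nd (.setR RbC (.add (.get Nrow (nv Vq)) (nv Vj)) (entry RC Vq)) ;;
    .setR RbC (.get Nrow (nv Vq)) (.get RoC (nv Vq)) ;;
    .setR RbR (nv Vq) (.get RoR (nv Vq))) ;;
  .loop Vi Nn (.setN Nbest (nv Vi) (.get Nasg (nv Vi)))

/-- Store the current solution if it is valid and better than the best one so far. -/
def attempt : Cmd :=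
  displace ;; verify ;;
  .ifz (.sub (.const 1) (nv Nok))
    (.ifz (nv Nhave) record (.ifle (rv Rbcost) (rv Rcost) .skip record)) .skip

/-- Move the center of the chosen ball towards the chosen point, or towards the first uncovered
point if there is one. -/
def update : Cmd :=
  .ifz (.sub (nv Nn) (nv Nu)) .skip (.setN Np (.const 0) (nv Nu)) ;;
  .loop Vj Nd (.setR RC (.add (.get Nrow (nv Nq)) (nv Vj))
    (.add (entry RC Nq) (.mul (.get RT (nv Nq)) (.sub (coord Np) (entry RC Nq))))) ;;
  -- The factor is `1` before the first move, which thus jumps onto the chosen point, and `1 / (2 *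
  -- K)` afterwards.
  .setR RT (nv Nq) (.div (.nat (.const 1)) (.nat (.add (nv NK) (nv NK)))) ;;
  .setR Rsq (nv Nq) (.mul (.mul growth (.get Rrad (nv Nq))) (.mul growth (.get Rrad (nv Nq))))

/-- One step of a trial for given random choices. -/
def body : Cmd :=
  coverage ;; .ifz (.sub (nv Nn) (nv Nu)) (flow ;; attempt) .skip ;; update

/-- All three random choices are made in every step: the displacement for a possible solution, the
point, and the ball that moves. This keeps the rest of a step deterministic. -/
def trialStep : Cmd :=
  .rand Ns (nv Nf) ;; .rand Np (.sub (nv Nn) (.const 1)) ;; .rand Nq (.sub (nv Nk) (.const 1)) ;; body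

/-- The radius of ball `q` for the random choice `Nx`. -/
def setRadius : Cmd :=
  .setR Rrad (nv Vq) (.mul (rv Rg) (.div (.nat (.add (nv Nx) (.const 1))) (.nat (nv NkK)))) ;;
  -- A ball with the squared radius `-1` covers nothing, as is right for a ball without a center.
  .setR Rsq (nv Vq) (.sub (.nat (.const 0)) (.nat (.const 1))) ;;
  .setR RT (nv Vq) (.nat (.const 1))

/-- The number `Nf` of steps is far more than a trial needs; reusing one large number as sweep, step
and trial count saves further parameters. -/
def trial : Cmd :=
  .loop Vq Nk (.rand Nx (nv NkK) ;; setRadius) ;; .loop Vt Nf trialStep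

/-- The distance of the points `a` and `b`. -/
def pairDist : Cmd :=
  sqDist (coord Va) (coord Vb) ;; .setR Rg (.const 0) (.sqrt (rv Rz))

/-- Store a solution of cost zero if there are at most as many points as balls. -/
def singletons : Cmd :=
  .ifz (.sub (nv Nn) (nv Nk)) (.ifz (.sub (.const 1) (nv Ncap))
    (.setR Rmx (.const 0) (.inp (.const 0)) ;;
      .loop Vi Nn (.ifle (rv Rmx) (.inp (.get Nrow (nv Vi)))
        (.setR Rmx (.const 0) (.inp (.get Nrow (nv Vi)))) .skip) ;;
      .loop Vq Nk (
        .loop Vj Nd (.setR RbC (.add (.get Nrow (nv Vq)) (nv Vj)) (coord Vq)) ;;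
        -- The balls without a point are placed beyond the largest first coordinate, at different
        -- distances, to keep the centers distinct.
        .ifz (.sub (nv Nn) (nv Vq))
          (.setR RbC (.get Nrow (nv Vq)) (.add (rv Rmx) (.nat (nv Vq)))) .skip ;;
        .setR RbR (nv Vq) (.nat (.const 0))) ;;
      .loop Vi Nn (.setN Nbest (nv Vi) (nv Vi)) ;;
      .setR Rbcost (.const 0) (.nat (.const 0)) ;;
      .setN Nhave (.const 0) (.const 1)) .skip) .skip

/-- The distance of the pair plays the role of the largest cluster diameter. -/
def search : Cmd :=
  .loop Va Nn (.loop Vb Nn (pairDist ;; .loop Vtr Nf trial))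

/-- Add the scalar `x` to itself. -/
abbrev double (x : ℕ) : Cmd := .setN x (.const 0) (.add (nv x) (nv x))

/-- The parameters `K`, `64 * K` and `max k 2`. -/
def constants : Cmd :=
  double NK ;; double NK ;; double NK ;; double NK ;;
  .setN NL (.const 0) (nv NK) ;;
  double NL ;; double NL ;; double NL ;; double NL ;; double NL ;; double NL ;;
  .ifz (.sub (.const 2) (nv Nk)) (.setN Nk2 (.const 0) (nv Nk)) (.setN Nk2 (.const 0) (.const 2))

/-- Multiply `f` by `max k 2`. -/
def scaleF : Cmd :=
  .setN Nacc (.const 0) (.const 0) ;;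
  .loop Vt Nk2 (.setN Nacc (.const 0) (.add (nv Nacc) (nv Nf))) ;;
  .setN Nf (.const 0) (nv Nacc)

/-- The offsets of the rows of a matrix with `Nd` columns. -/
def setRows (b : ℕ) : Cmd :=
  .setN Nacc (.const 0) (.const 0) ;;
  .loop Vi b (.setN Nrow (nv Vi) (nv Nacc) ;; .setN Nacc (.const 0) (.add (nv Nacc) (nv Nd)))

/-- Without rounding, the integral capacity has to be found by comparisons. The largest candidate
`n` suffices, as no load exceeds `n`. -/
def setCap : Cmd :=
  .setN Ncap (.const 0) (.const 0) ;;
  .loop Vi Nn (.ifle (.nat (.add (nv Vi) (.const 1)))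
    (.mul (.add (.nat (.const 1)) (rv Reps)) (.nat (nv NU)))
    (.setN Ncap (.const 0) (.add (nv Vi) (.const 1))) .skip)

def parameters : Cmd :=
  .setN Nf (.const 0) (.const 1) ;;
  -- With `NL = 64 * K`, this computes `f = max k 2 ^ (k * K * 64 * K)` by additions only.
  .loop Vi Nk (.loop Vj NK (.loop Vq NL scaleF)) ;;
  .setN NkK (.const 0) (.const 0) ;;
  .loop Vi Nk (.setN NkK (.const 0) (.add (nv NkK) (nv NK))) ;;
  setRows Nn ;; setRows Nk ;; setCap

/-- Copy the best solution to contiguous memory behind the cells in use. -/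
def output : Cmd :=
  .setN Nacc (.const 0) (.const 0) ;;
  .loop Vi Nk (.setN Nacc (.const 0) (.add (nv Nacc) (nv Nd))) ;;
  -- `Nx` becomes `64 * (k * (d + 1) + n)`. Together with the offset 64 of raw addresses, the output
  -- lies above every array entry that is copied.
  .setN Nx (.const 0) (.const 0) ;;
  .loop Vi Nk (.loop Vj Nd (.setN Nx (.const 0) (.add (nv Nx) (.const 64))) ;;
    .setN Nx (.const 0) (.add (nv Nx) (.const 64))) ;;
  .loop Vi Nn (.setN Nx (.const 0) (.add (nv Nx) (.const 64))) ;;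
  .loop Vq Nk (.loop Vj Nd (.rawR (.add (nv Nx) (.add (.get Nrow (nv Vq)) (nv Vj))) (entry RbC Vq))) ;;
  .loop Vq Nk (.rawR (.add (nv Nx) (.add (nv Nacc) (nv Vq))) (.get RbR (nv Vq))) ;;
  .loop Vi Nn (.rawN (.add (nv Nx) (nv Vi)) (.get Nbest (nv Vi)))

/-- The addresses of the output. -/
def addresses : Cmd :=
  .setN Nn (.const 0) (.add (nv Nx) (.const 64)) ;;
  .setN Nd (.const 0) (.add (.add (nv Nx) (.const 64)) (nv Nacc)) ;;
  .setN Nk (.const 0) (.add (nv Nx) (.const 64))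

end

section

open scoped ENNReal

variable {I : ℕ → ℝ}

/-! ### Correctness of the deterministic parts -/

@[simp] theorem Mem.setN_N (σ : Mem) (x i v y j : ℕ) :
    (σ.setN x i v).N y j = if y = x ∧ j = i then v else σ.N y j := rfl

@[simp] theorem Mem.setN_R (σ : Mem) (x i v : ℕ) : (σ.setN x i v).R = σ.R := rfl

@[simp] theorem Mem.setR_R (σ : Mem) (x i : ℕ) (v : ℝ) (y j : ℕ) :
    (σ.setR x i v).R y j = if y = x ∧ j = i then v else σ.R y j := rfl

@[simp] theorem Mem.setR_N (σ : Mem) (x i : ℕ) (v : ℝ) : (σ.setR x i v).N = σ.N := rfl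

section exec

variable (σ : Mem)

theorem Cmd.exec_skip : skip.exec I σ = σ := rfl

theorem Cmd.exec_seq (c₁ c₂ : Cmd) : (c₁ ;; c₂).exec I σ = c₂.exec I (c₁.exec I σ) := rfl

theorem Cmd.exec_setN (x : ℕ) (i e : NExpr) :
    (Cmd.setN x i e).exec I σ = σ.setN x (i.eval σ) (e.eval σ) := rfl

theorem Cmd.exec_setR (x : ℕ) (i : NExpr) (e : RExpr) :
    (Cmd.setR x i e).exec I σ = σ.setR x (i.eval σ) (e.eval I σ) := rfl

theorem Cmd.exec_ifz (e : NExpr) (c₁ c₂ : Cmd) : (Cmd.ifz e c₁ c₂).exec I σ =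
    if e.eval σ = 0 then c₁.exec I σ else c₂.exec I σ := rfl

theorem Cmd.exec_ifle (a b : RExpr) (c₁ c₂ : Cmd) : (Cmd.ifle a b c₁ c₂).exec I σ =
    if a.eval I σ ≤ b.eval I σ then c₁.exec I σ else c₂.exec I σ := rfl

end exec

/-- The memories agree except for what the command `s` may write. -/
structure Cmd.Frame (s : Cmd) (σ τ : Mem) : Prop where
  N : ∀ x ∉ s.writesN, τ.N x = σ.N x
  R : ∀ x ∉ s.writesR, τ.R x = σ.R x

theorem Cmd.exec_frame {s : Cmd} (hs : s.NoRaw = true) (σ : Mem) : s.Frame σ (s.exec I σ) :=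
  ⟨fun _ hx => exec_N_of_notMem hs hx σ, fun _ hx => exec_R_of_notMem hs hx σ⟩

/-- A loop rule in which everything that the loop does not write is known not to change. -/
theorem Cmd.exec_loop_frame {v b m : ℕ} {s : Cmd} {σ : Mem} (hs : s.NoRaw = true)
    (hm : σ.N b 0 = m) (P : ℕ → Mem → Prop) (h0 : P 0 (σ.setN v 0 0))
    (hstep : ∀ i < m, ∀ τ, (loop v b s).Frame σ τ → P i τ → τ.N v 0 = i →
      P (i + 1) ((s.exec I τ).setN v 0 (i + 1))) :
    P m ((loop v b s).exec I σ) := by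
  have set_frame : ∀ τ i, (loop v b s).Frame σ τ → (loop v b s).Frame σ (τ.setN v 0 i) := by
    intro τ i h
    refine ⟨fun x hx => ?_, h.R⟩
    rw [← h.N x hx]
    simp only [writesN, List.mem_cons, not_or] at hx
    funext j
    simp [hx.1]
  refine (exec_loop hm (fun i τ => (loop v b s).Frame σ τ ∧ P i τ)
    ⟨set_frame _ _ ⟨fun _ _ => rfl, fun _ _ => rfl⟩, h0⟩ ?_).2
  rintro i hi τ ⟨h1, h2⟩ h3
  refine ⟨set_frame _ _ ⟨fun x hx => ?_, fun x hx => ?_⟩, hstep i hi τ h1 h2 h3⟩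
  · rw [← h1.N x hx]
    simp only [writesN, List.mem_cons, not_or] at hx
    exact exec_N_of_notMem hs hx.2 τ
  · rw [← h1.R x hx]
    exact exec_R_of_notMem hs hx τ

/-- The parameters. -/
structure Par (n d k K f cap : ℕ) (σ : Mem) : Prop where
  hn : σ.N Nn 0 = n
  hd : σ.N Nd 0 = d
  hk : σ.N Nk 0 = k
  hK : σ.N NK 0 = K
  hf : σ.N Nf 0 = f
  hkK : σ.N NkK 0 = k * K
  hcap : σ.N Ncap 0 = cap
  row : ∀ i, i < n ∨ i < k → σ.N Nrow i = i * d

variable {n d k K f cap : ℕ}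

theorem Par.of_eq {σ τ : Mem} (h : Par n d k K f cap σ) (hN : ∀ x < 12, τ.N x = σ.N x) :
    Par n d k K f cap τ :=
  ⟨by rw [hN _ (by norm_num), h.hn], by rw [hN _ (by norm_num), h.hd], by rw [hN _ (by norm_num), h.hk],
    by rw [hN _ (by norm_num), h.hK], by rw [hN _ (by norm_num), h.hf],
    by rw [hN _ (by norm_num), h.hkK], by rw [hN _ (by norm_num), h.hcap],
    by rw [hN _ (by norm_num)]; exact h.row⟩

theorem Par.frame {s : Cmd} {σ τ : Mem} (h : Par n d k K f cap σ) (hf : s.Frame σ τ)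
    (hs : ∀ x < 12, x ∉ s.writesN := by decide) : Par n d k K f cap τ :=
  h.of_eq fun x hx => hf.N x (hs x hx)

/-- The hypotheses allow any content `v` of the accumulator `Rz`, since it changes from round to
round. -/
theorem exec_sqDist {σ : Mem} {x y : RExpr} {X Y : ℕ → ℝ} (hd : σ.N Nd 0 = d)
    (hx : ∀ j < d, ∀ v, x.eval I ((σ.setN Vj 0 j).setR Rz 0 v) = X j)
    (hy : ∀ j < d, ∀ v, y.eval I ((σ.setN Vj 0 j).setR Rz 0 v) = Y j) :
    (sqDist x y).exec I σ =
      (σ.setN Vj 0 d).setR Rz 0 (∑ j ∈ Finset.range d, (X j - Y j) ^ 2) := by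
  refine Cmd.exec_loop (P := fun i τ => τ = (σ.setN Vj 0 i).setR Rz 0
    (∑ j ∈ Finset.range i, (X j - Y j) ^ 2)) (by simpa [Cmd.exec] using hd) ?_ ?_
  · ext <;> simp [Cmd.exec, NExpr.eval, RExpr.eval]
  · rintro i hi _ rfl -
    simp only [Cmd.exec, RExpr.eval, hx i hi, hy i hi, Finset.sum_range_succ]
    ext u v
    · by_cases h1 : u = 18 ∧ v = 0 <;> simp [NExpr.eval, h1]
    · by_cases h1 : u = 6 ∧ v = 0
      · simp [NExpr.eval, h1]; ring
      · simp [NExpr.eval, h1]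

/-- The current ball `q` covers point `i`. -/
def covers (I : ℕ → ℝ) (d : ℕ) (σ : Mem) (i q : ℕ) : Prop :=
  ∑ j ∈ Finset.range d, (I (i * d + j) - σ.R RC (q * d + j)) ^ 2 ≤ σ.R Rsq q

theorem covers_congr {σ τ : Mem} (h₁ : τ.R RC = σ.R RC) (h₂ : τ.R Rsq = σ.R Rsq) :
    covers I d τ = covers I d σ := by
  unfold covers
  rw [h₁, h₂]

theorem exec_sqDist_cover {σ : Mem} (h : Par n d k K f cap σ) {i q : ℕ} (hi : i < n) (hq : q < k)
    (hVi : σ.N Vi 0 = i) (hVq : σ.N Vq 0 = q) :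
    (sqDist (coord Vi) (entry RC Vq)).exec I σ = (σ.setN Vj 0 d).setR Rz 0
      (∑ j ∈ Finset.range d, (I (i * d + j) - σ.R RC (q * d + j)) ^ 2) := by
  refine exec_sqDist h.hd (fun j _ v => ?_) (fun j _ v => ?_)
  · simp [RExpr.eval, NExpr.eval, hVi, h.row i (.inl hi)]
  · simp [RExpr.eval, NExpr.eval, hVq, h.row q (.inr hq)]

theorem exec_coverage {σ : Mem} (h : Par n d k K f cap σ) :
    let τ := coverage.exec I σ
    (τ.N Nu 0 = n ∧ ∀ i < n, τ.N Nasg i < k ∧ covers I d σ i (τ.N Nasg i)) ∨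
      (τ.N Nu 0 < n ∧ (∀ q < k, ¬ covers I d σ (τ.N Nu 0) q) ∧
        ∀ i < τ.N Nu 0, ∃ q < k, covers I d σ i q) := by
  simp only [coverage, Cmd.exec_seq, Cmd.exec_setN]
  set σ₀ := σ.setN Nu ((NExpr.const 0).eval σ) ((nv Nn).eval σ) with hσ₀
  have h₀ : Par n d k K f cap σ₀ := h.of_eq fun x hx => by
    funext j
    have : x ≠ 25 := by omega
    simp [hσ₀, this]
  have hu₀ : σ₀.N Nu 0 = n := by simp [hσ₀, NExpr.eval, h.hn]
  have hR₀ : σ₀.R = σ.R := rfl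
  clear_value σ₀
  refine Cmd.exec_loop_frame (P := fun i τ =>
    (τ.N Nu 0 = n ∧ ∀ i' < i, τ.N Nasg i' < k ∧ covers I d σ i' (τ.N Nasg i')) ∨
      (τ.N Nu 0 < n ∧ (∀ q < k, ¬ covers I d σ (τ.N Nu 0) q) ∧
        ∀ i < τ.N Nu 0, ∃ q < k, covers I d σ i q)) rfl h₀.hn (.inl ?_) ?_
  · simp [hu₀]
  · intro i hi τ hτ hP hVi
    have hp := h₀.frame hτ
    have hRC : τ.R RC = σ.R RC := by rw [hτ.R _ (by decide), hR₀]
    have hRs : τ.R Rsq = σ.R Rsq := by rw [hτ.R _ (by decide), hR₀]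
    simp only [Cmd.exec_seq, Cmd.exec_setN, Cmd.exec_ifz, Cmd.exec_skip]
    set τ₀ := τ.setN Nany ((NExpr.const 0).eval τ) ((NExpr.const 0).eval τ) with hτ₀
    have hp₀ : Par n d k K f cap τ₀ := hp.of_eq fun x hx => by
      funext j
      have : x ≠ 26 := by omega
      simp [hτ₀, this]
    have key := Cmd.exec_loop_frame (I := I) (v := Vq) (b := Nk) (s :=
      sqDist (coord Vi) (entry RC Vq) ;;
      .ifle (rv Rz) (.get Rsq (nv Vq))
        (.setN Nany (.const 0) (.const 1) ;; .setN Nasg (nv Vi) (nv Vq)) .skip) (σ := τ₀) rfl hp₀.hk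
      (fun q ρ => (∀ i' < i, ρ.N Nasg i' = τ.N Nasg i') ∧
        ((ρ.N Nany 0 = 0 ∧ ∀ q' < q, ¬ covers I d σ i q') ∨
          (ρ.N Nany 0 ≠ 0 ∧ ρ.N Nasg i < k ∧ covers I d σ i (ρ.N Nasg i)))) ?_ ?_
    · have hframe := Cmd.exec_frame (I := I) (s := .loop Vq Nk (
        sqDist (coord Vi) (entry RC Vq) ;;
        .ifle (rv Rz) (.get Rsq (nv Vq))
          (.setN Nany (.const 0) (.const 1) ;; .setN Nasg (nv Vi) (nv Vq)) .skip)) rfl τ₀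
      set ρ := Cmd.exec I (.loop Vq Nk _) τ₀ with hρ
      clear_value ρ
      have hn : ρ.N Nn 0 = n := by rw [hframe.N _ (by decide), hp₀.hn]
      have hu : ρ.N Nu 0 = τ.N Nu 0 := by rw [hframe.N _ (by decide)]; simp [hτ₀]
      have hvi : ρ.N Vi 0 = i := by rw [hframe.N _ (by decide)]; simp [hτ₀, hVi]
      obtain ⟨k1, k2⟩ := key
      simp only [NExpr.eval, hn, hu, hvi]
      obtain ⟨e1, e2⟩ | ⟨e1, e2⟩ := hP
      · obtain ⟨g1, g2⟩ | ⟨g1, g2⟩ := k2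
        · right
          rw [if_pos (by omega)]
          simp [hi]
          exact ⟨g2, fun i' hi' => ⟨_, e2 i' hi'⟩⟩
        · left
          rw [if_neg (by omega)]
          simp only [Mem.setN_N]
          refine ⟨by simp [hu, e1], fun i' hi' => ?_⟩
          obtain h' | rfl : i' < i ∨ i' = i := by omega
          · simpa [k1 i' h'] using e2 i' h'
          · simpa using g2
      · right
        rw [if_neg (by omega)]
        simp [hu, e1]
        exact e2
    · simp [hτ₀, NExpr.eval]
    · rintro q hq ρ hρ ⟨hs, hinv⟩ hVq
      have hpρ := hp₀.frame hρ
      have hvi : ρ.N Vi 0 = i := by rw [hρ.N _ (by decide)]; simp [hτ₀, hVi]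
      have hRC' : ρ.R RC = σ.R RC := by rw [hρ.R _ (by decide)]; simp [hτ₀, hRC]
      have hRs' : ρ.R Rsq = σ.R Rsq := by rw [hρ.R _ (by decide)]; simp [hτ₀, hRs]
      simp only [Cmd.exec_seq, Cmd.exec_ifle, Cmd.exec_setN, Cmd.exec_skip, exec_sqDist_cover hpρ hi hq hvi hVq, RExpr.eval, NExpr.eval, Mem.setN_N,
        Mem.setR_N, Mem.setN_R, Mem.setR_R]
      simp only [Nat.reduceEqDiff, false_and, and_true, if_false, if_true, hVq,
        and_self, hRC', hRs', hvi]
      by_cases hc : covers I d σ i q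
      · rw [if_pos (by exact hc)]
        refine ⟨fun i' hi' => ?_, .inr ?_⟩
        · have : i' ≠ i := by omega
          simp [this, hs i' hi']
        · simp [hq, hc]
      · rw [if_neg (by exact hc)]
        refine ⟨fun i' hi' => by simp [hs i' hi'], ?_⟩
        obtain ⟨g1, g2⟩ | g := hinv
        · left
          refine ⟨by simp [g1], fun q' hq' => ?_⟩
          obtain h' | rfl : q' < q ∨ q' = q := by omega
          · exact g2 q' h'
          · exact hc
        · right
          simpa using g

end

/-! ### Correctness of the assignment procedure -/

section

variable {I : ℕ → ℝ} {n d k K f cap : ℕ}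

theorem load_succ (i : ℕ) (a : ℕ → ℕ) (q : ℕ) :
    load (i + 1) a q = load i a q + if a i = q then 1 else 0 := by
  unfold load
  rw [Finset.range_add_one, Finset.filter_insert]
  split_ifs with h
  · rw [Finset.card_insert_of_notMem (by simp)]
  · rfl

/-- The loads of the balls are stored. -/
def Loads (n k : ℕ) (τ : Mem) : Prop := ∀ q < k, τ.N Nload q = load n (τ.N Nasg) q

theorem Loads.of_eq {τ τ' : Mem} (h : Loads n k τ) (h₁ : τ'.N Nload = τ.N Nload)
    (h₂ : τ'.N Nasg = τ.N Nasg) : Loads n k τ' := fun q hq => by rw [h₁, h₂, h q hq]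

theorem exec_flowInit {σ : Mem} (h : Par n d k K f cap σ) :
    Loads n k (flowInit.exec I σ) ∧ ∀ q < k, (flowInit.exec I σ).N Nlab q = 0 := by
  simp only [flowInit, Cmd.exec_seq]
  have h1 := Cmd.exec_loop_frame (I := I) (v := Vq) (b := Nk)
    (s := .setN Nload (nv Vq) (.const 0) ;; .setN Nlab (nv Vq) (.const 0)) (σ := σ) rfl h.hk
    (fun m τ => ∀ q < m, τ.N Nload q = 0 ∧ τ.N Nlab q = 0) (by simp) (by
      intro q hq τ _ hP hVq r hr
      simp only [Cmd.exec_seq, Cmd.exec_setN, NExpr.eval]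
      by_cases hrq : r = q
      · simp [hVq, hrq]
      · simpa [hVq, hrq] using hP r (by omega))
  have f1 := Cmd.exec_frame (I := I) (s := .loop Vq Nk (.setN Nload (nv Vq) (.const 0) ;;
    .setN Nlab (nv Vq) (.const 0))) rfl σ
  set τ := Cmd.exec I (.loop Vq Nk _) σ
  clear_value τ
  have hp := h.frame f1
  have ha : τ.N Nasg = σ.N Nasg := f1.N _ (by decide)
  have h2 := Cmd.exec_loop_frame (I := I) (v := Vi) (b := Nn) (s := .setN Nload (.get Nasg (nv Vi))
    (.add (.get Nload (.get Nasg (nv Vi))) (.const 1))) (σ := τ) rfl hp.hn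
    (fun m ρ => ∀ q < k, ρ.N Nload q = load m (σ.N Nasg) q)
    (by simpa [load] using fun q hq => (h1 q hq).1) (by
      intro i hi ρ hρ hP hVi q hq
      have e : ρ.N Nasg = σ.N Nasg := by rw [hρ.N _ (by decide), ha]
      rw [load_succ]
      have := hP q hq
      by_cases hqi : q = σ.N Nasg i
      · simp [Cmd.exec_setN, NExpr.eval, hVi, e, ← hqi, this]
      · simp [Cmd.exec_setN, NExpr.eval, hVi, e, hqi, this, Ne.symm hqi])
  have f2 := Cmd.exec_frame (I := I) (s := .loop Vi Nn (.setN Nload (.get Nasg (nv Vi))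
    (.add (.get Nload (.get Nasg (nv Vi))) (.const 1)))) rfl τ
  refine ⟨fun q hq => ?_, fun q hq => ?_⟩
  · rw [h2 q hq, f2.N Nasg (by decide), ha]
  · rw [f2.N Nlab (by decide)]
    exact (h1 q hq).2

theorem exec_visit {τ : Mem} (h : Par n d k K f cap τ) {i q : ℕ} (hi : i < n) (hq : q < k)
    (hVi : τ.N Vi 0 = i) (hVq : τ.N Vq 0 = q) (hasg : τ.N Nasg i < k) (hl : Loads n k τ) :
    Loads n k (visit.exec I τ) ∧
    ((Adm n cap (covers I d τ) (τ.N Nasg) (τ.N Nlab) i q ∧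
        (visit.exec I τ).N Nasg = Function.update (τ.N Nasg) i q ∧
        (visit.exec I τ).N Nmoved 0 = 1) ∨
      (¬ Adm n cap (covers I d τ) (τ.N Nasg) (τ.N Nlab) i q ∧
        (visit.exec I τ).N Nasg = τ.N Nasg ∧
        (visit.exec I τ).N Nmoved 0 = τ.N Nmoved 0)) := by
  simp only [visit, Cmd.exec_seq, exec_sqDist_cover h hi hq hVi hVq, Cmd.exec_ifle, RExpr.eval,
    NExpr.eval, Mem.setN_N, Mem.setR_N, Mem.setN_R, Mem.setR_R]
  simp only [Nat.reduceEqDiff, false_and, and_true, if_false, if_true, and_self, hVq]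
  by_cases hc : covers I d τ i q
  swap
  · rw [if_neg (by exact hc)]
    exact ⟨hl.of_eq (by funext; simp [Cmd.exec_skip]) (by funext; simp [Cmd.exec_skip]),
      .inr ⟨fun hA => hc hA.1, by funext; simp [Cmd.exec_skip], by simp [Cmd.exec_skip]⟩⟩
  rw [if_pos (by exact hc)]
  simp only [Cmd.exec_ifz, NExpr.eval, Mem.setN_N, Mem.setR_N]
  simp only [Nat.reduceEqDiff, false_and, and_true, if_false, hVq, hVi, h.hcap, hl _ hasg]
  by_cases hA : Adm n cap (covers I d τ) (τ.N Nasg) (τ.N Nlab) i q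
  swap
  · rw [if_neg]
    · exact ⟨hl.of_eq (by funext; simp [Cmd.exec_skip]) (by funext; simp [Cmd.exec_skip]),
        .inr ⟨hA, by funext; simp [Cmd.exec_skip], by simp [Cmd.exec_skip]⟩⟩
    · intro h0
      exact hA ⟨hc, by omega, by omega⟩
  have hA' := hA
  obtain ⟨_, hA1, hA2⟩ := hA'
  rw [if_pos (by omega)]
  have hne : τ.N Nasg i ≠ q := by
    intro he
    rw [he] at hA1
    omega
  obtain ⟨e1, e2, e3⟩ := load_update hi hne
  have hasg' : ∀ σ' : Mem, (∀ r, σ'.N Nasg r = if r = i then q else τ.N Nasg r) →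
      σ'.N Nasg = Function.update (τ.N Nasg) i q := by
    intro σ' hσ'
    funext r
    rw [hσ', Function.update_apply]
  have goal1 : ∀ σ' : Mem, (∀ r, σ'.N Nasg r = if r = i then q else τ.N Nasg r) →
      (∀ r, σ'.N Nload r = if r = q then τ.N Nload q + 1 else if r = τ.N Nasg i then
        τ.N Nload (τ.N Nasg i) - 1 else τ.N Nload r) → Loads n k σ' := by
    intro σ' h1 h2 r hr
    rw [h2, hasg' σ' h1]
    split_ifs with g1 g2
    · rw [g1, e1, hl q hq]
    · rw [g2, hl _ hasg]
      omega
    · rw [e3 r g1 g2, hl r hr]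
  have hne' : q ≠ τ.N Nasg i := hne.symm
  refine ⟨goal1 _ (fun r => ?_) (fun r => ?_), .inl ⟨hA, hasg' _ fun r => ?_, ?_⟩⟩
  · simp [Cmd.exec_seq, Cmd.exec_setN, NExpr.eval, hVq, hVi]
  · simp [Cmd.exec_seq, Cmd.exec_setN, NExpr.eval, hVq, hVi, hne']
  · simp [Cmd.exec_seq, Cmd.exec_setN, NExpr.eval, hVq, hVi]
  · simp [Cmd.exec_seq, Cmd.exec_setN, NExpr.eval]

theorem exec_relabel {τ : Mem} (h : Par n d k K f cap τ) (hl : Loads n k τ) :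
    ∀ q < k, (relabel.exec I τ).N Nlab q =
      if cap < load n (τ.N Nasg) q then τ.N Nlab q + 1 else τ.N Nlab q := by
  have := Cmd.exec_loop_frame (I := I) (v := Vq) (b := Nk)
    (s := .ifz (.sub (.add (nv Ncap) (.const 1)) (.get Nload (nv Vq)))
      (.setN Nlab (nv Vq) (.add (.get Nlab (nv Vq)) (.const 1))) .skip) (σ := τ) rfl h.hk
    (fun m ρ => ∀ q, ρ.N Nlab q =
      if q < m ∧ cap < load n (τ.N Nasg) q then τ.N Nlab q + 1 else τ.N Nlab q) (by simp) (by
      intro q hq ρ hρ hP hVq r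
      have hload : ρ.N Nload q = load n (τ.N Nasg) q := by rw [hρ.N _ (by decide), hl q hq]
      simp only [Cmd.exec_ifz, NExpr.eval, hVq, (h.frame hρ).hcap, hload]
      by_cases hc : cap < load n (τ.N Nasg) q
      · rw [if_pos (by omega)]
        by_cases hr : r = q
        · subst hr
          simp [Cmd.exec_setN, NExpr.eval, hVq, hc, hP]
        · have : r < q + 1 ↔ r < q := by omega
          simp [Cmd.exec_setN, NExpr.eval, hVq, hr, this, hP]
      · rw [if_neg (by omega)]
        simp only [Cmd.exec_skip, Mem.setN_N, Nat.reduceEqDiff, false_and, if_false, hP]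
        congr 1
        apply propext
        constructor
        · exact fun g => ⟨by omega, g.2⟩
        · rintro ⟨g1, g2⟩
          refine ⟨?_, g2⟩
          have : r ≠ q := by
            rintro rfl
            exact hc g2
          omega)
  intro q hq
  rw [relabel, this q]
  simp [hq]

/-- The flow invariant and the stored loads hold unconditionally, so the result is always a covering
assignment. Feasibility only enters through `Progress`, which limits the number of sweeps. -/
theorem exec_flow {σ : Mem} (h : Par n d k K f cap σ)
    (hasg : ∀ i < n, σ.N Nasg i < k ∧ covers I d σ i (σ.N Nasg i)) :
    let τ := flow.exec I σ
    (∀ i < n, τ.N Nasg i < k ∧ covers I d σ i (τ.N Nasg i)) ∧ Loads n k τ ∧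
      (Feasible n k cap (covers I d σ) → (k + 1) * (k * k) + k < f →
        ∀ q < k, load n (τ.N Nasg) q ≤ cap) := by
  simp only [flow, Cmd.exec_seq]
  obtain ⟨l0, lab0⟩ := exec_flowInit (I := I) h
  have f0 := Cmd.exec_frame (I := I) (s := flowInit) rfl σ
  set σ₀ := flowInit.exec I σ
  clear_value σ₀
  have h₀ := h.frame f0
  have ha₀ : σ₀.N Nasg = σ.N Nasg := f0.N _ (by decide)
  have hR : σ₀.R = σ.R := by
    funext x
    exact f0.R x (by simp [flowInit, Cmd.writesR])
  have key := Cmd.exec_loop_frame (I := I) (v := Vit) (b := Nf) (s :=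
    .setN Nmoved (.const 0) (.const 0) ;; .loop Vi Nn (.loop Vq Nk visit) ;;
    .ifz (nv Nmoved) relabel .skip) (σ := σ₀) rfl h₀.hf
    (fun t τ => FlowInv n k cap (covers I d σ) (τ.N Nasg) (τ.N Nlab) ∧ Loads n k τ ∧
      (Feasible n k cap (covers I d σ) →
        Progress n k cap (covers I d σ) (τ.N Nasg) (τ.N Nlab) t)) ?_ ?_
  · obtain ⟨k1, k2, k3⟩ := key
    exact ⟨fun i hi => ⟨k1.lt i hi, k1.cov i hi⟩, k2, fun hf ht => (k3 hf).le_of_lt ht⟩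
  · have e1 : ∀ x j, (σ₀.setN Vit 0 0).N x j = if x = Vit ∧ j = 0 then 0 else σ₀.N x j :=
      fun _ _ => rfl
    have e2 : (σ₀.setN Vit 0 0).N Nasg = σ.N Nasg := by
      rw [← ha₀]; funext j; simp
    -- With all labels zero no push is admissible, so `M = 0` is a bound.
    refine ⟨?_, fun q hq => ?_, fun _ => .inr ⟨0, by omega, fun q hq => ?_, ?_, by omega⟩⟩
    · rw [e2]
      exact ⟨fun i hi => (hasg i hi).1, fun i hi => (hasg i hi).2,
        fun i hi q hq _ => by simp [lab0 _ (hasg i hi).1], fun q hq h0 => by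
          simp [lab0 q hq] at h0⟩
    · rw [e2, e1]
      simpa [ha₀] using l0 q hq
    · simp [lab0 q hq]
    · rintro i hi q hq ⟨_, g, _⟩
      rw [e2] at g
      simp [lab0 _ (hasg i hi).1] at g
  · rintro t ht τ hτ ⟨hF, hL, hP⟩ -
    have hp := h₀.frame hτ
    simp only [Cmd.exec_seq, Cmd.exec_setN, NExpr.eval]
    set τ₀ := τ.setN Nmoved 0 0 with hτ₀
    have hp₀ : Par n d k K f cap τ₀ := hp.of_eq fun x hx => by
      funext j
      have : x ≠ 30 := by omega
      simp [hτ₀, this]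
    have ea : τ₀.N Nasg = τ.N Nasg := by funext j; simp [hτ₀]
    have el : τ₀.N Nlab = τ.N Nlab := by funext j; simp [hτ₀]
    have eld : τ₀.N Nload = τ.N Nload := by funext j; simp [hτ₀]
    have em : τ₀.N Nmoved 0 = 0 := by simp [hτ₀]
    have eR : τ₀.R RC = σ.R RC ∧ τ₀.R Rsq = σ.R Rsq := by
      constructor
      · simp [hτ₀, hτ.R RC (by decide), hR]
      · simp [hτ₀, hτ.R Rsq (by decide), hR]
    clear_value τ₀
    have hcov : ∀ {ρ : Mem}, ρ.R RC = σ.R RC → ρ.R Rsq = σ.R Rsq → covers I d ρ = covers I d σ :=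
      fun g1 g2 => covers_congr g1 g2
    -- the invariant of the sweep
    let Inv : ℕ → ℕ → Mem → Prop := fun i q ρ => Loads n k ρ ∧ ∀ M,
      (∀ i < n, ∀ q < k, Adm n cap (covers I d σ) (τ.N Nasg) (τ.N Nlab) i q →
        τ.N Nlab (τ.N Nasg i) ≤ M) →
      SweepInv n k cap (covers I d σ) (τ.N Nasg) (τ.N Nlab) M i q (ρ.N Nasg) (ρ.N Nmoved 0)
    have sweep := Cmd.exec_loop_frame (I := I) (v := Vi) (b := Nn) (s := .loop Vq Nk visit)
      (σ := τ₀) rfl hp₀.hn (fun i ρ => Inv i 0 ρ) ?_ ?_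
    · have fs := Cmd.exec_frame (I := I) (s := .loop Vi Nn (.loop Vq Nk visit)) rfl τ₀
      set ρ := Cmd.exec I (.loop Vi Nn (.loop Vq Nk visit)) τ₀
      clear_value ρ
      obtain ⟨sL, sI⟩ := sweep
      have hpρ := hp₀.frame fs
      have elρ : ρ.N Nlab = τ.N Nlab := by rw [fs.N _ (by decide), el]
      -- The invariant of the sweep speaks about all upper bounds `M`; some bound is needed to get
      -- at the parts that do not depend on `M`.
      have hM₀ : ∃ M, ∀ i < n, ∀ q < k, Adm n cap (covers I d σ) (τ.N Nasg) (τ.N Nlab) i q →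
          τ.N Nlab (τ.N Nasg i) ≤ M :=
        ⟨∑ i ∈ Finset.range n, τ.N Nlab (τ.N Nasg i), fun i hi q _ _ =>
          Finset.single_le_sum (f := fun i => τ.N Nlab (τ.N Nasg i)) (fun _ _ => Nat.zero_le _)
            (by simpa using hi)⟩
      obtain ⟨M₀, hM₀⟩ := hM₀
      have s₀ := sI M₀ hM₀
      rw [Cmd.exec_ifz]
      by_cases hmv : (nv Nmoved).eval ρ = 0
      · rw [if_pos hmv]
        replace hmv : ρ.N Nmoved 0 = 0 := hmv
        have hrel := exec_relabel (I := I) hpρ sL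
        have fr := Cmd.exec_frame (I := I) (s := relabel) rfl ρ
        set π := relabel.exec I ρ
        clear_value π
        have ea' : (π.setN Vit 0 (t + 1)).N Nasg = ρ.N Nasg := by
          rw [← fr.N Nasg (by decide)]; funext j; simp
        have el' : (π.setN Vit 0 (t + 1)).N Nlab = π.N Nlab := by funext j; simp
        rw [elρ] at hrel
        refine ⟨?_, fun q hq => ?_, fun hf => ?_⟩
        · rw [ea', el']
          refine s₀.flow.relabel (fun i hi q hq => s₀.still hmv i hi q hq (.inl hi)) hrel
        · rw [ea', ← sL q hq, ← fr.N Nload (by decide)]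
          simp
        · rw [ea', el']
          exact (hP hf).of_relabel hf ⟨M₀, by rw [hmv] at s₀; exact s₀⟩ hrel
      · rw [if_neg hmv, Cmd.exec_skip]
        replace hmv : ρ.N Nmoved 0 ≠ 0 := hmv
        have ea' : (ρ.setN Vit 0 (t + 1)).N Nasg = ρ.N Nasg := by funext j; simp
        have el' : (ρ.setN Vit 0 (t + 1)).N Nlab = τ.N Nlab := by rw [← elρ]; funext j; simp
        refine ⟨?_, fun q hq => ?_, fun hf => ?_⟩
        · rw [ea', el']
          exact s₀.flow
        · rw [ea', ← sL q hq]
          simp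
        · rw [ea', el']
          exact (hP hf).of_moved hmv fun M hM => sI M hM
    · refine ⟨fun q hq => ?_, fun M hM => ?_⟩
      · have : (τ₀.setN Vi 0 0).N Nasg = τ.N Nasg := by rw [← ea]; funext j; simp
        rw [this, ← hL q hq, ← eld]
        simp
      · have e1 : (τ₀.setN Vi 0 0).N Nasg = τ.N Nasg := by rw [← ea]; funext j; simp
        rw [e1]
        exact ⟨hF, hM, fun i' _ q' _ hb => by omega, fun _ i' _ q' _ hb => by omega,
          fun h0 => absurd (by simpa using em) h0, fun h0 => h0⟩
    · intro i hi ρ hρ hI hVi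
      have hpρ := hp₀.frame hρ
      have step := Cmd.exec_loop_frame (I := I) (v := Vq) (b := Nk) (s := visit) (σ := ρ) rfl
        hpρ.hk (fun q π => Inv i q π) ?_ ?_
      · set π := Cmd.exec I (.loop Vq Nk visit) ρ
        obtain ⟨g1, g2⟩ := step
        have e1 : (π.setN Vi 0 (i + 1)).N Nasg = π.N Nasg := by funext j; simp
        refine ⟨fun q hq => ?_, fun M hM => ?_⟩
        · rw [e1, ← g1 q hq]; simp
        · rw [e1]
          simpa using (g2 M hM).next
      · obtain ⟨g1, g2⟩ := hI
        have e1 : (ρ.setN Vq 0 0).N Nasg = ρ.N Nasg := by funext j; simp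
        refine ⟨fun q hq => ?_, fun M hM => ?_⟩
        · rw [e1, ← g1 q hq]; simp
        · rw [e1]
          simpa using g2 M hM
      · rintro q hq π hπ ⟨g1, g2⟩ hVq
        have hpπ := hpρ.frame hπ
        have hvi : π.N Vi 0 = i := by rw [hπ.N _ (by decide), hVi]
        have c1 : π.R RC = σ.R RC := by rw [hπ.R _ (by decide), hρ.R _ (by decide), eR.1]
        have c2 : π.R Rsq = σ.R Rsq := by rw [hπ.R _ (by decide), hρ.R _ (by decide), eR.2]
        have elπ : π.N Nlab = τ.N Nlab := by rw [hπ.N _ (by decide), hρ.N _ (by decide), el]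
        obtain ⟨M₁, hM₁⟩ : ∃ M, ∀ i < n, ∀ q < k,
            Adm n cap (covers I d σ) (τ.N Nasg) (τ.N Nlab) i q → τ.N Nlab (τ.N Nasg i) ≤ M :=
          ⟨∑ i ∈ Finset.range n, τ.N Nlab (τ.N Nasg i), fun i hi q _ _ =>
            Finset.single_le_sum (f := fun i => τ.N Nlab (τ.N Nasg i)) (fun _ _ => Nat.zero_le _)
              (by simpa using hi)⟩
        obtain ⟨v1, v2⟩ := exec_visit hpπ hi hq hvi hVq ((g2 M₁ hM₁).flow.lt i hi) g1
        rw [hcov c1 c2, elπ] at v2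
        set ψ := visit.exec I π
        clear_value ψ
        have e1 : (ψ.setN Vq 0 (q + 1)).N Nasg = ψ.N Nasg := by funext j; simp
        refine ⟨fun r hr => ?_, fun M hM => ?_⟩
        · rw [e1, ← v1 r hr]; simp
        · rw [e1]
          obtain ⟨a1, a2, a3⟩ | ⟨a1, a2, a3⟩ := v2
          · simpa [a2, a3] using (g2 M hM).push hi hq a1
          · simpa [a2, a3] using (g2 M hM).skip a1

end

section

variable {I : ℕ → ℝ} {n d k K f cap : ℕ}

/-! ### Recording solutions -/

theorem inputArray_apply (P : Fin n → EuclideanSpace ℝ (Fin d)) (i : Fin n) (j : Fin d) :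
    inputArray P (i * d + j) = P i j := by
  have hd : 0 < d := j.pos
  have hlt : (i : ℕ) * d + j < n * d := by
    calc (i : ℕ) * d + j < i * d + d := by omega
      _ = (i + 1) * d := by ring
      _ ≤ n * d := Nat.mul_le_mul_right d i.2
  rw [inputArray, dif_pos hlt]
  have h1 : Fin.divNat (⟨i * d + j, hlt⟩ : Fin (n * d)) = i := by
    ext
    simp only [Fin.coe_divNat]
    rw [Nat.mul_comm, Nat.mul_add_div hd, Nat.div_eq_of_lt j.2, Nat.add_zero]
  have h2 : Fin.modNat (⟨i * d + j, hlt⟩ : Fin (n * d)) = j := by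
    ext
    simp only [Fin.coe_modNat]
    rw [Nat.mul_comm, Nat.mul_add_mod, Nat.mod_eq_of_lt j.2]
  rw [h1, h2]

/-- Row `q` of a matrix with `d` columns. -/
def rowPoint (d : ℕ) (C : ℕ → ℝ) (q : ℕ) : EuclideanSpace ℝ (Fin d) :=
  WithLp.toLp 2 fun j => C (q * d + j)

@[simp] theorem rowPoint_apply (C : ℕ → ℝ) (q : ℕ) (j : Fin d) :
    rowPoint d C q j = C (q * d + j) := rfl

theorem dist_rowPoint_sq (P : Fin n → EuclideanSpace ℝ (Fin d)) (i : Fin n) (C : ℕ → ℝ) (q : ℕ) :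
    ∑ j ∈ Finset.range d, (inputArray P (i * d + j) - C (q * d + j)) ^ 2 =
      dist (P i) (rowPoint d C q) ^ 2 := by
  rw [EuclideanSpace.dist_sq_eq, Finset.sum_range]
  refine Finset.sum_congr rfl fun j _ => ?_
  rw [inputArray_apply, rowPoint_apply, Real.dist_eq, sq_abs]

theorem covers_iff (P : Fin n → EuclideanSpace ℝ (Fin d)) (σ : Mem) (i : Fin n) (q : ℕ) :
    covers (inputArray P) d σ i q ↔ dist (P i) (rowPoint d (σ.R RC) q) ^ 2 ≤ σ.R Rsq q := by
  rw [covers, dist_rowPoint_sq]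

/-- The displacement of the center of ball `q`. -/
def shiftVal (k K f : ℕ) (g : ℝ) (s q : ℕ) : ℝ :=
  (s : ℝ) * q * (g / (((K : ℝ) * f) * ((k : ℝ) * k)))

theorem shiftVal_nonneg (k K f : ℕ) {g : ℝ} (hg : 0 ≤ g) (s q : ℕ) : 0 ≤ shiftVal k K f g s q := by
  unfold shiftVal
  positivity

/-- The displaced first coordinate of ball `q`. -/
def dispC (d k K f : ℕ) (σ : Mem) (q : ℕ) : ℝ :=
  σ.R RC (q * d) + shiftVal k K f (σ.R Rg 0) (σ.N Ns 0) q

/-- The final radius of ball `q`. -/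
def dispR (k K f : ℕ) (σ : Mem) (q : ℕ) : ℝ :=
  (1 + 1 / (K : ℝ)) * σ.R Rrad q + shiftVal k K f (σ.R Rg 0) (σ.N Ns 0) q

theorem exec_displace {σ : Mem} (h : Par n d k K f cap σ) :
    (∀ q < k, (displace.exec I σ).R RoC q = dispC d k K f σ q) ∧
    (∀ q < k, (displace.exec I σ).R RoR q = dispR k K f σ q) ∧
    (displace.exec I σ).R Rcost 0 = ∑ q ∈ Finset.range k, dispR k K f σ q := by
  simp only [displace, Cmd.exec_seq, Cmd.exec_setR]
  set σ₀ := σ.setR Rcost ((NExpr.const 0).eval σ) ((RExpr.nat (.const 0)).eval I σ) with hσ₀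
  have h₀ : Par n d k K f cap σ₀ := h.of_eq fun x _ => rfl
  refine Cmd.exec_loop_frame (σ := σ₀) (P := fun m τ => (∀ q < m, τ.R RoC q = dispC d k K f σ q) ∧
    (∀ q < m, τ.R RoR q = dispR k K f σ q) ∧
    τ.R Rcost 0 = ∑ q ∈ Finset.range m, dispR k K f σ q) rfl h₀.hk
    (by simp [hσ₀, RExpr.eval, NExpr.eval]) ?_
  rintro q hq τ hτ ⟨h1, h2, h3⟩ hVq
  have hp := h₀.frame hτ
  have e1 : τ.R RC = σ.R RC := by rw [hτ.R _ (by decide)]; funext j; simp [hσ₀]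
  have e2 : τ.R Rg = σ.R Rg := by rw [hτ.R _ (by decide)]; funext j; simp [hσ₀]
  have e3 : τ.R Rrad = σ.R Rrad := by rw [hτ.R _ (by decide)]; funext j; simp [hσ₀]
  have e4 : τ.N Ns = σ.N Ns := by rw [hτ.N _ (by decide)]; simp [hσ₀]
  have hC : (RExpr.add (.get RC (.get Nrow (nv Vq))) shift).eval I τ = dispC d k K f σ q := by
    simp [RExpr.eval, NExpr.eval, hVq, hp.row q (.inr hq), hp.hK, hp.hf, hp.hk, e1, e2, e4, dispC,
      shiftVal]
  have hR : ∀ v, (RExpr.add (.mul growth (.get Rrad (nv Vq))) shift).eval I (τ.setR RoC q v) =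
      dispR k K f σ q := by
    intro v
    simp [RExpr.eval, NExpr.eval, hVq, hp.hK, hp.hf, hp.hk, e3, e2, e4, dispR, shiftVal]
  have hq' : ∀ τ', τ'.N = τ.N → (nv Vq).eval τ' = q := by
    intro τ' h'
    simp [NExpr.eval, h', hVq]
  simp only [Cmd.exec_seq, Cmd.exec_setR, hC, hq' τ rfl]
  rw [hq' _ (by rfl), hR]
  refine ⟨fun r hr => ?_, fun r hr => ?_, ?_⟩
  · by_cases hrq : r = q
    · simp [hrq, NExpr.eval]
    · simpa [hrq, NExpr.eval] using h1 r (by omega)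
  · by_cases hrq : r = q
    · simp [hrq, NExpr.eval]
    · simpa [hrq, NExpr.eval] using h2 r (by omega)
  · simp [NExpr.eval, RExpr.eval, h3, Finset.sum_range_succ, hVq]

theorem exec_verify {σ : Mem} (h : Par n d k K f cap σ) :
    (verify.exec I σ).N Nok 0 ≤ 1 ∧ ((verify.exec I σ).N Nok 0 = 1 ↔
      ∀ q < k, σ.N Nload q ≤ cap ∧ ∀ r < k, q < r → σ.R RoC q ≠ σ.R RoC r) := by
  simp only [verify, Cmd.exec_seq, Cmd.exec_setN]
  set σ₀ := σ.setN Nok ((NExpr.const 0).eval σ) ((NExpr.const 1).eval σ) with hσ₀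
  have h₀ : Par n d k K f cap σ₀ := h.of_eq fun x hx => by
    funext j
    have : x ≠ 31 := by omega
    simp [hσ₀, this]
  refine Cmd.exec_loop_frame (σ := σ₀) (P := fun m τ => τ.N Nok 0 ≤ 1 ∧ (τ.N Nok 0 = 1 ↔
    ∀ q < m, σ.N Nload q ≤ cap ∧ ∀ r < k, q < r → σ.R RoC q ≠ σ.R RoC r)) rfl h₀.hk
    (by simp [hσ₀, NExpr.eval]) ?_
  rintro q hq τ hτ ⟨h1, h2⟩ hVq
  have hp := h₀.frame hτ
  have el : τ.N Nload = σ.N Nload := by rw [hτ.N _ (by decide)]; funext j; simp [hσ₀]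
  have ec : τ.R RoC = σ.R RoC := by rw [hτ.R _ (by decide)]; simp [hσ₀]
  rw [Cmd.exec_seq]
  have step1 : ∀ τ₁, τ₁ = (Cmd.ifz (.sub (.get Nload (nv Vq)) (nv Ncap)) .skip
      (.setN Nok (.const 0) (.const 0))).exec I τ → τ₁.N Nok 0 ≤ 1 ∧ (τ₁.N Nok 0 = 1 ↔
        (∀ q' < q, σ.N Nload q' ≤ cap ∧ ∀ r < k, q' < r → σ.R RoC q' ≠ σ.R RoC r) ∧
          σ.N Nload q ≤ cap) := by
    rintro _ rfl
    simp only [Cmd.exec_ifz, NExpr.eval, hVq, el, hp.hcap]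
    by_cases hc : σ.N Nload q ≤ cap
    · rw [if_pos (by omega)]
      simpa [Cmd.exec_skip, hc, h1] using h2
    · rw [if_neg (by omega)]
      simp [Cmd.exec_setN, NExpr.eval, hc]
  have f1 := Cmd.exec_frame (I := I) (s := .ifz (.sub (.get Nload (nv Vq)) (nv Ncap)) .skip
      (.setN Nok (.const 0) (.const 0))) rfl τ
  set τ₁ := Cmd.exec I (.ifz (.sub (.get Nload (nv Vq)) (nv Ncap)) .skip
      (.setN Nok (.const 0) (.const 0))) τ
  obtain ⟨s1, s2⟩ := step1 _ rfl
  clear_value τ₁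
  have hp₁ := hp.frame f1
  have step2 := Cmd.exec_loop_frame (I := I) (v := Vr) (b := Nk) (s :=
      .ifz (.sub (.add (nv Vq) (.const 1)) (nv Vr))
      (.ifle (.get RoC (nv Vq)) (.get RoC (nv Vr))
        (.ifle (.get RoC (nv Vr)) (.get RoC (nv Vq)) (.setN Nok (.const 0) (.const 0)) .skip) .skip)
      .skip) (σ := τ₁) rfl hp₁.hk (fun m ρ => ρ.N Nok 0 ≤ 1 ∧ (ρ.N Nok 0 = 1 ↔
        ((∀ q' < q, σ.N Nload q' ≤ cap ∧ ∀ r < k, q' < r → σ.R RoC q' ≠ σ.R RoC r) ∧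
          σ.N Nload q ≤ cap) ∧ ∀ r < m, q < r → σ.R RoC q ≠ σ.R RoC r)) ?_ ?_
  · obtain ⟨g1, g2⟩ := step2
    refine ⟨by simpa using g1, ?_⟩
    have : ∀ ρ : Mem, (ρ.setN Vq 0 (q + 1)).N Nok 0 = ρ.N Nok 0 := fun ρ => by simp
    rw [this, g2, and_assoc]
    constructor
    · rintro ⟨a1, a2, a3⟩ q' hq'
      obtain h' | rfl : q' < q ∨ q' = q := by omega
      · exact a1 q' h'
      · exact ⟨a2, a3⟩
    · intro a
      exact ⟨fun q' hq' => a q' (by omega), (a q (by omega)).1, (a q (by omega)).2⟩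
  · refine ⟨by simpa using s1, ?_⟩
    simpa using s2
  · rintro r hr ρ hρ ⟨g1, g2⟩ hVr
    have eq : ρ.N Vq 0 = q := by rw [hρ.N _ (by decide), f1.N _ (by decide), hVq]
    have ec' : ρ.R RoC = σ.R RoC := by rw [hρ.R _ (by decide), f1.R _ (by decide), ec]
    have keep : (q < r → σ.R RoC q ≠ σ.R RoC r) → (ρ.setN Vr 0 (r + 1)).N Nok 0 ≤ 1 ∧
        ((ρ.setN Vr 0 (r + 1)).N Nok 0 = 1 ↔
        ((∀ q' < q, σ.N Nload q' ≤ cap ∧ ∀ r < k, q' < r → σ.R RoC q' ≠ σ.R RoC r) ∧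
          σ.N Nload q ≤ cap) ∧ ∀ r' < r + 1, q < r' → σ.R RoC q ≠ σ.R RoC r') := by
      intro hne
      have : (ρ.setN Vr 0 (r + 1)).N Nok 0 = ρ.N Nok 0 := by simp
      rw [this]
      refine ⟨g1, g2.trans (and_congr_right fun _ => ?_)⟩
      constructor
      · intro a r' hr'
        obtain h' | rfl : r' < r ∨ r' = r := by omega
        · exact a r' h'
        · exact hne
      · exact fun a r' hr' => a r' (by omega)
    simp only [Cmd.exec_ifz, Cmd.exec_ifle, Cmd.exec_skip, NExpr.eval, RExpr.eval, eq, hVr, ec']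
    by_cases hqr : q < r
    swap
    · rw [if_neg (by omega)]
      exact keep fun h' => absurd h' hqr
    rw [if_pos (by omega)]
    by_cases hle : σ.R RoC q ≤ σ.R RoC r
    swap
    · rw [if_neg hle]
      exact keep fun _ h' => hle h'.le
    rw [if_pos hle]
    by_cases hle' : σ.R RoC r ≤ σ.R RoC q
    swap
    · rw [if_neg hle']
      exact keep fun _ h' => hle' h'.ge
    rw [if_pos hle']
    simp only [Cmd.exec_setN, NExpr.eval, Mem.setN_N, Nat.reduceEqDiff, false_and, if_false,
      and_self, if_true]
    refine ⟨by omega, ?_⟩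
    simp only [false_iff, not_and]
    intro _ a
    exact a r (by omega) hqr (le_antisymm hle hle')

/-- The stored solution is `S`. -/
structure Stored (σ : Mem) (S : Solution n d k) : Prop where
  cost : S.cost = σ.R Rbcost 0
  center : ∀ (q : Fin k) (j : Fin d), S.center q j = σ.R RbC (q * d + j)
  radius : ∀ q : Fin k, S.radius q = σ.R RbR q
  assign : ∀ i : Fin n, (S.assign i : ℕ) = σ.N Nbest i

theorem exec_record {σ : Mem} (h : Par n d k K f cap σ) :
    let τ := record.exec I σ
    τ.N Nhave 0 = 1 ∧ τ.R Rbcost 0 = σ.R Rcost 0 ∧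
      (∀ q < k, ∀ j < d, τ.R RbC (q * d + j) =
        if j = 0 then σ.R RoC q else σ.R RC (q * d + j)) ∧
      (∀ q < k, τ.R RbR q = σ.R RoR q) ∧ ∀ i < n, τ.N Nbest i = σ.N Nasg i := by
  simp only [record, Cmd.exec_seq]
  set σ₁ := Cmd.exec I (.setR Rbcost (.const 0) (rv Rcost))
    (Cmd.exec I (.setN Nhave (.const 0) (.const 1)) σ) with hσ₁
  have f1 : (Cmd.setN Nhave (.const 0) (.const 1) ;;
      Cmd.setR Rbcost (.const 0) (rv Rcost)).Frame σ σ₁ := Cmd.exec_frame rfl σ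
  have a1 : σ₁.N Nhave 0 = 1 := by simp [hσ₁, Cmd.exec_setN, Cmd.exec_setR, NExpr.eval]
  have a2 : σ₁.R Rbcost 0 = σ.R Rcost 0 := by
    simp [hσ₁, Cmd.exec_setN, Cmd.exec_setR, NExpr.eval, RExpr.eval]
  clear_value σ₁
  have h₁ := h.frame f1
  have b1 : σ₁.R RC = σ.R RC := f1.R _ (by decide)
  have b2 : σ₁.R RoC = σ.R RoC := f1.R _ (by decide)
  have b3 : σ₁.R RoR = σ.R RoR := f1.R _ (by decide)
  have b4 : σ₁.N Nasg = σ.N Nasg := f1.N _ (by decide)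
  set copy : Cmd := .loop Vj Nd (.setR RbC (.add (.get Nrow (nv Vq)) (nv Vj)) (entry RC Vq)) ;;
    .setR RbC (.get Nrow (nv Vq)) (.get RoC (nv Vq)) ;;
    .setR RbR (nv Vq) (.get RoR (nv Vq)) with hcopy
  have c1 := Cmd.exec_loop_frame (I := I) (v := Vq) (b := Nk) (s := copy) (σ := σ₁) rfl h₁.hk
    (fun m τ => (∀ q < m, ∀ j < d, τ.R RbC (q * d + j) =
        if j = 0 then σ.R RoC q else σ.R RC (q * d + j)) ∧
      (∀ q < m, τ.R RbR q = σ.R RoR q)) (by simp) ?_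
  · have f2 : (Cmd.loop Vq Nk copy).Frame σ₁ _ := Cmd.exec_frame (I := I) rfl σ₁
    set σ₂ := Cmd.exec I (.loop Vq Nk copy) σ₁
    clear_value σ₂
    have h₂ := h₁.frame f2
    have d1 := Cmd.exec_loop_frame (I := I) (v := Vi) (b := Nn)
      (s := .setN Nbest (nv Vi) (.get Nasg (nv Vi))) (σ := σ₂) rfl h₂.hn
      (fun m τ => ∀ i < m, τ.N Nbest i = σ.N Nasg i) (by simp) (by
        intro i hi τ hτ hP hVi i' hi'
        have e : τ.N Nasg = σ.N Nasg := by rw [hτ.N _ (by decide), f2.N _ (by decide), b4]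
        by_cases hii : i' = i
        · simp [Cmd.exec_setN, NExpr.eval, hVi, hii, e]
        · simpa [Cmd.exec_setN, NExpr.eval, hVi, hii] using hP i' (by omega))
    have f3 : (Cmd.loop Vi Nn (.setN Nbest (nv Vi) (.get Nasg (nv Vi)))).Frame σ₂ _ :=
      Cmd.exec_frame (I := I) rfl σ₂
    refine ⟨?_, ?_, fun q hq j hj => ?_, fun q hq => ?_, d1⟩
    · rw [f3.N Nhave (by decide), f2.N Nhave (by decide), a1]
    · rw [f3.R Rbcost (by decide), f2.R Rbcost (by decide), a2]
    · rw [f3.R RbC (by decide)]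
      exact c1.1 q hq j hj
    · rw [f3.R RbR (by decide)]
      exact c1.2 q hq
  · rintro q hq τ hτ ⟨g1, g2⟩ hVq
    have hp := h₁.frame hτ
    have e1 : τ.R RC = σ.R RC := by rw [hτ.R _ (by decide), b1]
    have e2 : τ.R RoC = σ.R RoC := by rw [hτ.R _ (by decide), b2]
    have e3 : τ.R RoR = σ.R RoR := by rw [hτ.R _ (by decide), b3]
    rw [hcopy, Cmd.exec_seq]
    have l1 := Cmd.exec_loop_frame (I := I) (v := Vj) (b := Nd)
      (s := .setR RbC (.add (.get Nrow (nv Vq)) (nv Vj)) (entry RC Vq)) (σ := τ) rfl hp.hd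
      (fun m ρ => (∀ j < m, ρ.R RbC (q * d + j) = σ.R RC (q * d + j)) ∧
        ∀ q' < q, ∀ j < d, ρ.R RbC (q' * d + j) =
        if j = 0 then σ.R RoC q' else σ.R RC (q' * d + j)) (by simpa using g1) (by
        rintro j hj ρ hρ ⟨p1, p2⟩ hVj
        have hVq' : ρ.N Vq 0 = q := by rw [hρ.N _ (by decide), hVq]
        have hrow := (hp.frame hρ).row q (.inr hq)
        have e : ρ.R RC = σ.R RC := by rw [hρ.R _ (by decide), e1]
        refine ⟨fun j' hj' => ?_, fun q' hq' j' hj' => ?_⟩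
        · by_cases hjj : j' = j
          · simp [Cmd.exec_setR, NExpr.eval, RExpr.eval, hVj, hVq', hrow, hjj, e]
          · simpa [Cmd.exec_setR, NExpr.eval, hVj, hVq', hrow, hjj] using p1 j' (by omega)
        · have hne : q' * d + j' ≠ q * d + j := by
            have : (q' + 1) * d ≤ q * d := Nat.mul_le_mul_right d hq'
            rw [Nat.succ_mul] at this
            omega
          simpa [Cmd.exec_setR, NExpr.eval, hVj, hVq', hrow, hne] using p2 q' hq' j' hj')
    have fl : (Cmd.loop Vj Nd (.setR RbC (.add (.get Nrow (nv Vq)) (nv Vj))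
      (entry RC Vq))).Frame τ _ := Cmd.exec_frame (I := I) rfl τ
    set ρ := Cmd.exec I (.loop Vj Nd (.setR RbC (.add (.get Nrow (nv Vq)) (nv Vj))
      (entry RC Vq))) τ
    clear_value ρ
    have hVq' : ρ.N Vq 0 = q := by rw [fl.N _ (by decide), hVq]
    have hrow := (hp.frame fl).row q (.inr hq)
    have e2' : ρ.R RoC = σ.R RoC := by rw [fl.R _ (by decide), e2]
    have e3' : ρ.R RoR = σ.R RoR := by rw [fl.R _ (by decide), e3]
    have e4' : ρ.R RbR = τ.R RbR := fl.R _ (by decide)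
    simp only [Cmd.exec_seq, Cmd.exec_setR, NExpr.eval, RExpr.eval, hVq', hrow, Mem.setR_N, e2']
    refine ⟨fun q' hq' j hj => ?_, fun q' hq' => ?_⟩
    · obtain h' | rfl : q' < q ∨ q' = q := by omega
      · have hne : q' * d + j ≠ q * d := by
          have : (q' + 1) * d ≤ q * d := Nat.mul_le_mul_right d h'
          rw [Nat.succ_mul] at this
          omega
        simpa [hne] using l1.2 q' h' j hj
      · by_cases hj0 : j = 0
        · simp [hj0]
        · simpa [hj0] using l1.1 j hj
    · by_cases hqq : q' = q
      · simp [hqq, e3']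
      · simpa [hqq, e4'] using g2 q' (by omega)

end

/-! ### Solution attempts, moves of centers, and the effect of one step -/

section

variable {n d k K f cap : ℕ}

/-- The best solution is valid, if there is one. -/
def Best (P : Fin n → EuclideanSpace ℝ (Fin d)) (k cap : ℕ) (σ : Mem) : Prop :=
  σ.N Nhave 0 ≠ 0 → ∃ S : Solution n d k, S.IsValid P cap ∧ Stored σ S

/-- The best solution costs at most `x`. -/
def Succ (x : ℝ) (σ : Mem) : Prop := σ.N Nhave 0 ≠ 0 ∧ σ.R Rbcost 0 ≤ x

/-- The radii and their squares are consistent. -/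
structure Geo (k K : ℕ) (σ : Mem) : Prop where
  g : 0 ≤ σ.R Rg 0
  rad : ∀ q < k, 0 ≤ σ.R Rrad q
  sq : ∀ q < k, σ.R Rsq q = -1 ∨ σ.R Rsq q = ((1 + 1 / (K : ℝ)) * σ.R Rrad q) ^ 2

theorem Best.of_eq {P : Fin n → EuclideanSpace ℝ (Fin d)} {σ τ : Mem} (h : Best P k cap σ)
    (h₁ : τ.N Nhave = σ.N Nhave) (h₂ : τ.N Nbest = σ.N Nbest) (h₃ : τ.R Rbcost = σ.R Rbcost)
    (h₄ : τ.R RbC = σ.R RbC) (h₅ : τ.R RbR = σ.R RbR) : Best P k cap τ := by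
  intro h0
  obtain ⟨S, hS, hst⟩ := h (by rwa [← h₁])
  exact ⟨S, hS, by rw [h₃]; exact hst.cost, by rw [h₄]; exact hst.center,
    by rw [h₅]; exact hst.radius, by rw [h₂]; exact hst.assign⟩

theorem Succ.of_eq {x : ℝ} {σ τ : Mem} (h : Succ x σ)
    (h₁ : τ.N Nhave = σ.N Nhave) (h₃ : τ.R Rbcost = σ.R Rbcost) : Succ x τ := by
  unfold Succ
  rw [h₁, h₃]
  exact h

theorem Geo.of_eq {σ τ : Mem} (h : Geo k K σ) (h₁ : τ.R Rg = σ.R Rg) (h₂ : τ.R Rrad = σ.R Rrad)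
    (h₃ : τ.R Rsq = σ.R Rsq) : Geo k K τ :=
  ⟨by rw [h₁]; exact h.g, by rw [h₂]; exact h.rad, by rw [h₂, h₃]; exact h.sq⟩

/-- The solution with displaced centers is valid. -/
theorem displaced_isValid (P : Fin n → EuclideanSpace ℝ (Fin d)) {σ : Mem} (hd : 1 ≤ d)
    (hg : Geo k K σ) {a : ℕ → ℕ}
    (ha : ∀ i < n, a i < k ∧ covers (inputArray P) d σ i (a i))
    (hl : ∀ q < k, load n a q ≤ cap)
    (hne : ∀ q < k, ∀ r < k, q < r → dispC d k K f σ q ≠ dispC d k K f σ r) :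
    Solution.IsValid (k := k) ⟨fun q => WithLp.toLp 2 fun j =>
        if (j : ℕ) = 0 then dispC d k K f σ q else σ.R RC (q * d + j),
      fun q => dispR k K f σ q, fun i => ⟨a i, (ha i i.2).1⟩⟩ P cap := by
  have shift0 : ∀ q, 0 ≤ shiftVal k K f (σ.R Rg 0) (σ.N Ns 0) q :=
    fun q => shiftVal_nonneg k K f hg.g _ q
  refine ⟨fun q r hqr => ?_, fun q => ?_, fun i => ?_, fun q => ?_⟩
  · have h0 := congrArg (fun x : EuclideanSpace ℝ (Fin d) => x ⟨0, hd⟩) hqr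
    simp only [if_true] at h0
    by_contra hne'
    obtain h | h := lt_or_gt_of_ne (fun h => hne' (Fin.ext h) : (q : ℕ) ≠ r)
    · exact hne q q.2 r r.2 h h0
    · exact hne r r.2 q q.2 h h0.symm
  · have := hg.rad q q.2
    have := shift0 q
    simp only [dispR]
    positivity
  · obtain ⟨h1, h2⟩ := ha i i.2
    rw [covers_iff P σ i] at h2
    have hr := hg.rad (a i) h1
    have h3 : dist (P i) (rowPoint d (σ.R RC) (a i)) ≤ (1 + 1 / (K : ℝ)) * σ.R Rrad (a i) := by
      obtain h | h := hg.sq (a i) h1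
      · rw [h] at h2
        -- The value `-1` is impossible here, because the ball covers a point.
        nlinarith [sq_nonneg (dist (P i) (rowPoint d (σ.R RC) (a i)))]
      · rw [h] at h2
        exact abs_le_of_sq_le_sq' h2 (by positivity) |>.2
    -- The radius was enlarged by exactly the distance by which the center is displaced.
    refine (dist_triangle _ (rowPoint d (σ.R RC) (a i)) _).trans (add_le_add h3 ?_)
    rw [EuclideanSpace.dist_eq]
    refine Real.sqrt_le_iff.2 ⟨shift0 _, ?_⟩
    rw [Finset.sum_eq_single ⟨0, hd⟩]
    · simp [dispC]
    · intro j _ hj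
      have : (j : ℕ) ≠ 0 := fun h => hj (Fin.ext h)
      simp [this]
    · simp
  · refine Nat.cast_le.2 (le_trans (le_of_eq ?_) (hl q q.2))
    rw [load]
    refine Finset.card_bij (fun i _ => (i : ℕ)) ?_ (fun _ _ _ _ h => Fin.ext h) ?_
    · intro i hi
      simp only [Finset.mem_filter, Finset.mem_univ, true_and, Fin.ext_iff] at hi
      simp [hi]
    · intro i hi
      simp only [Finset.mem_filter, Finset.mem_range] at hi
      exact ⟨⟨i, hi.1⟩, by simp [Fin.ext_iff, hi.2], rfl⟩

/-- If the new solution is not stored then the stored one is at least as cheap, so the cost bound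
holds in either case; for the same reason `Succ` is never lost. -/
theorem exec_attempt (P : Fin n → EuclideanSpace ℝ (Fin d)) {σ : Mem}
    (h : Par n d k K f cap σ) (hd : 1 ≤ d) (hg : Geo k K σ) (hl : Loads n k σ)
    (ha : ∀ i < n, σ.N Nasg i < k ∧ covers (inputArray P) d σ i (σ.N Nasg i))
    (hb : Best P k cap σ) :
    let τ := attempt.exec (inputArray P) σ
    Best P k cap τ ∧ (∀ x, Succ x σ → Succ x τ) ∧
      ((∀ q < k, load n (σ.N Nasg) q ≤ cap) →
        (∀ q < k, ∀ r < k, q < r → dispC d k K f σ q ≠ dispC d k K f σ r) →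
        Succ (∑ q ∈ Finset.range k, dispR k K f σ q) τ) := by
  simp only [attempt, Cmd.exec_seq]
  obtain ⟨a1, a2, a3⟩ := exec_displace (I := inputArray P) h
  have f1 := Cmd.exec_frame (I := inputArray P) (s := displace) rfl σ
  set σ₁ := displace.exec (inputArray P) σ
  clear_value σ₁
  have h₁ := h.frame f1
  obtain ⟨b1, b2⟩ := exec_verify (I := inputArray P) h₁
  have f2 := Cmd.exec_frame (I := inputArray P) (s := verify) rfl σ₁
  set σ₂ := verify.exec (inputArray P) σ₁
  clear_value σ₂
  have h₂ := h₁.frame f2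
  have eN : ∀ x, x ∉ displace.writesN → x ∉ verify.writesN → σ₂.N x = σ.N x :=
    fun x hx hx' => by rw [f2.N x hx', f1.N x hx]
  have eR : ∀ x, x ∉ displace.writesR → x ∉ verify.writesR → σ₂.R x = σ.R x :=
    fun x hx hx' => by rw [f2.R x hx', f1.R x hx]
  have hok : σ₂.N Nok 0 = 1 ↔ (∀ q < k, load n (σ.N Nasg) q ≤ cap) ∧
      ∀ q < k, ∀ r < k, q < r → dispC d k K f σ q ≠ dispC d k K f σ r := by
    rw [b2]
    have : ∀ q < k, σ₁.N Nload q = load n (σ.N Nasg) q := fun q hq => by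
      rw [f1.N _ (by decide), hl q hq]
    constructor
    · intro g
      refine ⟨fun q hq => this q hq ▸ (g q hq).1, fun q hq r hr hqr => ?_⟩
      rw [← a1 q hq, ← a1 r hr]
      exact (g q hq).2 r hr hqr
    · rintro ⟨g1, g2⟩ q hq
      refine ⟨this q hq ▸ g1 q hq, fun r hr hqr => ?_⟩
      rw [a1 q hq, a1 r hr]
      exact g2 q hq r hr hqr
  have hb₂ : Best P k cap σ₂ := hb.of_eq (eN _ (by decide) (by decide)) (eN _ (by decide) (by decide))
    (eR _ (by decide) (by decide)) (eR _ (by decide) (by decide)) (eR _ (by decide) (by decide))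
  have hs₂ : ∀ x, Succ x σ → Succ x σ₂ := fun x hx =>
    hx.of_eq (eN _ (by decide) (by decide)) (eR _ (by decide) (by decide))
  have hcost : σ₂.R Rcost 0 = ∑ q ∈ Finset.range k, dispR k K f σ q := by
    rw [f2.R _ (by decide), a3]
  rw [Cmd.exec_ifz, show NExpr.eval σ₂ ((NExpr.const 1).sub (nv Nok)) = 1 - σ₂.N Nok 0 from rfl]
  by_cases hc : σ₂.N Nok 0 = 1
  swap
  · rw [if_neg (by omega)]
    exact ⟨hb₂, hs₂, fun g1 g2 => absurd (hok.2 ⟨g1, g2⟩) hc⟩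
  rw [if_pos (by omega)]
  obtain ⟨g1, g2⟩ := hok.1 hc
  have hval := displaced_isValid P hd hg ha g1 g2
  have hrec : Best P k cap (record.exec (inputArray P) σ₂) ∧
      Succ (∑ q ∈ Finset.range k, dispR k K f σ q) (record.exec (inputArray P) σ₂) := by
    obtain ⟨r1, r2, r3, r4, r5⟩ := exec_record (I := inputArray P) h₂
    refine ⟨fun _ => ⟨_, hval, ?_, fun q j => ?_, fun q => ?_, fun i => ?_⟩, by omega, ?_⟩
    · rw [r2, hcost, Solution.cost, Finset.sum_range]
    · rw [r3 q q.2 j j.2, f2.R RoC (by decide), a1 q q.2, eR RC (by decide) (by decide)]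
    · rw [r4 q q.2, f2.R RoR (by decide), a2 q q.2]
    · rw [r5 i i.2, eN Nasg (by decide) (by decide)]
    · rw [r2, hcost]
  rw [Cmd.exec_ifz, show NExpr.eval σ₂ (nv Nhave) = σ₂.N Nhave 0 from rfl]
  by_cases hh : σ₂.N Nhave 0 = 0
  · rw [if_pos hh]
    exact ⟨hrec.1, fun x hx => absurd hh (hs₂ x hx).1, fun _ _ => hrec.2⟩
  · rw [if_neg hh, Cmd.exec_ifle, show RExpr.eval (inputArray P) σ₂ (rv Rbcost) = σ₂.R Rbcost 0 from rfl,
      show RExpr.eval (inputArray P) σ₂ (rv Rcost) = σ₂.R Rcost 0 from rfl]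
    by_cases hle : σ₂.R Rbcost 0 ≤ σ₂.R Rcost 0
    · rw [if_pos hle, Cmd.exec_skip]
      exact ⟨hb₂, hs₂, fun _ _ => ⟨hh, hcost ▸ hle⟩⟩
    · rw [if_neg hle]
      refine ⟨hrec.1, fun x hx => ⟨hrec.2.1, hrec.2.2.trans ?_⟩, fun _ _ => hrec.2⟩
      have := (hs₂ x hx).2
      rw [← hcost]
      linarith

/-- The center of ball `q` has moved towards point `p`. -/
structure Moved (P : Fin n → EuclideanSpace ℝ (Fin d)) (k K : ℕ) (p : Fin n) (q : ℕ) (σ τ : Mem) :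
    Prop where
  center : rowPoint d (τ.R RC) q =
    rowPoint d (σ.R RC) q + σ.R RT q • (P p - rowPoint d (σ.R RC) q)
  other : ∀ r < k, r ≠ q → rowPoint d (τ.R RC) r = rowPoint d (σ.R RC) r ∧
    τ.R RT r = σ.R RT r ∧ τ.R Rsq r = σ.R Rsq r
  factor : τ.R RT q = 1 / (2 * K)
  sq : τ.R Rsq q = ((1 + 1 / (K : ℝ)) * σ.R Rrad q) ^ 2

theorem exec_update (P : Fin n → EuclideanSpace ℝ (Fin d)) {σ : Mem}
    (h : Par n d k K f cap σ) (hg : Geo k K σ) :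
    let τ := update.exec (inputArray P) σ
    Geo k K τ ∧ ∀ p : Fin n, (p : ℕ) = (if σ.N Nu 0 < n then σ.N Nu 0 else σ.N Np 0) →
      ∀ q, σ.N Nq 0 = q → q < k → Moved P k K p q σ τ := by
  simp only [update, Cmd.exec_seq]
  set σ₁ := (Cmd.ifz (.sub (nv Nn) (nv Nu)) .skip (.setN Np (.const 0) (nv Nu))).exec
    (inputArray P) σ with hσ₁
  rw [Cmd.exec_ifz, show NExpr.eval σ (.sub (nv Nn) (nv Nu)) = σ.N Nn 0 - σ.N Nu 0 from rfl,
    Cmd.exec_skip] at hσ₁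
  have hp₁ : σ₁.N Np 0 = if σ.N Nu 0 < n then σ.N Nu 0 else σ.N Np 0 := by
    rw [hσ₁, h.hn]
    by_cases hu : σ.N Nu 0 < n
    · rw [if_neg (by omega), if_pos hu]
      simp [Cmd.exec_setN, NExpr.eval]
    · rw [if_pos (by omega), if_neg hu]
  have eN : ∀ x, x ≠ Np → σ₁.N x = σ.N x := by
    intro x hx
    rw [hσ₁]
    split_ifs
    · rfl
    · funext j
      simp [Cmd.exec_setN, hx]
  have eR : σ₁.R = σ.R := by
    rw [hσ₁]
    split_ifs <;> rfl
  clear_value σ₁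
  have h₁ : Par n d k K f cap σ₁ := h.of_eq fun x hx => eN x (by omega)
  set mv : Cmd := .setR RC (.add (.get Nrow (nv Nq)) (nv Vj))
    (.add (entry RC Nq) (.mul (.get RT (nv Nq)) (.sub (coord Np) (entry RC Nq)))) with hmv
  have f2 := Cmd.exec_frame (I := inputArray P) (s := .loop Vj Nd mv) rfl σ₁
  have l2 := fun (p : Fin n) (hpp : (p : ℕ) = if σ.N Nu 0 < n then σ.N Nu 0 else σ.N Np 0)
      (hq : σ.N Nq 0 < k) =>
    Cmd.exec_loop_frame (I := inputArray P) (v := Vj) (b := Nd) (s := mv) (σ := σ₁) rfl h₁.hd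
    (fun m τ => (∀ j < m, τ.R RC (σ.N Nq 0 * d + j) = σ.R RC (σ.N Nq 0 * d + j) +
        σ.R RT (σ.N Nq 0) * (inputArray P (p * d + j) - σ.R RC (σ.N Nq 0 * d + j))) ∧
      (∀ j, m ≤ j → j < d → τ.R RC (σ.N Nq 0 * d + j) = σ.R RC (σ.N Nq 0 * d + j)) ∧
      ∀ r, r ≠ σ.N Nq 0 → ∀ j < d, τ.R RC (r * d + j) = σ.R RC (r * d + j))
    (by simp [eR]) (by
      rintro j hj τ hτ ⟨g1, g2, g3⟩ hVj
      have hpτ := h₁.frame hτ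
      have e1 : τ.N Nq 0 = σ.N Nq 0 := by rw [hτ.N _ (by decide), eN _ (by decide)]
      have e2 : τ.N Np 0 = p := by rw [hτ.N _ (by decide), hp₁, hpp]
      have e3 : τ.R RT = σ.R RT := by rw [hτ.R _ (by decide), eR]
      have e4 := hpτ.row _ (.inr hq)
      have e5 := hpτ.row p (.inl p.2)
      have e6 := g2 j le_rfl hj
      have hτ' : ∀ x, ((mv.exec (inputArray P) τ).setN Vj 0 (j + 1)).R RC x =
          if x = σ.N Nq 0 * d + j then σ.R RC (σ.N Nq 0 * d + j) +
            σ.R RT (σ.N Nq 0) * (inputArray P (p * d + j) - σ.R RC (σ.N Nq 0 * d + j))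
          else τ.R RC x := by
        intro x
        simp [hmv, Cmd.exec_setR, NExpr.eval, RExpr.eval, e1, e2, e3, e4, e5, hVj, e6]
      refine ⟨fun j' hj' => ?_, fun j' h1 h2 => ?_, fun r hr j' hj' => ?_⟩
      · rw [hτ']
        split_ifs with hjj
        · rw [Nat.add_left_cancel hjj]
        · exact g1 j' (by omega)
      · rw [hτ', if_neg (by omega)]
        exact g2 j' (by omega) h2
      · rw [hτ', if_neg, g3 r hr j' hj']
        intro he
        obtain h' | h' := lt_or_gt_of_ne hr
        · have := Nat.mul_le_mul_right d h'
          rw [Nat.succ_mul] at this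
          omega
        · have := Nat.mul_le_mul_right d h'
          rw [Nat.succ_mul] at this
          omega)
  set σ₂ := Cmd.exec (inputArray P) (.loop Vj Nd mv) σ₁
  clear_value σ₂
  have h₂ := h₁.frame f2
  have e1 : σ₂.N Nq 0 = σ.N Nq 0 := by rw [f2.N _ (by decide), eN _ (by decide)]
  have e2 : σ₂.R RT = σ.R RT := by rw [f2.R _ (by decide), eR]
  have e3 : σ₂.R Rsq = σ.R Rsq := by rw [f2.R _ (by decide), eR]
  have e4 : σ₂.R Rrad = σ.R Rrad := by rw [f2.R _ (by decide), eR]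
  have e5 : σ₂.R Rg = σ.R Rg := by rw [f2.R _ (by decide), eR]
  simp only [Cmd.exec_setR, RExpr.eval, NExpr.eval, Mem.setR_N, h₂.hK, e1]
  refine ⟨⟨?_, ?_, ?_⟩, ?_⟩
  · simpa [e5] using hg.g
  · simpa [e4] using hg.rad
  · intro q hq
    by_cases hqq : q = σ.N Nq 0
    · right
      simp [hqq, e4]
      ring
    · simpa [hqq, e3, e4] using hg.sq q hq
  · rintro p hpp _ rfl hq
    obtain ⟨g1, -, g3⟩ := l2 p hpp hq
    refine ⟨?_, fun r hr hne => ⟨?_, ?_, ?_⟩, ?_, ?_⟩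
    · ext j
      simp [g1 j j.2, inputArray_apply]
    · ext j
      simp [g3 r hne j j.2]
    · simp [hne, e2]
    · simp [hne, e3]
    · simp
      ring
    · simp [e4]
      ring

/-- The properties that hold throughout the search. -/
structure Inv (P : Fin n → EuclideanSpace ℝ (Fin d)) (k K f cap : ℕ) (σ : Mem) : Prop where
  par : Par n d k K f cap σ
  best : Best P k cap σ

/-- The alternatives match the case analysis of `Setup.trialStep_le`: with an uncovered point, the
first such point determines the move; otherwise the random point does, and a solution is stored if
there is a feasible assignment and the displacement separates the centers. -/
theorem exec_body (P : Fin n → EuclideanSpace ℝ (Fin d)) {σ : Mem} (h : Inv P k K f cap σ)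
    (hd : 1 ≤ d) (hg : Geo k K σ) :
    let τ := body.exec (inputArray P) σ
    Inv P k K f cap τ ∧ Geo k K τ ∧ τ.R Rg = σ.R Rg ∧ τ.R Rrad = σ.R Rrad ∧
      (∀ x, Succ x σ → Succ x τ) ∧
      ((∀ q, σ.N Nq 0 = q → q < k → ∀ u : Fin n,
          (∀ q < k, ¬ covers (inputArray P) d σ u q) →
          (∀ i < (u : ℕ), ∃ q < k, covers (inputArray P) d σ i q) → Moved P k K u q σ τ) ∧
        ((∀ i < n, ∃ q < k, covers (inputArray P) d σ i q) →
          (∀ q, σ.N Nq 0 = q → q < k → ∀ p : Fin n, σ.N Np 0 = p → Moved P k K p q σ τ) ∧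
          ((k + 1) * (k * k) + k < f → Feasible n k cap (covers (inputArray P) d σ) →
            (∀ q < k, ∀ r < k, q < r → dispC d k K f σ q ≠ dispC d k K f σ r) →
            Succ (∑ q ∈ Finset.range k, dispR k K f σ q) τ))) := by
  obtain ⟨hpar, hbest⟩ := h
  simp only [body, Cmd.exec_seq]
  have hcov := exec_coverage (I := inputArray P) hpar
  have f1 := Cmd.exec_frame (I := inputArray P) (s := coverage) rfl σ
  set σ₁ := coverage.exec (inputArray P) σ
  clear_value σ₁
  have h₁ := hpar.frame f1
  have R₁ : ∀ x, x ≠ Rz → σ₁.R x = σ.R x := fun x hx => f1.R x (by simpa [coverage, sqDist, Cmd.writesR] using hx)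
  have b₁ : Best P k cap σ₁ := hbest.of_eq (f1.N _ (by decide)) (f1.N _ (by decide))
    (R₁ _ (by decide)) (R₁ _ (by decide)) (R₁ _ (by decide))
  have s₁ : ∀ x, Succ x σ → Succ x σ₁ := fun x hx => hx.of_eq (f1.N _ (by decide)) (R₁ _ (by decide))
  have g₁ : Geo k K σ₁ := hg.of_eq (R₁ _ (by decide)) (R₁ _ (by decide)) (R₁ _ (by decide))
  have c₁ : covers (inputArray P) d σ₁ = covers (inputArray P) d σ :=
    covers_congr (R₁ _ (by decide)) (R₁ _ (by decide))
  -- the middle part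
  have mid : ∃ σ₂, (Cmd.ifz (.sub (nv Nn) (nv Nu)) (flow ;; attempt) .skip).exec (inputArray P) σ₁ =
      σ₂ ∧ Best P k cap σ₂ ∧ (∀ x, Succ x σ → Succ x σ₂) ∧
      (∀ x, x ∉ flow.writesN → x ∉ attempt.writesN → σ₂.N x = σ₁.N x) ∧
      (∀ x, x ∉ flow.writesR → x ∉ attempt.writesR → σ₂.R x = σ₁.R x) ∧
      ((∀ i < n, ∃ q < k, covers (inputArray P) d σ i q) → σ₁.N Nu 0 = n ∧
        ((k + 1) * (k * k) + k < f → Feasible n k cap (covers (inputArray P) d σ) →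
            (∀ q < k, ∀ r < k, q < r → dispC d k K f σ q ≠ dispC d k K f σ r) →
            Succ (∑ q ∈ Finset.range k, dispR k K f σ q) σ₂)) := by
    refine ⟨_, rfl, ?_⟩
    rw [Cmd.exec_ifz]
    simp only [NExpr.eval, h₁.hn]
    obtain ⟨hu, ha⟩ | ⟨hu, hnc, -⟩ := hcov
    swap
    · rw [if_neg (by omega), Cmd.exec_skip]
      refine ⟨b₁, s₁, fun _ _ _ => rfl, fun _ _ _ => rfl, fun hall => ?_⟩
      obtain ⟨q, hq, hc⟩ := hall _ hu
      exact absurd hc (hnc q hq)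
    · rw [if_pos (by omega), Cmd.exec_seq]
      rw [← c₁] at ha
      obtain ⟨a1, a2, a3⟩ := exec_flow (I := inputArray P) h₁ ha
      have f2 := Cmd.exec_frame (I := inputArray P) (s := flow) rfl σ₁
      set σ₂ := flow.exec (inputArray P) σ₁
      clear_value σ₂
      have h₂ := h₁.frame f2
      have R₂ : ∀ x, x ≠ Rz → σ₂.R x = σ₁.R x := fun x hx =>
        f2.R x (by simpa [flow, flowInit, visit, relabel, sqDist, Cmd.writesR] using hx)
      have b₂ : Best P k cap σ₂ := b₁.of_eq (f2.N _ (by decide)) (f2.N _ (by decide))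
        (R₂ _ (by decide)) (R₂ _ (by decide)) (R₂ _ (by decide))
      have s₂ : ∀ x, Succ x σ → Succ x σ₂ := fun x hx =>
        (s₁ x hx).of_eq (f2.N _ (by decide)) (R₂ _ (by decide))
      have g₂ : Geo k K σ₂ := g₁.of_eq (R₂ _ (by decide)) (R₂ _ (by decide)) (R₂ _ (by decide))
      have c₂ : covers (inputArray P) d σ₂ = covers (inputArray P) d σ₁ :=
        covers_congr (R₂ _ (by decide)) (R₂ _ (by decide))
      obtain ⟨t1, t2, t3⟩ := exec_attempt P h₂ hd g₂ a2 (by rw [c₂]; exact a1) b₂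
      have f3 := Cmd.exec_frame (I := inputArray P) (s := attempt) rfl σ₂
      refine ⟨t1, fun x hx => t2 x (s₂ x hx), fun x h1 h2 => by rw [f3.N x h2, f2.N x h1],
        fun x h1 h2 => by rw [f3.R x h2, f2.R x h1], fun _ => ⟨hu, fun hf hfeas hne => ?_⟩⟩
      have es : σ₂.N Ns = σ.N Ns := by rw [f2.N _ (by decide), f1.N _ (by decide)]
      have eC : dispC d k K f σ₂ = dispC d k K f σ := by
        funext q
        simp only [dispC, es, R₂ RC (by decide), R₁ RC (by decide), R₂ Rg (by decide), R₁ Rg (by decide)]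
      have eD : dispR k K f σ₂ = dispR k K f σ := by
        funext q
        simp only [dispR, es, R₂ Rrad (by decide), R₁ Rrad (by decide), R₂ Rg (by decide),
          R₁ Rg (by decide)]
      rw [eC, eD] at t3
      exact t3 (a3 (by rw [c₁]; exact hfeas) hf) hne
  obtain ⟨σ₂, e2, b₂, s₂, N₂, R₂, k₂⟩ := mid
  rw [e2]
  have h₂ : Par n d k K f cap σ₂ := h₁.of_eq fun x hx => by
    refine N₂ x ?_ ?_ <;> revert x <;> decide
  have R₂' : ∀ x, x ∉ flow.writesR → x ∉ attempt.writesR → x ≠ Rz → σ₂.R x = σ.R x :=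
    fun x h1 h2 h3 => by rw [R₂ x h1 h2, R₁ x h3]
  have g₂ : Geo k K σ₂ := hg.of_eq (R₂' _ (by decide) (by decide) (by decide))
    (R₂' _ (by decide) (by decide) (by decide)) (R₂' _ (by decide) (by decide) (by decide))
  obtain ⟨u1, u2⟩ := exec_update P h₂ g₂
  have f3 := Cmd.exec_frame (I := inputArray P) (s := update) rfl σ₂
  set τ := update.exec (inputArray P) σ₂
  clear_value τ
  have moved : ∀ p q, Moved P k K p q σ₂ τ → Moved P k K p q σ τ := by
    rintro p q ⟨m1, m2, m3, m4⟩
    rw [R₂' RC (by decide) (by decide) (by decide)] at m1 m2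
    rw [R₂' RT (by decide) (by decide) (by decide)] at m1 m2
    rw [R₂' Rsq (by decide) (by decide) (by decide)] at m2
    rw [R₂' Rrad (by decide) (by decide) (by decide)] at m4
    exact ⟨m1, m2, m3, m4⟩
  have eu : σ₂.N Nu 0 = σ₁.N Nu 0 := by rw [N₂ _ (by decide) (by decide)]
  have eq : σ₂.N Nq 0 = σ.N Nq 0 := by rw [N₂ _ (by decide) (by decide), f1.N _ (by decide)]
  have ep : σ₂.N Np 0 = σ.N Np 0 := by rw [N₂ _ (by decide) (by decide), f1.N _ (by decide)]
  refine ⟨⟨h₂.frame f3, b₂.of_eq (f3.N _ (by decide)) (f3.N _ (by decide)) (f3.R _ (by decide))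
    (f3.R _ (by decide)) (f3.R _ (by decide))⟩, u1, ?_, ?_, fun x hx =>
    (s₂ x hx).of_eq (f3.N _ (by decide)) (f3.R _ (by decide)), ?_, ?_⟩
  · rw [f3.R _ (by decide), R₂' _ (by decide) (by decide) (by decide)]
  · rw [f3.R _ (by decide), R₂' _ (by decide) (by decide) (by decide)]
  · intro q hq hqk u hu hlt
    refine moved _ _ (u2 u ?_ q (by rw [eq, hq]) hqk)
    rw [eu]
    obtain ⟨hn, ha⟩ | ⟨hn, hnc, hc⟩ := hcov
    · exact absurd (ha u u.2).2 (hu _ (ha u u.2).1)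
    · rw [if_pos hn]
      refine le_antisymm ?_ ?_
      · by_contra hlt'
        obtain ⟨q', hq', hc'⟩ := hlt _ (not_le.1 hlt')
        exact hnc q' hq' hc'
      · by_contra hlt'
        obtain ⟨q', hq', hc'⟩ := hc _ (not_le.1 hlt')
        exact hu q' hq' hc'
  · intro hall
    obtain ⟨k1, k2⟩ := k₂ hall
    refine ⟨fun q hq hqk p hp => moved _ _ (u2 p ?_ q (by rw [eq, hq]) hqk), fun h1 h2 h3 =>
      (k2 h1 h2 h3).of_eq (f3.N _ (by decide)) (f3.R _ (by decide))⟩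
    rw [eu, k1, if_neg (by omega), ep, hp]

end

section

variable {n d k K f cap : ℕ}

/-! ### Geometry -/

/-- Stewart's theorem for a point of the line through `c` and `p`. -/
theorem sq_dist_move {E : Type*} [NormedAddCommGroup E] [InnerProductSpace ℝ E] (c p z : E)
    (t : ℝ) : dist (c + t • (p - c)) z ^ 2 =
      (1 - t) * dist c z ^ 2 + t * dist p z ^ 2 - t * (1 - t) * dist p c ^ 2 := by
  have h1 : c + t • (p - c) - z = (1 - t) • (c - z) + t • (p - z) := by module
  have h2 : p - c = (p - z) - (c - z) := by abel
  rw [dist_eq_norm, dist_eq_norm, dist_eq_norm, dist_eq_norm, h1, h2]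
  generalize c - z = u
  generalize p - z = v
  rw [norm_add_sq_real, norm_sub_sq_real, norm_smul, norm_smul, mul_pow, mul_pow, inner_smul_left,
    inner_smul_right, real_inner_comm u]
  simp only [Real.norm_eq_abs, sq_abs, conj_trivial]
  ring

/-- A point in the ball around `z` that is far from the center `c` decreases the potential. -/
theorem potential_move {E : Type*} [NormedAddCommGroup E] [InnerProductSpace ℝ E] {c p z : E}
    {ρ : ℝ} (hK : 1 ≤ K) (hz : dist p z ≤ ρ) (hc : ((1 + 1 / (K : ℝ)) * ρ) ^ 2 ≤ dist p c ^ 2) :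
    dist (c + (1 / (2 * K : ℝ)) • (p - c)) z ^ 2 + 1 / (2 * K) * ρ ^ 2 ≤
      (1 - 1 / (2 * K)) * (dist c z ^ 2 + 1 / (2 * K) * ρ ^ 2) := by
  have hK' : (1 : ℝ) ≤ K := by exact_mod_cast hK
  obtain ⟨e, he⟩ : ∃ e : ℝ, e = 1 / K := ⟨_, rfl⟩
  have e0 : 0 < e := by rw [he]; positivity
  have e1 : e ≤ 1 := by
    rw [he, div_le_one (by linarith)]
    exact hK'
  have ht : 1 / (2 * K : ℝ) = e / 2 := by rw [he]; field_simp
  rw [sq_dist_move, ht]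
  rw [← he] at hc
  have h1 : dist p z ^ 2 ≤ ρ ^ 2 := by
    have := dist_nonneg (x := p) (y := z)
    gcongr
  have h2 : e / 2 * (1 - e / 2) * ((1 + e) * ρ) ^ 2 ≤ e / 2 * (1 - e / 2) * dist p c ^ 2 :=
    mul_le_mul_of_nonneg_left hc (by nlinarith)
  have h3 : e / 2 * dist p z ^ 2 ≤ e / 2 * ρ ^ 2 := mul_le_mul_of_nonneg_left h1 (by linarith)
  -- With the bounds for `dist p z` and `dist p c` inserted, the slack of the claim is half of this
  -- quantity. The factor `1 + e` in the radius is what makes it nonnegative.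
  have h4 : 0 ≤ e ^ 2 * (1 - e ^ 2 / 2) * ρ ^ 2 := by
    have : 0 ≤ 1 - e ^ 2 / 2 := by nlinarith
    positivity
  nlinarith

/-- The potential cannot decrease too often. -/
theorem potential_steps {b m : ℕ} {x ρ : ℝ} (hK : 1 ≤ K) (hb : K ≤ 2 ^ b) (hρ : 0 < ρ)
    (h : x ^ 2 + 1 / (2 * K) * ρ ^ 2 ≤ (1 - 1 / (2 * K : ℝ)) ^ m * ((1 + 1 / (2 * K)) * ρ ^ 2)) :
    m < 2 * K * (b + 2) := by
  by_contra! hm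
  have hK' : (1 : ℝ) ≤ K := by exact_mod_cast hK
  obtain ⟨t, ht⟩ : ∃ t : ℝ, t = 1 / (2 * K) := ⟨_, rfl⟩
  have t0 : 0 < t := by rw [ht]; positivity
  have t1 : t ≤ 1 / 2 := by
    rw [ht, div_le_div_iff₀ (by linarith) (by norm_num)]
    linarith
  have htK : t * (2 * K) = 1 := by rw [ht]; field_simp
  rw [← ht] at h
  have h1 : (1 - t) ^ (2 * K) ≤ 1 / 2 := by
    have := Real.one_sub_div_pow_le_exp_neg (n := 2 * K) (t := 1) (by push_cast; linarith)
    push_cast at this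
    rw [← ht] at this
    exact this.trans Real.exp_neg_one_lt_half.le
  -- Each block of `2 * K` moves at least halves the upper bound of the potential.
  have h2 : (1 - t) ^ m ≤ (1 / 2) ^ (b + 2) := by
    calc (1 - t) ^ m ≤ (1 - t) ^ (2 * K * (b + 2)) :=
          pow_le_pow_of_le_one (by linarith) (by linarith) hm
      _ = ((1 - t) ^ (2 * K)) ^ (b + 2) := by rw [pow_mul]
      _ ≤ (1 / 2) ^ (b + 2) := pow_le_pow_left₀ (pow_nonneg (by linarith) _) h1 _
  have h3 : (1 / 2 : ℝ) ^ (b + 2) ≤ t / 2 := by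
    have hb' : (K : ℝ) ≤ 2 ^ b := by exact_mod_cast hb
    have : (1 / 2 : ℝ) ^ (b + 2) * 2 ^ b = 1 / 4 := by
      rw [pow_add, mul_right_comm, ← mul_pow]
      norm_num
    have h4 : (1 / 2 : ℝ) ^ (b + 2) * K ≤ 1 / 4 := by
      rw [← this]
      gcongr
    nlinarith
  have hρ2 : 0 < ρ ^ 2 := by positivity
  have h5 : (1 - t) ^ m * ((1 + t) * ρ ^ 2) ≤ t / 2 * ((1 + t) * ρ ^ 2) :=
    mul_le_mul_of_nonneg_right (h2.trans h3) (by positivity)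
  -- The potential is at least `t * ρ ^ 2`, but by `h5` it is at most `t / 2 * (1 + t) * ρ ^ 2`,
  -- which is smaller.
  nlinarith [sq_nonneg x, mul_pos t0 hρ2]

/-! ### Targets of the search -/

/-- A clustering that the search can find: the radii `ρ`, the centers `c` and the clusters `o`. -/
structure Target (P : Fin n → EuclideanSpace ℝ (Fin d)) (k U : ℕ) (ρ : ℕ → ℝ)
    (c : ℕ → EuclideanSpace ℝ (Fin d)) (o : Fin n → ℕ) : Prop where
  lt : ∀ i, o i < k
  pos : ∀ q < k, 0 < ρ q
  dist_le : ∀ i, dist (P i) (c (o i)) ≤ ρ (o i)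
  card_le : ∀ q < k, (Finset.univ.filter fun i => o i = q).card ≤ U

/-- This relates `n` to the capacity: more than `U / (k * K)` points make up more than a fraction `1
/ (k ^ 2 * K)` of all points. -/
theorem Target.le_mul {P : Fin n → EuclideanSpace ℝ (Fin d)} {U : ℕ} {ρ : ℕ → ℝ}
    {c : ℕ → EuclideanSpace ℝ (Fin d)} {o : Fin n → ℕ} (h : Target P k U ρ c o) : n ≤ k * U := by
  calc n = (Finset.univ : Finset (Fin n)).card := by simp
    _ = ∑ q ∈ Finset.range k, (Finset.univ.filter fun i => o i = q).card :=
        Finset.card_eq_sum_card_fiberwise fun i _ => by simpa using h.lt i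
    _ ≤ ∑ q ∈ Finset.range k, U := Finset.sum_le_sum fun q hq => h.card_le q (by simpa using hq)
    _ = k * U := by simp

/-- If few points are outside of their balls then there is a good assignment. -/
theorem Target.feasible {P : Fin n → EuclideanSpace ℝ (Fin d)} {U : ℕ} {ρ : ℕ → ℝ}
    {c : ℕ → EuclideanSpace ℝ (Fin d)} {o : Fin n → ℕ} (h : Target P k U ρ c o) (hK : 1 ≤ K)
    {Cov : ℕ → ℕ → Prop} (hall : ∀ i < n, ∃ q < k, Cov i q)
    (hcap : ∀ m ≤ n, (m : ℝ) ≤ (1 + 1 / (K : ℝ)) * U → m ≤ cap)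
    (hfew : ∀ q < k,
      {i | o i = q ∧ ¬ Cov i q}.ncard * (k * K) ≤ U) : Feasible n k cap Cov := by
  classical
  choose! b hb using hall
  -- Points inside the ball of their own cluster stay there; the others go to any ball that covers
  -- them.
  obtain ⟨a, ha⟩ : ∃ a : ℕ → ℕ, ∀ i : Fin n, a i = if Cov i (o i) then o i else b i :=
    ⟨fun i => if hi : i < n then (if Cov i (o ⟨i, hi⟩) then o ⟨i, hi⟩ else b i) else 0, fun i => by
      simp [i.2]⟩
  refine ⟨a, fun i hi => ?_, fun q hq => hcap _ (load_le n a q) ?_⟩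
  · have := ha ⟨i, hi⟩
    simp only at this
    rw [this]
    split_ifs with hc
    · exact ⟨h.lt _, hc⟩
    · exact hb i hi
  have hk : 0 < k := by omega
  have e1 : load n a q = (Finset.univ.filter fun i : Fin n => a i = q).card := by
    rw [load]
    symm
    refine Finset.card_bij (fun i _ => (i : ℕ)) ?_ (fun _ _ _ _ h => Fin.ext h) ?_
    · intro i hi
      simpa using hi
    · intro i hi
      simp only [Finset.mem_filter, Finset.mem_range] at hi
      exact ⟨⟨i, hi.1⟩, by simp [hi.2], rfl⟩
  have e2 : (Finset.univ.filter fun i : Fin n => a i = q) ⊆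
      (Finset.univ.filter fun i => o i = q) ∪
        (Finset.range k).biUnion fun r => Finset.univ.filter fun i => o i = r ∧ ¬ Cov i r := by
    intro i hi
    simp only [Finset.mem_filter, Finset.mem_univ, true_and] at hi
    rw [ha] at hi
    simp only [Finset.mem_union, Finset.mem_biUnion, Finset.mem_filter, Finset.mem_univ, true_and,
      Finset.mem_range]
    split_ifs at hi with hc
    · exact .inl hi
    · exact .inr ⟨o i, h.lt i, rfl, hc⟩
  have e3 : ∀ r < k, (((Finset.univ.filter fun i => o i = r ∧ ¬ Cov i r).card : ℕ) : ℝ) ≤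
      U / (k * K) := by
    intro r hr
    have := hfew r hr
    rw [Set.ncard_eq_toFinset_card', Set.toFinset_ofPred] at this
    rw [le_div_iff₀ (by positivity)]
    exact_mod_cast this
  -- In the worst case the ball receives its own cluster and all exceptional points, at most `U / (k
  -- * K)` from each of the `k` clusters.
  have e4 : (load n a q : ℝ) ≤ U + ∑ r ∈ Finset.range k, (U : ℝ) / (k * K) := by
    have : load n a q ≤ U + ∑ r ∈ Finset.range k,
        (Finset.univ.filter fun i => o i = r ∧ ¬ Cov i r).card := by
      rw [e1]
      refine (Finset.card_le_card e2).trans ((Finset.card_union_le _ _).trans ?_)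
      exact add_le_add (h.card_le q hq) Finset.card_biUnion_le
    calc (load n a q : ℝ) ≤ U + ∑ r ∈ Finset.range k,
        (((Finset.univ.filter fun i => o i = r ∧ ¬ Cov i r).card : ℕ) : ℝ) := by exact_mod_cast this
      _ ≤ _ := by
        gcongr with r hr
        exact e3 r (by simpa using hr)
  refine e4.trans (le_of_eq ?_)
  rw [Finset.sum_const, Finset.card_range, nsmul_eq_mul]
  field_simp

/-- Most displacements lead to distinct first coordinates. -/
theorem card_good_shift (C : ℕ → ℝ) {η : ℝ} (hη : η ≠ 0) (hf : 2 * (k * k) ≤ f + 1) :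
    ∃ S : Finset ℕ, (∀ s ∈ S, s ≤ f ∧ ∀ q < k, ∀ r < k, q < r →
      C q + (s : ℝ) * q * η ≠ C r + (s : ℝ) * r * η) ∧ f + 1 ≤ 2 * S.card := by
  classical
  refine ⟨(Finset.range (f + 1)).filter fun s => ∀ q < k, ∀ r < k, q < r →
      C q + (s : ℝ) * q * η ≠ C r + (s : ℝ) * r * η, fun s hs => ?_, ?_⟩
  · simp only [Finset.mem_filter, Finset.mem_range] at hs
    exact ⟨by omega, hs.2⟩
  have h1 := Finset.card_filter_add_card_filter_not (s := Finset.range (f + 1)) fun s : ℕ =>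
    ∀ q < k, ∀ r < k, q < r → C q + (s : ℝ) * q * η ≠ C r + (s : ℝ) * r * η
  have h2 : ((Finset.range (f + 1)).filter fun s : ℕ => ¬ ∀ q < k, ∀ r < k, q < r →
      C q + (s : ℝ) * q * η ≠ C r + (s : ℝ) * r * η).card ≤ k * k := by
    have hsub : ((Finset.range (f + 1)).filter fun s : ℕ => ¬ ∀ q < k, ∀ r < k, q < r →
      C q + (s : ℝ) * q * η ≠ C r + (s : ℝ) * r * η) ⊆
        (Finset.range k ×ˢ Finset.range k).biUnion fun x => (Finset.range (f + 1)).filter fun s : ℕ =>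
          x.1 < x.2 ∧ C x.1 + (s : ℝ) * x.1 * η = C x.2 + (s : ℝ) * x.2 * η := by
      intro s hs
      simp only [Finset.mem_filter] at hs
      obtain ⟨h1, h2⟩ := hs
      push Not at h2
      obtain ⟨q, hq, r, hr, hqr, he⟩ := h2
      simp only [Finset.mem_biUnion, Finset.mem_product, Finset.mem_range, Finset.mem_filter]
      exact ⟨(q, r), ⟨hq, hr⟩, by simpa using h1, hqr, he⟩
    -- For a fixed pair `q < r` the coincidence is a linear equation in `s` with slope `(r - q) * η
    -- ≠ 0`, so at most one `s` is bad.
    refine (Finset.card_le_card hsub).trans ((Finset.card_biUnion_le_card_mul _ _ 1 ?_).trans ?_)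
    · rintro ⟨q, r⟩ -
      rw [Finset.card_le_one]
      intro s hs s' hs'
      simp only [Finset.mem_filter] at hs hs'
      obtain ⟨-, hqr, he⟩ := hs
      obtain ⟨-, -, he'⟩ := hs'
      have hqr' : (q : ℝ) < r := by exact_mod_cast hqr
      have : ((s : ℝ) - s') * ((r - q) * η) = 0 := by linear_combination he' - he
      rcases mul_eq_zero.1 this with h | h
      · exact_mod_cast sub_eq_zero.1 h
      · rcases mul_eq_zero.1 h with h | h
        · linarith
        · exact absurd h hη
    · simp
  rw [Finset.card_range] at h1
  omega

end

/-! ### Existence of a cheap target on the grid of radii -/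

section

variable {n d k K f cap : ℕ}

section target

variable {P : Fin n → EuclideanSpace ℝ (Fin d)}

theorem Solution.IsValid.cost_nonneg {S : Solution n d k} {u : ℝ} (h : S.IsValid P u) :
    0 ≤ S.cost := Finset.sum_nonneg fun q _ => h.radius_nonneg q

theorem Solution.IsValid.radius_le_cost {S : Solution n d k} {u : ℝ} (h : S.IsValid P u)
    (q : Fin k) : S.radius q ≤ S.cost :=
  Finset.single_le_sum (fun q _ => h.radius_nonneg q) (Finset.mem_univ q)

theorem Solution.IsValid.dist_le_cost {S : Solution n d k} {u : ℝ} (h : S.IsValid P u) {i j : Fin n}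
    (hij : S.assign i = S.assign j) : dist (P i) (P j) ≤ 2 * S.cost := by
  have h1 := h.dist_le i
  have h2 := h.dist_le j
  have h3 := h.radius_le_cost (S.assign j)
  rw [hij] at h1
  have h4 := dist_triangle_right (P i) (P j) (S.center (S.assign j))
  linarith

/-- If there are more points than balls then the optimum is positive. -/
theorem OPT_pos (hP : Function.Injective P) (hkn : k < n) {u : ℝ}
    (hS : ∃ S : Solution n d k, S.IsValid P u) : 0 < OPT P k u := by
  obtain ⟨δ, hδ, hmin⟩ : ∃ δ > 0, ∀ i j, i ≠ j → δ ≤ dist (P i) (P j) := by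
    have hne : (Finset.univ.filter fun x : Fin n × Fin n => x.1 ≠ x.2).Nonempty ∨ n ≤ 1 := by
      by_cases h : n ≤ 1
      · exact .inr h
      · exact .inl ⟨(⟨0, by omega⟩, ⟨1, by omega⟩), by simp⟩
    obtain hne | hn := hne
    · obtain ⟨x, hx, hmin⟩ := Finset.exists_min_image _ (fun x : Fin n × Fin n => dist (P x.1) (P x.2)) hne
      refine ⟨_, dist_pos.2 fun h => (Finset.mem_filter.1 hx).2 (hP h), fun i j hij => ?_⟩
      exact hmin (i, j) (by simpa using hij)
    · exact ⟨1, one_pos, fun i j hij => absurd (Fin.ext (by omega)) hij⟩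
  -- By the pigeonhole principle two points share a ball, whose radius is then at least half of
  -- their distance.
  have : δ / 2 ≤ OPT P k u := by
    refine le_csInf ?_ ?_
    · obtain ⟨S, hS⟩ := hS
      exact ⟨_, S, hS, rfl⟩
    · rintro _ ⟨S, hS, rfl⟩
      obtain ⟨i, j, hij, he⟩ := Fintype.exists_ne_map_eq_of_card_lt S.assign (by simpa using hkn)
      have := hmin i j hij
      have := hS.dist_le_cost he
      linarith
  linarith

/-- The solution of radius at most the diameter of a cluster. -/
theorem exists_small_radii {S : Solution n d k} {U : ℕ} (h : S.IsValid P U) {D : ℝ}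
    (hdiam : ∀ i j, S.assign i = S.assign j → dist (P i) (P j) ≤ D) :
    ∃ c : Fin k → EuclideanSpace ℝ (Fin d),
      ∀ i, dist (P i) (c (S.assign i)) ≤ min (S.radius (S.assign i)) D := by
  classical
  -- A used ball whose radius exceeds `D` is recentred at one of its own points; then the radius `D`
  -- suffices.
  refine ⟨fun q => if hq : ∃ i, D < S.radius q ∧ S.assign i = q then P hq.choose else S.center q,
    fun i => ?_⟩
  simp only
  split_ifs with hq
  · have := hq.choose_spec
    rw [min_eq_right this.1.le]
    exact hdiam _ _ this.2.symm
  · have : S.radius (S.assign i) ≤ D := by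
      by_contra hlt
      exact hq ⟨i, not_le.1 hlt, rfl⟩
    rw [min_eq_left this]
    exact h.dist_le i

/-- The scale `D` is the largest distance of two points with a common ball; it is positive since `k
< n`. Cutting the radii at `D` puts them into the range of the grid. Rounding costs `D / (k * K)`
per ball, hence `D / K` in total, and the summand `D / K` in the conclusion pays for the
displacement of the centers. Both are small because `D` is at most twice the cost. -/
theorem exists_target (hP : Function.Injective P) (hkn : k < n) (hK : 16 ≤ K) {U : ℕ}
    (hS : ∃ S : Solution n d k, S.IsValid P (U : ℝ)) :
    ∃ (a b : Fin n) (ρ : ℕ → ℝ) (c : ℕ → EuclideanSpace ℝ (Fin d)) (o : Fin n → ℕ),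
      Target P k U ρ c o ∧ 0 < dist (P a) (P b) ∧
      (∀ q < k, ∃ j ≤ k * K, ρ q = dist (P a) (P b) * (((j + 1 : ℕ) : ℝ) / ((k * K : ℕ) : ℝ))) ∧
      (1 + 1 / (K : ℝ)) * ∑ q ∈ Finset.range k, ρ q + dist (P a) (P b) / K ≤
        (1 + 16 / K) * OPT P k (U : ℝ) := by
  classical
  have hO := OPT_pos hP hkn hS
  have hK' : (16 : ℝ) ≤ K := by exact_mod_cast hK
  obtain ⟨e, he⟩ : ∃ e : ℝ, e = 1 / K := ⟨_, rfl⟩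
  have e0 : 0 < e := by rw [he]; positivity
  have e1 : e ≤ 1 / 16 := by
    rw [he]
    exact one_div_le_one_div_of_le (by norm_num) hK'
  -- a nearly optimal solution
  obtain ⟨S, hS, hcost⟩ : ∃ S : Solution n d k, S.IsValid P (U : ℝ) ∧
      S.cost ≤ (1 + e) * OPT P k (U : ℝ) := by
    obtain ⟨x, ⟨S, hS, rfl⟩, hx⟩ := exists_lt_of_csInf_lt
      (s := {c : ℝ | ∃ S : Solution n d k, S.IsValid P (U : ℝ) ∧ S.cost = c})
      (b := (1 + e) * OPT P k (U : ℝ)) (by obtain ⟨S, hS⟩ := hS; exact ⟨_, S, hS, rfl⟩)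
      (show OPT P k (U : ℝ) < _ by nlinarith)
    exact ⟨S, hS, hx.le⟩
  -- the diameter of the clusters
  obtain ⟨i₀, j₀, hij, hassign⟩ := Fintype.exists_ne_map_eq_of_card_lt S.assign (by simpa using hkn)
  obtain ⟨⟨a, b⟩, hab, hmax⟩ := Finset.exists_max_image
    (Finset.univ.filter fun x : Fin n × Fin n => S.assign x.1 = S.assign x.2)
    (fun x => dist (P x.1) (P x.2)) ⟨(i₀, j₀), by simpa using hassign⟩
  simp only [Finset.mem_filter, Finset.mem_univ, true_and] at hab hmax
  obtain ⟨D, hDdef⟩ : ∃ D, D = dist (P a) (P b) := ⟨_, rfl⟩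
  have hD : 0 < D := by
    have h1 : 0 < dist (P i₀) (P j₀) := dist_pos.2 fun h => hij (hP h)
    have := hmax (i₀, j₀) hassign
    rw [hDdef]
    linarith
  have hDcost : D ≤ 2 * S.cost := by
    rw [hDdef]
    exact hS.dist_le_cost hab
  obtain ⟨c, hc⟩ := exists_small_radii (D := D) hS fun i j h => by
    rw [hDdef]
    exact hmax (i, j) h
  have hk : 0 < k := (S.assign i₀).pos
  have hkK : (0 : ℝ) < ((k * K : ℕ) : ℝ) := by
    have : 0 < k * K := Nat.mul_pos hk (by omega)
    exact_mod_cast this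
  -- rounding
  obtain ⟨m, hm⟩ : ∃ m : ℕ → ℝ, ∀ q : Fin k, m q = min (S.radius q) D :=
    ⟨fun q => if hq : q < k then min (S.radius ⟨q, hq⟩) D else 0, fun q => by simp⟩
  have hm0 : ∀ q < k, 0 ≤ m q ∧ m q ≤ D := fun q hq => by
    rw [hm ⟨q, hq⟩]
    exact ⟨le_min (hS.radius_nonneg _) hD.le, min_le_right _ _⟩
  -- Adding one to the floor rounds up, and also makes every radius positive.
  let j : ℕ → ℕ := fun q => ⌊m q * ((k * K : ℕ) : ℝ) / D⌋₊
  let ρ : ℕ → ℝ := fun q => D * (((j q + 1 : ℕ) : ℝ) / ((k * K : ℕ) : ℝ))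
  have hρ : ∀ q < k, m q ≤ ρ q ∧ ρ q ≤ m q + D / ((k * K : ℕ) : ℝ) := by
    intro q hq
    have h1 : m q * ((k * K : ℕ) : ℝ) / D < j q + 1 := Nat.lt_floor_add_one _
    have h2 : (j q : ℝ) ≤ m q * ((k * K : ℕ) : ℝ) / D :=
      Nat.floor_le (by have := (hm0 q hq).1; positivity)
    rw [div_lt_iff₀ hD] at h1
    rw [le_div_iff₀ hD] at h2
    have e : ρ q = (j q + 1) * D / ((k * K : ℕ) : ℝ) := by
      simp only [ρ]
      push_cast
      ring
    rw [e]
    refine ⟨(le_div_iff₀ hkK).2 h1.le, ?_⟩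
    rw [div_le_iff₀ hkK, add_mul (m q), div_mul_cancel₀ _ hkK.ne']
    linarith
  have hsum : ∑ q ∈ Finset.range k, ρ q ≤ S.cost + D * e := by
    calc ∑ q ∈ Finset.range k, ρ q ≤ ∑ q ∈ Finset.range k, (m q + D / ((k * K : ℕ) : ℝ)) :=
          Finset.sum_le_sum fun q hq => (hρ q (by simpa using hq)).2
      _ = ∑ q ∈ Finset.range k, m q + D * e := by
          rw [Finset.sum_add_distrib, Finset.sum_const, Finset.card_range, nsmul_eq_mul, he]
          have : (k : ℝ) ≠ 0 := by exact_mod_cast hk.ne'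
          push_cast
          field_simp
      _ ≤ S.cost + D * e := by
          gcongr
          rw [Finset.sum_range, Solution.cost]
          exact Finset.sum_le_sum fun q _ => by rw [hm]; exact min_le_left _ _
  refine ⟨a, b, ρ, fun q => if hq : q < k then c ⟨q, hq⟩ else 0, fun i => S.assign i,
    ⟨fun i => (S.assign i).2, fun q hq => ?_, fun i => ?_, fun q hq => ?_⟩, ?_, fun q hq =>
    ⟨j q, ?_, ?_⟩, ?_⟩
  · simp only [ρ]
    positivity
  · simp only [Fin.is_lt, dif_pos, Fin.eta]
    refine (hc i).trans ?_
    rw [← hm]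
    exact (hρ _ (S.assign i).2).1
  · have := hS.card_le ⟨q, hq⟩
    simp only [Fin.ext_iff] at this
    exact_mod_cast this
  · rwa [← hDdef]
  · refine Nat.floor_le_of_le ?_
    rw [div_le_iff₀ hD, mul_comm]
    exact mul_le_mul_of_nonneg_left (hm0 q hq).2 hkK.le
  · rw [← hDdef]
  · rw [← hDdef, ← he, div_eq_mul_one_div D, ← he, div_eq_mul_one_div 16, ← he]
    have hOe : S.cost * e ≤ (1 + e) * OPT P k (U : ℝ) * e := by gcongr
    have hc0 := hS.cost_nonneg
    -- The factors multiply to `1 + 6 * e + 7 * e ^ 2 + 2 * e ^ 3`, at most `1 + 15 * e`; the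
    -- constant 16 leaves some room.
    calc (1 + e) * ∑ q ∈ Finset.range k, ρ q + D * e ≤ (1 + e) * (S.cost + D * e) + D * e := by gcongr
      _ ≤ (1 + e) * (S.cost + 2 * S.cost * e) + 2 * S.cost * e := by gcongr
      _ = S.cost * (1 + 5 * e + 2 * e ^ 2) := by ring
      _ ≤ (1 + e) * OPT P k (U : ℝ) * (1 + 5 * e + 2 * e ^ 2) := by gcongr
      _ = OPT P k (U : ℝ) * (1 + 6 * e + 7 * e ^ 2 + 2 * e ^ 3) := by ring
      _ ≤ OPT P k (U : ℝ) * (1 + 16 * e) := by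
        refine mul_le_mul_of_nonneg_left ?_ hO.le
        have : e ^ 2 ≤ e := by nlinarith
        have : e ^ 3 ≤ e := by nlinarith [mul_pos e0 e0]
        linarith
      _ = _ := by ring

end target

end

section

open scoped ENNReal

variable {n d k K f cap : ℕ}

/-! ### The success probability -/

open Classical in
/-- A bound on the failure probability: `⊤` if something impossible happens, `0` in case of success,
and `y` otherwise. -/
def val (good done : Prop) (y : ℝ≥0∞) : ℝ≥0∞ := if good then (if done then 0 else y) else ⊤

section val

variable {g g' s s' : Prop} {a y y' : ℝ≥0∞}

theorem le_val (h₁ : g → s → a ≤ 0) (h₂ : g → ¬ s → a ≤ y) : a ≤ val g s y := by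
  unfold val
  split_ifs with hg hs
  · exact h₁ hg hs
  · exact h₂ hg hs
  · exact le_top

theorem val_le (hg : g) (h : ¬ s → y ≤ a) : val g s y ≤ a := by
  unfold val
  rw [if_pos hg]
  split_ifs with hs
  · exact zero_le
  · exact h hs

theorem val_done (hg : g) (hs : s) : val g s y = 0 := by
  rw [val, if_pos hg, if_pos hs]

theorem val_mono (hg : g' → g) (hs : g' → s' → s) (hy : g' → y ≤ y') : val g s y ≤ val g' s' y' :=
  le_val (fun h h' => (val_done (hg h) (hs h h')).le) fun h _ => val_le (hg h) fun _ => hy h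

end val

theorem wp_rand_le {I : ℕ → ℝ} {x M : ℕ} {e : NExpr} {F : Mem → ℝ≥0∞} {σ : Mem} {y : ℝ≥0∞}
    (he : e.eval σ = M) (h : ∀ m ≤ M, F (σ.setN x 0 m) ≤ y) : (Cmd.rand x e).wp I F σ ≤ y := by
  simp only [Cmd.wp, he]
  exact average_le h

theorem wp_rand_le_fail {I : ℕ → ℝ} {x M : ℕ} {e : NExpr} {F : Mem → ℝ≥0∞} {σ : Mem}
    {β θ : ℝ} (he : e.eval σ = M) (S : Finset ℕ) (hS : ∀ m ∈ S, m ≤ M)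
    (hθ : 0 ≤ θ) (hθ1 : θ ≤ 1) (hcard : β * ((M : ℝ) + 1) ≤ S.card)
    (h1 : ∀ m ≤ M, F (σ.setN x 0 m) ≤ 1) (hF : ∀ m ∈ S, F (σ.setN x 0 m) ≤ fail θ) :
    (Cmd.rand x e).wp I F σ ≤ fail (β * θ) := by
  simp only [Cmd.wp, he]
  exact average_le_fail S hS hθ hθ1 hcard h1 hF

theorem Inv.of_eq {P : Fin n → EuclideanSpace ℝ (Fin d)} {σ τ : Mem} (h : Inv P k K f cap σ)
    (hN : ∀ x, x < 12 ∨ x = Nhave ∨ x = Nbest → τ.N x = σ.N x)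
    (hR : ∀ x, x = Rbcost ∨ x = RbC ∨ x = RbR → τ.R x = σ.R x) : Inv P k K f cap τ :=
  ⟨h.par.of_eq fun x hx => hN x (.inl hx), h.best.of_eq (hN _ (by decide)) (hN _ (by decide))
    (hR _ (by decide)) (hR _ (by decide)) (hR _ (by decide))⟩

theorem Mem.setN_N_ne (σ : Mem) {x y : ℕ} (i v : ℕ) (h : y ≠ x) : (σ.setN x i v).N y = σ.N y := by
  funext j
  simp [h]

theorem Mem.setR_R_ne (σ : Mem) {x y : ℕ} (i : ℕ) (v : ℝ) (h : y ≠ x) :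
    (σ.setR x i v).R y = σ.R y := by
  funext j
  simp [h]

theorem Inv.setN {P : Fin n → EuclideanSpace ℝ (Fin d)} {σ : Mem} (h : Inv P k K f cap σ)
    {x : ℕ} (hx : 12 ≤ x) (hx' : x < 32) (i v : ℕ) : Inv P k K f cap (σ.setN x i v) :=
  h.of_eq (fun y hy => σ.setN_N_ne i v (by omega)) fun _ _ => rfl

theorem Succ.setN {y : ℝ} {σ : Mem} (h : Succ y σ) {x : ℕ} (hx' : x < 32) (i v : ℕ) :
    Succ y (σ.setN x i v) :=
  h.of_eq (σ.setN_N_ne i v (by omega)) rfl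

theorem Succ.mono {x y : ℝ} {σ : Mem} (h : Succ x σ) (hxy : x ≤ y) : Succ y σ :=
  ⟨h.1, h.2.trans hxy⟩

/-- The invariant of the steps of a trial. -/
structure StepInv (P : Fin n → EuclideanSpace ℝ (Fin d)) (k K f cap : ℕ) (g : ℝ) (σ : Mem) :
    Prop where
  inv : Inv P k K f cap σ
  geo : Geo k K σ
  g_eq : σ.R Rg 0 = g

theorem StepInv.setN {P : Fin n → EuclideanSpace ℝ (Fin d)} {g : ℝ} {σ : Mem}
    (h : StepInv P k K f cap g σ) {x : ℕ} (hx : 12 ≤ x) (hx' : x < 32) (i v : ℕ) :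
    StepInv P k K f cap g (σ.setN x i v) :=
  ⟨h.inv.setN hx hx' i v, h.geo.of_eq rfl rfl rfl, h.g_eq⟩

/-- All choices of the trial up to its step `t` agree with the target. -/
structure OnTrack (k K : ℕ) (D : ℝ) (ρ : ℕ → ℝ) (c : ℕ → EuclideanSpace ℝ (Fin d)) (t : ℕ)
    (σ : Mem) : Prop where
  g : σ.R Rg 0 = D
  rad : ∀ q < k, σ.R Rrad q = ρ q
  count : ∃ m : ℕ → ℕ, ∑ q ∈ Finset.range k, m q = t ∧ ∀ q < k,
    (m q = 0 ∧ σ.R RT q = 1 ∧ σ.R Rsq q = -1) ∨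
    (∃ l, m q = l + 1 ∧ σ.R RT q = 1 / (2 * K) ∧ σ.R Rsq q = ((1 + 1 / (K : ℝ)) * ρ q) ^ 2 ∧
      dist (rowPoint d (σ.R RC) q) (c q) ^ 2 + 1 / (2 * K) * ρ q ^ 2 ≤
        (1 - 1 / (2 * K : ℝ)) ^ l * ((1 + 1 / (2 * K)) * ρ q ^ 2))

section track

variable {P : Fin n → EuclideanSpace ℝ (Fin d)} {U b : ℕ} {D x : ℝ} {ρ : ℕ → ℝ}
  {c : ℕ → EuclideanSpace ℝ (Fin d)} {o : Fin n → ℕ}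

theorem OnTrack.of_eq {t : ℕ} {σ τ : Mem} (h : OnTrack k K D ρ c t σ) (hR : τ.R = σ.R) :
    OnTrack k K D ρ c t τ :=
  ⟨by rw [hR]; exact h.g, by rw [hR]; exact h.rad, by rw [hR]; exact h.count⟩

/-- A trial can only be on track while every ball has moved at most `2 * K * (b + 2)` times, by
`potential_steps`. -/
theorem OnTrack.le {t : ℕ} {σ : Mem} (h : OnTrack k K D ρ c t σ) (hK : 1 ≤ K) (hb : K ≤ 2 ^ b)
    (hρ : ∀ q < k, 0 < ρ q) : t ≤ k * (2 * K * (b + 2)) := by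
  obtain ⟨m, hm, hcnt⟩ := h.count
  rw [← hm]
  calc ∑ q ∈ Finset.range k, m q ≤ ∑ q ∈ Finset.range k, 2 * K * (b + 2) :=
        Finset.sum_le_sum fun q hq => by
          have hq' : q < k := by simpa using hq
          obtain ⟨h0, -⟩ | ⟨l, hl, -, -, hpot⟩ := hcnt q hq'
          · omega
          · have := potential_steps hK hb (hρ q hq') hpot
            omega
    _ = k * (2 * K * (b + 2)) := by simp

/-- The first move of a ball puts its center at a point of the cluster, where the potential is at
most `(1 + 1 / (2 * K)) * ρ ^ 2`. Every later one multiplies the bound by `1 - 1 / (2 * K)`. -/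
theorem OnTrack.move {t : ℕ} {σ τ : Mem} (h : OnTrack k K D ρ c t σ) (hK : 1 ≤ K)
    (hT : Target P k U ρ c o) {p : Fin n}
    (hp : ¬ covers (inputArray P) d σ p (o p)) (hm : Moved P k K p (o p) σ τ)
    (hg : τ.R Rg = σ.R Rg) (hrad : τ.R Rrad = σ.R Rrad) : OnTrack k K D ρ c (t + 1) τ := by
  obtain ⟨m, hsum, hcnt⟩ := h.count
  have hq := hT.lt p
  refine ⟨by rw [hg]; exact h.g, by rw [hrad]; exact h.rad, Function.update m (o p) (m (o p) + 1),
    ?_, fun q hqk => ?_⟩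
  · rw [Finset.sum_update_of_mem (by simpa using hq), ← hsum,
      ← Finset.add_sum_erase _ m (show o p ∈ Finset.range k by simpa using hq),
      Finset.sdiff_singleton_eq_erase]
    omega
  by_cases hqp : q = o p
  swap
  · obtain ⟨e1, e2, e3⟩ := hm.other q hqk hqp
    rw [Function.update_of_ne hqp, e1, e2, e3]
    exact hcnt q hqk
  subst hqp
  right
  refine ⟨m (o p), by simp, hm.factor, by rw [hm.sq, h.rad _ hq], ?_⟩
  have hdist := hT.dist_le p
  rw [covers_iff, not_le] at hp
  rw [hm.center]
  have hK' : (1 : ℝ) ≤ K := by exact_mod_cast hK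
  obtain ⟨h0, hT1, -⟩ | ⟨l, hl, hTl, hsq, hpot⟩ := hcnt _ hqk
  · rw [hT1, h0, one_smul, add_sub_cancel, pow_zero, one_mul, add_mul, one_mul]
    gcongr
  · rw [hTl, hl, pow_succ' (1 - 1 / (2 * K : ℝ)), mul_assoc (1 - 1 / (2 * K : ℝ))]
    refine (potential_move hK hdist ?_).trans (mul_le_mul_of_nonneg_left hpot ?_)
    · rw [← hsq]
      exact hp.le
    · have : 1 / (2 * K : ℝ) ≤ 1 := by
        rw [div_le_one (by linarith)]
        linarith
      linarith

/-- The probability of a good choice in one step. -/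
def stepProb (k K : ℕ) : ℝ := 1 / (K * (k : ℝ) ^ 3)

/-- A lower bound for the success probability of a trial for the right scale, where `K ≤ 2 ^ b`. -/
def trialProb (k K b : ℕ) : ℝ :=
  (1 / ((k * K : ℕ) + 1)) ^ k * stepProb k K ^ (k * (2 * K * (b + 2)) + 1)

/-- The assumptions on the parameters and the target. -/
structure Setup (P : Fin n → EuclideanSpace ℝ (Fin d)) (k K f cap U b : ℕ) (D x : ℝ) (ρ : ℕ → ℝ)
    (c : ℕ → EuclideanSpace ℝ (Fin d)) (o : Fin n → ℕ) : Prop where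
  target : Target P k U ρ c o
  hn : 1 ≤ n
  hd : 1 ≤ d
  hk : 1 ≤ k
  hK : 2 ≤ K
  hb : K ≤ 2 ^ b
  hD : 0 < D
  hx : (1 + 1 / (K : ℝ)) * ∑ q ∈ Finset.range k, ρ q + D / K ≤ x
  hcap : ∀ m ≤ n, (m : ℝ) ≤ (1 + 1 / (K : ℝ)) * U → m ≤ cap
  flow_lt : (k + 1) * (k * k) + k < f
  steps_lt : k * (2 * K * (b + 2)) < f
  grid : ∀ q < k, ∃ j ≤ k * K, ρ q = D * (((j + 1 : ℕ) : ℝ) / ((k * K : ℕ) : ℝ))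
  amplify : (1 - trialProb k K b) ^ f ≤ 1 / 2

theorem stepProb_pos (hk : 1 ≤ k) (hK : 1 ≤ K) : 0 < stepProb k K := by
  have : (0 : ℝ) < k := by exact_mod_cast hk
  have : (0 : ℝ) < K := by exact_mod_cast hK
  unfold stepProb
  positivity

theorem stepProb_le_inv (hk : 1 ≤ k) (hK : 1 ≤ K) : stepProb k K ≤ 1 / k := by
  have hk' : (1 : ℝ) ≤ k := by exact_mod_cast hk
  have hK' : (1 : ℝ) ≤ K := by exact_mod_cast hK
  refine one_div_le_one_div_of_le (by linarith) ?_
  calc (k : ℝ) = 1 * k ^ 1 := by ring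
    _ ≤ K * k ^ 3 := mul_le_mul hK' (pow_le_pow_right₀ hk' (by norm_num)) (by positivity) (by linarith)

theorem stepProb_le_half (hk : 1 ≤ k) (hK : 2 ≤ K) : stepProb k K ≤ 1 / 2 := by
  have hk' : (1 : ℝ) ≤ k := by exact_mod_cast hk
  have hK' : (2 : ℝ) ≤ K := by exact_mod_cast hK
  refine one_div_le_one_div_of_le (by norm_num) ?_
  calc (2 : ℝ) = 2 * 1 := by ring
    _ ≤ K * k ^ 3 := mul_le_mul hK' (one_le_pow₀ hk') zero_le_one (by linarith)

open Classical in
/-- The bound on the failure probability before step `t`. -/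
def stepVal (P : Fin n → EuclideanSpace ℝ (Fin d)) (k K f cap b : ℕ) (D x g : ℝ) (ρ : ℕ → ℝ)
    (c : ℕ → EuclideanSpace ℝ (Fin d)) (t : ℕ) (σ : Mem) : ℝ≥0∞ :=
  val (StepInv P k K f cap g σ) (Succ x σ) (if OnTrack k K D ρ c t σ then
    fail (stepProb k K ^ (k * (2 * K * (b + 2)) + 1 - t)) else 1)

variable {g : ℝ}

/-- As `s ≤ f` and `q < k`, each displacement is at most `D / (K * k)`; together they cost at most
`D / K`. -/
theorem Setup.sum_dispR_le (h : Setup P k K f cap U b D x ρ c o) {σ : Mem} (hg : σ.R Rg 0 = D)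
    (hrad : ∀ q < k, σ.R Rrad q = ρ q) (hs : σ.N Ns 0 ≤ f) :
    ∑ q ∈ Finset.range k, dispR k K f σ q ≤ x := by
  refine le_trans ?_ h.hx
  have hf : (0 : ℝ) < f := by
    have := h.flow_lt
    exact_mod_cast (by omega : 0 < f)
  have hk : (0 : ℝ) < k := by exact_mod_cast h.hk
  have hK : (0 : ℝ) < K := by exact_mod_cast (by have := h.hK; omega : 0 < K)
  calc ∑ q ∈ Finset.range k, dispR k K f σ q
      ≤ ∑ q ∈ Finset.range k, ((1 + 1 / (K : ℝ)) * ρ q + D / K / k) := by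
        refine Finset.sum_le_sum fun q hq => ?_
        have hq' : q < k := by simpa using hq
        rw [dispR, hrad q hq', hg]
        gcongr
        have h1 : ((σ.N Ns 0 : ℕ) : ℝ) ≤ f := by exact_mod_cast hs
        have h2 : (q : ℝ) ≤ k := by exact_mod_cast hq'.le
        have hD := h.hD
        calc shiftVal k K f D (σ.N Ns 0) q ≤ (f : ℝ) * k * (D / (((K : ℝ) * f) * ((k : ℝ) * k))) := by
              unfold shiftVal
              gcongr
          _ = D / K / k := by field_simp
    _ = _ := by
      rw [Finset.sum_add_distrib, ← Finset.mul_sum, Finset.sum_const, Finset.card_range,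
        nsmul_eq_mul]
      field_simp

/-- While the trial is on track, one choice of sufficient probability either extends the track or
ends in success. The cases are: a point is uncovered; a cluster has many points outside of its ball;
neither holds, and then there is a good assignment. -/
theorem Setup.trialStep_le (h : Setup P k K f cap U b D x ρ c o) (t : ℕ) (σ : Mem) :
    trialStep.wp (inputArray P)
      (fun τ => stepVal P k K f cap b D x g ρ c (t + 1) (τ.setN Vt 0 (t + 1))) σ ≤
      stepVal P k K f cap b D x g ρ c t σ := by
  classical
  have hk := h.hk
  have hK : 1 ≤ K := by have := h.hK; omega
  have hn := h.hn
  have hk' : (0 : ℝ) < k := by exact_mod_cast hk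
  have hK' : (0 : ℝ) < K := by exact_mod_cast hK
  have hβ0 := stepProb_pos hk hK
  have hβ1 := stepProb_le_half hk h.hK
  by_cases hI : StepInv P k K f cap g σ
  swap
  · rw [stepVal, val, if_neg hI]
    exact le_top
  have hpar := hI.inv.par
  obtain ⟨F, hF⟩ : ∃ F : Mem → ℝ≥0∞, F = fun τ => stepVal P k K f cap b D x g ρ c (t + 1)
      (τ.setN Vt 0 (t + 1)) := ⟨_, rfl⟩
  obtain ⟨pre, hpre⟩ : ∃ pre : ℕ → ℕ → ℕ → Mem,
      pre = fun s p q => ((σ.setN Ns 0 s).setN Np 0 p).setN Nq 0 q := ⟨_, rfl⟩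
  have preI : ∀ s p q, StepInv P k K f cap g (pre s p q) := fun s p q => by
    rw [hpre]
    exact ((hI.setN (by norm_num) (by norm_num) _ _).setN (by norm_num) (by norm_num) _ _).setN
      (by norm_num) (by norm_num) _ _
  have preR : ∀ s p q, (pre s p q).R = σ.R := fun s p q => by rw [hpre]; rfl
  have preS : ∀ s p q, (pre s p q).N Ns 0 = s := fun s p q => by rw [hpre]; simp
  have preP : ∀ s p q, (pre s p q).N Np 0 = p := fun s p q => by rw [hpre]; simp
  have preQ : ∀ s p q, (pre s p q).N Nq 0 = q := fun s p q => by rw [hpre]; simp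
  have cov : ∀ s p q, covers (inputArray P) d (pre s p q) = covers (inputArray P) d σ :=
    fun s p q => covers_congr (by rw [preR]) (by rw [preR])
  have hbody := fun s p q => exec_body P (preI s p q).inv h.hd (preI s p q).geo
  -- the three random choices
  have hwp : ∀ (y : ℝ≥0∞), (Cmd.rand Ns (nv Nf)).wp (inputArray P) (fun σ₁ =>
      (Cmd.rand Np (.sub (nv Nn) (.const 1))).wp (inputArray P) (fun σ₂ =>
        (Cmd.rand Nq (.sub (nv Nk) (.const 1))).wp (inputArray P) (fun σ₃ =>
          F (body.exec (inputArray P) σ₃)) σ₂) σ₁) σ ≤ y →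
      trialStep.wp (inputArray P) F σ ≤ y := by
    intro y hy
    refine le_trans (le_of_eq ?_) hy
    simp only [trialStep, Cmd.wp]
    simp only [Cmd.wp_eq_exec (s := body) rfl]
  have evS : (nv Nf).eval σ = f := hpar.hf
  have evP : ∀ s, (NExpr.sub (nv Nn) (.const 1)).eval (σ.setN Ns 0 s) = n - 1 := fun s => by
    simp [NExpr.eval, hpar.hn]
  have evQ : ∀ s p, (NExpr.sub (nv Nk) (.const 1)).eval ((σ.setN Ns 0 s).setN Np 0 p) = k - 1 :=
    fun s p => by simp [NExpr.eval, hpar.hk]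
  have post : ∀ s p q, StepInv P k K f cap g
      ((body.exec (inputArray P) (pre s p q)).setN Vt 0 (t + 1)) := fun s p q => by
    obtain ⟨b1, b2, b3, -⟩ := hbody s p q
    exact StepInv.setN ⟨b1, b2, by rw [b3]; exact (preI s p q).g_eq⟩ (by norm_num) (by norm_num) _ _
  have preEq : ∀ s p q, ((σ.setN Ns 0 s).setN Np 0 p).setN Nq 0 q = pre s p q :=
    fun s p q => by rw [hpre]
  have Fsucc : ∀ s p q, Succ x (body.exec (inputArray P) (pre s p q)) →
      F (body.exec (inputArray P) (pre s p q)) = 0 := fun s p q hs => by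
    rw [hF]
    exact val_done (post s p q) (hs.setN (by norm_num) _ _)
  have F1 : ∀ s p q, F (body.exec (inputArray P) (pre s p q)) ≤ 1 := fun s p q => by
    rw [hF]
    refine val_le (post s p q) fun _ => ?_
    split_ifs
    · exact fail_le_one (by positivity)
    · exact le_rfl
  have Fmove : ∀ s p q, OnTrack k K D ρ c (t + 1) (body.exec (inputArray P) (pre s p q)) →
      F (body.exec (inputArray P) (pre s p q)) ≤
        fail (stepProb k K ^ (k * (2 * K * (b + 2)) + 1 - (t + 1))) := fun s p q ht => by
    rw [hF]
    refine val_le (post s p q) fun _ => ?_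
    have ht' : OnTrack k K D ρ c (t + 1)
        ((body.exec (inputArray P) (pre s p q)).setN Vt 0 (t + 1)) := ht.of_eq rfl
    rw [if_pos ht']
  rw [← hF]
  refine le_val (fun _ hs => hwp _ ?_) fun _ hs => ?_
  · refine wp_rand_le evS fun s _ => wp_rand_le (evP s) fun p _ => wp_rand_le (evQ s p) fun q _ => ?_
    rw [preEq, Fsucc s p q]
    obtain ⟨-, -, -, -, b5, -⟩ := hbody s p q
    refine b5 x ?_
    rw [← preEq]
    exact ((hs.setN (by norm_num) _ _).setN (by norm_num) _ _).setN (by norm_num) _ _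
  split_ifs with ht
  swap
  · refine hwp _ ?_
    refine wp_rand_le evS fun s _ => wp_rand_le (evP s) fun p _ => wp_rand_le (evQ s p) fun q _ => ?_
    rw [preEq]
    exact F1 s p q
  -- The remaining exponent is thus positive, and its truncated subtraction is exact.
  have htM := ht.le hK h.hb h.target.pos
  obtain ⟨e, he⟩ : ∃ e, k * (2 * K * (b + 2)) = t + e := ⟨_, (Nat.add_sub_cancel' htM).symm⟩
  have he1 : k * (2 * K * (b + 2)) + 1 - (t + 1) = e := by omega
  have he0 : k * (2 * K * (b + 2)) + 1 - t = e + 1 := by omega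
  rw [he1] at Fmove
  rw [he0]
  have hθ0 : 0 ≤ stepProb k K ^ e := by positivity
  have hθ1 : stepProb k K ^ e ≤ 1 := pow_le_one₀ hβ0.le (by linarith)
  have cardQ : 1 / (k : ℝ) * (((k - 1 : ℕ) : ℝ) + 1) ≤ 1 := by
    have : ((k - 1 : ℕ) : ℝ) + 1 = k := by exact_mod_cast Nat.sub_add_cancel hk
    rw [this, one_div, inv_mul_cancel₀ hk'.ne']
  have trk : ∀ s p q (i : Fin n), ¬ covers (inputArray P) d σ i (o i) →
      Moved P k K i (o i) (pre s p q) (body.exec (inputArray P) (pre s p q)) →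
      OnTrack k K D ρ c (t + 1) (body.exec (inputArray P) (pre s p q)) := by
    intro s p q i hi hm
    obtain ⟨-, -, b3, b4, -⟩ := hbody s p q
    exact OnTrack.move (ht.of_eq (preR s p q)) hK h.target (by rwa [cov]) hm b3 b4
  by_cases hall : ∀ i < n, ∃ q < k, covers (inputArray P) d σ i q
  swap
  · -- there is an uncovered point
    obtain ⟨u, ⟨hun, hu⟩, hlt⟩ : ∃ u, (u < n ∧ ∀ q < k, ¬ covers (inputArray P) d σ u q) ∧
        ∀ i < u, ∃ q < k, covers (inputArray P) d σ i q := by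
      push Not at hall
      refine ⟨Nat.find hall, Nat.find_spec hall, fun i hi => ?_⟩
      have := Nat.find_min hall hi
      push Not at this
      exact this (hi.trans (Nat.find_spec hall).1)
    have hou := h.target.lt ⟨u, hun⟩
    have : fail (1 / k * stepProb k K ^ e) ≤ fail (stepProb k K ^ (e + 1)) := by
      refine fail_anti ?_
      rw [pow_succ']
      exact mul_le_mul_of_nonneg_right (stepProb_le_inv hk hK) hθ0
    refine (hwp _ ?_).trans this
    refine wp_rand_le evS fun s _ => wp_rand_le (evP s) fun p _ =>
      wp_rand_le_fail (evQ s p) {o ⟨u, hun⟩} (fun m hm => by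
        rw [Finset.mem_singleton] at hm
        omega) hθ0 hθ1 (by simpa using cardQ) (fun q _ => by rw [preEq]; exact F1 s p q)
        fun q hq => ?_
    rw [Finset.mem_singleton] at hq
    subst hq
    rw [preEq]
    refine Fmove _ _ _ (trk _ _ _ ⟨u, hun⟩ (hu _ hou) ?_)
    obtain ⟨-, -, -, -, -, b6, -⟩ := hbody s p (o ⟨u, hun⟩)
    refine b6 _ (preQ _ _ _) hou ⟨u, hun⟩ ?_ ?_
    · rw [cov]
      exact hu
    · rw [cov]
      exact hlt
  by_cases hfew : ∀ q < k, {i | o i = q ∧ ¬ covers (inputArray P) d σ i q}.ncard * (k * K) ≤ U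
  swap
  · -- there is a cluster with many points outside of its ball
    push Not at hfew
    obtain ⟨q₀, hq₀, hmany⟩ := hfew
    let S : Finset ℕ := Finset.image (fun i : Fin n => (i : ℕ)) (Finset.univ.filter fun i : Fin n =>
      o i = q₀ ∧ ¬ covers (inputArray P) d σ i q₀)
    have hScard : S.card = {i | o i = q₀ ∧ ¬ covers (inputArray P) d σ i q₀}.ncard := by
      rw [show S.card = _ from Finset.card_image_of_injective _ Fin.val_injective,
        Set.ncard_eq_toFinset_card',
        Set.toFinset_ofPred]
    -- From `n ≤ k * U` and `U < |S| * (k * K)`: a random point belongs to `S` with probability at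
    -- least `1 / (k ^ 2 * K)`.
    have hbound : (n : ℝ) ≤ k * (S.card * (k * K)) := by
      have h1 := h.target.le_mul
      rw [← hScard] at hmany
      have : n ≤ k * (S.card * (k * K)) := h1.trans (Nat.mul_le_mul_left k hmany.le)
      exact_mod_cast this
    have : 1 / ((k : ℝ) ^ 2 * K) * (1 / k * stepProb k K ^ e) = stepProb k K ^ (e + 1) := by
      rw [pow_succ' (stepProb k K), ← mul_assoc]
      congr 1
      rw [stepProb]
      field_simp
    rw [← this]
    refine hwp _ (wp_rand_le evS fun s _ => wp_rand_le_fail (evP s) S (fun m hm => ?_)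
      (by positivity) ?_ ?_ (fun p _ => wp_rand_le (evQ s p) fun q _ => by rw [preEq]; exact F1 s p q)
      fun p hp => ?_)
    · simp only [S, Finset.mem_image] at hm
      obtain ⟨i, -, rfl⟩ := hm
      have := i.2
      omega
    · have : 1 / (k : ℝ) ≤ 1 := by
        rw [div_le_one hk']
        exact_mod_cast hk
      exact mul_le_one₀ this hθ0 hθ1
    · have : ((n - 1 : ℕ) : ℝ) + 1 = n := by exact_mod_cast Nat.sub_add_cancel hn
      rw [this, one_div_mul_eq_div, div_le_iff₀ (by positivity)]
      linarith
    · simp only [S, Finset.mem_image, Finset.mem_filter, Finset.mem_univ, true_and] at hp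
      obtain ⟨i, ⟨hoi, hi⟩, rfl⟩ := hp
      refine wp_rand_le_fail (evQ s i) {q₀} (fun m hm => by
        rw [Finset.mem_singleton] at hm
        omega) hθ0 hθ1 (by simpa using cardQ) (fun q _ => by rw [preEq]; exact F1 s i q)
        fun q hq => ?_
      rw [Finset.mem_singleton] at hq
      subst hq
      rw [preEq]
      subst hoi
      refine Fmove _ _ _ (trk _ _ _ i hi ?_)
      obtain ⟨-, -, -, -, -, -, b7⟩ := hbody s i (o i)
      rw [cov] at b7
      exact (b7 hall).1 _ (preQ _ _ _) hq₀ i (preP _ _ _)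
  · -- there is a good assignment
    have hfeas := h.target.feasible hK hall h.hcap hfew
    have hDpos := h.hD
    have hf0 : (0 : ℝ) < f := by
      have := h.flow_lt
      exact_mod_cast (by omega : 0 < f)
    obtain ⟨S, hS, hcard⟩ := card_good_shift (k := k) (f := f) (fun q => σ.R RC (q * d))
      (η := D / (((K : ℝ) * f) * ((k : ℝ) * k))) (by positivity) (by
        have := h.flow_lt
        nlinarith)
    -- At least half of the displacements are good; afterwards success is certain, whatever the
    -- other two choices are.
    have : fail (1 / 2 * 1) ≤ fail (stepProb k K ^ (e + 1)) := by
      refine fail_anti ?_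
      rw [pow_succ, mul_comm (1 / 2 : ℝ)]
      exact mul_le_mul hθ1 hβ1 hβ0.le zero_le_one
    refine (hwp _ ?_).trans this
    refine wp_rand_le_fail evS S (fun s hs => (hS s hs).1) zero_le_one le_rfl ?_ (fun s _ =>
      wp_rand_le (evP s) fun p _ => wp_rand_le (evQ s p) fun q _ => by rw [preEq]; exact F1 s p q)
      fun s hs => wp_rand_le (evP s) fun p _ => wp_rand_le (evQ s p) fun q _ => ?_
    · have : ((f + 1 : ℕ) : ℝ) ≤ ((2 * S.card : ℕ) : ℝ) := by exact_mod_cast hcard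
      push_cast at this
      linarith
    · rw [preEq, Fsucc s p q]
      · exact zero_le
      obtain ⟨-, -, -, -, -, -, b7⟩ := hbody s p q
      rw [cov] at b7
      refine ((b7 hall).2 h.flow_lt hfeas ?_).mono ?_
      · intro q' hq' r hr hqr
        have := (hS s hs).2 q' hq' r hr hqr
        simp only [dispC, shiftVal, preR, preS, ht.g]
        exact this
      · refine h.sum_dispR_le ?_ ?_ ?_
        · rw [preR]
          exact ht.g
        · rw [preR]
          exact ht.rad
        · rw [preS]
          exact (hS s hs).1

end track

end

/-! ### From one step to the whole search -/

section

open scoped ENNReal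

variable {n d k K f cap : ℕ}

theorem Cmd.wp_const_mul {I : ℕ → ℝ} (s : Cmd) (y : ℝ≥0∞) (F : Mem → ℝ≥0∞) (σ : Mem) :
    s.wp I (fun τ => y * F τ) σ = y * s.wp I F σ := by
  induction s generalizing F σ with
  | rand x e => simp only [wp, ← Finset.mul_sum, mul_div_assoc]
  | seq c₁ c₂ ih₁ ih₂ =>
    simp only [wp]
    rw [← ih₁]
    congr 1
    funext τ
    exact ih₂ F τ
  | ifz e c₁ c₂ ih₁ ih₂ =>
    simp only [wp]
    split_ifs
    · exact ih₁ F σ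
    · exact ih₂ F σ
  | ifle a b c₁ c₂ ih₁ ih₂ =>
    simp only [wp]
    split_ifs
    · exact ih₁ F σ
    · exact ih₂ F σ
  | loop v b c ih =>
    simp only [wp]
    generalize σ.N b 0 = m
    induction m generalizing F with
    | zero => rfl
    | succ m ihm =>
      simp only [wpRounds]
      rw [← ihm]
      congr 1
      funext τ
      exact ih (fun ρ => F (ρ.setN v 0 (m + 1))) τ
  | _ => rfl

/-- The factor must not be zero: `0 * ⊤ = 0` would forget that the invariant is required. -/
theorem mul_val {g s : Prop} {y z : ℝ≥0∞} (hy : y ≠ 0) : y * val g s z = val g s (y * z) := by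
  unfold val
  split_ifs
  · simp
  · rfl
  · exact ENNReal.mul_top hy

section track

variable {P : Fin n → EuclideanSpace ℝ (Fin d)} {U b : ℕ} {D x g : ℝ} {ρ : ℕ → ℝ}
  {c : ℕ → EuclideanSpace ℝ (Fin d)} {o : Fin n → ℕ}

theorem stepVal_setN_le {t : ℕ} (σ : Mem) {y : ℕ} (hy : 12 ≤ y) (hy' : y < 32) (i v : ℕ) :
    stepVal P k K f cap b D x g ρ c t (σ.setN y i v) ≤ stepVal P k K f cap b D x g ρ c t σ := by
  classical
  refine val_mono (fun h => h.setN hy hy' i v) (fun _ h => h.setN hy' i v) fun _ => le_of_eq ?_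
  have : OnTrack k K D ρ c t (σ.setN y i v) ↔ OnTrack k K D ρ c t σ :=
    ⟨fun h => h.of_eq rfl, fun h => h.of_eq rfl⟩
  exact if_congr this rfl rfl

/-- There are more steps than good moves can exist, so a trial cannot be on track until the end
without having succeeded. -/
theorem Setup.steps_le (h : Setup P k K f cap U b D x ρ c o) {F : Mem → ℝ≥0∞}
    (hF : ∀ τ, F τ ≤ val (StepInv P k K f cap g τ) (Succ x τ) 1) (σ : Mem) :
    (Cmd.loop Vt Nf trialStep).wp (inputArray P) F σ ≤ stepVal P k K f cap b D x g ρ c 0 σ := by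
  by_cases hI : StepInv P k K f cap g σ
  swap
  · rw [stepVal, val, if_neg hI]
    exact le_top
  refine (Cmd.wp_loop_le hI.inv.par.hf (fun t τ => stepVal P k K f cap b D x g ρ c t τ)
    (fun t _ τ _ => h.trialStep_le t τ) fun τ => (hF τ).trans ?_).trans
    (stepVal_setN_le σ (by norm_num) (by norm_num) _ _)
  refine val_mono id (fun _ => id) fun _ => ?_
  rw [if_neg]
  intro ht
  have := ht.le (by have := h.hK; omega) h.hb h.target.pos
  have := h.steps_lt
  omega

/-- The invariant of the choice of the radii. -/
structure RadInv (P : Fin n → EuclideanSpace ℝ (Fin d)) (k K f cap : ℕ) (g : ℝ) (q : ℕ) (σ : Mem) :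
    Prop where
  inv : Inv P k K f cap σ
  g_eq : σ.R Rg 0 = g
  chosen : ∀ r < q, 0 ≤ σ.R Rrad r ∧ σ.R Rsq r = -1 ∧ σ.R RT r = 1

open Classical in
/-- The bound on the failure probability after the choice of `q` radii. -/
def radVal (P : Fin n → EuclideanSpace ℝ (Fin d)) (k K f cap b : ℕ) (D x g : ℝ) (ρ : ℕ → ℝ)
    (q : ℕ) (σ : Mem) : ℝ≥0∞ :=
  val (RadInv P k K f cap g q σ) (Succ x σ) (if g = D ∧ ∀ r < q, σ.R Rrad r = ρ r then
    fail ((1 / ((k * K : ℕ) + 1)) ^ (k - q) * stepProb k K ^ (k * (2 * K * (b + 2)) + 1)) else 1)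

theorem exec_setRadius {I : ℕ → ℝ} {σ : Mem} {q m : ℕ} (hpar : Par n d k K f cap σ)
    (hq : σ.N Vq 0 = q) (hm : σ.N Nx 0 = m) :
    (setRadius.exec I σ).R Rrad q = σ.R Rg 0 * (((m + 1 : ℕ) : ℝ) / ((k * K : ℕ) : ℝ)) ∧
    (setRadius.exec I σ).R Rsq q = -1 ∧ (setRadius.exec I σ).R RT q = 1 ∧
    ∀ r ≠ q, (setRadius.exec I σ).R Rrad r = σ.R Rrad r ∧
      (setRadius.exec I σ).R Rsq r = σ.R Rsq r ∧ (setRadius.exec I σ).R RT r = σ.R RT r := by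
  refine ⟨?_, ?_, ?_, fun r hr => ⟨?_, ?_, ?_⟩⟩
  · simp [setRadius, Cmd.exec_seq, Cmd.exec_setR, NExpr.eval, RExpr.eval, hq, hm, hpar.hkK]
  · simp [setRadius, Cmd.exec_seq, Cmd.exec_setR, NExpr.eval, RExpr.eval, hq]
  · simp [setRadius, Cmd.exec_seq, Cmd.exec_setR, NExpr.eval, RExpr.eval, hq]
  · simp [setRadius, Cmd.exec_seq, Cmd.exec_setR, NExpr.eval, hq, hr]
  · simp [setRadius, Cmd.exec_seq, Cmd.exec_setR, NExpr.eval, hq, hr]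
  · simp [setRadius, Cmd.exec_seq, Cmd.exec_setR, NExpr.eval, hq, hr]

/-- At the right scale, exactly one of the `k * K + 1` outcomes yields the target radius of ball
`q`. At any other scale the bound `1` is kept. -/
theorem Setup.radius_le (h : Setup P k K f cap U b D x ρ c o) (hg : 0 ≤ g) {q : ℕ} (hq : q < k)
    {σ : Mem} (hVq : σ.N Vq 0 = q) :
    (Cmd.rand Nx (nv NkK) ;; setRadius).wp (inputArray P)
      (fun τ => radVal P k K f cap b D x g ρ (q + 1) (τ.setN Vq 0 (q + 1))) σ ≤
      radVal P k K f cap b D x g ρ q σ := by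
  classical
  by_cases hI : RadInv P k K f cap g q σ
  swap
  · rw [radVal, val, if_neg hI]
    exact le_top
  have hK : 1 ≤ K := by have := h.hK; omega
  have hβ0 := stepProb_pos h.hk hK
  have hβ1 : stepProb k K ≤ 1 := (stepProb_le_half h.hk h.hK).trans (by norm_num)
  obtain ⟨post, hpost⟩ : ∃ post : ℕ → Mem, post = fun m =>
      (setRadius.exec (inputArray P) (σ.setN Nx 0 m)).setN Vq 0 (q + 1) := ⟨_, rfl⟩
  have hwp : ∀ y, (Cmd.rand Nx (nv NkK)).wp (inputArray P) (fun τ =>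
      radVal P k K f cap b D x g ρ (q + 1) ((setRadius.exec (inputArray P) τ).setN Vq 0 (q + 1))) σ ≤ y →
      (Cmd.rand Nx (nv NkK) ;; setRadius).wp (inputArray P)
      (fun τ => radVal P k K f cap b D x g ρ (q + 1) (τ.setN Vq 0 (q + 1))) σ ≤ y := by
    intro y hy
    refine le_trans (le_of_eq ?_) hy
    simp only [Cmd.wp]
    simp only [Cmd.wp_eq_exec (s := setRadius) rfl]
  have hpostR : ∀ m, (post m).R Rrad q = g * (((m + 1 : ℕ) : ℝ) / ((k * K : ℕ) : ℝ)) ∧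
      (post m).R Rsq q = -1 ∧ (post m).R RT q = 1 ∧
      ∀ r ≠ q, (post m).R Rrad r = σ.R Rrad r ∧ (post m).R Rsq r = σ.R Rsq r ∧
        (post m).R RT r = σ.R RT r := by
    intro m
    have := exec_setRadius (I := inputArray P) (σ := σ.setN Nx 0 m) (q := q) (m := m)
      (hI.inv.setN (by norm_num) (by norm_num) _ _).par (by simpa using hVq) (by simp)
    rw [Mem.setN_R, hI.g_eq] at this
    rw [hpost]
    exact this
  have hfr : ∀ m, setRadius.Frame (σ.setN Nx 0 m) (setRadius.exec (inputArray P) (σ.setN Nx 0 m)) :=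
    fun m => Cmd.exec_frame rfl _
  have hinv : ∀ m, Inv P k K f cap (post m) := fun m => by
    rw [hpost]
    refine Inv.setN (Inv.of_eq (hI.inv.setN (x := Nx) (by norm_num) (by norm_num) 0 m)
      (fun y hy => (hfr m).N y (by simp [setRadius, Cmd.writesN]))
      fun y hy => (hfr m).R y ?_) (by norm_num) (by norm_num) _ _
    simp only [setRadius, Cmd.writesR]
    rcases hy with rfl | rfl | rfl <;> decide
  have hrad : ∀ m, RadInv P k K f cap g (q + 1) (post m) := fun m => by
    refine ⟨hinv m, ?_, fun r hr => ?_⟩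
    · rw [hpost]
      simp only [Mem.setN_R]
      rw [(hfr m).R _ (by decide)]
      exact hI.g_eq
    · obtain ⟨h1, h2, h3, h4⟩ := hpostR m
      by_cases hrq : r = q
      · rw [hrq, h1, h2, h3]
        exact ⟨by positivity, rfl, rfl⟩
      · obtain ⟨e1, e2, e3⟩ := h4 r hrq
        rw [e1, e2, e3]
        exact hI.chosen r (by omega)
  have hsucc : ∀ m, Succ x σ → Succ x (post m) := fun m hs => by
    rw [hpost]
    refine Succ.setN ((hs.setN (x := Nx) (by norm_num) 0 m).of_eq ((hfr m).N _ (by decide))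
      ((hfr m).R _ (by decide))) (by norm_num) _ _
  have ev : (nv NkK).eval σ = k * K := hI.inv.par.hkK
  have ev' : ∀ m, (setRadius.exec (inputArray P) (σ.setN Nx 0 m)).setN Vq 0 (q + 1) = post m :=
    fun m => by rw [hpost]
  have one : ∀ m, radVal P k K f cap b D x g ρ (q + 1) (post m) ≤ 1 := fun m => by
    refine val_le (hrad m) fun _ => ?_
    split_ifs
    · exact fail_le_one (by positivity)
    · exact le_rfl
  refine le_val (fun _ hs => hwp _ (wp_rand_le ev fun m _ => ?_)) fun _ _ => ?_
  · rw [ev']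
    exact (val_done (hrad m) (hsucc m hs)).le
  split_ifs with hgood
  swap
  · refine hwp _ (wp_rand_le ev fun m _ => ?_)
    rw [ev']
    exact one m
  obtain ⟨rfl, hgood⟩ := hgood
  obtain ⟨j, hj, hρ⟩ := h.grid q hq
  obtain ⟨e, he⟩ : ∃ e, k - q = e + 1 := ⟨k - q - 1, by omega⟩
  rw [he, pow_succ', mul_assoc]
  have hγ : (1 : ℝ) / ((k * K : ℕ) + 1) ≤ 1 := by
    rw [div_le_one (by positivity)]
    have : (0 : ℝ) ≤ ((k * K : ℕ) : ℝ) := by positivity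
    linarith
  refine hwp _ (wp_rand_le_fail ev {j} (fun m hm => by
    rw [Finset.mem_singleton] at hm
    omega) (by positivity) (mul_le_one₀ (pow_le_one₀ (by positivity) hγ) (by positivity)
      (pow_le_one₀ hβ0.le hβ1)) ?_ (fun m _ => by rw [ev']; exact one m) fun m hm => ?_)
  · rw [one_div, inv_mul_cancel₀ (by positivity)]
    simp
  · rw [Finset.mem_singleton] at hm
    subst hm
    rw [ev']
    refine val_le (hrad m) fun _ => ?_
    rw [if_pos, show k - (q + 1) = e by omega]
    refine ⟨rfl, fun r hr => ?_⟩
    obtain ⟨h1, -, -, h4⟩ := hpostR m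
    by_cases hrq : r = q
    · rw [hrq, h1, hρ]
    · rw [(h4 r hrq).1]
      exact hgood r (by omega)

/-- The invariant of the trials for the scale `g`. -/
structure ScaleInv (P : Fin n → EuclideanSpace ℝ (Fin d)) (k K f cap : ℕ) (g : ℝ) (σ : Mem) :
    Prop where
  inv : Inv P k K f cap σ
  g_eq : σ.R Rg 0 = g

theorem ScaleInv.setN {σ : Mem} (h : ScaleInv P k K f cap g σ) {x : ℕ} (hx : 12 ≤ x) (hx' : x < 32)
    (i v : ℕ) : ScaleInv P k K f cap g (σ.setN x i v) :=
  ⟨h.inv.setN hx hx' i v, h.g_eq⟩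

open Classical in
theorem Setup.trial_le_one (h : Setup P k K f cap U b D x ρ c o) (hg : 0 ≤ g) {F : Mem → ℝ≥0∞}
    (hF : ∀ τ, F τ ≤ val (ScaleInv P k K f cap g τ) (Succ x τ) 1) (σ : Mem) :
    trial.wp (inputArray P) F σ ≤ val (ScaleInv P k K f cap g σ) (Succ x σ)
      (if g = D then fail (trialProb k K b) else 1) := by
  have hK : 1 ≤ K := by have := h.hK; omega
  have hβ0 := stepProb_pos h.hk hK
  by_cases hI : ScaleInv P k K f cap g σ
  swap
  · rw [val, if_neg hI]
    exact le_top
  rw [trial, Cmd.wp]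
  refine (Cmd.wp_loop_le hI.inv.par.hk (fun q τ => radVal P k K f cap b D x g ρ q τ)
    (fun q hq τ hVq => h.radius_le hg hq hVq) fun τ => (h.steps_le (g := g) (fun τ => (hF τ).trans
      (val_mono (fun hs => ⟨hs.inv, hs.g_eq⟩) (fun _ => id) fun _ => le_rfl)) τ).trans ?_).trans ?_
  · refine val_mono (fun hr => ⟨hr.inv, ⟨by rw [hr.g_eq]; exact hg, fun q hq => (hr.chosen q hq).1,
      fun q hq => .inl (hr.chosen q hq).2.1⟩, hr.g_eq⟩) (fun _ => id) fun hr => ?_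
    rw [Nat.sub_self, pow_zero, one_mul, Nat.sub_zero]
    by_cases hgood : g = D ∧ ∀ r < k, τ.R Rrad r = ρ r
    · rw [if_pos hgood, if_pos]
      exact ⟨by rw [hr.g_eq, hgood.1], hgood.2, fun _ => 0, by simp, fun q hq =>
        .inl ⟨rfl, (hr.chosen q hq).2.2, (hr.chosen q hq).2.1⟩⟩
    · rw [if_neg hgood]
      split_ifs
      · exact fail_le_one (by positivity)
      · exact le_rfl
  · refine val_mono (fun hs => ⟨hs.inv.setN (by norm_num) (by norm_num) _ _, hs.g_eq, fun r hr =>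
      absurd hr (Nat.not_lt_zero r)⟩) (fun _ hs => hs.setN (by norm_num) _ _) fun _ => le_of_eq ?_
    simp [trialProb]

-- Homogeneity in the final value `y` makes the failure probabilities of consecutive trials
-- multiply.
open Classical in
theorem Setup.trial_le (h : Setup P k K f cap U b D x ρ c o) (hg : 0 ≤ g) {F : Mem → ℝ≥0∞}
    {y : ℝ≥0∞} (hy : y ≠ 0)
    (hF : ∀ τ, F τ ≤ val (ScaleInv P k K f cap g τ) (Succ x τ) y) (σ : Mem) :
    trial.wp (inputArray P) F σ ≤ val (ScaleInv P k K f cap g σ) (Succ x σ)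
      (y * if g = D then fail (trialProb k K b) else 1) := by
  calc trial.wp (inputArray P) F σ ≤ trial.wp (inputArray P)
        (fun τ => y * val (ScaleInv P k K f cap g τ) (Succ x τ) 1) σ :=
        Cmd.wp_mono _ (fun τ => by rw [mul_val hy, mul_one]; exact hF τ) σ
    _ = y * trial.wp (inputArray P) (fun τ => val (ScaleInv P k K f cap g τ) (Succ x τ) 1) σ :=
        Cmd.wp_const_mul _ _ _ _
    _ ≤ y * val (ScaleInv P k K f cap g σ) (Succ x σ)
      (if g = D then fail (trialProb k K b) else 1) := by
        gcongr
        exact h.trial_le_one hg (fun _ => le_rfl) σ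
    _ = _ := mul_val hy

theorem trialProb_nonneg (k K b : ℕ) : 0 ≤ trialProb k K b := by
  unfold trialProb stepProb
  positivity

theorem trialProb_le_half (hk : 1 ≤ k) (hK : 2 ≤ K) : trialProb k K b ≤ 1 / 2 := by
  have hβ0 := stepProb_pos hk (by omega : 1 ≤ K)
  have hβ1 := stepProb_le_half hk hK
  have hγ : (1 : ℝ) / ((k * K : ℕ) + 1) ≤ 1 := by
    rw [div_le_one (by positivity)]
    have : (0 : ℝ) ≤ ((k * K : ℕ) : ℝ) := by positivity
    linarith
  rw [trialProb, pow_succ, ← mul_assoc]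
  have h1 : (1 / ((k * K : ℕ) + 1 : ℝ)) ^ k * stepProb k K ^ (k * (2 * K * (b + 2))) ≤ 1 :=
    mul_le_one₀ (pow_le_one₀ (by positivity) hγ) (by positivity) (pow_le_one₀ hβ0.le (by linarith))
  calc _ ≤ 1 * stepProb k K := mul_le_mul_of_nonneg_right h1 hβ0.le
    _ ≤ 1 / 2 := by linarith

/-- For scales other than the target's: nothing is gained, but invariants and earlier success are
kept. -/
theorem Setup.trials_le (h : Setup P k K f cap U b D x ρ c o) (hg : 0 ≤ g) {F : Mem → ℝ≥0∞}
    {y : ℝ≥0∞} (hy : y ≠ 0)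
    (hF : ∀ τ, F τ ≤ val (ScaleInv P k K f cap g τ) (Succ x τ) y) (σ : Mem) :
    (Cmd.loop Vtr Nf trial).wp (inputArray P) F σ ≤
      val (ScaleInv P k K f cap g σ) (Succ x σ) y := by
  classical
  by_cases hI : ScaleInv P k K f cap g σ
  swap
  · rw [val, if_neg hI]
    exact le_top
  have set : ∀ τ j, val (ScaleInv P k K f cap g (τ.setN Vtr 0 j)) (Succ x (τ.setN Vtr 0 j)) y ≤
      val (ScaleInv P k K f cap g τ) (Succ x τ) y := fun τ j =>
    val_mono (fun hs => hs.setN (by norm_num) (by norm_num) _ _)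
      (fun _ hs => hs.setN (by norm_num) _ _) fun _ => le_rfl
  refine (Cmd.wp_loop_le hI.inv.par.hf (fun _ τ => val (ScaleInv P k K f cap g τ) (Succ x τ) y)
    (fun t _ τ _ => (h.trial_le hg hy (fun τ => set τ _) τ).trans (val_mono id (fun _ => id)
      fun _ => ?_)) hF).trans (set σ 0)
  refine mul_le_of_le_one_right' ?_
  split_ifs
  · exact fail_le_one (trialProb_nonneg _ _ _)
  · exact le_rfl

theorem Setup.trials_le_half (h : Setup P k K f cap U b D x ρ c o) {F : Mem → ℝ≥0∞}
    (hF : ∀ τ, F τ ≤ val (ScaleInv P k K f cap D τ) (Succ x τ) 1) (σ : Mem) :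
    (Cmd.loop Vtr Nf trial).wp (inputArray P) F σ ≤
      val (ScaleInv P k K f cap D σ) (Succ x σ) (1 / 2) := by
  classical
  by_cases hI : ScaleInv P k K f cap D σ
  swap
  · rw [val, if_neg hI]
    exact le_top
  have hhalf := trialProb_le_half (b := b) h.hk h.hK
  have hne : fail (trialProb k K b) ≠ 0 := by
    rw [fail, Ne, ENNReal.ofReal_eq_zero, not_le]
    linarith
  refine (Cmd.wp_loop_le hI.inv.par.hf (fun t τ => val (ScaleInv P k K f cap D τ) (Succ x τ)
    (fail (trialProb k K b) ^ (f - t))) (fun t ht τ _ => ?_) fun τ => (hF τ).trans ?_).trans ?_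
  · refine (h.trial_le h.hD.le (pow_ne_zero (f - (t + 1)) hne) (fun τ => val_mono
      (fun hs => hs.setN (by norm_num) (by norm_num) _ _)
      (fun _ hs => hs.setN (by norm_num) _ _) fun _ => le_rfl) τ).trans
      (val_mono id (fun _ => id) fun _ => ?_)
    rw [if_pos rfl, ← pow_succ, show f - (t + 1) + 1 = f - t by omega]
  · rw [Nat.sub_self, pow_zero]
  · refine val_mono (fun hs => hs.setN (by norm_num) (by norm_num) _ _)
      (fun _ hs => hs.setN (by norm_num) _ _) fun _ => ?_
    rw [Nat.sub_zero, fail, ← ENNReal.ofReal_pow (by linarith)]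
    refine (ENNReal.ofReal_le_ofReal h.amplify).trans (le_of_eq ?_)
    rw [ENNReal.ofReal_div_of_pos (by norm_num)]
    simp

theorem exec_pairDist {σ : Mem} (hI : Inv P k K f cap σ) {i j : Fin n} (hi : σ.N Va 0 = i)
    (hj : σ.N Vb 0 = j) : ScaleInv P k K f cap (dist (P i) (P j)) (pairDist.exec (inputArray P) σ) ∧
      (pairDist.exec (inputArray P) σ).N Va = σ.N Va ∧
      (∀ x, Succ x σ → Succ x (pairDist.exec (inputArray P) σ)) := by
  have hf : pairDist.Frame σ (pairDist.exec (inputArray P) σ) := Cmd.exec_frame rfl σ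
  refine ⟨⟨hI.of_eq (fun y hy => hf.N y ?_) fun y hy => hf.R y ?_, ?_⟩, hf.N _ (by decide),
    fun x hx => hx.of_eq (hf.N _ (by decide)) (hf.R _ (by decide))⟩
  · simp only [pairDist, sqDist, Cmd.writesN]
    rcases hy with hy | rfl | rfl
    · simp
      omega
    all_goals decide
  · simp only [pairDist, sqDist, Cmd.writesR]
    rcases hy with rfl | rfl | rfl <;> decide
  · rw [pairDist, Cmd.exec_seq, exec_sqDist (d := d) (X := fun l => inputArray P (i * d + l))
      (Y := fun l => inputArray P (j * d + l)) hI.par.hd]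
    · simp only [Cmd.exec_setR, NExpr.eval, RExpr.eval, Mem.setR_R, and_self, if_true]
      rw [EuclideanSpace.dist_eq, Finset.sum_range]
      congr 1
      refine Finset.sum_congr rfl fun l _ => ?_
      rw [inputArray_apply, inputArray_apply, Real.dist_eq, sq_abs]
    · intro l _ v
      simp [RExpr.eval, NExpr.eval, hi, hI.par.row i (.inl i.2)]
    · intro l _ v
      simp [RExpr.eval, NExpr.eval, hj, hI.par.row j (.inl j.2)]

/-- The search finds a good solution with probability at least `1 / 2`. -/
theorem Setup.search_le {i₀ j₀ : Fin n} (h : Setup P k K f cap U b (dist (P i₀) (P j₀)) x ρ c o)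
    {F : Mem → ℝ≥0∞} (hF : ∀ τ, F τ ≤ val (Inv P k K f cap τ) (Succ x τ) 1) (σ : Mem) :
    search.wp (inputArray P) F σ ≤ val (Inv P k K f cap σ) (Succ x σ) (1 / 2) := by
  classical
  by_cases hI : Inv P k K f cap σ
  swap
  · rw [val, if_neg hI]
    exact le_top
  -- The bound before the pair `(i, j)` is tried: `1 / 2` while the right pair is still to come, and
  -- `1` after it.
  let y : ℕ → ℕ → ℝ≥0∞ := fun i j => if i < i₀ ∨ (i = i₀ ∧ j ≤ j₀) then 1 / 2 else 1
  have hy : ∀ i j, y i j ≠ 0 := fun i j => by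
    simp only [y]
    split_ifs <;> simp
  have hy1 : ∀ i j, y i j ≤ 1 := fun i j => by
    simp only [y]
    split_ifs
    · exact ENNReal.half_le_self
    · exact le_rfl
  have set : ∀ (z : ℕ) (w : ℝ≥0∞), 12 ≤ z → z < 32 → ∀ τ l,
      val (Inv P k K f cap (τ.setN z 0 l)) (Succ x (τ.setN z 0 l)) w ≤
      val (Inv P k K f cap τ) (Succ x τ) w := fun z w hz hz' τ l =>
    val_mono (fun hs => hs.setN hz hz' _ _) (fun _ hs => hs.setN hz' _ _) fun _ => le_rfl
  rw [search]
  refine (Cmd.wp_loop_le hI.par.hn (fun i τ => val (Inv P k K f cap τ) (Succ x τ) (y i 0))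
    (fun i hi τ hVa => ?_) fun τ => (hF τ).trans (val_mono id (fun _ => id) fun _ => ?_)).trans
    ((set Va _ (by norm_num) (by norm_num) σ 0).trans (val_mono id (fun _ => id) fun _ => ?_))
  rotate_left
  · simp only [y]
    rw [if_neg (by have := i₀.2; omega)]
  · simp only [y]
    rw [if_pos (by omega)]
  by_cases hIτ : Inv P k K f cap τ
  swap
  · rw [val, if_neg hIτ]
    exact le_top
  refine (Cmd.wp_loop_le hIτ.par.hn (fun j τ => val (Inv P k K f cap τ ∧ τ.N Va 0 = i) (Succ x τ)
    (y i j)) (fun j hj π hVb => ?_) fun π => ?_).trans ?_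
  rotate_left
  · refine (set Va _ (by norm_num) (by norm_num) π (i + 1)).trans
      (val_mono (fun h => h.1) (fun _ => id) fun _ => ?_)
    simp only [y]
    split_ifs with h1 h2 h2
    · exact le_rfl
    · exact ENNReal.half_le_self
    · have := j₀.2
      omega
    · exact le_rfl
  · exact val_mono (fun hs => ⟨hs.setN (by norm_num) (by norm_num) _ _, by simpa using hVa⟩)
      (fun _ hs => hs.setN (by norm_num) _ _) fun _ => le_rfl
  -- one pair
  by_cases hIπ : Inv P k K f cap π ∧ π.N Va 0 = i
  swap
  · rw [val, if_neg hIπ]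
    exact le_top
  obtain ⟨p1, p2, p3⟩ := exec_pairDist hIπ.1 (i := ⟨i, hi⟩) (j := ⟨j, hj⟩) hIπ.2 hVb
  rw [Cmd.wp, Cmd.wp_eq_exec (s := pairDist) rfl]
  set ψ := pairDist.exec (inputArray P) π
  clear_value ψ
  -- The trials do not write to `Va`, so the outer loop variable may be assumed to keep its value.
  rw [← Cmd.wp_congr (F := fun τ => if τ.N Va 0 = i then val (Inv P k K f cap (τ.setN Vb 0 (j + 1)) ∧
      (τ.setN Vb 0 (j + 1)).N Va 0 = i) (Succ x (τ.setN Vb 0 (j + 1))) (y i (j + 1)) else 0)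
      fun τ hτ => if_pos (by rw [hτ _ (by decide), p2, hIπ.2])]
  have hF' : ∀ g τ, (if τ.N Va 0 = i then val (Inv P k K f cap (τ.setN Vb 0 (j + 1)) ∧
      (τ.setN Vb 0 (j + 1)).N Va 0 = i) (Succ x (τ.setN Vb 0 (j + 1))) (y i (j + 1)) else 0) ≤
      val (ScaleInv P k K f cap g τ) (Succ x τ) (y i (j + 1)) := by
    intro g τ
    split_ifs with hτ
    · exact val_mono (fun hs => ⟨hs.inv.setN (by norm_num) (by norm_num) _ _, by simpa using hτ⟩)
        (fun _ hs => hs.setN (by norm_num) _ _) fun _ => le_rfl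
    · exact zero_le
  have fin : ∀ {g w}, ScaleInv P k K f cap g ψ → w ≤ y i j →
      val (ScaleInv P k K f cap g ψ) (Succ x ψ) w ≤ val (Inv P k K f cap π ∧ π.N Va 0 = i)
        (Succ x π) (y i j) := fun hs hw =>
    val_mono (fun _ => hs) (fun _ => p3 x) fun _ => hw
  by_cases hij : i = i₀ ∧ j = j₀
  · obtain ⟨rfl, rfl⟩ := hij
    refine (h.trials_le_half (fun τ => (hF' _ τ).trans (val_mono id (fun _ => id) fun _ =>
      hy1 _ _)) ψ).trans (fin p1 ?_)
    simp [y]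
  · refine (h.trials_le dist_nonneg (hy _ _) (hF' _) ψ).trans (fin p1 ?_)
    simp only [y]
    split_ifs with h1 h2 h2
    · exact le_rfl
    · exact ENNReal.half_le_self
    · omega
    · exact le_rfl

end track

end

section

variable {I : ℕ → ℝ} {n d k K f cap : ℕ}

/-! ### Parameters and output -/

theorem exec_constants {σ : Mem} {K₀ : ℕ} (hK : σ.N NK 0 = K₀) (hk : σ.N Nk 0 = k) :
    (constants.exec I σ).N NK 0 = 16 * K₀ ∧ (constants.exec I σ).N NL 0 = 64 * (16 * K₀) ∧
      (constants.exec I σ).N Nk2 0 = max k 2 := by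
  have last : ∀ τ : Mem, ∀ π, π = (Cmd.ifz (.sub (.const 2) (nv Nk))
      (.setN Nk2 (.const 0) (nv Nk)) (.setN Nk2 (.const 0) (.const 2))).exec I τ →
      π.N NK 0 = τ.N NK 0 ∧ π.N NL 0 = τ.N NL 0 ∧ (τ.N Nk 0 = k → π.N Nk2 0 = max k 2) := by
    rintro τ _ rfl
    rw [Cmd.exec_ifz, show NExpr.eval τ (.sub (.const 2) (nv Nk)) = 2 - τ.N Nk 0 from rfl]
    split_ifs with h
    · simp [Cmd.exec_setN, NExpr.eval]
      omega
    · simp [Cmd.exec_setN, NExpr.eval]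
      omega
  simp only [constants, Cmd.exec_seq]
  refine ⟨(last _ _ rfl).1.trans ?_, (last _ _ rfl).2.1.trans ?_, (last _ _ rfl).2.2 ?_⟩
  · simp [Cmd.exec_setN, NExpr.eval, hK]
    omega
  · simp [Cmd.exec_setN, NExpr.eval, hK]
    omega
  · simp [Cmd.exec_setN, hk]

theorem exec_scaleF {σ : Mem} {m : ℕ} (hm : σ.N Nk2 0 = m) :
    (scaleF.exec I σ).N Nf 0 = m * σ.N Nf 0 := by
  simp only [scaleF, Cmd.exec_seq, Cmd.exec_setN]
  set σ₀ := σ.setN Nacc ((NExpr.const 0).eval σ) ((NExpr.const 0).eval σ) with hσ₀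
  have key := Cmd.exec_loop_frame (I := I) (v := Vt) (b := Nk2) (m := m)
    (s := .setN Nacc (.const 0) (.add (nv Nacc) (nv Nf)))
    (σ := σ₀) rfl (by simpa [hσ₀] using hm)
    (fun i τ => τ.N Nacc 0 = i * σ.N Nf 0) (by simp [hσ₀, NExpr.eval]) (by
      intro i _ τ hτ hP _
      have : τ.N Nf = σ.N Nf := by
        rw [hτ.N _ (by decide)]
        exact σ.setN_N_ne _ _ (by decide)
      simp [Cmd.exec_setN, NExpr.eval, hP, this]
      ring)
  simpa [NExpr.eval] using key

theorem exec_setRows {σ : Mem} {b m : ℕ} (hb : b ≠ Nacc) (hm : σ.N b 0 = m) (hd : σ.N Nd 0 = d) :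
    ∀ i, ((setRows b).exec I σ).N Nrow i = if i < m then i * d else σ.N Nrow i := by
  simp only [setRows, Cmd.exec_seq, Cmd.exec_setN]
  set σ₀ := σ.setN Nacc ((NExpr.const 0).eval σ) ((NExpr.const 0).eval σ) with hσ₀
  refine (Cmd.exec_loop_frame (I := I) (v := Vi) (b := b) (m := m) (s := .setN Nrow (nv Vi) (nv Nacc) ;;
    .setN Nacc (.const 0) (.add (nv Nacc) (nv Nd))) (σ := σ₀) rfl (by simpa [hσ₀, hb] using hm)
    (fun l τ => τ.N Nacc 0 = l * d ∧ ∀ i, τ.N Nrow i = if i < l then i * d else σ.N Nrow i)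
    (by simp [hσ₀, NExpr.eval]) ?_).2
  rintro l hl τ hτ ⟨h1, h2⟩ hVi
  have e1 : τ.N Nd 0 = d := by
    rw [hτ.N _ (by simp [Cmd.writesN]), ← hd, hσ₀]
    simp
  refine ⟨?_, fun i => ?_⟩
  · simp [Cmd.exec_seq, Cmd.exec_setN, NExpr.eval, h1, e1]
    ring
  · by_cases hil : i = l
    · simp [Cmd.exec_seq, Cmd.exec_setN, NExpr.eval, hVi, hil, h1]
    · simp only [Cmd.exec_seq, Cmd.exec_setN, NExpr.eval, Mem.setN_N, hVi]
      simp only [Nat.reduceEqDiff, false_and, if_false, true_and, hil, h2]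
      split_ifs <;> first | rfl | omega

theorem exec_setCap {σ : Mem} (hn : σ.N Nn 0 = n) {U : ℕ} (hU : σ.N NU 0 = U) {ε : ℝ}
    (hε : σ.R Reps 0 = ε) (hε0 : 0 ≤ ε) :
    (((setCap.exec I σ).N Ncap 0 : ℕ) : ℝ) ≤ (1 + ε) * U ∧
      ∀ m ≤ n, (m : ℝ) ≤ (1 + ε) * U → m ≤ (setCap.exec I σ).N Ncap 0 := by
  simp only [setCap, Cmd.exec_seq, Cmd.exec_setN]
  set σ₀ := σ.setN Ncap ((NExpr.const 0).eval σ) ((NExpr.const 0).eval σ) with hσ₀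
  refine Cmd.exec_loop_frame (I := I) (v := Vi) (b := Nn) (m := n) (s := .ifle (.nat (.add (nv Vi) (.const 1)))
    (.mul (.add (.nat (.const 1)) (rv Reps)) (.nat (nv NU)))
    (.setN Ncap (.const 0) (.add (nv Vi) (.const 1))) .skip) (σ := σ₀) rfl (by simpa [hσ₀] using hn)
    (fun l τ => ((τ.N Ncap 0 : ℕ) : ℝ) ≤ (1 + ε) * U ∧
      ∀ m ≤ l, (m : ℝ) ≤ (1 + ε) * U → m ≤ τ.N Ncap 0) ?_ ?_
  · refine ⟨?_, fun m hm _ => by omega⟩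
    simp [hσ₀, NExpr.eval]
    positivity
  · rintro l hl τ hτ ⟨h1, h2⟩ hVi
    have e1 : τ.N NU 0 = U := by
      rw [hτ.N _ (by decide), ← hU, hσ₀]
      simp
    have e2 : τ.R Reps 0 = ε := by
      rw [hτ.R _ (by decide), ← hε, hσ₀]
      simp
    have ev1 : (RExpr.nat (.add (nv Vi) (.const 1))).eval I τ = ((l + 1 : ℕ) : ℝ) := by
      simp [RExpr.eval, NExpr.eval, hVi]
    have ev2 : (RExpr.mul (.add (.nat (.const 1)) (rv Reps)) (.nat (nv NU))).eval I τ =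
        (1 + ε) * U := by
      simp [RExpr.eval, NExpr.eval, e1, e2]
    rw [Cmd.exec_ifle, ev1, ev2]
    split_ifs with hle
    · have : (((Cmd.setN Ncap (.const 0) (.add (nv Vi) (.const 1))).exec I τ).setN Vi 0 (l + 1)).N
          Ncap 0 = l + 1 := by
        simp [Cmd.exec_setN, NExpr.eval, hVi]
      rw [this]
      exact ⟨hle, fun m hm _ => hm⟩
    · have : ((Cmd.skip.exec I τ).setN Vi 0 (l + 1)).N Ncap 0 = τ.N Ncap 0 := by
        simp [Cmd.exec_skip]
      rw [this]
      refine ⟨h1, fun m hm hmU => h2 m ?_ hmU⟩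
      by_contra hlt
      obtain rfl : m = l + 1 := by omega
      exact hle hmU

theorem exec_parameters {σ : Mem} {U L m : ℕ} {ε : ℝ} (hn : σ.N Nn 0 = n) (hd : σ.N Nd 0 = d)
    (hk : σ.N Nk 0 = k) (hU : σ.N NU 0 = U) (hK : σ.N NK 0 = K) (hL : σ.N NL 0 = L)
    (hm : σ.N Nk2 0 = m) (hε : σ.R Reps 0 = ε) (hε0 : 0 ≤ ε) :
    ∃ cap : ℕ, (cap : ℝ) ≤ (1 + ε) * U ∧ (∀ m ≤ n, (m : ℝ) ≤ (1 + ε) * U → m ≤ cap) ∧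
      Par n d k K (m ^ (k * K * L)) cap (parameters.exec I σ) := by
  simp only [parameters, Cmd.exec_seq]
  -- the number `f`
  set σ₀ := Cmd.exec I (.setN Nf (.const 0) (.const 1)) σ with hσ₀
  have f0 : (Cmd.setN Nf (.const 0) (.const 1)).Frame σ σ₀ := Cmd.exec_frame rfl σ
  have g0 : σ₀.N Nf 0 = 1 := by simp [hσ₀, Cmd.exec_setN, NExpr.eval]
  clear_value σ₀
  have l1 := Cmd.exec_loop_frame (I := I) (v := Vi) (b := Nk) (m := k)
    (s := .loop Vj NK (.loop Vq NL scaleF)) (σ := σ₀) rfl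
    (by rw [f0.N _ (by decide), hk]) (fun i τ => τ.N Nf 0 = m ^ (i * K * L)) (by simp [g0]) (by
      intro i _ τ hτ hP _
      have key := Cmd.exec_loop_frame (I := I) (v := Vj) (b := NK) (m := K)
        (s := .loop Vq NL scaleF) (σ := τ) rfl
        (by rw [hτ.N _ (by decide), f0.N _ (by decide), hK])
        (fun j ρ => ρ.N Nf 0 = m ^ (i * K * L + j * L)) (by simp [hP]) (by
          intro j _ ρ hρ hP' _
          have key := Cmd.exec_loop_frame (I := I) (v := Vq) (b := NL) (m := L)
            (s := scaleF) (σ := ρ) rfl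
            (by rw [hρ.N _ (by decide), hτ.N _ (by decide), f0.N _ (by decide), hL])
            (fun l π => π.N Nf 0 = m ^ (i * K * L + j * L + l)) (by simp [hP']) (by
              intro l _ π hπ hP'' _
              have := exec_scaleF (I := I) (σ := π) (m := m) (by
                rw [hπ.N _ (by decide), hρ.N _ (by decide), hτ.N _ (by decide), f0.N _ (by decide),
                  hm])
              rw [hP''] at this
              simp [this]
              ring)
          simp [key]
          ring)
      simp [key]
      ring)
  have f1 : (Cmd.loop Vi Nk (.loop Vj NK (.loop Vq NL scaleF))).Frame σ₀ _ :=
    Cmd.exec_frame (I := I) rfl σ₀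
  set σ₁ := Cmd.exec I (.loop Vi Nk (.loop Vj NK (.loop Vq NL scaleF))) σ₀
  clear_value σ₁
  -- the product `k * K`
  set σ₂ := Cmd.exec I (.setN NkK (.const 0) (.const 0)) σ₁ with hσ₂
  have f2 : (Cmd.setN NkK (.const 0) (.const 0)).Frame σ₁ σ₂ := Cmd.exec_frame rfl σ₁
  have g2 : σ₂.N NkK 0 = 0 := by simp [hσ₂, Cmd.exec_setN, NExpr.eval]
  clear_value σ₂
  have l3 := Cmd.exec_loop_frame (I := I) (v := Vi) (b := Nk) (m := k)
    (s := .setN NkK (.const 0) (.add (nv NkK) (nv NK))) (σ := σ₂) rfl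
    (by rw [f2.N _ (by decide), f1.N _ (by decide), f0.N _ (by decide), hk])
    (fun i τ => τ.N NkK 0 = i * K) (by simp [g2]) (by
      intro i _ τ hτ hP _
      have : τ.N NK 0 = K := by
        rw [hτ.N _ (by decide), f2.N _ (by decide), f1.N _ (by decide), f0.N _ (by decide), hK]
      simp [Cmd.exec_setN, NExpr.eval, hP, this]
      ring)
  have f3 : (Cmd.loop Vi Nk (.setN NkK (.const 0) (.add (nv NkK) (nv NK)))).Frame σ₂ _ :=
    Cmd.exec_frame (I := I) rfl σ₂
  set σ₃ := Cmd.exec I (.loop Vi Nk (.setN NkK (.const 0) (.add (nv NkK) (nv NK)))) σ₂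
  clear_value σ₃
  have e3 : ∀ x, x ∉ [Nf, Vi, Vj, Vq, Nacc, Vt, NkK] → σ₃.N x = σ.N x := by
    intro x hx
    simp only [List.mem_cons, not_or] at hx
    rw [f3.N x, f2.N x, f1.N x, f0.N x] <;> simp [Cmd.writesN, scaleF] <;> tauto
  have f3' : σ₃.N Nf 0 = m ^ (k * K * L) := by
    rw [f3.N _ (by decide), f2.N _ (by decide), l1]
  -- the rows
  have l4 := exec_setRows (I := I) (σ := σ₃) (b := Nn) (m := n) (d := d) (by decide)
    (by rw [e3 _ (by decide), hn]) (by rw [e3 _ (by decide), hd])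
  have f4 : (setRows Nn).Frame σ₃ _ := Cmd.exec_frame (I := I) rfl σ₃
  set σ₄ := (setRows Nn).exec I σ₃
  clear_value σ₄
  have l5 := exec_setRows (I := I) (σ := σ₄) (b := Nk) (m := k) (d := d) (by decide)
    (by rw [f4.N _ (by decide), e3 _ (by decide), hk]) (by rw [f4.N _ (by decide), e3 _ (by decide), hd])
  have f5 : (setRows Nk).Frame σ₄ _ := Cmd.exec_frame (I := I) rfl σ₄
  set σ₅ := (setRows Nk).exec I σ₄
  clear_value σ₅
  have e5 : ∀ x, x ∉ [Nf, Vi, Vj, Vq, Nacc, Vt, NkK, Nrow] → σ₅.N x = σ.N x := by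
    intro x hx
    simp only [List.mem_cons, not_or] at hx
    rw [f5.N x, f4.N x, e3 x] <;> simp [Cmd.writesN, setRows] <;> tauto
  have r5 : σ₅.R Reps 0 = ε := by
    rw [f5.R _ (by decide), f4.R _ (by decide), f3.R _ (by decide), f2.R _ (by decide),
      f1.R _ (by decide), f0.R _ (by decide), hε]
  obtain ⟨c1, c2⟩ := exec_setCap (I := I) (σ := σ₅) (n := n) (U := U) (by rw [e5 _ (by decide), hn])
    (by rw [e5 _ (by decide), hU]) r5 hε0
  have f6 : setCap.Frame σ₅ _ := Cmd.exec_frame (I := I) rfl σ₅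
  refine ⟨_, c1, c2, ⟨?_, ?_, ?_, ?_, ?_, ?_, rfl, fun i hi => ?_⟩⟩
  · rw [f6.N _ (by decide), e5 _ (by decide), hn]
  · rw [f6.N _ (by decide), e5 _ (by decide), hd]
  · rw [f6.N _ (by decide), e5 _ (by decide), hk]
  · rw [f6.N _ (by decide), e5 _ (by decide), hK]
  · rw [f6.N _ (by decide), f5.N _ (by decide), f4.N _ (by decide), f3']
  · rw [f6.N _ (by decide), f5.N _ (by decide), f4.N _ (by decide), l3]
  · rw [f6.N _ (by decide), l5, l4]
    split_ifs with h1 h2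
    · rfl
    · rfl
    · omega

theorem exec_singletons (P : Fin n → EuclideanSpace ℝ (Fin d)) (hP : Function.Injective P)
    {σ : Mem} (h : Par n d k K f cap σ) (hn : 1 ≤ n) (hd : 1 ≤ d) (hhave : σ.N Nhave 0 = 0) :
    Inv P k K f cap (singletons.exec (inputArray P) σ) ∧
      (n ≤ k → 1 ≤ cap → Succ 0 (singletons.exec (inputArray P) σ)) ∧
      (k < n → (singletons.exec (inputArray P) σ).N Nhave 0 = 0) := by
  have hfr : singletons.Frame σ (singletons.exec (inputArray P) σ) := Cmd.exec_frame rfl σ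
  suffices hs : (n ≤ k → 1 ≤ cap → Best P k cap (singletons.exec (inputArray P) σ) ∧
      Succ 0 (singletons.exec (inputArray P) σ)) ∧
      (¬ (n ≤ k ∧ 1 ≤ cap) → (singletons.exec (inputArray P) σ).N Nhave 0 = 0) by
    by_cases hc : n ≤ k ∧ 1 ≤ cap
    · exact ⟨⟨h.frame hfr, (hs.1 hc.1 hc.2).1⟩, fun h1 h2 => (hs.1 h1 h2).2, fun h => by omega⟩
    · exact ⟨⟨h.frame hfr, fun h' => absurd (hs.2 hc) h'⟩, fun h1 h2 => absurd ⟨h1, h2⟩ hc,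
        fun _ => hs.2 hc⟩
  rw [singletons, Cmd.exec_ifz, show NExpr.eval σ (.sub (nv Nn) (nv Nk)) = σ.N Nn 0 - σ.N Nk 0 from rfl,
    h.hn, h.hk]
  by_cases hnk : n ≤ k
  swap
  · rw [if_neg (by omega)]
    exact ⟨fun h' => absurd h' hnk, fun _ => hhave⟩
  rw [if_pos (by omega), Cmd.exec_ifz,
    show NExpr.eval σ (.sub (.const 1) (nv Ncap)) = 1 - σ.N Ncap 0 from rfl, h.hcap]
  by_cases hcap : 1 ≤ cap
  swap
  · rw [if_neg (by omega)]
    exact ⟨fun _ h' => absurd h' hcap, fun _ => hhave⟩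
  rw [if_pos (by omega)]
  refine ⟨fun _ _ => ?_, fun h' => absurd ⟨hnk, hcap⟩ h'⟩
  simp only [Cmd.exec_seq]
  -- the largest first coordinate
  set σ₁ := Cmd.exec (inputArray P) (.setR Rmx (.const 0) (.inp (.const 0))) σ with hσ₁
  have f1 : (Cmd.setR Rmx (.const 0) (.inp (.const 0))).Frame σ σ₁ := Cmd.exec_frame rfl σ
  clear_value σ₁
  have h₁ := h.frame f1
  have m2 := Cmd.exec_loop_frame (I := inputArray P) (v := Vi) (b := Nn)
    (s := .ifle (rv Rmx) (.inp (.get Nrow (nv Vi)))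
      (.setR Rmx (.const 0) (.inp (.get Nrow (nv Vi)))) .skip) (σ := σ₁) rfl h₁.hn
    (fun l τ => ∀ i < l, inputArray P (i * d) ≤ τ.R Rmx 0) (by simp) (by
      intro l hl τ hτ hmx hVi i hi
      have hrow := (h₁.frame hτ).row l (.inl hl)
      have ev : (RExpr.inp (.get Nrow (nv Vi))).eval (inputArray P) τ = inputArray P (l * d) := by
        simp [RExpr.eval, NExpr.eval, hVi, hrow]
      rw [Cmd.exec_ifle, ev, show RExpr.eval (inputArray P) τ (rv Rmx) = τ.R Rmx 0 from rfl]
      split_ifs with hle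
      · have : (((Cmd.setR Rmx (.const 0) (.inp (.get Nrow (nv Vi)))).exec (inputArray P) τ).setN
            Vi 0 (l + 1)).R Rmx 0 = inputArray P (l * d) := by
          rw [Cmd.exec_setR, ev]
          simp [NExpr.eval]
        rw [this]
        obtain h' | rfl : i < l ∨ i = l := by omega
        · exact (hmx i h').trans hle
        · exact le_rfl
      · have : ((Cmd.skip.exec (inputArray P) τ).setN Vi 0 (l + 1)).R Rmx 0 = τ.R Rmx 0 := by
          simp [Cmd.exec_skip]
        rw [this]
        obtain h' | rfl : i < l ∨ i = l := by omega
        · exact hmx i h'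
        · exact (not_le.1 hle).le)
  have f2 : (Cmd.loop Vi Nn (.ifle (rv Rmx) (.inp (.get Nrow (nv Vi)))
      (.setR Rmx (.const 0) (.inp (.get Nrow (nv Vi)))) .skip)).Frame σ₁ _ :=
    Cmd.exec_frame (I := inputArray P) rfl σ₁
  set σ₂ := Cmd.exec (inputArray P) (.loop Vi Nn (.ifle (rv Rmx) (.inp (.get Nrow (nv Vi)))
      (.setR Rmx (.const 0) (.inp (.get Nrow (nv Vi)))) .skip)) σ₁
  clear_value σ₂
  have h₂ := h₁.frame f2
  obtain ⟨M, hM⟩ : ∃ M, M = σ₂.R Rmx 0 := ⟨_, rfl⟩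
  rw [← hM] at m2
  -- the centers
  set put : Cmd := .loop Vj Nd (.setR RbC (.add (.get Nrow (nv Vq)) (nv Vj)) (coord Vq)) ;;
        .ifz (.sub (nv Nn) (nv Vq))
          (.setR RbC (.get Nrow (nv Vq)) (.add (rv Rmx) (.nat (nv Vq)))) .skip ;;
        .setR RbR (nv Vq) (.nat (.const 0)) with hput
  have m3 := Cmd.exec_loop_frame (I := inputArray P) (v := Vq) (b := Nk) (s := put) (σ := σ₂) rfl h₂.hk
    (fun l τ => ∀ q < l, τ.R RbR q = 0 ∧ ∀ j < d, τ.R RbC (q * d + j) =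
      if n ≤ q ∧ j = 0 then M + q else inputArray P (q * d + j)) (by simp) (by
      intro q hq τ hτ hprev hVq
      have hp := h₂.frame hτ
      have eM : τ.R Rmx 0 = M := by rw [hτ.R _ (by decide), hM]
      rw [hput, Cmd.exec_seq]
      have l1 := Cmd.exec_loop_frame (I := inputArray P) (v := Vj) (b := Nd)
        (s := .setR RbC (.add (.get Nrow (nv Vq)) (nv Vj)) (coord Vq)) (σ := τ) rfl hp.hd
        (fun m ρ => (∀ j < m, ρ.R RbC (q * d + j) = inputArray P (q * d + j)) ∧
          ∀ q' < q, ∀ j < d, ρ.R RbC (q' * d + j) =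
            if n ≤ q' ∧ j = 0 then M + q' else inputArray P (q' * d + j))
        (by simpa using fun q' hq' => (hprev q' hq').2) (by
          rintro j hj ρ hρ ⟨p1, p2⟩ hVj
          have hVq' : ρ.N Vq 0 = q := by rw [hρ.N _ (by decide), hVq]
          have hrow := (hp.frame hρ).row q (.inr hq)
          refine ⟨fun j' hj' => ?_, fun q' hq' j' hj' => ?_⟩
          · by_cases hjj : j' = j
            · simp [Cmd.exec_setR, NExpr.eval, RExpr.eval, hVj, hVq', hrow, hjj]
            · simpa [Cmd.exec_setR, NExpr.eval, hVj, hVq', hrow, hjj] using p1 j' (by omega)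
          · have hne : q' * d + j' ≠ q * d + j := by
              have : (q' + 1) * d ≤ q * d := Nat.mul_le_mul_right d hq'
              rw [Nat.succ_mul] at this
              omega
            simpa [Cmd.exec_setR, NExpr.eval, hVj, hVq', hrow, hne] using p2 q' hq' j' hj')
      have fl : (Cmd.loop Vj Nd (.setR RbC (.add (.get Nrow (nv Vq)) (nv Vj)) (coord Vq))).Frame τ _ :=
        Cmd.exec_frame (I := inputArray P) rfl τ
      set ρ := Cmd.exec (inputArray P) (.loop Vj Nd (.setR RbC (.add (.get Nrow (nv Vq)) (nv Vj))
        (coord Vq))) τ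
      clear_value ρ
      have hVq' : ρ.N Vq 0 = q := by rw [fl.N _ (by decide), hVq]
      have hpρ := hp.frame fl
      have hrow := hpρ.row q (.inr hq)
      have e1 : ρ.R Rmx 0 = M := by rw [fl.R _ (by decide), eM]
      have e2 : ρ.R RbR = τ.R RbR := fl.R _ (by decide)
      rw [Cmd.exec_seq, Cmd.exec_ifz,
        show NExpr.eval ρ (.sub (nv Nn) (nv Vq)) = ρ.N Nn 0 - ρ.N Vq 0 from rfl, hpρ.hn, hVq']
      set π := if n - q = 0 then Cmd.exec (inputArray P) (.setR RbC (.get Nrow (nv Vq))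
        (.add (rv Rmx) (.nat (nv Vq)))) ρ else Cmd.skip.exec (inputArray P) ρ with hπ
      have pN : π.N = ρ.N := by
        rw [hπ]
        split_ifs <;> rfl
      have pR : π.R RbR = ρ.R RbR := by
        rw [hπ]
        split_ifs
        · exact Mem.setR_R_ne _ _ _ (by decide)
        · rfl
      have pC : ∀ i, π.R RbC i = if n ≤ q ∧ i = q * d then M + q else ρ.R RbC i := by
        intro i
        rw [hπ]
        split_ifs with a1 a2 a2
        · simp [Cmd.exec_setR, NExpr.eval, RExpr.eval, hVq', hrow, a2.2, e1]
        · have : i ≠ q * d := fun h => a2 ⟨by omega, h⟩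
          simp [Cmd.exec_setR, NExpr.eval, hVq', hrow, this]
        · omega
        · rfl
      clear_value π
      intro q' hq'
      refine ⟨?_, fun j hj => ?_⟩
      · by_cases hqq : q' = q
        · simp [Cmd.exec_setR, NExpr.eval, RExpr.eval, pN, hVq', hqq]
        · simpa [Cmd.exec_setR, NExpr.eval, pN, hVq', hqq, pR, e2] using (hprev q' (by omega)).1
      · have : (((Cmd.setR RbR (nv Vq) (.nat (.const 0))).exec (inputArray P) π).setN Vq 0 (q + 1)).R
            RbC = π.R RbC := by
          simp only [Cmd.exec_setR, Mem.setN_R]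
          exact Mem.setR_R_ne _ _ _ (by decide)
        rw [this, pC]
        obtain h' | rfl : q' < q ∨ q' = q := by omega
        · have hne : q' * d + j ≠ q * d := by
            have : (q' + 1) * d ≤ q * d := Nat.mul_le_mul_right d h'
            rw [Nat.succ_mul] at this
            omega
          rw [if_neg (fun h => hne h.2)]
          exact l1.2 q' h' j hj
        · by_cases hj0 : j = 0
          · subst hj0
            simp only [add_zero, and_true]
            split_ifs
            · rfl
            · exact l1.1 0 hj
          · rw [if_neg (by omega), if_neg (fun h => hj0 h.2)]
            exact l1.1 j hj)
  have f3 : (Cmd.loop Vq Nk put).Frame σ₂ _ := Cmd.exec_frame (I := inputArray P) rfl σ₂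
  set σ₃ := Cmd.exec (inputArray P) (.loop Vq Nk put) σ₂
  clear_value σ₃
  have h₃ := h₂.frame f3
  -- the assignment
  have m4 := Cmd.exec_loop_frame (I := inputArray P) (v := Vi) (b := Nn)
    (s := .setN Nbest (nv Vi) (nv Vi)) (σ := σ₃) rfl h₃.hn
    (fun l τ => ∀ i < l, τ.N Nbest i = i) (by simp) (by
      intro l _ τ _ hprev hVi i hi
      by_cases hil : i = l
      · simp [Cmd.exec_setN, NExpr.eval, hVi, hil]
      · simpa [Cmd.exec_setN, NExpr.eval, hVi, hil] using hprev i (by omega))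
  have f4 : (Cmd.loop Vi Nn (.setN Nbest (nv Vi) (nv Vi))).Frame σ₃ _ :=
    Cmd.exec_frame (I := inputArray P) rfl σ₃
  set σ₄ := Cmd.exec (inputArray P) (.loop Vi Nn (.setN Nbest (nv Vi) (nv Vi))) σ₃
  clear_value σ₄
  refine ⟨fun _ => ⟨⟨fun q => WithLp.toLp 2 fun j => if n ≤ (q : ℕ) ∧ (j : ℕ) = 0 then M + (q : ℕ) else
    inputArray P (q * d + j), fun _ => 0, fun i => ⟨i, i.2.trans_le hnk⟩⟩, ⟨?_, fun _ => le_rfl,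
      fun i => ?_, fun q => ?_⟩, ?_, fun q j => ?_, fun q => ?_, fun i => ?_⟩, ?_, ?_⟩
  · intro q r hqr
    have hcoord := fun j => congrArg (fun x : EuclideanSpace ℝ (Fin d) => x j) hqr
    simp only at hcoord
    have h0 := hcoord ⟨0, hd⟩
    simp only [and_true, Nat.add_zero] at h0
    have hn0 : (1 : ℝ) ≤ n := by exact_mod_cast hn
    -- In the mixed cases one center has the first coordinate `M + q` with `q ≥ n ≥ 1`, which
    -- exceeds the first coordinates of all input points.
    split_ifs at h0 with h1 h2 h2
    · exact Fin.ext (by exact_mod_cast add_left_cancel h0)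
    · have := m2 r (by omega)
      have : (n : ℝ) ≤ (q : ℕ) := by exact_mod_cast h1
      linarith
    · have := m2 q (by omega)
      have : (n : ℝ) ≤ (r : ℕ) := by exact_mod_cast h2
      linarith
    · have : (⟨q, by omega⟩ : Fin n) = ⟨r, by omega⟩ := by
        refine hP ?_
        ext j
        have := hcoord j
        rw [if_neg (by omega), if_neg (by omega)] at this
        rw [← inputArray_apply, ← inputArray_apply]
        exact this
      exact Fin.ext (Fin.mk.inj_iff.1 this)
  · have : P i = WithLp.toLp 2 fun j : Fin d => if n ≤ (i : ℕ) ∧ (j : ℕ) = 0 then M + (i : ℕ) else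
        inputArray P (i * d + j) := by
      ext j
      have := i.2
      simp only
      rw [if_neg (by omega), inputArray_apply]
    simp only
    rw [← this, dist_self]
  · refine le_trans (Nat.cast_le.2 (Finset.card_le_one.2 ?_)) (by exact_mod_cast hcap)
    intro i hi j hj
    simp only [Finset.mem_filter, Finset.mem_univ, true_and] at hi hj
    exact Fin.ext (Fin.mk.inj_iff.1 (hi.trans hj.symm))
  · simp [Solution.cost, Cmd.exec_setR, Cmd.exec_setN, NExpr.eval, RExpr.eval]
  · have := (m3 q q.2).2 j j.2
    rw [← f4.R RbC (by decide)] at this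
    simp [Cmd.exec_setR, Cmd.exec_setN, this]
  · have := (m3 q q.2).1
    rw [← f4.R RbR (by decide)] at this
    simp [Cmd.exec_setR, Cmd.exec_setN, this]
  · simp [Cmd.exec_setR, Cmd.exec_setN, m4 i i.2]
  · simp [Cmd.exec_setR, Cmd.exec_setN, NExpr.eval]
  · simp [Cmd.exec_setR, Cmd.exec_setN, NExpr.eval, RExpr.eval]

end

section

variable {I : ℕ → ℝ} {n d k K f cap : ℕ}

/-! ### The output -/

/-- The natural number at the absolute address `a + 64`. -/
def Mem.absN (σ : Mem) (a : ℕ) : ℕ := σ.N (a % 64) (a / 64 + 1)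

/-- The real number at the absolute address `a + 64`. -/
def Mem.absR (σ : Mem) (a : ℕ) : ℝ := σ.R (a % 64) (a / 64 + 1)

theorem absolute_inj {a b : ℕ} : a % 64 = b % 64 ∧ a / 64 + 1 = b / 64 + 1 ↔ a = b := by omega

@[simp] theorem Mem.absN_setN_zero (σ : Mem) (x v a : ℕ) : (σ.setN x 0 v).absN a = σ.absN a := by
  simp [absN]

@[simp] theorem Mem.absR_setN (σ : Mem) (x i v a : ℕ) : (σ.setN x i v).absR a = σ.absR a := rfl

theorem Mem.absN_setN (σ : Mem) (b v a : ℕ) :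
    (σ.setN (b % 64) (b / 64 + 1) v).absN a = if a = b then v else σ.absN a := by
  simp only [absN, setN_N, absolute_inj]

theorem Mem.absR_setR (σ : Mem) (b : ℕ) (v : ℝ) (a : ℕ) :
    (σ.setR (b % 64) (b / 64 + 1) v).absR a = if a = b then v else σ.absR a := by
  simp only [absR, setR_R, absolute_inj]

/-- The memories agree up to index `B`, except for the variables of loops. -/
structure AgreeBelow (B : ℕ) (σ τ : Mem) : Prop where
  N : ∀ x, x ∉ [Vi, Vq, Vj] → ∀ i ≤ B, τ.N x i = σ.N x i
  R : ∀ x, ∀ i ≤ B, τ.R x i = σ.R x i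

theorem AgreeBelow.refl (B : ℕ) (σ : Mem) : AgreeBelow B σ σ := ⟨fun _ _ _ _ => rfl, fun _ _ _ => rfl⟩

theorem AgreeBelow.set {B : ℕ} {σ τ : Mem} (h : AgreeBelow B σ τ) {v : ℕ} (hv : v ∈ [Vi, Vq, Vj])
    (m : ℕ) : AgreeBelow B σ (τ.setN v 0 m) := by
  refine ⟨fun x hx i hi => ?_, h.R⟩
  have : x ≠ v := fun e => hx (e ▸ hv)
  simp [this, h.N x hx i hi]

theorem AgreeBelow.rawN {B : ℕ} {σ τ : Mem} (h : AgreeBelow B σ τ) {a : ℕ} (ha : 64 * B ≤ a) (m : ℕ) :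
    AgreeBelow B σ (τ.setN (a % 64) (a / 64 + 1) m) := by
  refine ⟨fun x hx i hi => ?_, h.R⟩
  have : i ≠ a / 64 + 1 := by omega
  simp [this, h.N x hx i hi]

theorem AgreeBelow.rawR {B : ℕ} {σ τ : Mem} (h : AgreeBelow B σ τ) {a : ℕ} (ha : 64 * B ≤ a) (m : ℝ) :
    AgreeBelow B σ (τ.setR (a % 64) (a / 64 + 1) m) := by
  refine ⟨h.N, fun x i hi => ?_⟩
  have : i ≠ a / 64 + 1 := by omega
  simp [this, h.R x i hi]

/-- Every entry that is read has an index of at most `B = k * (d + 1) + n`, whereas the raw writes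
start at index `B + 1`. So copying never destroys data that are still needed. -/
theorem exec_output {σ : Mem} (hn : σ.N Nn 0 = n) (hd : σ.N Nd 0 = d) (hk : σ.N Nk 0 = k)
    (hrow : ∀ q < k, σ.N Nrow q = q * d) :
    (output.exec I σ).N Nx 0 = 64 * (k * (d + 1) + n) ∧ (output.exec I σ).N Nacc 0 = k * d ∧
    (∀ q < k, ∀ j < d, (output.exec I σ).absR (64 * (k * (d + 1) + n) + (q * d + j)) =
      σ.R RbC (q * d + j)) ∧
    (∀ q < k, (output.exec I σ).absR (64 * (k * (d + 1) + n) + (k * d + q)) = σ.R RbR q) ∧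
    ∀ i < n, (output.exec I σ).absN (64 * (k * (d + 1) + n) + i) = σ.N Nbest i := by
  simp only [output, Cmd.exec_seq]
  have f0 : (Cmd.setN Nacc (.const 0) (.const 0)).Frame σ _ := Cmd.exec_frame (I := I) rfl σ
  have e0 : (Cmd.exec I (Cmd.setN Nacc (.const 0) (.const 0)) σ).N Nacc 0 = 0 := by
    simp [Cmd.exec_setN, NExpr.eval]
  set σ₀ := Cmd.exec I (Cmd.setN Nacc (.const 0) (.const 0)) σ
  clear_value σ₀
  have e1 := Cmd.exec_loop_frame (I := I) (v := Vi) (b := Nk) (m := k)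
    (s := .setN Nacc (.const 0) (.add (nv Nacc) (nv Nd))) (σ := σ₀) rfl
    (by rw [f0.N _ (by decide), hk]) (fun i τ => τ.N Nacc 0 = i * d) (by simp [e0]) (by
      intro i _ τ hτ hP _
      have : τ.N Nd 0 = d := by rw [hτ.N _ (by decide), f0.N _ (by decide), hd]
      simp [Cmd.exec_setN, NExpr.eval, hP, this]
      ring)
  have f1 : (Cmd.loop Vi Nk (.setN Nacc (.const 0) (.add (nv Nacc) (nv Nd)))).Frame σ₀ _ :=
    Cmd.exec_frame (I := I) rfl σ₀
  set σ₁ := Cmd.exec I (Cmd.loop Vi Nk (.setN Nacc (.const 0) (.add (nv Nacc) (nv Nd)))) σ₀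
  clear_value σ₁
  have f2 : (Cmd.setN Nx (.const 0) (.const 0)).Frame σ₁ _ := Cmd.exec_frame (I := I) rfl σ₁
  have e2 : (Cmd.exec I (Cmd.setN Nx (.const 0) (.const 0)) σ₁).N Nx 0 = 0 := by
    simp [Cmd.exec_setN, NExpr.eval]
  set σ₂ := Cmd.exec I (Cmd.setN Nx (.const 0) (.const 0)) σ₁
  clear_value σ₂
  have g2 : ∀ x ∉ [Nacc, Vi, Nx], σ₂.N x = σ.N x := by
    intro x hx
    simp only [List.mem_cons, not_or] at hx
    rw [f2.N x, f1.N x, f0.N x] <;> simp [Cmd.writesN] <;> tauto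
  have e3 := Cmd.exec_loop_frame (I := I) (v := Vi) (b := Nk) (m := k)
    (s := .loop Vj Nd (.setN Nx (.const 0) (.add (nv Nx) (.const 64))) ;;
      .setN Nx (.const 0) (.add (nv Nx) (.const 64))) (σ := σ₂) rfl
    (by rw [g2 _ (by decide), hk]) (fun i τ => τ.N Nx 0 = 64 * (i * (d + 1))) (by simp [e2]) (by
      intro i _ τ hτ hP _
      have key := Cmd.exec_loop_frame (I := I) (v := Vj) (b := Nd) (m := d)
        (s := .setN Nx (.const 0) (.add (nv Nx) (.const 64))) (σ := τ) rfl
        (by rw [hτ.N _ (by decide), g2 _ (by decide), hd])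
        (fun j ρ => ρ.N Nx 0 = 64 * (i * (d + 1) + j)) (by simp [hP]) (by
          intro j _ ρ _ hP' _
          simp [Cmd.exec_setN, NExpr.eval, hP']
          ring)
      rw [Cmd.exec_seq, Cmd.exec_setN]
      simp only [NExpr.eval, Mem.setN_N, key]
      simp
      ring)
  have f3 : (Cmd.loop Vi Nk (.loop Vj Nd (.setN Nx (.const 0) (.add (nv Nx) (.const 64))) ;;
      .setN Nx (.const 0) (.add (nv Nx) (.const 64)))).Frame σ₂ _ := Cmd.exec_frame (I := I) rfl σ₂
  set σ₃ := Cmd.exec I (Cmd.loop Vi Nk (.loop Vj Nd (.setN Nx (.const 0) (.add (nv Nx) (.const 64))) ;;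
      .setN Nx (.const 0) (.add (nv Nx) (.const 64)))) σ₂
  clear_value σ₃
  have e4 := Cmd.exec_loop_frame (I := I) (v := Vi) (b := Nn) (m := n)
    (s := .setN Nx (.const 0) (.add (nv Nx) (.const 64))) (σ := σ₃) rfl
    (by rw [f3.N _ (by decide), g2 _ (by decide), hn])
    (fun i τ => τ.N Nx 0 = 64 * (k * (d + 1) + i)) (by simp [e3]) (by
      intro i _ τ hτ hP _
      simp [Cmd.exec_setN, NExpr.eval, hP]
      ring)
  have f4 : (Cmd.loop Vi Nn (.setN Nx (.const 0) (.add (nv Nx) (.const 64)))).Frame σ₃ _ :=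
    Cmd.exec_frame (I := I) rfl σ₃
  set σ₄ := Cmd.exec I (Cmd.loop Vi Nn (.setN Nx (.const 0) (.add (nv Nx) (.const 64)))) σ₃
  clear_value σ₄
  have gN : ∀ x ∉ [Nacc, Vi, Vj, Nx], σ₄.N x = σ.N x := by
    intro x hx
    simp only [List.mem_cons, not_or] at hx
    rw [f4.N x, f3.N x, g2 x] <;> simp [Cmd.writesN] <;> tauto
  have gR : σ₄.R = σ.R := by
    funext x
    rw [f4.R x, f3.R x, f2.R x, f1.R x, f0.R x] <;> simp [Cmd.writesR]
  have gacc : σ₄.N Nacc 0 = k * d := by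
    rw [f4.N _ (by decide), f3.N _ (by decide), f2.N _ (by decide), e1]
  clear f0 e0 f1 e1 f2 e2 g2 f3 e3 f4 σ₀ σ₁ σ₂ σ₃
  obtain ⟨B, hB⟩ : ∃ B, B = k * (d + 1) + n := ⟨_, rfl⟩
  rw [← hB] at e4 ⊢
  have hkB : k + n ≤ B := by rw [hB]; nlinarith
  have cell : ∀ q < k, ∀ j < d, q * d + j < k * d := fun q hq j hj => by
    have := Nat.mul_le_mul_right d (Nat.succ_le_of_lt hq)
    rw [Nat.succ_mul] at this
    omega
  have hkd : k * d ≤ B := by rw [hB]; nlinarith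
  -- the values of the names in use
  have vals : ∀ {τ}, AgreeBelow B σ₄ τ → τ.N Nn 0 = n ∧ τ.N Nd 0 = d ∧ τ.N Nk 0 = k ∧
      τ.N Nacc 0 = k * d ∧ τ.N Nx 0 = 64 * B ∧ ∀ q < k, τ.N Nrow q = q * d := by
    intro τ hτ
    refine ⟨?_, ?_, ?_, ?_, ?_, fun q hq => ?_⟩
    · rw [hτ.N _ (by decide) _ (Nat.zero_le _), gN _ (by decide), hn]
    · rw [hτ.N _ (by decide) _ (Nat.zero_le _), gN _ (by decide), hd]
    · rw [hτ.N _ (by decide) _ (Nat.zero_le _), gN _ (by decide), hk]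
    · rw [hτ.N _ (by decide) _ (Nat.zero_le _), gacc]
    · rw [hτ.N _ (by decide) _ (Nat.zero_le _), e4]
    · rw [hτ.N _ (by decide) _ (by omega), gN _ (by decide), hrow q hq]
  -- the centers
  have c1 := Cmd.exec_loop (I := I) (v := Vq) (b := Nk) (m := k)
    (s := .loop Vj Nd (.rawR (.add (nv Nx) (.add (.get Nrow (nv Vq)) (nv Vj))) (entry RbC Vq)))
    (σ := σ₄) (vals (.refl B σ₄)).2.2.1
    (fun l τ => AgreeBelow B σ₄ τ ∧
      ∀ q < l, ∀ j < d, τ.absR (64 * B + (q * d + j)) = σ.R RbC (q * d + j))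
    ⟨(AgreeBelow.refl B σ₄).set (by decide) _, by simp⟩ (by
      rintro l hl τ ⟨hτ, hC⟩ hVq
      have key := Cmd.exec_loop (I := I) (v := Vj) (b := Nd) (m := d)
        (s := .rawR (.add (nv Nx) (.add (.get Nrow (nv Vq)) (nv Vj))) (entry RbC Vq))
        (σ := τ) (vals hτ).2.1
        (fun j' ρ => AgreeBelow B σ₄ ρ ∧ ρ.N Vq 0 = l ∧
          (∀ q < l, ∀ j < d, ρ.absR (64 * B + (q * d + j)) = σ.R RbC (q * d + j)) ∧
          ∀ j < j', ρ.absR (64 * B + (l * d + j)) = σ.R RbC (l * d + j))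
        ⟨hτ.set (by decide) _, by simp [hVq], by simpa using hC, by simp⟩ (by
          rintro j' hj' ρ ⟨hρ, hVq', hC', hD⟩ hVj
          obtain ⟨-, -, -, -, hx, hr⟩ := vals hρ
          have ea : NExpr.eval ρ (.add (nv Nx) (.add (.get Nrow (nv Vq)) (nv Vj))) =
              64 * B + (l * d + j') := by
            simp [NExpr.eval, hx, hVq', hr l hl, hVj]
          have eb : RExpr.eval I ρ (entry RbC Vq) = σ.R RbC (l * d + j') := by
            simp only [RExpr.eval, NExpr.eval, hVq', hr l hl, hVj]
            rw [hρ.R _ _ ((cell l hl j' hj').le.trans hkd), gR]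
          simp only [Cmd.exec, ea, eb, Mem.absR_setN, Mem.absR_setR]
          refine ⟨(hρ.rawR (by omega) _).set (by decide) _, by simp [hVq'], fun q hq j hj => ?_,
            fun j hj => ?_⟩
          · have := Nat.mul_le_mul_right d (Nat.succ_le_of_lt hq)
            rw [Nat.succ_mul] at this
            rw [if_neg (by omega), hC' q hq j hj]
          · by_cases hjj : j = j'
            · simp [hjj]
            · rw [if_neg (by omega), hD j (by omega)])
      refine ⟨key.1.set (by decide) _, fun q hq j hj => ?_⟩
      rw [Mem.absR_setN]
      obtain h | rfl : q < l ∨ q = l := by omega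
      · exact key.2.2.1 q h j hj
      · exact key.2.2.2 j hj)
  set σ₅ := Cmd.exec I (.loop Vq Nk (.loop Vj Nd
    (.rawR (.add (nv Nx) (.add (.get Nrow (nv Vq)) (nv Vj))) (entry RbC Vq)))) σ₄
  clear_value σ₅
  obtain ⟨c1, c2⟩ := c1
  -- the radii
  have c3 := Cmd.exec_loop (I := I) (v := Vq) (b := Nk) (m := k)
    (s := .rawR (.add (nv Nx) (.add (nv Nacc) (nv Vq))) (.get RbR (nv Vq)))
    (σ := σ₅) (vals c1).2.2.1
    (fun l τ => AgreeBelow B σ₄ τ ∧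
      (∀ q < k, ∀ j < d, τ.absR (64 * B + (q * d + j)) = σ.R RbC (q * d + j)) ∧
      ∀ q < l, τ.absR (64 * B + (k * d + q)) = σ.R RbR q)
    ⟨c1.set (by decide) _, by simpa using c2, by simp⟩ (by
      rintro l hl τ ⟨hτ, hC, hD⟩ hVq
      obtain ⟨-, -, -, ha, hx, -⟩ := vals hτ
      have ea : NExpr.eval τ (.add (nv Nx) (.add (nv Nacc) (nv Vq))) = 64 * B + (k * d + l) := by
        simp [NExpr.eval, hx, ha, hVq]
      have eb : RExpr.eval I τ (.get RbR (nv Vq)) = σ.R RbR l := by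
        simp only [RExpr.eval, NExpr.eval, hVq]
        rw [hτ.R _ _ (by omega), gR]
      simp only [Cmd.exec, ea, eb, Mem.absR_setN, Mem.absR_setR]
      refine ⟨(hτ.rawR (by omega) _).set (by decide) _, fun q hq j hj => ?_, fun q hq => ?_⟩
      · have := cell q hq j hj
        rw [if_neg (by omega), hC q hq j hj]
      · by_cases hql : q = l
        · simp [hql]
        · rw [if_neg (by omega), hD q (by omega)])
  set σ₆ := Cmd.exec I (.loop Vq Nk (.rawR (.add (nv Nx) (.add (nv Nacc) (nv Vq))) (.get RbR (nv Vq)))) σ₅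
  clear_value σ₆
  obtain ⟨c3, c4, c5⟩ := c3
  -- the assignment
  have c6 := Cmd.exec_loop (I := I) (v := Vi) (b := Nn) (m := n)
    (s := .rawN (.add (nv Nx) (nv Vi)) (.get Nbest (nv Vi)))
    (σ := σ₆) (vals c3).1
    (fun l τ => AgreeBelow B σ₄ τ ∧ τ.R = σ₆.R ∧
      ∀ i < l, τ.absN (64 * B + i) = σ.N Nbest i)
    ⟨c3.set (by decide) _, rfl, by simp⟩ (by
      rintro l hl τ ⟨hτ, hR, hD⟩ hVi
      obtain ⟨-, -, -, -, hx, -⟩ := vals hτ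
      have ea : NExpr.eval τ (.add (nv Nx) (nv Vi)) = 64 * B + l := by
        simp [NExpr.eval, hx, hVi]
      have eb : NExpr.eval τ (.get Nbest (nv Vi)) = σ.N Nbest l := by
        simp only [NExpr.eval, hVi]
        rw [hτ.N _ (by decide) _ (by omega), gN _ (by decide)]
      simp only [Cmd.exec, ea, eb, Mem.absN_setN_zero, Mem.absN_setN]
      refine ⟨(hτ.rawN (by omega) _).set (by decide) _, by simpa using hR, fun i hi => ?_⟩
      by_cases hil : i = l
      · simp [hil]
      · rw [if_neg (by omega), hD i (by omega)])
  set σ₇ := Cmd.exec I (.loop Vi Nn (.rawN (.add (nv Nx) (nv Vi)) (.get Nbest (nv Vi)))) σ₆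
  clear_value σ₇
  obtain ⟨c6, c7, c8⟩ := c6
  refine ⟨(vals c6).2.2.2.2.1, (vals c6).2.2.2.1, fun q hq j hj => ?_, fun q hq => ?_, c8⟩
  · rw [Mem.absR, c7]
    exact c4 q hq j hj
  · rw [Mem.absR, c7]
    exact c5 q hq

theorem Stored.outputs {σ : Mem} {S : Solution n d k} (hS : Stored σ S) (hn : σ.N Nn 0 = n)
    (hd : σ.N Nd 0 = d) (hk : σ.N Nk 0 = k) (hrow : ∀ q < k, σ.N Nrow q = q * d) {c : Config}
    (hc : c.view = (output ;; addresses).exec I σ) : Outputs c S := by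
  obtain ⟨h1, h2, h3, h4, h5⟩ := exec_output (I := I) hn hd hk hrow
  rw [Cmd.exec_seq] at hc
  set τ := output.exec I σ
  clear_value τ
  obtain ⟨B, hB⟩ : ∃ B, B = 64 * (k * (d + 1) + n) := ⟨_, rfl⟩
  rw [← hB] at h1 h3 h4 h5
  have a0 : c.nat 0 = B + 64 := by
    have : c.view.N Nn 0 = c.nat 0 := by simp [Config.view]
    rw [← this, hc]
    simp [addresses, Cmd.exec_seq, Cmd.exec_setN, NExpr.eval, h1]
  have a1 : c.nat 1 = B + 64 + k * d := by
    have : c.view.N Nd 0 = c.nat 1 := by simp [Config.view]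
    rw [← this, hc]
    simp [addresses, Cmd.exec_seq, Cmd.exec_setN, NExpr.eval, h1, h2]
  have a2 : c.nat 2 = B + 64 := by
    have : c.view.N Nk 0 = c.nat 2 := by simp [Config.view]
    rw [← this, hc]
    simp [addresses, Cmd.exec_seq, Cmd.exec_setN, NExpr.eval, h1]
  have aN : ∀ a, c.nat (64 + a) = τ.absN a := by
    intro a
    have e1 : c.view.absN a = c.nat (64 + a) := by
      simp only [Mem.absN, Config.view]
      rw [if_pos ⟨Nat.mod_lt _ (by norm_num), .inr (by omega)⟩]
      congr 1
      omega
    rw [← e1, hc]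
    simp [addresses, Cmd.exec_seq, Cmd.exec_setN, NExpr.eval]
  have aR : ∀ a, c.real (64 + a) = τ.absR a := by
    intro a
    have e1 : c.view.absR a = c.real (64 + a) := by
      simp only [Mem.absR, Config.view]
      rw [if_pos ⟨Nat.mod_lt _ (by norm_num), .inr (by omega)⟩]
      congr 1
      omega
    rw [← e1, hc]
    simp [addresses, Cmd.exec_seq, Cmd.exec_setN]
  refine ⟨fun q j => ?_, fun q => ?_, fun i => ?_⟩
  · rw [hS.center, ← h3 q q.2 j j.2, ← aR, a0]
    congr 1
    ring
  · rw [hS.radius, ← h4 q q.2, ← aR, a1]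
    congr 1
    ring
  · rw [hS.assign, ← h5 i i.2, ← aN, a2]
    congr 1
    ring

end

section

variable {A : Program} {I : ℕ → ℝ}

/-! ### The precision -/

/-- Search for the least `K ≥ 1` with `1 ≤ K * ε`. -/
def precision : List Instr :=
  [.natConst 16 1, .realOfNat 8 16, .natAdd 4 4 16, .realOfNat 9 4, .realMul 10 9 0,
    .realJump 8 10 7, .natJump 16 16 2]

theorem precision_step {c : Config} {j : ℕ} {ε : ℝ} (hA : CodeAt A 0 precision) (hpc : c.pc = 2)
    (h1 : c.nat 16 = 1) (hj : c.nat 4 = j) (h8 : c.real 8 = 1) (hε : c.real 0 = ε) :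
    ∃ c', Leads A I c 4 c' ∧ c'.pc = (if 1 ≤ ((j + 1 : ℕ) : ℝ) * ε then 7 else 6) ∧
      c'.nat = Function.update c.nat 4 (j + 1) ∧ c'.real 8 = 1 ∧ c'.real 0 = ε := by
  have get : ∀ (i : ℕ) {instr : Instr} {c : Config}, c.pc = i → precision[i]? = some instr →
      A[c.pc]? = some instr := fun i instr c hc h => by
    rw [hc]
    simpa using hA.get i h
  have s1 : Leads A I c 1 (c.setNat 4 (c.nat 4 + c.nat 16)) := .of_exec (get 2 hpc rfl) rfl
  set c₁ := c.setNat 4 (c.nat 4 + c.nat 16) with hc₁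
  have p1 : c₁.pc = 3 := by simp [hc₁, Config.setNat, hpc]
  have n1 : c₁.nat = Function.update c.nat 4 (j + 1) := by simp [hc₁, Config.setNat, hj, h1]
  have r1 : c₁.real = c.real := rfl
  clear_value c₁
  have s2 : Leads A I c₁ 1 (c₁.setReal 9 (c₁.nat 4 : ℝ)) := .of_exec (get 3 p1 rfl) rfl
  set c₂ := c₁.setReal 9 (c₁.nat 4 : ℝ) with hc₂
  have p2 : c₂.pc = 4 := by simp [hc₂, Config.setReal, p1]
  have n2 : c₂.nat = c₁.nat := rfl
  have r2 : c₂.real = Function.update c.real 9 ((j + 1 : ℕ) : ℝ) := by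
    simp [hc₂, Config.setReal, r1, n1]
  clear_value c₂
  have s3 : Leads A I c₂ 1 (c₂.setReal 10 (c₂.real 9 * c₂.real 0)) := .of_exec (get 4 p2 rfl) rfl
  set c₃ := c₂.setReal 10 (c₂.real 9 * c₂.real 0) with hc₃
  have p3 : c₃.pc = 5 := by simp [hc₃, Config.setReal, p2]
  have n3 : c₃.nat = c₂.nat := rfl
  have r3 : c₃.real 8 = 1 ∧ c₃.real 10 = ((j + 1 : ℕ) : ℝ) * ε ∧ c₃.real 0 = ε := by
    simp [hc₃, Config.setReal, r2, h8, hε]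
  clear_value c₃
  classical
  have s4 : Leads A I c₃ 1 (c₃.jump (c₃.real 8 ≤ c₃.real 10) 7) := .of_exec (get 5 p3 rfl) (by
    simp only [Instr.exec])
  refine ⟨_, ((s1.trans s2).trans s3).trans s4, ?_, ?_, r3.1, r3.2.2⟩
  · simp only [Config.jump, r3.1, r3.2.1, p3]
  · simp only [Config.jump, n3, n2, n1]

/-- `m` is the number of rounds that still fail. A failing round takes five steps, the last round
four, as it skips the jump back. -/
theorem precision_loop {ε : ℝ} (hA : CodeAt A 0 precision) (hε0 : 0 < ε) (m : ℕ) {c : Config} {j : ℕ}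
    (hpc : c.pc = 2) (h1 : c.nat 16 = 1) (hj : c.nat 4 = j) (h8 : c.real 8 = 1) (hε : c.real 0 = ε)
    (hm : ⌈1 / ε⌉₊ = j + 1 + m) :
    ∃ c', Leads A I c (5 * m + 4) c' ∧ c'.pc = 7 ∧
      c'.nat = Function.update c.nat 4 ⌈1 / ε⌉₊ ∧ c'.real 0 = ε := by
  have key : ∀ l : ℕ, 1 ≤ (l : ℝ) * ε ↔ ⌈1 / ε⌉₊ ≤ l := fun l => by
    rw [Nat.ceil_le, div_le_iff₀ hε0]
  induction m generalizing c j with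
  | zero =>
    obtain ⟨c', hl, hp, hn, _, h0⟩ := precision_step (I := I) hA hpc h1 hj h8 hε
    rw [if_pos ((key _).2 (by omega))] at hp
    exact ⟨c', hl, hp, by rw [hn, hm], h0⟩
  | succ m ih =>
    obtain ⟨c', hl, hp, hn, h8', h0⟩ := precision_step (I := I) hA hpc h1 hj h8 hε
    rw [if_neg (fun h => by have := (key _).1 h; omega)] at hp
    have s : Leads A I c' 1 (c'.jump (c'.nat 16 ≤ c'.nat 16) 2) := .of_exec
      (instr := .natJump 16 16 2) (by
        rw [hp]
        simpa using hA.get 6 (instr := .natJump 16 16 2) rfl) rfl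
    obtain ⟨c'', hl', hp', hn', h0'⟩ := ih (c := c'.jump (c'.nat 16 ≤ c'.nat 16) 2) (j := j + 1)
      (by simp [Config.jump]) (by simp [Config.jump, hn, h1]) (by simp [Config.jump, hn]) h8' h0
      (by omega)
    refine ⟨c'', ?_, hp', ?_, h0'⟩
    · have := (hl.trans s).trans hl'
      rwa [show 4 + 1 + (5 * m + 4) = 5 * (m + 1) + 4 by ring] at this
    · rw [hn']
      simp [Config.jump, hn]

theorem precision_leads {ε : ℝ} (hA : CodeAt A 0 precision) (hε0 : 0 < ε) {c : Config} (hpc : c.pc = 0)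
    (h4 : c.nat 4 = 0) (hε : c.real 0 = ε) :
    ∃ c', Leads A I c (5 * ⌈1 / ε⌉₊ + 1) c' ∧ c'.pc = 7 ∧
      c'.nat = Function.update (Function.update c.nat 16 1) 4 ⌈1 / ε⌉₊ ∧ c'.real 0 = ε := by
  have s1 : Leads A I c 1 (c.setNat 16 1) := .of_exec (instr := .natConst 16 1) (by
    rw [hpc]
    simpa using hA.get 0 (instr := .natConst 16 1) rfl) rfl
  set c₁ := c.setNat 16 1 with hc₁
  have p1 : c₁.pc = 1 := by simp [hc₁, Config.setNat, hpc]
  have s2 : Leads A I c₁ 1 (c₁.setReal 8 (c₁.nat 16 : ℝ)) := .of_exec (instr := .realOfNat 8 16) (by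
    rw [p1]
    simpa using hA.get 1 (instr := .realOfNat 8 16) rfl) rfl
  have hpos : 0 < ⌈1 / ε⌉₊ := Nat.ceil_pos.2 (by positivity)
  obtain ⟨c', hl, hp, hn, h0⟩ := precision_loop (I := I) hA hε0 (⌈1 / ε⌉₊ - 1)
    (c := c₁.setReal 8 (c₁.nat 16 : ℝ)) (j := 0) (by simp [Config.setReal, p1])
    (by simp [Config.setReal, hc₁, Config.setNat]) (by simp [Config.setReal, hc₁, Config.setNat, h4])
    (by simp [Config.setReal, hc₁, Config.setNat]) (by simp [Config.setReal, hc₁, Config.setNat, hε])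
    (by omega)
  refine ⟨c', ?_, hp, hn, h0⟩
  have := (s1.trans s2).trans hl
  rwa [show 1 + 1 + (5 * (⌈1 / ε⌉₊ - 1) + 4) = 5 * ⌈1 / ε⌉₊ + 1 by omega] at this

end

section

/-! ### Running time and number of repetitions -/

/-- The running time if all loops had one round. -/
def Cmd.weight : Cmd → ℕ
  | seq c₁ c₂ => c₁.weight + c₂.weight
  | ifz e c₁ c₂ => (e.code 0).length + (c₁.weight + c₂.weight + 3)
  | ifle x y c₁ c₂ => (x.code 0).length + (y.code 1).length + (c₁.weight + c₂.weight + 3)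
  -- The overhead of a loop is two steps once and four per round.
  | loop _ _ c => c.weight + 6
  | s => (s.code 0).length

/-- The nesting depth of loops, where a loop with bound `b` counts `p b`. -/
def Cmd.depth (p : ℕ → ℕ) : Cmd → ℕ
  | seq c₁ c₂ => max (c₁.depth p) (c₂.depth p)
  | ifz _ c₁ c₂ => max (c₁.depth p) (c₂.depth p)
  | ifle _ _ c₁ c₂ => max (c₁.depth p) (c₂.depth p)
  | loop _ b c => p b + c.depth p
  | _ => 0

/-- Each loop bound is dominated by a monomial in `n`, `d`, `f`. Nested loops multiply these
monomials, while sequences and branches take the larger exponents, so only the nesting depths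
matter. -/
theorem Cmd.cost_le {ρ p q r : ℕ → ℕ} {n d f : ℕ} (hn : 1 ≤ n) (hd : 1 ≤ d) (hf : 1 ≤ f) (s : Cmd)
    (h : ∀ b ∈ s.bounds, ρ b ≤ n ^ p b * d ^ q b * f ^ r b) :
    s.cost ρ ≤ s.weight * (n ^ s.depth p * d ^ s.depth q * f ^ s.depth r) := by
  have mono : ∀ {a a' b b' c c' : ℕ}, a ≤ a' → b ≤ b' → c ≤ c' →
      n ^ a * d ^ b * f ^ c ≤ n ^ a' * d ^ b' * f ^ c' := fun ha hb hc =>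
    Nat.mul_le_mul (Nat.mul_le_mul (Nat.pow_le_pow_right hn ha) (Nat.pow_le_pow_right hd hb))
      (Nat.pow_le_pow_right hf hc)
  have one : ∀ {a b c : ℕ}, 1 ≤ n ^ a * d ^ b * f ^ c := fun {a b c} =>
    Nat.one_le_iff_ne_zero.2 (by positivity)
  induction s with
  | seq c₁ c₂ ih₁ ih₂ =>
    simp only [bounds, List.mem_append] at h
    have h1 := ih₁ fun b hb => h b (.inl hb)
    have h2 := ih₂ fun b hb => h b (.inr hb)
    simp only [cost, weight, depth, Nat.add_mul]
    exact Nat.add_le_add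
      (h1.trans (Nat.mul_le_mul_left _ (mono (le_max_left _ _) (le_max_left _ _) (le_max_left _ _))))
      (h2.trans (Nat.mul_le_mul_left _ (mono (le_max_right _ _) (le_max_right _ _) (le_max_right _ _))))
  | ifz e c₁ c₂ ih₁ ih₂ =>
    simp only [bounds, List.mem_append] at h
    have h1 := ih₁ fun b hb => h b (.inl hb)
    have h2 := ih₂ fun b hb => h b (.inr hb)
    simp only [cost, weight, depth, Nat.add_mul]
    refine Nat.add_le_add (Nat.le_mul_of_pos_right _ one) (Nat.add_le_add (Nat.add_le_add
      (h1.trans (Nat.mul_le_mul_left _ (mono (le_max_left _ _) (le_max_left _ _) (le_max_left _ _))))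
      (h2.trans (Nat.mul_le_mul_left _ (mono (le_max_right _ _) (le_max_right _ _) (le_max_right _ _)))))
      (Nat.le_mul_of_pos_right _ one))
  | ifle x y c₁ c₂ ih₁ ih₂ =>
    simp only [bounds, List.mem_append] at h
    have h1 := ih₁ fun b hb => h b (.inl hb)
    have h2 := ih₂ fun b hb => h b (.inr hb)
    simp only [cost, weight, depth, Nat.add_mul]
    refine Nat.add_le_add (Nat.add_le_add (Nat.le_mul_of_pos_right _ one) (Nat.le_mul_of_pos_right _ one))
      (Nat.add_le_add (Nat.add_le_add
      (h1.trans (Nat.mul_le_mul_left _ (mono (le_max_left _ _) (le_max_left _ _) (le_max_left _ _))))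
      (h2.trans (Nat.mul_le_mul_left _ (mono (le_max_right _ _) (le_max_right _ _) (le_max_right _ _)))))
      (Nat.le_mul_of_pos_right _ one))
  | loop v b c ih =>
    simp only [bounds, List.mem_cons] at h
    have h1 := ih fun b hb => h b (.inr hb)
    have h2 := h b (.inl rfl)
    simp only [cost, weight, depth]
    have h3 : c.cost ρ + 4 ≤ (c.weight + 4) * (n ^ c.depth p * d ^ c.depth q * f ^ c.depth r) := by
      rw [Nat.add_mul]
      exact Nat.add_le_add h1 (Nat.le_mul_of_pos_right _ one)
    calc 2 + ρ b * (c.cost ρ + 4)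
        ≤ 2 * (n ^ (p b + c.depth p) * d ^ (q b + c.depth q) * f ^ (r b + c.depth r)) +
          (n ^ p b * d ^ q b * f ^ r b) *
            ((c.weight + 4) * (n ^ c.depth p * d ^ c.depth q * f ^ c.depth r)) :=
          Nat.add_le_add (Nat.le_mul_of_pos_right _ one) (Nat.mul_le_mul h2 h3)
      _ = _ := by ring
  | skip => exact Nat.zero_le _
  | _ => exact Nat.le_mul_of_pos_right _ one

/-- The number of repetitions. -/
def reps (k K : ℕ) : ℕ := max k 2 ^ (k * K * (64 * K))

/-- This uses only `m < 2 ^ m`. -/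
theorem lt_reps {k K m e : ℕ} (hm : m ≤ e) (he : e ≤ 64 * (k * K ^ 2)) : m < reps k K :=
  lt_of_lt_of_le (Nat.lt_pow_self (le_max_right k 2)) (Nat.pow_le_pow_right
    (by have := le_max_right k 2; omega) (hm.trans (he.trans (le_of_eq (by ring)))))

/-- About `K log K` guesses per ball, each of probability `K ^ (-1)` up to powers of `k`, give the
exponent `K (log K) ^ 2`. The bound on `(b + 3) ^ 2` reduces it to `K ^ 2`, so no logarithm of `1 /
ε` remains. The hypothesis `16 ≤ K` is the base case `49 ≤ 64` of the induction. -/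
theorem exists_bits {K : ℕ} (hK : 16 ≤ K) : ∃ b, K ≤ 2 ^ b ∧ (b + 3) ^ 2 ≤ 8 * K := by
  refine ⟨Nat.clog 2 K, Nat.le_pow_clog (by norm_num) K, ?_⟩
  have h1 := Nat.pow_pred_clog_lt_self (b := 2) (by norm_num) (x := K) (by omega)
  have h2 := Nat.le_pow_clog (b := 2) (by norm_num) K
  have h3 : 4 ≤ Nat.clog 2 K := by
    by_contra h
    have : 2 ^ Nat.clog 2 K ≤ 2 ^ 3 := Nat.pow_le_pow_right (by norm_num) (by omega)
    omega
  obtain ⟨m, hm⟩ : ∃ m, Nat.clog 2 K = m + 4 := ⟨_, (Nat.sub_add_cancel h3).symm⟩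
  rw [hm] at h1 ⊢
  have h4 : (m + 4 + 3) ^ 2 ≤ 8 * 2 ^ (m + 3) := by
    clear h1 hm
    induction m with
    | zero => norm_num
    | succ m ih =>
      have : 2 ^ (m + 1 + 3) = 2 * 2 ^ (m + 3) := by ring
      have : (m + 1 + 4 + 3) ^ 2 ≤ 2 * (m + 4 + 3) ^ 2 := by
        nlinarith [Nat.zero_le m, Nat.zero_le (m * m)]
      omega
  have : (m + 4).pred = m + 3 := rfl
  rw [this] at h1
  omega

theorem inv_reps_le_trialProb {k K b : ℕ} (hk : 1 ≤ k) (hK : 16 ≤ K) (hb : K ≤ 2 ^ b)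
    (hbK : (b + 3) ^ 2 ≤ 8 * K) : 1 / (reps k K : ℝ) ≤ trialProb k K b := by
  set M := max k 2 with hM
  have hM2 : 2 ≤ M := le_max_right _ _
  have hkM : k ≤ M := le_max_left _ _
  have hKM : K ≤ M ^ b := hb.trans (Nat.pow_le_pow_left hM2 b)
  have e1 : k * K + 1 ≤ M ^ (b + 2) := by
    calc k * K + 1 ≤ M * M ^ b * 2 := by
          have := Nat.mul_le_mul hkM hKM
          have : 1 ≤ k * K := Nat.mul_pos hk (by omega)
          omega
      _ ≤ M * M ^ b * M := Nat.mul_le_mul_left _ hM2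
      _ = M ^ (b + 2) := by ring
  have e2 : K * k ^ 3 ≤ M ^ (b + 3) := by
    rw [pow_add]
    exact Nat.mul_le_mul hKM (Nat.pow_le_pow_left hkM 3)
  have hb2 : b + 2 ≤ 8 * K := le_trans (by nlinarith) hbK
  -- The exponents of `max k 2` for the radii and for the steps of a trial.
  have e3 : (b + 2) * k + (b + 3) * (k * (2 * K * (b + 2)) + 1) ≤ k * K * (64 * K) := by
    have h1 : (b + 2) * k ≤ k * (8 * K) := by
      rw [Nat.mul_comm]
      exact Nat.mul_le_mul_left _ hb2
    have h2 : (b + 3) * (k * (2 * K * (b + 2))) ≤ k * (2 * K * (8 * K)) := by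
      have : (b + 3) * (b + 2) ≤ 8 * K := le_trans (by nlinarith) hbK
      calc (b + 3) * (k * (2 * K * (b + 2))) = k * (2 * K * ((b + 3) * (b + 2))) := by ring
        _ ≤ _ := by gcongr
    have h3 : b + 3 ≤ k * (8 * K) := by nlinarith
    have h4 : k * (8 * K) ≤ k * (K * K) := by
      gcongr
      omega
    nlinarith
  have e4 : (k * K + 1) ^ k * (K * k ^ 3) ^ (k * (2 * K * (b + 2)) + 1) ≤ reps k K := by
    calc _ ≤ (M ^ (b + 2)) ^ k * (M ^ (b + 3)) ^ (k * (2 * K * (b + 2)) + 1) :=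
          Nat.mul_le_mul (Nat.pow_le_pow_left e1 _) (Nat.pow_le_pow_left e2 _)
      _ = M ^ ((b + 2) * k + (b + 3) * (k * (2 * K * (b + 2)) + 1)) := by
          rw [← pow_mul, ← pow_mul, ← pow_add]
      _ ≤ _ := Nat.pow_le_pow_right (by omega) e3
  have e5 : trialProb k K b =
      1 / (((k * K + 1) ^ k * (K * k ^ 3) ^ (k * (2 * K * (b + 2)) + 1) : ℕ) : ℝ) := by
    rw [trialProb, stepProb, one_div_pow, one_div_pow, one_div_mul_one_div]
    push_cast
    rfl
  rw [e5]
  refine one_div_le_one_div_of_le ?_ (by exact_mod_cast e4)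
  have : 0 < (k * K + 1) ^ k * (K * k ^ 3) ^ (k * (2 * K * (b + 2)) + 1) := by
    have : 0 < K := by omega
    positivity
  exact_mod_cast this

/-- So large a lower bound lets one factor `reps k K` absorb the constants of the running time. -/
theorem two_le_reps {k K : ℕ} (hk : 1 ≤ k) (hK : 16 ≤ K) : 2 ^ 64 ≤ reps k K := by
  calc 2 ^ 64 ≤ max k 2 ^ 64 := Nat.pow_le_pow_left (le_max_right _ _) _
    _ ≤ _ := Nat.pow_le_pow_right (by have := le_max_right k 2; omega)
      (by have : 1 ≤ k * K := Nat.mul_pos hk (by omega)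
          nlinarith)

theorem one_sub_pow_reps_le {k K b : ℕ} (hk : 1 ≤ k) (hK : 16 ≤ K) (hb : K ≤ 2 ^ b)
    (hbK : (b + 3) ^ 2 ≤ 8 * K) : (1 - trialProb k K b) ^ reps k K ≤ 1 / 2 := by
  have h1 := inv_reps_le_trialProb hk hK hb hbK
  have hf := two_le_reps hk hK
  have hf' : (1 : ℝ) ≤ reps k K := by
    have : 1 ≤ reps k K := by omega
    exact_mod_cast this
  have h2 : trialProb k K b ≤ 1 := by
    have h3 : stepProb k K ≤ 1 := (stepProb_le_inv hk (by omega)).trans (by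
      rw [div_le_one (by exact_mod_cast hk)]
      exact_mod_cast hk)
    refine mul_le_one₀ (pow_le_one₀ (by positivity) ?_)
      (pow_nonneg (stepProb_pos hk (by omega)).le _) (pow_le_one₀ (stepProb_pos hk (by omega)).le h3)
    rw [div_le_one (by positivity)]
    linarith [Nat.cast_nonneg (α := ℝ) (k * K)]
  calc (1 - trialProb k K b) ^ reps k K ≤ (1 - 1 / (reps k K : ℝ)) ^ reps k K :=
        pow_le_pow_left₀ (by linarith) (by linarith) _
    _ ≤ Real.exp (-1) := Real.one_sub_div_pow_le_exp_neg hf'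
    _ ≤ 1 / 2 := Real.exp_neg_one_lt_half.le

/-- The exponent is `5 * 64 * 16 ^ 2 = 81920` times `k * K₀ ^ 2`. The estimate `K₀ ≤ 2 / min ε 1`
contributes a factor 4, and `log 2 ≥ 1 / 2`, for the change to base two, a factor 2; this gives
655360. -/
theorem reps_pow_le {k K₀ : ℕ} {ε : ℝ} (hε : 0 < ε) (hK : K₀ = ⌈1 / ε⌉₊) :
    ((reps k (16 * K₀) : ℕ) : ℝ) ^ 5 ≤
      (2 : ℝ) ^ (655360 * ((k : ℝ) / (min ε 1) ^ 2 * Real.log (max (k : ℝ) 2))) := by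
  have hm : 0 < min ε 1 := lt_min hε one_pos
  have hK0 : (K₀ : ℝ) ≤ 2 / min ε 1 := by
    have h1 : (K₀ : ℝ) < 1 / ε + 1 := by
      rw [hK]
      exact Nat.ceil_lt_add_one (by positivity)
    have h2 : 1 / ε ≤ 1 / min ε 1 := one_div_le_one_div_of_le hm (min_le_left _ _)
    have h3 : 1 ≤ 1 / min ε 1 := by
      rw [le_div_iff₀ hm]
      simp
    calc (K₀ : ℝ) ≤ 1 / min ε 1 + 1 / min ε 1 := by linarith
      _ = 2 / min ε 1 := by ring
  have hK2 : (K₀ : ℝ) ^ 2 ≤ 4 / (min ε 1) ^ 2 := by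
    calc (K₀ : ℝ) ^ 2 ≤ (2 / min ε 1) ^ 2 := pow_le_pow_left₀ (by positivity) hK0 2
      _ = _ := by rw [div_pow]; norm_num
  obtain ⟨M, hM⟩ : ∃ M : ℝ, M = max (k : ℝ) 2 := ⟨_, rfl⟩
  have hM2 : 2 ≤ M := hM ▸ le_max_right _ _
  have hlog : 0 ≤ Real.log M := Real.log_nonneg (by linarith)
  have e1 : ((reps k (16 * K₀) : ℕ) : ℝ) ^ 5 = Real.exp (Real.log M * (81920 * (k * (K₀ : ℝ) ^ 2))) := by
    rw [reps]
    push_cast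
    rw [← hM, ← pow_mul, ← Real.rpow_natCast, Real.rpow_def_of_pos (by linarith)]
    congr 2
    push_cast
    ring
  rw [e1, ← hM, Real.rpow_def_of_pos two_pos]
  refine Real.exp_le_exp.2 ?_
  have hl2 : 1 / 2 ≤ Real.log 2 := by linarith [Real.log_two_gt_d9]
  obtain ⟨y, hy⟩ : ∃ y : ℝ, y = (k : ℝ) / (min ε 1) ^ 2 := ⟨_, rfl⟩
  have hy0 : 0 ≤ y := by rw [hy]; positivity
  have h1 : (k : ℝ) * (K₀ : ℝ) ^ 2 ≤ 4 * y := by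
    calc (k : ℝ) * (K₀ : ℝ) ^ 2 ≤ k * (4 / (min ε 1) ^ 2) := by gcongr
      _ = 4 * y := by rw [hy]; ring
  rw [← hy]
  have h2 : Real.log M * (81920 * (k * (K₀ : ℝ) ^ 2)) ≤ Real.log M * (81920 * (4 * y)) := by gcongr
  have h3 : 0 ≤ y * Real.log M := by positivity
  nlinarith

end

section

open scoped ENNReal

variable {A : Program} {I : ℕ → ℝ} {n d k K f cap U : ℕ}

/-! ### The algorithm -/

theorem Cmd.wp_le {s : Cmd} {F : Mem → ℝ≥0∞} {y : ℝ≥0∞} (h : ∀ τ, F τ ≤ y) (σ : Mem) :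
    s.wp I F σ ≤ y := by
  induction s generalizing F σ with
  | rand x e => exact average_le fun m _ => h _
  | seq c₁ c₂ ih₁ ih₂ => exact ih₁ (fun τ => ih₂ h τ) σ
  | ifz e c₁ c₂ ih₁ ih₂ =>
    simp only [wp]
    split_ifs
    · exact ih₁ h σ
    · exact ih₂ h σ
  | ifle a b c₁ c₂ ih₁ ih₂ =>
    simp only [wp]
    split_ifs
    · exact ih₁ h σ
    · exact ih₂ h σ
  | loop v b c ih => exact wp_loop_le rfl (fun _ _ => y) (fun i _ τ _ => ih (fun _ => le_rfl) τ) h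
  | _ => exact h _

/-- The part of the program that is run with the final parameters. -/
def solve : Cmd := singletons ;; .ifz (nv Nhave) search .skip ;; output

/-- The program is compiled in chunks, because compiled code is only verified for commands that do
not write to their own loop bounds. `parameters` loops over scalars set by `constants`, `solve` over
`Nf` set by `parameters`, and `addresses` overwrites `Nn`, `Nd` and `Nk`. -/
def constantsCode : List Instr := constants.code 7

def parametersCode : List Instr := parameters.code (7 + constantsCode.length)

def solveCode : List Instr := solve.code (7 + constantsCode.length + parametersCode.length)

def addressesCode : List Instr :=
  addresses.code (7 + constantsCode.length + parametersCode.length + solveCode.length)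

/-- The program. -/
def program : Program := precision ++ (constantsCode ++ (parametersCode ++ (solveCode ++ addressesCode)))

theorem length_program : program.length =
    7 + constantsCode.length + parametersCode.length + solveCode.length + addressesCode.length := by
  simp [program, precision]
  omega

/-- The loop bounds that count as the number of points. -/
def isPoints (x : ℕ) : ℕ := if x = Nn then 1 else 0

/-- The loop bounds that count as the dimension. -/
def isDim (x : ℕ) : ℕ := if x = Nd then 1 else 0

/-- The other loop bounds. -/
def isOther (x : ℕ) : ℕ := if x = Nn then 0 else if x = Nd then 0 else 1

theorem Cmd.cost_le_of_bounds {s : Cmd} {σ : Mem} (hn : σ.N Nn 0 = n) (hn1 : 1 ≤ n) (hd : σ.N Nd 0 = d)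
    (hd1 : 1 ≤ d) (hf : 1 ≤ f) (h : ∀ x ∈ s.bounds, x ≠ Nn → x ≠ Nd → σ.N x 0 ≤ f)
    (h₁ : s.depth isPoints ≤ 3) (h₂ : s.depth isDim ≤ 1) (h₃ : s.depth isOther ≤ 4) :
    s.cost (fun x => σ.N x 0) ≤ s.weight * (n ^ 3 * d * f ^ 4) := by
  refine (cost_le (p := isPoints) (q := isDim) (r := isOther) hn1 hd1 hf s fun x hx => ?_).trans ?_
  · unfold isPoints isDim isOther
    split_ifs with h1 h2 h3
    · omega
    · subst h1
      simp [hn]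
    · subst h3
      simp [hd]
    · simpa using h x hx h1 h3
  · refine Nat.mul_le_mul_left _ (Nat.mul_le_mul (Nat.mul_le_mul (Nat.pow_le_pow_right hn1 h₁) ?_)
      (Nat.pow_le_pow_right hf h₃))
    simpa using Nat.pow_le_pow_right hd1 h₂

theorem chunk_reach {s : Cmd} (hs : s.Ok = true) (hb : ∀ x ∈ s.bounds, x ∉ s.writesN) {b t : ℕ}
    (hc : CodeAt A b (s.code b)) {c : Config} (hpc : c.pc = b) {F : Mem → ℝ≥0∞}
    {G : Config → ℝ≥0∞} (h : ∀ c', c'.pc = b + (s.code b).length → Reach A I G t c' (F c'.view)) :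
    Reach A I G (s.cost (fun x => c.view.N x 0) + t) c (s.wp I F c.view) :=
  (Cmd.code_reach s hs (D := s.writesN) hc hpc (fun _ _ => rfl) (fun _ h => h) hb F).comp
    fun c' => reach_exitAt_apply (h c')

/-- A command without random choices leads to its result. -/
theorem chunk_reach_of_det {s : Cmd} (hs : s.Ok = true) (hb : ∀ x ∈ s.bounds, x ∉ s.writesN)
    (hdet : s.Det = true) {b t : ℕ} (hc : CodeAt A b (s.code b)) {c : Config} (hpc : c.pc = b)
    {x : ℝ≥0∞} {G : Config → ℝ≥0∞}
    (h : ∀ c', c'.pc = b + (s.code b).length → c'.view = s.exec I c.view → Reach A I G t c' x) :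
    Reach A I G (s.cost (fun x => c.view.N x 0) + t) c x := by
  classical
  have := chunk_reach (I := I) hs hb hc hpc (t := t)
    (F := fun τ => if τ = s.exec I c.view then x else ⊤) fun c' hc' => reach_ite (h c' hc')
  rwa [Cmd.wp_eq_exec hdet, if_pos rfl] at this

/-- The time and the memory `σ` before `solve` do not depend on `F`, so that all later probability
estimates concern commands only. -/
theorem program_reach {ε : ℝ} {K₀ : ℕ} (hn : 1 ≤ n) (hd : 1 ≤ d) (hk : 1 ≤ k) (hε : 0 < ε)
    (hK₀ : K₀ = ⌈1 / ε⌉₊) : ∃ (t : ℕ) (cap : ℕ) (σ : Mem),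
      t ≤ n ^ 3 * d * reps k (16 * K₀) ^ 5 ∧ (cap : ℝ) ≤ (1 + ε) * U ∧
      (∀ m ≤ n, (m : ℝ) ≤ (1 + ε) * U → m ≤ cap) ∧
      Par n d k (16 * K₀) (reps k (16 * K₀)) cap σ ∧ σ.N Nhave 0 = 0 ∧
      ∀ F : Mem → ℝ≥0∞, Reach program I (exitAt program.length F) t (initial n d k U ε)
        ((solve ;; addresses).wp I F σ) := by
  classical
  have hA : ∀ i < program.length, program[0 + i]? = program[i]? := fun i _ => by rw [Nat.zero_add]
  have hA : CodeAt program 0 program := hA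
  have a0 : CodeAt program 0 precision := hA.left
  have hA := hA.right
  have a1 := hA.left
  have hA := hA.right
  have a2 := hA.left
  have hA := hA.right
  have a3 := hA.left
  have a4 := hA.right
  rw [show 0 + precision.length = 7 from rfl] at a1 a2 a3 a4
  obtain ⟨c, hlead, hpc, hnat, hreal⟩ := precision_leads (I := I) a0 hε (c := initial n d k U ε) rfl rfl rfl
  rw [← hK₀] at hlead hnat
  have hK₀1 : 1 ≤ K₀ := by
    rw [hK₀]
    exact Nat.ceil_pos.2 (by positivity)
  have v : ∀ x < 40, c.view.N x 0 = if x = 4 then K₀ else if x = 16 then 1 else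
      (initial n d k U ε).nat x := fun x hx => by
    have : x < 64 := by omega
    simp [Config.view, hx, this, hnat, Function.update_apply]
  have v0 : c.view.N Nn 0 = n := by simp [v, initial]
  have v1 : c.view.N Nd 0 = d := by simp [v, initial]
  have v2 : c.view.N Nk 0 = k := by simp [v, initial]
  have v3 : c.view.N NU 0 = U := by simp [v, initial]
  have v4 : c.view.N NK 0 = K₀ := by simp [v]
  have v5 : c.view.N Nhave 0 = 0 := by simp [v, initial]
  have v6 : c.view.R Reps 0 = ε := by simp [Config.view, hreal]
  obtain ⟨e1, e2, e3⟩ := exec_constants (I := I) v4 v2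
  have f1 : constants.Frame c.view (constants.exec I c.view) := Cmd.exec_frame rfl _
  set σ₁ := constants.exec I c.view with hσ₁
  obtain ⟨cap, hcap, hcap', hpar⟩ := exec_parameters (I := I) (σ := σ₁) (n := n) (d := d) (k := k) (U := U)
    (by rw [f1.N _ (by decide), v0]) (by rw [f1.N _ (by decide), v1]) (by rw [f1.N _ (by decide), v2])
    (by rw [f1.N _ (by decide), v3]) e1 e2 e3 (by rw [f1.R _ (by decide), v6]) hε.le
  have f2 : parameters.Frame σ₁ (parameters.exec I σ₁) := Cmd.exec_frame rfl _
  rw [show max k 2 ^ (k * (16 * K₀) * (64 * (16 * K₀))) = reps k (16 * K₀) from rfl] at hpar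
  set σ₂ := parameters.exec I σ₁ with hσ₂
  set f := reps k (16 * K₀) with hf
  have hf64 : 2 ^ 64 ≤ f := two_le_reps hk (by omega)
  have hkf : 64 * (16 * K₀) < f := lt_reps (e := 64 * (k * (16 * K₀) ^ 2)) (by
    refine Nat.mul_le_mul_left _ ?_
    calc 16 * K₀ = 1 * (16 * K₀) ^ 1 := by ring
      _ ≤ k * (16 * K₀) ^ 2 := Nat.mul_le_mul hk (Nat.pow_le_pow_right (by omega) (by norm_num))) le_rfl
  have hkf' : max k 2 ≤ f := by
    refine (lt_reps (e := 64 * (k * (16 * K₀) ^ 2)) ?_ le_rfl).le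
    have : 2 ≤ 64 * k := by omega
    have : k ≤ k * (16 * K₀) ^ 2 := Nat.le_mul_of_pos_right _ (by positivity)
    omega
  have hk_f : k ≤ f := (le_max_left _ _).trans hkf'
  -- the running time
  have t1 := Cmd.cost_le_of_bounds (s := constants) (f := f) v0 hn v1 hd (by omega)
    (fun x hx => absurd hx (by revert x; decide)) (by decide) (by decide) (by decide)
  have t2 := Cmd.cost_le_of_bounds (s := parameters) (σ := σ₁) (n := n) (d := d) (f := f)
    (by rw [f1.N _ (by decide), v0]) hn (by rw [f1.N _ (by decide), v1]) hd (by omega) (by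
      have b2 : σ₁.N Nk 0 ≤ f := by rw [f1.N _ (by decide), v2]; exact hk_f
      have b4 : σ₁.N NK 0 ≤ f := by omega
      have b5 : σ₁.N NL 0 ≤ f := by omega
      have b6 : σ₁.N Nk2 0 ≤ f := by omega
      have hb : parameters.bounds ⊆ [Nn, Nd, Nk, NK, NL, Nk2] := by decide
      intro x hx h0 h1
      have := hb hx
      simp only [List.mem_cons, List.not_mem_nil, or_false] at this
      obtain rfl | rfl | rfl | rfl | rfl | rfl := this
      · exact absurd rfl h0
      · exact absurd rfl h1
      all_goals assumption) (by decide) (by decide) (by decide)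
  have t3 := Cmd.cost_le_of_bounds (s := solve) (f := f) hpar.hn hn hpar.hd hd (by omega) (by
      have hb : solve.bounds ⊆ [Nn, Nd, Nk, Nf] := by decide
      intro x hx h0 h1
      have := hb hx
      simp only [List.mem_cons, List.not_mem_nil, or_false] at this
      obtain rfl | rfl | rfl | rfl := this
      · exact absurd rfl h0
      · exact absurd rfl h1
      · rw [hpar.hk]; exact hk_f
      · exact hpar.hf.le) (by decide) (by decide) (by decide)
  have w : 6 + constants.weight + parameters.weight + solve.weight + addresses.cost (fun _ => 0) ≤
    2 ^ 20 := by decide +kernel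
  refine ⟨5 * K₀ + 1 + (constants.cost (fun x => c.view.N x 0) + (parameters.cost (fun x => σ₁.N x 0) +
    (solve.cost (fun x => σ₂.N x 0) + (addresses.cost (fun _ => 0) + 0)))), cap, σ₂, ?_, hcap, hcap',
    hpar, ?_, fun F => hlead _ _ _ ?_⟩
  · set Y := n ^ 3 * d * f ^ 4 with hY
    have hY1 : f ≤ Y := by
      calc f = 1 * f ^ 1 := by ring
        _ ≤ n ^ 3 * d * f ^ 4 := Nat.mul_le_mul (Nat.one_le_iff_ne_zero.2 (by positivity))
          (Nat.pow_le_pow_right (by omega) (by norm_num))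
    have h5 : 5 * K₀ + 1 + addresses.cost (fun _ => 0) ≤ (6 + addresses.cost (fun _ => 0)) * Y := by
      have : addresses.cost (fun _ => 0) ≤ addresses.cost (fun _ => 0) * Y :=
        Nat.le_mul_of_pos_right _ (by omega)
      rw [Nat.add_mul]
      omega
    calc _ ≤ (6 + constants.weight + parameters.weight + solve.weight +
          addresses.cost (fun _ => 0)) * Y := by
          simp only [Nat.add_mul] at h5 ⊢
          omega
      _ ≤ f * Y := Nat.mul_le_mul_right _ (by omega)
      _ = n ^ 3 * d * f ^ 5 := by rw [hY]; ring
  · rw [f2.N _ (by decide), f1.N _ (by decide), v5]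
  · refine chunk_reach_of_det (s := constants) rfl (by decide) rfl a1 hpc fun c₁ hpc₁ hc₁ => ?_
    rw [← constantsCode] at hpc₁
    rw [← hσ₁] at hc₁
    rw [← hc₁] at hσ₂ ⊢
    refine chunk_reach_of_det (s := parameters) rfl (by decide) rfl a2 hpc₁ fun c₂ hpc₂ hc₂ => ?_
    rw [← parametersCode] at hpc₂
    rw [← hσ₂] at hc₂
    rw [← hc₂]
    refine chunk_reach (s := solve) rfl (by decide) a3 hpc₂ fun c₃ hpc₃ => ?_
    rw [← solveCode] at hpc₃
    refine chunk_reach (s := addresses) rfl (by decide) a4 hpc₃ fun c₄ hpc₄ => ?_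
    rw [← addressesCode, ← length_program] at hpc₄
    exact reach_exitAt hpc₄ le_rfl

end

/-! ### Success and halting of the algorithm -/

section

open scoped ENNReal

variable {A : Program} {I : ℕ → ℝ} {n d k K f cap U : ℕ}

theorem Solution.IsValid.mono {P : Fin n → EuclideanSpace ℝ (Fin d)} {S : Solution n d k} {u v : ℝ}
    (h : S.IsValid P u) (huv : u ≤ v) : S.IsValid P v :=
  ⟨h.1, h.2, h.3, fun q => (h.4 q).trans huv⟩

theorem OPT_nonneg (P : Fin n → EuclideanSpace ℝ (Fin d)) (k : ℕ) (u : ℝ) : 0 ≤ OPT P k u := by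
  refine Real.sInf_nonneg ?_
  rintro _ ⟨S, hS, rfl⟩
  exact Finset.sum_nonneg fun q _ => hS.radius_nonneg q

/-- The expected indicator of failure of the search. -/
theorem solve_wp_le {P : Fin n → EuclideanSpace ℝ (Fin d)} (hP : Function.Injective P) (hn : 1 ≤ n)
    (hd : 1 ≤ d) (hk : 1 ≤ k) {ε : ℝ} (hε : 0 < ε) {K₀ : ℕ} (hK₀ : K₀ = ⌈1 / ε⌉₊)
    (hcap : ∀ m ≤ n, (m : ℝ) ≤ (1 + ε) * U → m ≤ cap)
    {σ : Mem} (hσ : Par n d k (16 * K₀) (reps k (16 * K₀)) cap σ) (h0 : σ.N Nhave 0 = 0)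
    (hS : ∃ S : Solution n d k, S.IsValid P (U : ℝ)) {F : Mem → ℝ≥0∞}
    (hF : ∀ τ, F (output.exec (inputArray P) τ) ≤ val (Inv P k (16 * K₀) (reps k (16 * K₀)) cap τ)
      (Succ ((1 + ε) * OPT P k U) τ) 1) :
    solve.wp (inputArray P) F σ ≤ 1 / 2 := by
  have hO := OPT_nonneg P k U
  have hK1 : 1 ≤ K₀ := by
    rw [hK₀]
    exact Nat.ceil_pos.2 (by positivity)
  have hKε : 1 / (K₀ : ℝ) ≤ ε := by
    have : 1 / ε ≤ K₀ := by
      rw [hK₀]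
      exact Nat.le_ceil _
    rw [div_le_iff₀ hε] at this
    rw [div_le_iff₀ (by exact_mod_cast hK1)]
    linarith
  have hcast : ((16 * K₀ : ℕ) : ℝ) = 16 * K₀ := by push_cast; rfl
  obtain ⟨h1, h2, h3⟩ := exec_singletons P hP hσ hn hd h0
  have e : solve.wp (inputArray P) F σ = (Cmd.ifz (nv Nhave) search .skip ;; output).wp (inputArray P) F
      (singletons.exec (inputArray P) σ) := by
    rw [solve]
    exact Cmd.wp_eq_exec (s := singletons) rfl _ _
  rw [e]
  set τ := singletons.exec (inputArray P) σ
  have e2 : ∀ s : Cmd, (s ;; output).wp (inputArray P) F τ =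
      s.wp (inputArray P) (fun τ => F (output.exec (inputArray P) τ)) τ := fun s => by
    change s.wp (inputArray P) (fun τ => output.wp (inputArray P) F τ) τ = _
    congr 1
    funext τ
    exact Cmd.wp_eq_exec rfl _ _
  rw [e2]
  change (if τ.N Nhave 0 = 0 then search.wp (inputArray P) _ τ else F _) ≤ _
  by_cases hkn : k < n
  · rw [if_pos (h3 hkn)]
    obtain ⟨a, b, ρ, c, o, ht, hD, hgrid, hx⟩ := exists_target hP hkn (K := 16 * K₀) (by omega) hS
    obtain ⟨b', hb', hbK⟩ := exists_bits (K := 16 * K₀) (by omega)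
    have setup : Setup P k (16 * K₀) (reps k (16 * K₀)) cap U b' (dist (P a) (P b))
        ((1 + ε) * OPT P k U) ρ c o := by
      refine ⟨ht, hn, hd, hk, by omega, hb', hD, hx.trans ?_, fun m hm hmU => hcap m hm (hmU.trans ?_),
        ?_, ?_, hgrid, one_sub_pow_reps_le hk (by omega) hb' hbK⟩
      · refine mul_le_mul_of_nonneg_right ?_ hO
        have : (16 : ℝ) / ((16 * K₀ : ℕ) : ℝ) = 1 / K₀ := by
          rw [hcast]
          field_simp
        rw [this]
        linarith
      · refine mul_le_mul_of_nonneg_right ?_ (Nat.cast_nonneg _)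
        have : 1 / ((16 * K₀ : ℕ) : ℝ) ≤ 1 / K₀ :=
          one_div_le_one_div_of_le (by exact_mod_cast hK1) (by exact_mod_cast (by omega))
        linarith
      · calc (k + 1) * (k * k) + k ≤ 3 * max k 2 ^ 3 := by
              have : (k + 1) * (k * k) + k ≤ 3 * k ^ 3 := by nlinarith [Nat.mul_le_mul hk hk]
              exact this.trans (Nat.mul_le_mul_left _ (Nat.pow_le_pow_left (le_max_left _ _) _))
          _ < max k 2 ^ 2 * max k 2 ^ 3 := by
              have : 2 ^ 2 ≤ max k 2 ^ 2 := Nat.pow_le_pow_left (le_max_right _ _) _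
              have : 0 < max k 2 ^ 3 := by have := le_max_right k 2; positivity
              nlinarith
          _ = max k 2 ^ 5 := by ring
          _ ≤ _ := Nat.pow_le_pow_right (by have := le_max_right k 2; omega) (by
              have : 1 ≤ k * (16 * K₀) := Nat.mul_pos hk (by omega)
              nlinarith)
      · refine lt_reps (e := k * (2 * (16 * K₀) * (b' + 2))) le_rfl ?_
        have : b' + 2 ≤ 8 * (16 * K₀) := le_trans (by nlinarith) hbK
        calc k * (2 * (16 * K₀) * (b' + 2)) ≤ k * (2 * (16 * K₀) * (8 * (16 * K₀))) := by gcongr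
          _ ≤ _ := by
            have := Nat.zero_le (k * (16 * K₀) ^ 2)
            nlinarith
    exact (setup.search_le hF τ).trans (val_le h1 fun _ => le_rfl)
  -- Some ball of a valid solution receives a point, so `U ≥ 1`.
  · have hcap1 : 1 ≤ cap := by
      refine hcap 1 hn ?_
      obtain ⟨S, hS⟩ := hS
      have h4 := hS.card_le (S.assign ⟨0, hn⟩)
      have h5 : 0 < (Finset.univ.filter fun i => S.assign i = S.assign ⟨0, hn⟩).card :=
        Finset.card_pos.2 ⟨⟨0, hn⟩, by simp⟩
      have h6 : (1 : ℝ) ≤ U := le_trans (by exact_mod_cast h5) h4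
      push_cast
      nlinarith
    have hs := h2 (by omega) hcap1
    rw [if_neg hs.1]
    refine (hF τ).trans ?_
    rw [val_done h1 (hs.mono (by positivity))]
    exact zero_le

/-- A configuration of positive probability with value `⊤` would make the expectation infinite. -/
theorem haltsWithin_of_expect {G : Config → ℝ≥0∞} (hG : ∀ c, G c ≠ ⊤ → Halted A c) {c : Config} {t : ℕ}
    (h : expect (run A I c t) G ≠ ⊤) : HaltsWithin A I c t := by
  intro c' hc'
  refine hG c' fun htop => h ?_
  refine top_unique ?_
  calc (⊤ : ℝ≥0∞) = run A I c t c' * G c' := by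
        rw [htop, ENNReal.mul_top ((PMF.mem_support_iff _ _).1 hc')]
    _ ≤ _ := ENNReal.le_tsum c'

/-- Markov's inequality: `G` dominates the indicator of the complement of `s`. -/
theorem one_sub_expect_le {α : Type*} (μ : PMF α) {G : α → ℝ≥0∞} {s : Set α}
    (hG : ∀ a ∉ s, 1 ≤ G a) : 1 - expect μ G ≤ μ.toOuterMeasure s := by
  classical
  rw [tsub_le_iff_right, PMF.toOuterMeasure_apply, expect, ← ENNReal.tsum_add, ← μ.tsum_coe]
  refine ENNReal.tsum_le_tsum fun a => ?_
  by_cases ha : a ∈ s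
  · rw [Set.indicator_of_mem ha]
    exact le_self_add
  · rw [Set.indicator_of_notMem ha, zero_add]
    exact le_mul_of_one_le_right' (hG a ha)

end

end SumOfRadii

end

theorem theorem8 :
    ∃ (A : SumOfRadii.Program) (C p : ℝ), 0 < C ∧ 0 < p ∧
      ∀ (n d k U : ℕ) (ε : ℝ) (P : Fin n → EuclideanSpace ℝ (Fin d)),
        1 ≤ n → 1 ≤ d → 1 ≤ k → 0 < ε → Function.Injective P →
        ∃ T : ℕ,
          (T : ℝ) ≤ (2 : ℝ) ^ (C * ((k : ℝ) / (min ε 1) ^ 2 * Real.log (max (k : ℝ) 2)))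
            * (d : ℝ) * (n : ℝ) ^ 3 ∧
          SumOfRadii.HaltsWithin A (SumOfRadii.inputArray P)
            (SumOfRadii.initial n d k U ε) T ∧
          ((∃ S : SumOfRadii.Solution n d k, S.IsValid P (U : ℝ)) →
            ENNReal.ofReal p ≤
              (SumOfRadii.run A (SumOfRadii.inputArray P)
                (SumOfRadii.initial n d k U ε) T).toOuterMeasure
                {c | ∃ S : SumOfRadii.Solution n d k, SumOfRadii.Outputs c S ∧
                  S.IsValid P ((1 + ε) * (U : ℝ)) ∧
                  S.cost ≤ (1 + ε) * SumOfRadii.OPT P k (U : ℝ)}) := by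
  classical
  open SumOfRadii in
  refine ⟨program, 655360, 1 / 2, by norm_num, by norm_num, fun n d k U ε P hn hd hk hε hP => ?_⟩
  obtain ⟨K₀, hK₀⟩ : ∃ K₀, K₀ = ⌈1 / ε⌉₊ := ⟨_, rfl⟩
  obtain ⟨T, cap, σ, hT, hcap, hcap', hpar, h0, hreach⟩ :=
    program_reach (I := inputArray P) (U := U) hn hd hk hε hK₀
  set K := 16 * K₀ with hK
  set f := reps k K with hf
  refine ⟨T, ?_, ?_⟩
  · have h1 : (T : ℝ) ≤ (n : ℝ) ^ 3 * d * (f : ℝ) ^ 5 := by exact_mod_cast hT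
    calc (T : ℝ) ≤ (n : ℝ) ^ 3 * d * (f : ℝ) ^ 5 := h1
      _ ≤ (n : ℝ) ^ 3 * d * _ := mul_le_mul_of_nonneg_left (reps_pow_le hε hK₀) (by positivity)
      _ = _ := by ring
  set good := {c : Config | ∃ S : Solution n d k, Outputs c S ∧ S.IsValid P ((1 + ε) * (U : ℝ)) ∧
    S.cost ≤ (1 + ε) * OPT P k (U : ℝ)} with hgood
  let G : Config → ENNReal := fun c => if Halted program c then (if c ∈ good then 0 else 1) else ⊤
  -- Success is expressed through the memory `ρ` before the output phase, since `addresses`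
  -- overwrites the scalars `n`, `d`, `k` to which the invariant refers.
  let F : Mem → ENNReal := fun τ => if ∃ ρ, τ = (output ;; addresses).exec (inputArray P) ρ ∧
    Inv P k K f cap ρ ∧ Succ ((1 + ε) * OPT P k U) ρ then 0 else 1
  have hFG : ∀ c, G c ≤ exitAt program.length F c := by
    intro c
    unfold exitAt
    split_ifs with hc
    swap
    · exact le_top
    have hh : Halted program c := hc.ge
    simp only [G, F, if_pos hh]
    split_ifs with h1 h2 h2
    · exact le_rfl
    · exact zero_le
    · exfalso
      obtain ⟨ρ, hρ, hI, hs⟩ := h2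
      obtain ⟨S, hS, hst⟩ := hI.best hs.1
      exact h1 ⟨S, hst.outputs hI.par.hn hI.par.hd hI.par.hk (fun q hq => hI.par.row q (.inr hq)) hρ,
        hS.mono hcap, hst.cost.le.trans hs.2⟩
    · exact le_rfl
  have hG : ∀ c, G c ≠ ⊤ → Halted program c := by
    intro c hc
    by_contra h
    exact hc (by simp [G, h])
  have hrun : expect (run program (inputArray P) (initial n d k U ε) T) G ≤
      (solve ;; addresses).wp (inputArray P) F σ := by
    refine Reach.expect_run_le hG ?_
    simpa using (hreach F).comp (t := 0) fun c => .finish (hFG c)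
  -- Halting needs no solution to exist: `F ≤ 1` alone makes the expectation finite.
  refine ⟨haltsWithin_of_expect hG (ne_top_of_le_ne_top ENNReal.one_ne_top (hrun.trans
    (Cmd.wp_le (fun τ => ?_) σ))), fun hS => ?_⟩
  · simp only [F]
    split_ifs
    · exact zero_le
    · exact le_rfl
  have half : (solve ;; addresses).wp (inputArray P) F σ ≤ 1 / 2 := by
    have e : (solve ;; addresses).wp (inputArray P) F σ =
        solve.wp (inputArray P) (fun τ => F (addresses.exec (inputArray P) τ)) σ := by
      change solve.wp (inputArray P) (fun τ => addresses.wp (inputArray P) F τ) σ = _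
      congr 1
    rw [e]
    refine solve_wp_le hP hn hd hk hε hK₀ hcap' hpar h0 hS fun τ => le_val (fun h1 h2 => ?_) fun _ _ => ?_
    · simp only [F]
      rw [if_pos ⟨τ, rfl, h1, h2⟩]
    · simp only [F]
      split_ifs
      · exact zero_le
      · exact le_rfl
  calc ENNReal.ofReal (1 / 2) = 1 - 1 / 2 := by
        rw [ENNReal.ofReal_div_of_pos two_pos]
        simp
    _ ≤ 1 - expect (run program (inputArray P) (initial n d k U ε) T) G :=
        tsub_le_tsub_left (hrun.trans half) _
    _ ≤ _ := one_sub_expect_le _ fun c hc => by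
        simp only [G, if_neg hc]
        split_ifs
        · exact le_rfl
        · exact le_top
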